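/- **Theorem (Global error of the MWLS algorithm).** *Parameters, grid, deterministic constants.* Let $d,q\ge 1$, $T>0$, $R_\pi>0$, $L_f,C_f,C_M\ge 0$, $\theta_L,\theta_C\in(0,1]$. A grid is $\pi=\{0=t_0<\dots<t_N=T\}$ with $\Delta_i:=t_{i+1}-t_i$ and $\Delta_{i+1}/\Delta_i\le R_\pi$ for $0\le i\le N-2$. (a) There are finite constants $B_{\alpha,\beta}\ge 0$ ($\alpha,\beta>0$), depending only on $R_\pi,\alpha,\beta$, such that for all such grids (of any horizon) and all $0\le i<k\le N$, $$\sum_{j=i}^{k-1}\frac{\Delta_j}{(t_k-t_j)^{1-\alpha}}\le B_{\alpha,1}(t_k-t_i)^{\alpha},\qquad \sum_{j=i+1}^{k-1}\frac{\Delta_j}{(t_k-t_j)^{1-\alpha}(t_j-t_i)^{1-\beta}}\le B_{\alpha,\beta}(t_k-t_i)^{\alpha+\beta-1}.$$ (b) For all $C_u\ge 0$, $\gamma>0$ there is a finite constant $G_\gamma=G_\gamma(C_u)\ge 0$, depending only on $C_u,\gamma,T,\theta_L,R_\pi$, such that for all such grids of $[0,T]$, all $0\le k<N$ and all nonnegative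 sequences $u,w$ with $$u_j\le w_j+C_u\sum_{l=j+1}^{N-1}\frac{u_l\Delta_l}{(T-t_l)^{(1-\theta_L)/2}(t_l-t_j)^{1/2}},\qquad k\le j\le N,$$ one has, for $k\le j\le N$, $$\sum_{l=j+1}^{N-1}\frac{u_l\Delta_l}{(T-t_l)^{(1-\theta_L)/2}(t_l-t_j)^{1-\gamma}}\le G_\gamma\sum_{l=j+1}^{N-1}\frac{w_l\Delta_l}{(T-t_l)^{(1-\theta_L)/2}(t_l-t_j)^{1-\gamma}},$$ and, if $\gamma=1$, also the same inequality with both sums starting at $l=j$. Fix any constants $B$ and $G$ as in (a) and (b). Put $C_u^{\rm st}:=L_f(C_M+\sqrt T)$, $g_\gamma:=G_\gamma(C_u^{\rm st})$, and $$C_y^{(1)}:=1+L_fg_1\bigl(C_MB_{\theta_L/2,1}+B_{1/2+\theta_L/2,1}\sqrt T\bigr)T^{\theta_L/2},\qquad C_y^{(2)}:=1+L_fg_1(C_M+\sqrt T)B_{\theta_L/2,1}T^{\theta_L/2},$$ $$C_z^{(1)}:=C_M\bigl(1+L_fg_{1/2}C_MB_{\theta_L/2,1/2}T^{\theta_L/2}\bigr),\quad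 C_z^{(2)}:=C_M\bigl(1+L_fg_{1/2}(C_M+\sqrt T)B_{\theta_L/2,1/2}T^{\theta_L/2}\bigr),\quad C_z^{(3)}:=C_ML_fg_{1/2}B_{1/2+\theta_L/2,1/2}.$$ *Setting.* Let $(\Omega,\mathcal F,\mathbb P)$ be a probability space with a filtration $(\mathcal F_{t_i})_{0\le i\le N}$, $\mathbb E_i:=\mathbb E[\cdot|\mathcal F_{t_i}]$, and assume: * $X$ is an adapted chain in $\mathbb R^d$, and $H^{(i)}_j$ ($0\le i<j\le N$) are $\mathcal F_T$-measurable, square integrable, $\mathbb R^q$-valued. For each $i<N$ there is a $\sigma$-algebra $\mathcal G_i\subset\mathcal F_T$ independent of $\mathcal F_{t_i}$ such that for every $j>i$, $X_j=V^{(i)}_j(X_i)$ and $H^{(i)}_j=W^{(i)}_j(X_i)$ a.s. with $\mathcal G_i\otimes\mathcal B(\mathbb R^d)$-measurable random functions $V^{(i)}_j,W^{(i)}_j$. * $\mathbb E_i[H^{(i)}_j]=0$ and $(\mathbb E_i|H^{(i)}_j|^2)^{1/2}\le C_M(t_j-t_i)^{-1/2}$. * $\xi=\Phi(X_N)$ with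 $\Phi$ bounded and measurable; $C_\xi:=\operatorname{ess\,sup}|\xi|$. * $f_i(x,y,z)$ is measurable on $\mathbb R^d\times\mathbb R\times\mathbb R^q$ and, for almost every $x$ under the law of $X_i$ and all $y,y',z,z'$, $|f_i(x,y,z)-f_i(x,y',z')|\le L_f(T-t_i)^{-(1-\theta_L)/2}(|y-y'|+|z-z'|)$ and $|f_i(x,0,0)|\le C_f(T-t_i)^{-(1-\theta_C)}$. Then there are measurable functions $y_i$ ($0\le i\le N$) and $z_i$ ($0\le i<N$) such that $Y_i=y_i(X_i)$, $Z_i=z_i(X_i)$ solve $$Y_i=\mathbb E_i\Bigl[\xi+\sum_{j=i}^{N-1}f_j(X_j,Y_{j+1},Z_j)\Delta_j\Bigr],\qquad Z_i=\mathbb E_i\Bigl[\xi H^{(i)}_N+\sum_{j=i+1}^{N-1}f_j(X_j,Y_{j+1},Z_j)H^{(i)}_j\Delta_j\Bigr];$$ fix any such functions. Define $$C_{y,i}:=C_y^{(1)}C_\xi+C_y^{(2)}C_fB_{\theta_C,1}(T-t_i)^{\theta_C},$$ $$C_{z,i}:=C_z^{(1)}\frac{\operatorname{ess\,sup}\,(\mathbb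 E_i|\xi-\mathbb E_i\xi|^2)^{1/2}}{\sqrt{T-t_i}}+\frac{C_z^{(2)}C_fB_{\theta_C,1/2}}{(T-t_i)^{1/2-\theta_C}}+C_z^{(3)}C_\xi(T-t_i)^{\theta_L/2},$$ $$\Gamma_{y,i}:=c_1C_\xi+c_2C_f(T-t_i)^{\theta_C},\qquad \Gamma_{z,i}:=c_3C_\xi(T-t_i)^{-1/2}+c_4C_f(T-t_i)^{\theta_C-1/2},$$ where, with $a:=(1+\theta_L)/2$, $$c_1:=1+L_f\bigl(C_y^{(1)}B_{a,1}T^{a}+\sqrt q\,C_z^{(1)}B_{\theta_L/2,1}T^{\theta_L/2}+\sqrt q\,C_z^{(3)}B_{\theta_L+1/2,1}T^{\theta_L+1/2}\bigr),$$ $$c_2:=B_{\theta_C,1}+L_f\bigl(C_y^{(2)}B_{\theta_C,1}B_{\theta_C+a,1}T^{a}+\sqrt q\,C_z^{(2)}B_{\theta_C,1/2}B_{\theta_C+\theta_L/2,1}T^{\theta_L/2}\bigr),$$ $$c_3:=C_M\bigl[1+L_f\bigl(C_y^{(1)}B_{a,1/2}T^{a}+\sqrt q\,C_z^{(1)}B_{\theta_L/2,1/2}T^{\theta_L/2}+\sqrt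 q\,C_z^{(3)}B_{\theta_L+1/2,1/2}T^{\theta_L+1/2}\bigr)\bigr],$$ $$c_4:=C_M\bigl[B_{\theta_C,1/2}+L_f\bigl(C_y^{(2)}B_{\theta_C,1}B_{\theta_C+a,1/2}T^{a}+\sqrt q\,C_z^{(2)}B_{\theta_C,1/2}B_{\theta_C+\theta_L/2,1/2}T^{\theta_L/2}\bigr)\bigr].$$ *Algorithm.* For $i<N$ let $\mathcal K_{Y,i}$, $\mathcal K_{Z,i}$ be the spans of $K_{Y,i}$ (resp. $K_{Z,i}$) measurable functions $p:\mathbb R^d\to\mathbb R$ (resp. $\mathbb R^q$) with $\mathbb E|p(X_i)|^2<\infty$, and let $M_i\ge\max(1,K_{Y,i},K_{Z,i})$. On another probability space take independent simulations $(H^{(i,m)},X^{(i,m)})$, $i<N$, $1\le m\le M_i$, where $(H^{(i,m)},X^{(i,m)})$ has the law of $(H^{(i)}_{i+1},\dots,H^{(i)}_N,X_i,\dots,X_N)$; those with first index $i$ form the cloud $\mathcal C_i$. Let $\mathcal T_L$ be the coordinatewise truncation to $[-L,L]$. Put $y^M_N:=\Phi$ and, for $i=N-1,\dots,0$, $z^M_i:=\mathcal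 T_{C_{z,i}}(\psi_{Z,i})$ and then $y^M_i:=\mathcal T_{C_{y,i}}(\psi_{Y,i})$, where $\psi_{Z,i}$, $\psi_{Y,i}$ are $\sigma(\mathcal C_i,\dots,\mathcal C_{N-1})\otimes\mathcal B(\mathbb R^d)$-measurable and, almost surely, minimize over $\phi\in\mathcal K_{Z,i}$, resp. $\phi\in\mathcal K_{Y,i}$, $$\frac1{M_i}\sum_{m}\bigl|\phi(X^{(i,m)}_i)-S_{Z,i}(H^{(i,m)},X^{(i,m)})\bigr|^2,\qquad \frac1{M_i}\sum_m\bigl|\phi(X^{(i,m)}_i)-S_{Y,i}(X^{(i,m)})\bigr|^2,$$ $$S_{Z,i}(h,x):=\Phi(x_N)h_N+\sum_{k=i+1}^{N-1}f_k\bigl(x_k,y^M_{k+1}(x_{k+1}),z^M_k(x_k)\bigr)h_k\Delta_k,\qquad S_{Y,i}(x):=\Phi(x_N)+\sum_{k=i}^{N-1}f_k\bigl(x_k,y^M_{k+1}(x_{k+1}),z^M_k(x_k)\bigr)\Delta_k.$$ *Errors.* Let $\|\varphi\|_{k,M}^2:=\frac1{M_k}\sum_{m}|\varphi(X^{(k,m)}_k)|^2$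 and, for $i<N$, $$\mathcal E^Y_{{\rm App},i}:=\sqrt{\inf_{\phi\in\mathcal K_{Y,i}}\mathbb E|\phi(X_i)-y_i(X_i)|^2},\qquad \mathcal E^Z_{{\rm App},i}:=\sqrt{\inf_{\phi\in\mathcal K_{Z,i}}\mathbb E|\phi(X_i)-z_i(X_i)|^2},$$ $$\mathcal E^Y_{{\rm Dep},i}:=C_{y,i}\sqrt{\frac{2028(K_{Y,i}+1)\log(3M_i)}{M_i}},\qquad \mathcal E^Z_{{\rm Dep},i}:=C_{z,i}\sqrt{\frac{2028(K_{Z,i}+1)\,q\log(3M_i)}{M_i}},$$ $$\mathcal E(k):=\mathcal E^Y_{{\rm App},k+1}+\Gamma_{y,k+1}\sqrt{\frac{K_{Y,k+1}}{M_{k+1}}}+\mathcal E^Z_{{\rm App},k}+\Gamma_{z,k}\sqrt{\frac{K_{Z,k}}{M_k}}+L_f\bigl(\mathcal E^Y_{{\rm Dep},k+1}+\mathcal E^Z_{{\rm Dep},k}\bigr),\quad 0\le k\le N-1,$$ where the three terms with index $k+1=N$ are $0$ (no regression is made at time $N$). *Conclusion.* For every $k\in\{0,\dots,N-1\}$, $\|y_k-y^M_k\|_{k,M}^2$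 and $\|z_k-z^M_k\|_{k,M}^2$ are integrable and $$\bigl(\mathbb E\|y_k-y^M_k\|_{k,M}^2\bigr)^{1/2}\le\mathcal E^Y_{{\rm App},k}+\Gamma_{y,k}\sqrt{\frac{K_{Y,k}}{M_k}}+C^M_y\sum_{j=k}^{N-1}\frac{\mathcal E(j)\Delta_j}{(T-t_j)^{(1-\theta_L)/2}},$$ $$\bigl(\mathbb E\|z_k-z^M_k\|_{k,M}^2\bigr)^{1/2}\le\mathcal E^Z_{{\rm App},k}+\Gamma_{z,k}\sqrt{\frac{K_{Z,k}}{M_k}}+C^M_z\sum_{j=k+1}^{N-1}\frac{\mathcal E(j)\Delta_j}{(T-t_j)^{(1-\theta_L)/2}\sqrt{t_j-t_k}},$$ where, with $C_u:=L_f(\sqrt2\,C_M+4\sqrt T)$, $$C^M_y:=2+4L_fG_1(C_u)\bigl(1+B_{\theta_L/2,1}T^{\theta_L/2}(C_M+2\sqrt T)\bigr),$$ $$C^M_z:=C_M+\sqrt2\,C_ML_fG_{1/2}(C_u)\bigl(1+B_{\theta_L/2,1/2}T^{\theta_L/2}(C_M+2\sqrt T)\bigr).$$ -/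

import Mathlib

open MeasureTheory ProbabilityTheory Filter

noncomputable section

namespace MWLS

/-- Euclidean space of dimension `n`. -/
abbrev Vec (n : ℕ) := EuclideanSpace ℝ (Fin n)

/-! ### Time grids and the two families of deterministic constants -/

/-- `0 = t 0 < t 1 < ⋯ < t N = T`, with ratio of consecutive steps at most `R`. -/
structure IsTimeGrid (T R : ℝ) (N : ℕ) (t : ℕ → ℝ) : Prop where
  zero : t 0 = 0
  last : t N = T
  lt : ∀ i, i < N → t i < t (i + 1)
  ratio : ∀ i, i + 2 ≤ N → (t (i + 2) - t (i + 1)) / (t (i + 1) - t i) ≤ R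

/-- `B α β` bounds the (singular) Riemann sums below, on all grids of ratio at most `R`. -/
def IsSumConstant (R : ℝ) (B : ℝ → ℝ → ℝ) : Prop :=
  ∀ α β : ℝ, 0 < α → 0 < β → 0 ≤ B α β ∧
    ∀ (T : ℝ) (N : ℕ) (t : ℕ → ℝ), 0 < T → IsTimeGrid T R N t →
      ∀ i k, i < k → k ≤ N →
        (∑ j ∈ Finset.Ico i k, (t (j + 1) - t j) / (t k - t j) ^ (1 - α)
            ≤ B α 1 * (t k - t i) ^ α) ∧
        (∑ j ∈ Finset.Ioo i k,
            (t (j + 1) - t j) / ((t k - t j) ^ (1 - α) * (t j - t i) ^ (1 - β))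
            ≤ B α β * (t k - t i) ^ (α + β - 1))

/-- `c` is an admissible constant, with parameter `γ`, in the discrete Gronwall inequality for
nonnegative sequences with
`u j ≤ w j + Cu * ∑_{l = j+1}^{N-1} u l Δ l / ((T - t l)^(1/2-β) (t l - t j)^(1/2-α))`,
for all grids of `[0, T]` of ratio at most `R`. For `γ = 1` the weight has no singularity
at `t j`, and the sums may also start at `l = j`. -/
def IsGronwallConstant (R T α β Cu γ c : ℝ) : Prop :=
  0 ≤ c ∧ ∀ (N : ℕ) (t : ℕ → ℝ), IsTimeGrid T R N t → ∀ k, k < N →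
    ∀ u w : ℕ → ℝ, (∀ l, 0 ≤ u l) → (∀ l, 0 ≤ w l) →
      (∀ j, k ≤ j → j ≤ N → u j ≤ w j + Cu * ∑ l ∈ Finset.Ioo j N,
        u l * (t (l + 1) - t l) /
          ((T - t l) ^ (1 / 2 - β) * (t l - t j) ^ (1 / 2 - α))) →
      ∀ j, k ≤ j → j ≤ N →
        (∑ l ∈ Finset.Ioo j N,
            u l * (t (l + 1) - t l) / ((T - t l) ^ (1 / 2 - β) * (t l - t j) ^ (1 - γ))
          ≤ c * ∑ l ∈ Finset.Ioo j N,
            w l * (t (l + 1) - t l) / ((T - t l) ^ (1 / 2 - β) * (t l - t j) ^ (1 - γ))) ∧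
        (γ = 1 →
          ∑ l ∈ Finset.Ico j N, u l * (t (l + 1) - t l) / (T - t l) ^ (1 / 2 - β)
            ≤ c * ∑ l ∈ Finset.Ico j N, w l * (t (l + 1) - t l) / (T - t l) ^ (1 / 2 - β))

/-! ### Parameters and explicit constants -/

/-- The deterministic parameters: horizon, bound on the grid ratio, Lipschitz constant and bound
at zero of the driver, constant of the Malliavin weights, and the two singularity exponents. -/
structure Params where
  T : ℝ
  R : ℝ
  Lf : ℝ
  Cf : ℝ
  CM : ℝ
  θL : ℝ
  θC : ℝ

namespace Params

structure Admissible (p : Params) : Prop where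
  T_pos : 0 < p.T
  R_pos : 0 < p.R
  Lf_nonneg : 0 ≤ p.Lf
  Cf_nonneg : 0 ≤ p.Cf
  CM_nonneg : 0 ≤ p.CM
  θL_mem : p.θL ∈ Set.Ioc (0 : ℝ) 1
  θC_mem : p.θC ∈ Set.Ioc (0 : ℝ) 1

variable (p : Params) (B G : ℝ → ℝ → ℝ)

/- In the constants below, `B α β` is the constant for Riemann sums and `G Cu γ` the Gronwall
constant for the coefficient `Cu` and the parameter `γ`. -/

/-- The Gronwall coefficient of the stability estimates. -/
def CuStab : ℝ := p.Lf * (p.CM + √p.T)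

/-- The Gronwall coefficient of the Monte Carlo error. -/
def CuMC : ℝ := p.Lf * (√2 * p.CM + 4 * √p.T)

def Cy1 : ℝ :=
  1 + p.Lf * G p.CuStab 1 *
    (p.CM * B (p.θL / 2) 1 + B (1 / 2 + p.θL / 2) 1 * √p.T) * p.T ^ (p.θL / 2)

def Cy2 : ℝ :=
  1 + p.Lf * G p.CuStab 1 * (p.CM + √p.T) * B (p.θL / 2) 1 * p.T ^ (p.θL / 2)

def Cz1 : ℝ :=
  p.CM * (1 + p.Lf * G p.CuStab (1 / 2) * p.CM * B (p.θL / 2) (1 / 2) * p.T ^ (p.θL / 2))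

def Cz2 : ℝ :=
  p.CM * (1 + p.Lf * G p.CuStab (1 / 2) * (p.CM + √p.T) * B (p.θL / 2) (1 / 2) *
    p.T ^ (p.θL / 2))

def Cz3 : ℝ :=
  p.CM * p.Lf * G p.CuStab (1 / 2) * B (1 / 2 + p.θL / 2) (1 / 2)

/-- The constant `c₁` of the observation bound for `Y`. The factors `√q` below are there because
the truncation of a vector acts on each of its `q` coordinates. -/
def c1 (q : ℕ) : ℝ :=
  1 + p.Lf *
    (p.Cy1 B G * B ((1 + p.θL) / 2) 1 * p.T ^ ((1 + p.θL) / 2)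
      + √q * p.Cz1 B G * B (p.θL / 2) 1 * p.T ^ (p.θL / 2)
      + √q * p.Cz3 B G * B (p.θL + 1 / 2) 1 * p.T ^ (p.θL + 1 / 2))

def c2 (q : ℕ) : ℝ :=
  B p.θC 1 + p.Lf *
    (p.Cy2 B G * B p.θC 1 * B (p.θC + (1 + p.θL) / 2) 1 * p.T ^ ((1 + p.θL) / 2)
      + √q * p.Cz2 B G * B p.θC (1 / 2) * B (p.θC + p.θL / 2) 1 * p.T ^ (p.θL / 2))

def c3 (q : ℕ) : ℝ :=
  p.CM * (1 + p.Lf *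
    (p.Cy1 B G * B ((1 + p.θL) / 2) (1 / 2) * p.T ^ ((1 + p.θL) / 2)
      + √q * p.Cz1 B G * B (p.θL / 2) (1 / 2) * p.T ^ (p.θL / 2)
      + √q * p.Cz3 B G * B (p.θL + 1 / 2) (1 / 2) * p.T ^ (p.θL + 1 / 2)))

def c4 (q : ℕ) : ℝ :=
  p.CM * (B p.θC (1 / 2) + p.Lf *
    (p.Cy2 B G * B p.θC 1 * B (p.θC + (1 + p.θL) / 2) (1 / 2) * p.T ^ ((1 + p.θL) / 2)
      + √q * p.Cz2 B G * B p.θC (1 / 2) * B (p.θC + p.θL / 2) (1 / 2) * p.T ^ (p.θL / 2)))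

/-- The constant in front of the time average in the error bound for `Y`. -/
def CMy : ℝ :=
  2 + 4 * p.Lf * G p.CuMC 1 * (1 + B (p.θL / 2) 1 * p.T ^ (p.θL / 2) * (p.CM + 2 * √p.T))

/-- The constant in front of the time average in the error bound for `Z`. -/
def CMz : ℝ :=
  p.CM + √2 * p.CM * p.Lf * G p.CuMC (1 / 2) *
    (1 + B (p.θL / 2) (1 / 2) * p.T ^ (p.θL / 2) * (p.CM + 2 * √p.T))

end Params

/-! ### Dynamic programming equation with Malliavin weights -/

/-- `(Y, Z)` solves the dynamic programming equation with terminal condition `ξ`, driver `g` and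
Malliavin weights `H`. -/
def IsMWDPSolution {Ω : Type*} {mΩ : MeasurableSpace Ω} {q : ℕ} (P : Measure Ω)
    (ℱ : Filtration ℕ mΩ) (N : ℕ) (t : ℕ → ℝ) (ξ : Ω → ℝ) (g : ℕ → Ω → ℝ → Vec q → ℝ)
    (H : ℕ → ℕ → Ω → Vec q) (Y : ℕ → Ω → ℝ) (Z : ℕ → Ω → Vec q) : Prop :=
  (∀ i, i ≤ N → Y i =ᵐ[P]
    P[fun ω => ξ ω + ∑ j ∈ Finset.Ico i N,
      g j ω (Y (j + 1) ω) (Z j ω) * (t (j + 1) - t j) | ℱ i]) ∧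
  (∀ i, i < N → Z i =ᵐ[P]
    P[fun ω => ξ ω • H i N ω + ∑ j ∈ Finset.Ioo i N,
      (g j ω (Y (j + 1) ω) (Z j ω) * (t (j + 1) - t j)) • H i j ω | ℱ i])

/-- The data of the problem: grid `t` with `N` steps, filtration (`ℱ i` is the information at
time `t i`), chain `X`, weights `H i j`, terminal function `Φ`, driver functions `f i`. -/
structure Model (Ω : Type*) [mΩ : MeasurableSpace Ω] (d q : ℕ) where
  N : ℕ
  t : ℕ → ℝ
  ℱ : Filtration ℕ mΩ
  X : ℕ → Ω → Vec d
  H : ℕ → ℕ → Ω → Vec q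
  Φ : Vec d → ℝ
  f : ℕ → Vec d → ℝ → Vec q → ℝ

namespace Model

variable {Ω : Type*} [mΩ : MeasurableSpace Ω] {d q : ℕ}

/-- The Markovian assumptions. -/
structure MarkovAssumptions (𝓜 : Model Ω d q) (P : Measure Ω) (p : Params) : Prop where
  grid : IsTimeGrid p.T p.R 𝓜.N 𝓜.t
  X_adapted : ∀ i, i ≤ 𝓜.N → Measurable[𝓜.ℱ i] (𝓜.X i)
  /-- From time `i` on, the chain and the weights are functions of `X i` and of noise which is
  independent of the past. -/
  flow : ∀ i, i < 𝓜.N → ∃ 𝒢 : Set.Iic (𝓜.ℱ 𝓜.N),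
    Indep 𝒢.1 (𝓜.ℱ i) P ∧ ∀ j, i < j → j ≤ 𝓜.N →
      (∃ V : Ω → Vec d → Vec d,
        Measurable[𝒢.1.prod inferInstance] (fun a : Ω × Vec d => V a.1 a.2) ∧
        ∀ᵐ ω ∂P, 𝓜.X j ω = V ω (𝓜.X i ω)) ∧
      (∃ W : Ω → Vec d → Vec q,
        Measurable[𝒢.1.prod inferInstance] (fun a : Ω × Vec d => W a.1 a.2) ∧
        ∀ᵐ ω ∂P, 𝓜.H i j ω = W ω (𝓜.X i ω))
  Φ_measurable : Measurable 𝓜.Φ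
  Φ_bounded : ∃ C : ℝ, ∀ x, |𝓜.Φ x| ≤ C
  f_measurable : ∀ i, i < 𝓜.N →
    Measurable (fun a : Vec d × ℝ × Vec q => 𝓜.f i a.1 a.2.1 a.2.2)
  f_lipschitz : ∀ i, i < 𝓜.N → ∀ᵐ x ∂(P.map (𝓜.X i)), ∀ (y y' : ℝ) (z z' : Vec q),
    |𝓜.f i x y z - 𝓜.f i x y' z'|
      ≤ p.Lf / (p.T - 𝓜.t i) ^ ((1 - p.θL) / 2) * (|y - y'| + ‖z - z'‖)
  f_zero : ∀ i, i < 𝓜.N → ∀ᵐ x ∂(P.map (𝓜.X i)),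
    |𝓜.f i x 0 0| ≤ p.Cf / (p.T - 𝓜.t i) ^ (1 - p.θC)
  H_measurable : ∀ i j, i < j → j ≤ 𝓜.N → Measurable[𝓜.ℱ 𝓜.N] (𝓜.H i j)
  H_memLp : ∀ i j, i < j → j ≤ 𝓜.N → MemLp (𝓜.H i j) 2 P
  H_centered : ∀ i j, i < j → j ≤ 𝓜.N → P[𝓜.H i j | 𝓜.ℱ i] =ᵐ[P] 0
  H_bound : ∀ i j, i < j → j ≤ 𝓜.N →
    ∀ᵐ ω ∂P, √((P[fun ω' => ‖𝓜.H i j ω'‖ ^ 2 | 𝓜.ℱ i]) ω)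
      ≤ p.CM / √(𝓜.t j - 𝓜.t i)

/-- The terminal condition. -/
def ξ (𝓜 : Model Ω d q) (ω : Ω) : ℝ := 𝓜.Φ (𝓜.X 𝓜.N ω)

/-- The measurable functions `y i` and `z i` represent the solution of the dynamic programming
equation: `Y i = y i (X i)` and `Z i = z i (X i)`. -/
def IsMarkovSolution (𝓜 : Model Ω d q) (P : Measure Ω) (y : ℕ → Vec d → ℝ)
    (z : ℕ → Vec d → Vec q) : Prop :=
  (∀ i, i ≤ 𝓜.N → Measurable (y i)) ∧ (∀ i, i < 𝓜.N → Measurable (z i)) ∧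
  IsMWDPSolution P 𝓜.ℱ 𝓜.N 𝓜.t 𝓜.ξ (fun i ω => 𝓜.f i (𝓜.X i ω)) 𝓜.H
    (fun i ω => y i (𝓜.X i ω)) (fun i ω => z i (𝓜.X i ω))

/-- Essential supremum of the terminal condition. -/
def Cξ (𝓜 : Model Ω d q) (P : Measure Ω) : ℝ := (eLpNorm 𝓜.ξ ⊤ P).toReal

/-- Essential supremum of the conditional standard deviation of `ξ` given `ℱ i`. -/
def devξ (𝓜 : Model Ω d q) (P : Measure Ω) (i : ℕ) : ℝ :=
  (eLpNorm
    (fun ω => √((P[fun ω' => (𝓜.ξ ω' - (P[𝓜.ξ | 𝓜.ℱ i]) ω') ^ 2 | 𝓜.ℱ i]) ω)) ⊤ P).toReal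

variable (𝓜 : Model Ω d q) (P : Measure Ω) (p : Params) (B G : ℝ → ℝ → ℝ)

/-- The almost sure bound on `Y i`, used as truncation level. -/
def Cy (i : ℕ) : ℝ :=
  p.Cy1 B G * 𝓜.Cξ P + p.Cy2 B G * p.Cf * B p.θC 1 * (p.T - 𝓜.t i) ^ p.θC

/-- The almost sure bound on `Z i`, used as truncation level. -/
def Cz (i : ℕ) : ℝ :=
  p.Cz1 B G * 𝓜.devξ P i / √(p.T - 𝓜.t i)
    + p.Cz2 B G * p.Cf * B p.θC (1 / 2) / (p.T - 𝓜.t i) ^ (1 / 2 - p.θC)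
    + p.Cz3 B G * 𝓜.Cξ P * (p.T - 𝓜.t i) ^ (p.θL / 2)

/-- The bound on the observations for `Y` at time `i`. -/
def Γy (i : ℕ) : ℝ :=
  p.c1 B G q * 𝓜.Cξ P + p.c2 B G q * p.Cf * (p.T - 𝓜.t i) ^ p.θC

/-- The bound on the conditional standard deviation of the observations for `Z` at time `i`. -/
def Γz (i : ℕ) : ℝ :=
  p.c3 B G q * 𝓜.Cξ P * (p.T - 𝓜.t i) ^ (-(1 / 2) : ℝ)
    + p.c4 B G q * p.Cf * (p.T - 𝓜.t i) ^ (p.θC - 1 / 2)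

/-- The observation for `Y` at time `i` along the path `x`, computed with the functions
`y` and `z`. -/
def obsY (y : ℕ → Vec d → ℝ) (z : ℕ → Vec d → Vec q) (i : ℕ) (x : ℕ → Vec d) : ℝ :=
  𝓜.Φ (x 𝓜.N) + ∑ k ∈ Finset.Ico i 𝓜.N,
    𝓜.f k (x k) (y (k + 1) (x (k + 1))) (z k (x k)) * (𝓜.t (k + 1) - 𝓜.t k)

/-- The observation for `Z` at time `i` along the weights `h` and the path `x`, computed with the
functions `y` and `z`. -/
def obsZ (y : ℕ → Vec d → ℝ) (z : ℕ → Vec d → Vec q) (i : ℕ) (h : ℕ → Vec q)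
    (x : ℕ → Vec d) : Vec q :=
  𝓜.Φ (x 𝓜.N) • h 𝓜.N + ∑ k ∈ Finset.Ioo i 𝓜.N,
    (𝓜.f k (x k) (y (k + 1) (x (k + 1))) (z k (x k)) * (𝓜.t (k + 1) - 𝓜.t k)) • h k

end Model

/-! ### The algorithm -/

/-- Truncation of a real number at level `L`. -/
def trunc (L x : ℝ) : ℝ := max (-L) (min x L)

/-- Truncation of a vector at level `L`, coordinate by coordinate. -/
def truncVec {n : ℕ} (L : ℝ) (x : Vec n) : Vec n := WithLp.toLp 2 (fun l => trunc L (x l))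

/-- `ψ` is a least-squares approximation, in the span of the functions `p k`, of the observations
`s m` at the sample points `x m`. -/
def IsOLS {d K M : ℕ} {F : Type*} [NormedAddCommGroup F] [NormedSpace ℝ F]
    (p : Fin K → Vec d → F) (x : Fin M → Vec d) (s : Fin M → F) (ψ : Vec d → F) : Prop :=
  ψ ∈ Submodule.span ℝ (Set.range p) ∧
  ∀ φ ∈ Submodule.span ℝ (Set.range p),
    (1 / M : ℝ) * ∑ m, ‖ψ (x m) - s m‖ ^ 2 ≤ (1 / M : ℝ) * ∑ m, ‖φ (x m) - s m‖ ^ 2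

/-- Basis functions and numbers of simulations at each time. -/
structure Regression (d q : ℕ) where
  KY : ℕ → ℕ
  KZ : ℕ → ℕ
  pY : (i : ℕ) → Fin (KY i) → Vec d → ℝ
  pZ : (i : ℕ) → Fin (KZ i) → Vec d → Vec q
  M : ℕ → ℕ

structure Regression.Admissible {d q : ℕ} (𝓡 : Regression d q) {Ω : Type*} [MeasurableSpace Ω]
    (𝓜 : Model Ω d q) (P : Measure Ω) : Prop where
  pY_measurable : ∀ i, i < 𝓜.N → ∀ k, Measurable (𝓡.pY i k)
  pZ_measurable : ∀ i, i < 𝓜.N → ∀ k, Measurable (𝓡.pZ i k)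
  pY_memLp : ∀ i, i < 𝓜.N → ∀ k, MemLp (fun ω => 𝓡.pY i k (𝓜.X i ω)) 2 P
  pZ_memLp : ∀ i, i < 𝓜.N → ∀ k, MemLp (fun ω => 𝓡.pZ i k (𝓜.X i ω)) 2 P
  one_le_M : ∀ i, i < 𝓜.N → 1 ≤ 𝓡.M i
  K_le_M : ∀ i, i < 𝓜.N → max (𝓡.KY i) (𝓡.KZ i) ≤ 𝓡.M i

/-- The vector `(h (i+1), …, h N, x i, …, x N)` on which the regressions at time `i` are based. -/
def pathAt {α : Type*} {d q : ℕ} (N i : ℕ) (h : ℕ → α → Vec q) (x : ℕ → α → Vec d) (a : α) :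
    (Set.Ioc i N → Vec q) × (Set.Icc i N → Vec d) :=
  (fun j => h j a, fun j => x j a)

/-- The clouds of simulations: in the `m`-th simulation of the cloud at time `i`, the chain takes
the value `X i m j` at time `j`, and `H i m j` is the weight between the times `i` and `j`. -/
structure Clouds (Ω' : Type*) (d q : ℕ) (M : ℕ → ℕ) where
  X : (i : ℕ) → Fin (M i) → ℕ → Ω' → Vec d
  H : (i : ℕ) → Fin (M i) → ℕ → Ω' → Vec q

namespace Clouds

variable {Ω Ω' : Type*} [MeasurableSpace Ω] [MeasurableSpace Ω'] {d q : ℕ} {M : ℕ → ℕ}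

/-- All simulations are independent, and those of the cloud at time `i` are copies of
`(H i (i+1), …, H i N, X i, …, X N)`. -/
structure AreSimulations (𝓢 : Clouds Ω' d q M) (P' : Measure Ω') (𝓜 : Model Ω d q)
    (P : Measure Ω) : Prop where
  measurable : ∀ i, i < 𝓜.N → ∀ m : Fin (M i),
    Measurable (pathAt 𝓜.N i (𝓢.H i m) (𝓢.X i m))
  copies : ∀ i, i < 𝓜.N → ∀ m : Fin (M i),
    IdentDistrib (pathAt 𝓜.N i (𝓢.H i m) (𝓢.X i m)) (pathAt 𝓜.N i (𝓜.H i) 𝓜.X) P' P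
  indep : iIndepFun (fun (a : Σ i : Fin 𝓜.N, Fin (M i)) =>
    pathAt 𝓜.N a.1 (𝓢.H a.1 a.2) (𝓢.X a.1 a.2)) P'

/-- The σ-algebra generated by the clouds at the times `i, …, N - 1`. -/
abbrev sigmaFrom (𝓢 : Clouds Ω' d q M) (N i : ℕ) : MeasurableSpace Ω' :=
  ⨆ a : {a : Σ j : Fin N, Fin (M j) // i ≤ a.1},
    MeasurableSpace.comap (pathAt N a.1.1 (𝓢.H a.1.1 a.1.2) (𝓢.X a.1.1 a.1.2)) inferInstance

end Clouds

/-- `(yM, zM)` is the output of the algorithm with regression functions `(ψY, ψZ)`: least-squares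
regressions on the cloud at time `i`, backward in `i`, followed by truncation. A solution of the
regression at time `i` is a random function that depends on the clouds at the times
`i, …, N - 1` only. -/
structure IsMWLS {Ω Ω' : Type*} [MeasurableSpace Ω] [MeasurableSpace Ω'] {d q : ℕ}
    (𝓜 : Model Ω d q) (P : Measure Ω) (p : Params) (B G : ℝ → ℝ → ℝ) (𝓡 : Regression d q)
    (𝓢 : Clouds Ω' d q 𝓡.M) (P' : Measure Ω')
    (ψY yM : ℕ → Ω' → Vec d → ℝ) (ψZ zM : ℕ → Ω' → Vec d → Vec q) : Prop where
  terminal : ∀ ω x, yM 𝓜.N ω x = 𝓜.Φ x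
  z_eq : ∀ i, i < 𝓜.N → ∀ ω x, zM i ω x = truncVec (𝓜.Cz P p B G i) (ψZ i ω x)
  y_eq : ∀ i, i < 𝓜.N → ∀ ω x, yM i ω x = trunc (𝓜.Cy P p B G i) (ψY i ω x)
  ψZ_measurable : ∀ i, i < 𝓜.N →
    Measurable[(𝓢.sigmaFrom 𝓜.N i).prod inferInstance] (fun a : Ω' × Vec d => ψZ i a.1 a.2)
  ψY_measurable : ∀ i, i < 𝓜.N →
    Measurable[(𝓢.sigmaFrom 𝓜.N i).prod inferInstance] (fun a : Ω' × Vec d => ψY i a.1 a.2)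
  ψZ_solves : ∀ i, i < 𝓜.N → ∀ᵐ ω ∂P',
    IsOLS (𝓡.pZ i) (fun m => 𝓢.X i m i ω)
      (fun m => 𝓜.obsZ (fun k => yM k ω) (fun k => zM k ω) i
        (fun k => 𝓢.H i m k ω) (fun k => 𝓢.X i m k ω)) (ψZ i ω)
  ψY_solves : ∀ i, i < 𝓜.N → ∀ᵐ ω ∂P',
    IsOLS (𝓡.pY i) (fun m => 𝓢.X i m i ω)
      (fun m => 𝓜.obsY (fun k => yM k ω) (fun k => zM k ω) i
        (fun k => 𝓢.X i m k ω)) (ψY i ω)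

/-! ### Errors -/

section Errors

variable {Ω Ω' : Type*} [MeasurableSpace Ω] [MeasurableSpace Ω'] {d q : ℕ}

/-- The squared empirical norm at time `k` of `g`, on the cloud at time `k`. -/
def empNormSq {M : ℕ → ℕ} (𝓢 : Clouds Ω' d q M) {F : Type*} [NormedAddCommGroup F]
    (k : ℕ) (g : Ω' → Vec d → F) (ω : Ω') : ℝ :=
  (1 / M k : ℝ) * ∑ m : Fin (M k), ‖g ω (𝓢.X k m k ω)‖ ^ 2

/-- Best approximation error, in mean square under the law of `X`, of the function `v` in the span
of the functions `p k`. -/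
def appError {K : ℕ} {F : Type*} [NormedAddCommGroup F] [NormedSpace ℝ F] (P : Measure Ω)
    (X : Ω → Vec d) (p : Fin K → Vec d → F) (v : Vec d → F) : ℝ :=
  √(⨅ φ : Submodule.span ℝ (Set.range p), ∫ ω, ‖(φ : Vec d → F) (X ω) - v (X ω)‖ ^ 2 ∂P)

variable (𝓜 : Model Ω d q) (P : Measure Ω) (p : Params) (B G : ℝ → ℝ → ℝ)
  (𝓡 : Regression d q)

/-- Interdependence error for `Y`. -/
def depErrorY (i : ℕ) : ℝ :=
  𝓜.Cy P p B G i * √(2028 * (𝓡.KY i + 1) * Real.log (3 * 𝓡.M i) / 𝓡.M i)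

/-- Interdependence error for `Z`. -/
def depErrorZ (i : ℕ) : ℝ :=
  𝓜.Cz P p B G i * √(2028 * (𝓡.KZ i + 1) * q * Real.log (3 * 𝓡.M i) / 𝓡.M i)

/-- Approximation plus statistical error of the regression for `Y` at time `i < N`. -/
def regErrorY (y : ℕ → Vec d → ℝ) (i : ℕ) : ℝ :=
  appError P (𝓜.X i) (𝓡.pY i) (y i) + 𝓜.Γy P p B G i * √((𝓡.KY i : ℝ) / 𝓡.M i)

/-- Approximation plus statistical error of the regression for `Z` at time `i < N`. -/
def regErrorZ (z : ℕ → Vec d → Vec q) (i : ℕ) : ℝ :=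
  appError P (𝓜.X i) (𝓡.pZ i) (z i) + 𝓜.Γz P p B G i * √((𝓡.KZ i : ℝ) / 𝓡.M i)

/-- The local error at time `k`. No regression is made at time `N`, where the function is known
exactly, and so the three terms for `Y` at time `k + 1` are zero if `k + 1 = N`. -/
def localError (y : ℕ → Vec d → ℝ) (z : ℕ → Vec d → Vec q) (k : ℕ) : ℝ :=
  (if k + 1 < 𝓜.N then
      regErrorY 𝓜 P p B G 𝓡 y (k + 1) + p.Lf * depErrorY 𝓜 P p B G 𝓡 (k + 1)
    else 0)
  + regErrorZ 𝓜 P p B G 𝓡 z k + p.Lf * depErrorZ 𝓜 P p B G 𝓡 k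

end Errors

end MWLS

end

/-! The functions entering the observations at time `i` come from the clouds at later times, and
these are independent of the cloud at time `i` (the single exception, `zM i` in the observation for
`Y`, is treated below). Once the later clouds are frozen, each step is an ordinary regression: the
observation is a function of one simulated path, and its regression function is its mean under the
conditional law of the path given the current state.

Least squares is an orthogonal projection in the space of values at the `M` sample points. Hence
`eLpNorm_regression_le` splits the error in the empirical norm into three main contributions. The
first is the distance from the exact function to the regression space. The second is the projection
of the centered noise: it has rank at most `K`, and the noises of different simulations are
uncorrelated, so its mean square is at most `Γ² K` (`integral_inner_sq_le`). The third is the bias,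
the conditional mean of the difference between the observations computed with the approximate and
with the exact functions. Lipschitz continuity of the driver and the conditional Cauchy–Schwarz
inequality for the weights bound it by the errors at later times (`eLpNorm_drv_sub_le`,
`eLpNorm_integral_kernel_le`). For `Y` there is a fourth contribution, because `zM i` depends on the
cloud at time `i`. It is replaced by the exact `z i`, at the price of a residual controlled by the
empirical error of `Z` at time `i`.

The bias involves errors along an independent path, whereas a regression controls the error on its
own cloud. `integral_sq_le_of_law` passes from one to the other by a ghost sample. Exchanging sample
and ghost points preserves the law. For fixed points, the squared deviations of the truncated
functions of a `K`-dimensional space have only polynomially many superlevel sets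
(`card_le_of_shatters` with the Sauer–Shelah lemma), and an exponential moment bound over this
family costs a term of order `K log M / M`. Truncation is essential here, and it never increases the
error because the exact functions lie within the truncation levels (`ae_bounds`).

The errors thus satisfy a backward recursion whose kernel is singular at the current time and at
`T`. `errorRecursion_bounds` solves it with the discrete Gronwall inequality, whose constant exists
because an exponential weight in time makes the iterated kernel contract
(`exists_gronwallConstant`). The truncation levels come from a recursion of the same type
(`stability_bounds`), satisfied by the root mean squares of the solution on every event of the past.
A mean square bound on all such events is an almost sure bound (`ae_norm_le_of_rms_le`). -/

namespace MWLS

/-! ### Elementary estimates for powers -/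

/-- Bernoulli's inequality for `(y / x) ^ α`, multiplied by `x ^ α`. The right side telescopes along
a grid, which replaces the comparison of a Riemann sum with an integral. -/
theorem sub_div_rpow_le {x y α : ℝ} (hy : 0 ≤ y) (hx : 0 < x) (hα : 0 < α)
    (hα1 : α ≤ 1) : (x - y) / x ^ (1 - α) ≤ (x ^ α - y ^ α) / α := by
  have h := rpow_one_add_le_one_add_mul_self (s := y / x - 1)
    (by have := div_nonneg hy hx.le; linarith) hα.le hα1
  rw [show 1 + (y / x - 1) = y / x by ring, Real.div_rpow hy hx.le,
    div_le_iff₀ (Real.rpow_pos_of_pos hx α)] at h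
  have hx1 : x ^ (1 - α) = x / x ^ α := by rw [Real.rpow_sub hx, Real.rpow_one]
  have hp := Real.rpow_pos_of_pos hx α
  rw [hx1, le_div_iff₀ hα]
  have : (x - y) / (x / x ^ α) * α = x ^ α * (α * (1 - y / x)) := by field_simp
  rw [this]
  nlinarith

/-- Away from its singularity the weight is comparable to its value at `L`. The maximum with `1`
covers both signs of `1 - α`. -/
theorem one_div_rpow_le_of_half_le {x L α : ℝ} (hL : 0 < L) (h1 : L / 2 ≤ x) (h2 : x ≤ L) :
    1 / x ^ (1 - α) ≤ max 1 (2 ^ (1 - α)) * (1 / L ^ (1 - α)) := by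
  have hx : 0 < x := by linarith
  have hLp := Real.rpow_pos_of_pos hL (1 - α)
  have hxp := Real.rpow_pos_of_pos hx (1 - α)
  rw [mul_one_div, div_le_div_iff₀ hxp hLp, one_mul]
  rcases le_total α 1 with h | h
  · have : L ^ (1 - α) ≤ (2 * x) ^ (1 - α) :=
      Real.rpow_le_rpow hL.le (by linarith) (by linarith)
    rw [Real.mul_rpow (by norm_num) hx.le] at this
    exact this.trans (mul_le_mul_of_nonneg_right (le_max_right _ _) hxp.le)
  · have : L ^ (1 - α) ≤ x ^ (1 - α) := Real.rpow_le_rpow_of_nonpos hx h2 (by linarith)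
    refine this.trans ?_
    exact le_mul_of_one_le_left hxp.le (le_max_left _ _)

theorem sum_Ico_le_sub {a φ : ℕ → ℝ} {i k : ℕ} (hik : i ≤ k)
    (h : ∀ j, i ≤ j → j < k → a j ≤ φ (j + 1) - φ j) :
    ∑ j ∈ Finset.Ico i k, a j ≤ φ k - φ i := by
  rw [← Finset.sum_Ico_sub φ hik]
  exact Finset.sum_le_sum fun j hj => h j (Finset.mem_Ico.1 hj).1 (Finset.mem_Ico.1 hj).2

theorem Ioo_eq_Ico_succ (i k : ℕ) : Finset.Ioo i k = Finset.Ico (i + 1) k := by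
  ext j; simp

/-! ### Time grids -/

namespace IsTimeGrid

variable {T R : ℝ} {N : ℕ} {t : ℕ → ℝ}

theorem mono (h : IsTimeGrid T R N t) {i j : ℕ} (hij : i ≤ j) (hj : j ≤ N) : t i ≤ t j := by
  induction j, hij using Nat.le_induction with
  | base => exact le_rfl
  | succ j hij ih => exact (ih (by omega)).trans (h.lt j (by omega)).le

theorem strict (h : IsTimeGrid T R N t) {i j : ℕ} (hij : i < j) (hj : j ≤ N) : t i < t j :=
  (h.lt i (by omega)).trans_le (h.mono hij hj)

theorem lt_last (h : IsTimeGrid T R N t) {i : ℕ} (hi : i < N) : t i < T :=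
  h.last ▸ h.strict hi le_rfl

theorem nonneg (h : IsTimeGrid T R N t) {i : ℕ} (hi : i ≤ N) : 0 ≤ t i :=
  h.zero ▸ h.mono (Nat.zero_le i) hi

theorem le_last (h : IsTimeGrid T R N t) {i : ℕ} (hi : i ≤ N) : t i ≤ T :=
  h.last ▸ h.mono hi le_rfl

theorem step_pos (h : IsTimeGrid T R N t) {i : ℕ} (hi : i < N) : 0 < t (i + 1) - t i :=
  sub_pos.2 (h.lt i hi)

theorem step_le (h : IsTimeGrid T R N t) {i : ℕ} (hi : i + 2 ≤ N) :
    t (i + 2) - t (i + 1) ≤ R * (t (i + 1) - t i) :=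
  (div_le_iff₀ (h.step_pos (by omega))).1 (h.ratio i hi)

/-- For `α ≤ 1` the weight increases in `t j`, so left endpoints give a sum below the integral and
no assumption on the step ratio is needed. For `α ≥ 1` the weight is at most its value at `t i`. -/
theorem sum_backward_le (h : IsTimeGrid T R N t) {α : ℝ} (hα : 0 < α) {i k : ℕ} (hik : i < k)
    (hk : k ≤ N) :
    ∑ j ∈ Finset.Ico i k, (t (j + 1) - t j) / (t k - t j) ^ (1 - α)
      ≤ max 1 (1 / α) * (t k - t i) ^ α := by
  have hL : 0 < t k - t i := sub_pos.2 (h.strict hik hk)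
  have hLp := Real.rpow_pos_of_pos hL α
  rcases le_total α 1 with hα1 | hα1
  · have := sum_Ico_le_sub (a := fun j => (t (j + 1) - t j) / (t k - t j) ^ (1 - α))
      (φ := fun j => -((t k - t j) ^ α / α)) hik.le (fun j hj1 hj2 => by
        have := sub_div_rpow_le (x := t k - t j) (y := t k - t (j + 1)) (α := α)
          (sub_nonneg.2 (h.mono hj2 hk)) (sub_pos.2 (h.strict hj2 hk)) hα hα1
        rw [show t k - t j - (t k - t (j + 1)) = t (j + 1) - t j by ring] at this
        refine this.trans (le_of_eq ?_)
        ring)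
    refine this.trans ?_
    rw [sub_self, Real.zero_rpow hα.ne', zero_div, neg_zero, zero_sub, neg_neg,
      div_eq_mul_one_div, mul_comm]
    exact mul_le_mul_of_nonneg_right (le_max_right _ _) hLp.le
  · have h1 : ∀ j ∈ Finset.Ico i k, (t (j + 1) - t j) / (t k - t j) ^ (1 - α)
        ≤ (t (j + 1) - t j) * (t k - t i) ^ (α - 1) := by
      intro j hj
      obtain ⟨hj1, hj2⟩ := Finset.mem_Ico.1 hj
      have hpos : 0 < t k - t j := sub_pos.2 (h.strict hj2 hk)
      rw [div_eq_mul_inv, ← Real.rpow_neg hpos.le, neg_sub]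
      refine mul_le_mul_of_nonneg_left ?_ (h.step_pos (by omega)).le
      exact Real.rpow_le_rpow hpos.le (by linarith [h.mono hj1 (by omega)]) (by linarith)
    refine (Finset.sum_le_sum h1).trans ?_
    rw [← Finset.sum_mul, Finset.sum_Ico_sub t hik.le]
    have : (t k - t i) * (t k - t i) ^ (α - 1) = (t k - t i) ^ α := by
      rw [← Real.rpow_one_add' hL.le (by linarith)]; congr 1; ring
    rw [this]
    exact le_mul_of_one_le_left hLp.le (le_max_left _ _)

/-- For `β ≤ 1` the weight decreases in `t j`, so left endpoints overestimate the integral. The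
ratio bound replaces the step after `t j` by `R` times the step before it, for which `t j` is a
right endpoint. This is why the telescoping function has index `j - 1`. -/
theorem sum_forward_le (h : IsTimeGrid T R N t) (hR : 0 ≤ R) {β : ℝ} (hβ : 0 < β) {i k : ℕ}
    (hik : i < k) (hk : k ≤ N) :
    ∑ j ∈ Finset.Ioo i k, (t (j + 1) - t j) / (t j - t i) ^ (1 - β)
      ≤ max 1 (R / β) * (t k - t i) ^ β := by
  have hL : 0 < t k - t i := sub_pos.2 (h.strict hik hk)
  have hLp := Real.rpow_pos_of_pos hL β
  rw [Ioo_eq_Ico_succ]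
  rcases le_total β 1 with hβ1 | hβ1
  · have := sum_Ico_le_sub (a := fun j => (t (j + 1) - t j) / (t j - t i) ^ (1 - β))
      (φ := fun j => R / β * (t (j - 1) - t i) ^ β) (Nat.succ_le_of_lt hik) (fun j hj1 hj2 => by
        obtain ⟨m, rfl⟩ : ∃ m, j = m + 1 := ⟨j - 1, by omega⟩
        have h1 := sub_div_rpow_le (x := t (m + 1) - t i) (y := t m - t i) (α := β)
          (sub_nonneg.2 (h.mono (by omega) (by omega)))
          (sub_pos.2 (h.strict (by omega) (by omega))) hβ hβ1
        rw [show t (m + 1) - t i - (t m - t i) = t (m + 1) - t m by ring] at h1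
        have h2 := h.step_le (i := m) (by omega)
        have hp : 0 < (t (m + 1) - t i) ^ (1 - β) :=
          Real.rpow_pos_of_pos (sub_pos.2 (h.strict (by omega) (by omega))) _
        simp only [Nat.add_sub_cancel]
        calc (t (m + 1 + 1) - t (m + 1)) / (t (m + 1) - t i) ^ (1 - β)
            ≤ R * (t (m + 1) - t m) / (t (m + 1) - t i) ^ (1 - β) := by gcongr
          _ = R * ((t (m + 1) - t m) / (t (m + 1) - t i) ^ (1 - β)) := by ring
          _ ≤ R * (((t (m + 1) - t i) ^ β - (t m - t i) ^ β) / β) :=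
              mul_le_mul_of_nonneg_left h1 hR
          _ = _ := by ring)
    refine this.trans ?_
    rw [Nat.succ_sub_one, sub_self, Real.zero_rpow hβ.ne', mul_zero, sub_zero]
    refine mul_le_mul (le_max_right _ _) ?_ ?_ (by positivity)
    · exact Real.rpow_le_rpow (sub_nonneg.2 (h.mono (by omega) (by omega)))
        (by linarith [h.mono (i := k - 1) (j := k) (by omega) hk]) hβ.le
    · exact Real.rpow_nonneg (sub_nonneg.2 (h.mono (by omega) (by omega))) _
  · have h1 : ∀ j ∈ Finset.Ico (i + 1) k, (t (j + 1) - t j) / (t j - t i) ^ (1 - β)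
        ≤ (t (j + 1) - t j) * (t k - t i) ^ (β - 1) := by
      intro j hj
      obtain ⟨hj1, hj2⟩ := Finset.mem_Ico.1 hj
      have hpos : 0 < t j - t i := sub_pos.2 (h.strict (by omega) (by omega))
      rw [div_eq_mul_inv, ← Real.rpow_neg hpos.le, neg_sub]
      refine mul_le_mul_of_nonneg_left ?_ (h.step_pos (by omega)).le
      exact Real.rpow_le_rpow hpos.le (by linarith [h.mono hj2.le hk]) (by linarith)
    refine (Finset.sum_le_sum h1).trans ?_
    rw [← Finset.sum_mul, Finset.sum_Ico_sub t hik]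
    have : (t k - t i) * (t k - t i) ^ (β - 1) = (t k - t i) ^ β := by
      rw [← Real.rpow_one_add' hL.le (by linarith)]; congr 1; ring
    calc (t k - t (i + 1)) * (t k - t i) ^ (β - 1)
        ≤ (t k - t i) * (t k - t i) ^ (β - 1) := by
          refine mul_le_mul_of_nonneg_right ?_ (Real.rpow_nonneg hL.le _)
          linarith [h.lt i (by omega)]
      _ = (t k - t i) ^ β := this
      _ ≤ _ := le_mul_of_one_le_left hLp.le (le_max_left _ _)

/-- At each `t j` one of the distances to the ends is at least half of the total length. That factor
is frozen by `one_div_rpow_le_of_half_le`, and a sum with one singularity remains. -/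
theorem sum_two_sided_le (h : IsTimeGrid T R N t) (hR : 0 ≤ R) {α β : ℝ} (hα : 0 < α)
    (hβ : 0 < β) {i k : ℕ} (hik : i < k) (hk : k ≤ N) :
    ∑ j ∈ Finset.Ioo i k,
        (t (j + 1) - t j) / ((t k - t j) ^ (1 - α) * (t j - t i) ^ (1 - β))
      ≤ (max 1 (2 ^ (1 - α)) * max 1 (R / β) + max 1 (2 ^ (1 - β)) * max 1 (1 / α))
        * (t k - t i) ^ (α + β - 1) := by
  have hL : 0 < t k - t i := sub_pos.2 (h.strict hik hk)
  set L := t k - t i with hLdef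
  set cα : ℝ := max 1 (2 ^ (1 - α))
  set cβ : ℝ := max 1 (2 ^ (1 - β))
  have hcα : 0 ≤ cα := zero_le_one.trans (le_max_left _ _)
  have hcβ : 0 ≤ cβ := zero_le_one.trans (le_max_left _ _)
  have hLα := Real.rpow_pos_of_pos hL (1 - α)
  have hLβ := Real.rpow_pos_of_pos hL (1 - β)
  have key : ∀ j ∈ Finset.Ioo i k,
      (t (j + 1) - t j) / ((t k - t j) ^ (1 - α) * (t j - t i) ^ (1 - β))
      ≤ cα * (1 / L ^ (1 - α)) * ((t (j + 1) - t j) / (t j - t i) ^ (1 - β))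
        + cβ * (1 / L ^ (1 - β)) * ((t (j + 1) - t j) / (t k - t j) ^ (1 - α)) := by
    intro j hj
    obtain ⟨hj1, hj2⟩ := Finset.mem_Ioo.1 hj
    have hd := h.step_pos (i := j) (by omega)
    have p1 : 0 < t k - t j := sub_pos.2 (h.strict hj2 hk)
    have p2 : 0 < t j - t i := sub_pos.2 (h.strict hj1 (by omega))
    have q1 := Real.rpow_pos_of_pos p1 (1 - α)
    have q2 := Real.rpow_pos_of_pos p2 (1 - β)
    have n1 : 0 ≤ cα * (1 / L ^ (1 - α)) * ((t (j + 1) - t j) / (t j - t i) ^ (1 - β)) := by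
      positivity
    have n2 : 0 ≤ cβ * (1 / L ^ (1 - β)) * ((t (j + 1) - t j) / (t k - t j) ^ (1 - α)) := by
      positivity
    rcases le_total (t j - t i) (L / 2) with hc | hc
    · have := one_div_rpow_le_of_half_le (α := α) hL (x := t k - t j) (by linarith) (by linarith)
      have h3 := mul_le_mul_of_nonneg_right this
        (div_nonneg hd.le q2.le)
      have h4 : 1 / (t k - t j) ^ (1 - α) * ((t (j + 1) - t j) / (t j - t i) ^ (1 - β))
        = (t (j + 1) - t j) / ((t k - t j) ^ (1 - α) * (t j - t i) ^ (1 - β)) := by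
        field_simp
      linarith
    · have := one_div_rpow_le_of_half_le (α := β) hL (x := t j - t i) hc (by linarith)
      have h3 := mul_le_mul_of_nonneg_right this
        (div_nonneg hd.le q1.le)
      have h4 : 1 / (t j - t i) ^ (1 - β) * ((t (j + 1) - t j) / (t k - t j) ^ (1 - α))
        = (t (j + 1) - t j) / ((t k - t j) ^ (1 - α) * (t j - t i) ^ (1 - β)) := by
        field_simp
      linarith
  refine (Finset.sum_le_sum key).trans ?_
  rw [Finset.sum_add_distrib, ← Finset.mul_sum, ← Finset.mul_sum]
  have s1 := h.sum_forward_le hR hβ hik hk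
  have s2 : ∑ j ∈ Finset.Ioo i k, (t (j + 1) - t j) / (t k - t j) ^ (1 - α)
      ≤ max 1 (1 / α) * L ^ α := by
    refine le_trans ?_ (h.sum_backward_le hα hik hk)
    refine Finset.sum_le_sum_of_subset_of_nonneg Finset.Ioo_subset_Ico_self ?_
    intro j hj _
    obtain ⟨hj1, hj2⟩ := Finset.mem_Ico.1 hj
    exact div_nonneg (h.step_pos (by omega)).le
      (Real.rpow_nonneg (sub_nonneg.2 (h.mono hj2.le hk)) _)
  have e1 : 1 / L ^ (1 - α) * L ^ β = L ^ (α + β - 1) := by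
    rw [one_div, ← Real.rpow_neg hL.le, ← Real.rpow_add hL]; congr 1; ring
  have e2 : 1 / L ^ (1 - β) * L ^ α = L ^ (α + β - 1) := by
    rw [one_div, ← Real.rpow_neg hL.le, ← Real.rpow_add hL]; congr 1; ring
  calc _ ≤ cα * (1 / L ^ (1 - α)) * (max 1 (R / β) * L ^ β)
        + cβ * (1 / L ^ (1 - β)) * (max 1 (1 / α) * L ^ α) := by gcongr
    _ = cα * max 1 (R / β) * (1 / L ^ (1 - α) * L ^ β)
        + cβ * max 1 (1 / α) * (1 / L ^ (1 - β) * L ^ α) := by ring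
    _ = _ := by rw [e1, e2]; ring

end IsTimeGrid

/-- The one-sided and two-sided constants are added because `B α 1` has to serve in both
inequalities. -/
theorem exists_isSumConstant {R : ℝ} (hR : 0 ≤ R) : ∃ B : ℝ → ℝ → ℝ, IsSumConstant R B := by
  refine ⟨fun α β => max 1 (1 / α) +
    (max 1 (2 ^ (1 - α)) * max 1 (R / β) + max 1 (2 ^ (1 - β)) * max 1 (1 / α)), ?_⟩
  intro α β hα hβ
  have n1 : ∀ x : ℝ, 0 ≤ max 1 x := fun x => zero_le_one.trans (le_max_left _ _)
  have n2 : ∀ β' : ℝ,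
      0 ≤ max 1 ((2 : ℝ) ^ (1 - α)) * max 1 (R / β')
        + max 1 ((2 : ℝ) ^ (1 - β')) * max 1 (1 / α) := fun β' =>
    add_nonneg (mul_nonneg (n1 _) (n1 _)) (mul_nonneg (n1 _) (n1 _))
  refine ⟨add_nonneg (n1 _) (n2 _), fun T N t _ h i k hik hk => ⟨?_, ?_⟩⟩
  · have hL : 0 < t k - t i := sub_pos.2 (h.strict hik hk)
    refine (h.sum_backward_le hα hik hk).trans ?_
    exact mul_le_mul_of_nonneg_right (le_add_of_nonneg_right (n2 1)) (Real.rpow_nonneg hL.le _)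
  · have hL : 0 < t k - t i := sub_pos.2 (h.strict hik hk)
    refine (h.sum_two_sided_le hR hα hβ hik hk).trans ?_
    exact mul_le_mul_of_nonneg_right (le_add_of_nonneg_left (n1 _)) (Real.rpow_nonneg hL.le _)

/-! ### Iterated singular sums -/

theorem sum_Ioo_sum_Ioo_comm {j N : ℕ} (f : ℕ → ℕ → ℝ) :
    ∑ l ∈ Finset.Ioo j N, ∑ m ∈ Finset.Ioo l N, f l m
      = ∑ m ∈ Finset.Ioo j N, ∑ l ∈ Finset.Ioo j m, f l m :=
  Finset.sum_comm' fun l m => by simp only [Finset.mem_Ioo]; omega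

theorem sum_Ico_sum_Ioo_comm {j N : ℕ} (f : ℕ → ℕ → ℝ) :
    ∑ l ∈ Finset.Ico j N, ∑ m ∈ Finset.Ioo l N, f l m
      = ∑ m ∈ Finset.Ico j N, ∑ l ∈ Finset.Ico j m, f l m :=
  Finset.sum_comm' fun l m => by simp only [Finset.mem_Ioo, Finset.mem_Ico]; omega

section IteratedSums

variable {T R : ℝ} {N : ℕ} {t : ℕ → ℝ} {B : ℝ → ℝ → ℝ} {β ε γ : ℝ}

/-- Since `t m ≤ T`, the singularity at `T` is dominated by one at `t m`. The combined exponent `1 -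
(β - ε)` stays below one when `ε < β`. The parameter `ε` is `0` in the estimates of recursions and
positive in the Gronwall argument. -/
theorem kernel_le (h : IsTimeGrid T R N t) (hβ : β ≤ 1 / 2) {l m : ℕ} (hlm : l < m)
    (hm : m ≤ N) :
    (t (l + 1) - t l) / (T - t l) ^ (1 / 2 - β) / (t m - t l) ^ (1 / 2 + ε)
      ≤ (t (l + 1) - t l) / (t m - t l) ^ (1 - (β - ε)) := by
  have p : 0 < t m - t l := sub_pos.2 (h.strict hlm hm)
  have : (t m - t l) ^ (1 - (β - ε)) = (t m - t l) ^ (1 / 2 - β) * (t m - t l) ^ (1 / 2 + ε) := by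
    rw [← Real.rpow_add p]; congr 1; ring
  rw [this, div_div]
  have hd := h.step_pos (i := l) (by omega)
  have : (t m - t l) ^ (1 / 2 - β) ≤ (T - t l) ^ (1 / 2 - β) :=
    Real.rpow_le_rpow p.le (by linarith [h.le_last hm]) (by linarith)
  have q1 := Real.rpow_pos_of_pos p (1 / 2 - β)
  have q2 := Real.rpow_pos_of_pos p (1 / 2 + ε)
  gcongr

/-- After exchanging the sums, the inner one is a discrete Beta integral with a positive power `β -
ε` to spare, which is bounded by that power of `T`. Iterating the kernel therefore reproduces the
outer weight up to a constant. -/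
theorem double_sum_Ioo_le (h : IsTimeGrid T R N t) (hB : IsSumConstant R B) (hT : 0 < T)
    (hβ : β ≤ 1 / 2) (hε : ε < β) (hγ : 0 < γ) {d : ℕ → ℝ} (hd : ∀ m, m < N → 0 ≤ d m)
    (j : ℕ) :
    ∑ l ∈ Finset.Ioo j N, (t (l + 1) - t l) / ((T - t l) ^ (1 / 2 - β) * (t l - t j) ^ (1 - γ))
        * ∑ m ∈ Finset.Ioo l N, d m / (t m - t l) ^ (1 / 2 + ε)
      ≤ B (β - ε) γ * T ^ (β - ε) * ∑ m ∈ Finset.Ioo j N, d m / (t m - t j) ^ (1 - γ) := by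
  simp_rw [Finset.mul_sum]
  rw [sum_Ioo_sum_Ioo_comm]
  refine Finset.sum_le_sum fun m hm => ?_
  obtain ⟨hm1, hm2⟩ := Finset.mem_Ioo.1 hm
  have hB' := hB (β - ε) γ (by linarith) hγ
  have hk := (hB'.2 T N t hT h j m hm1 hm2.le).2
  have p : 0 < t m - t j := sub_pos.2 (h.strict hm1 hm2.le)
  have hdm := hd m hm2
  calc ∑ l ∈ Finset.Ioo j m, (t (l + 1) - t l) / ((T - t l) ^ (1 / 2 - β) * (t l - t j) ^ (1 - γ))
          * (d m / (t m - t l) ^ (1 / 2 + ε))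
      ≤ ∑ l ∈ Finset.Ioo j m, d m * ((t (l + 1) - t l) /
          ((t m - t l) ^ (1 - (β - ε)) * (t l - t j) ^ (1 - γ))) := by
        refine Finset.sum_le_sum fun l hl => ?_
        obtain ⟨hl1, hl2⟩ := Finset.mem_Ioo.1 hl
        have hk := kernel_le (ε := ε) h hβ hl2 hm2.le
        have q : 0 < (t l - t j) ^ (1 - γ) :=
          Real.rpow_pos_of_pos (sub_pos.2 (h.strict hl1 (by omega))) _
        calc _ = d m * ((t (l + 1) - t l) / (T - t l) ^ (1 / 2 - β) / (t m - t l) ^ (1 / 2 + ε)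
              / (t l - t j) ^ (1 - γ)) := by
              simp only [div_eq_mul_inv, mul_inv]; ring
          _ ≤ d m * ((t (l + 1) - t l) / (t m - t l) ^ (1 - (β - ε)) / (t l - t j) ^ (1 - γ)) := by
              gcongr
          _ = _ := by rw [div_div]
    _ ≤ d m * (B (β - ε) γ * (t m - t j) ^ (β - ε + γ - 1)) := by
        rw [← Finset.mul_sum]; exact mul_le_mul_of_nonneg_left hk hdm
    _ = B (β - ε) γ * (t m - t j) ^ (β - ε) * (d m / (t m - t j) ^ (1 - γ)) := by
        rw [show β - ε + γ - 1 = (β - ε) - (1 - γ) by ring, Real.rpow_sub p]; ring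
    _ ≤ B (β - ε) γ * T ^ (β - ε) * (d m / (t m - t j) ^ (1 - γ)) := by
        have : (t m - t j) ^ (β - ε) ≤ T ^ (β - ε) := Real.rpow_le_rpow p.le
          (by linarith [h.le_last hm2.le, h.nonneg (i := j) (by omega)]) (by linarith)
        have q := Real.rpow_pos_of_pos p (1 - γ)
        have := hB'.1
        gcongr

theorem double_sum_Ico_le (h : IsTimeGrid T R N t) (hB : IsSumConstant R B) (hT : 0 < T)
    (hβ : β ≤ 1 / 2) (hε : ε < β) {d : ℕ → ℝ} (hd : ∀ m, m < N → 0 ≤ d m) (j : ℕ) :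
    ∑ l ∈ Finset.Ico j N, (t (l + 1) - t l) / (T - t l) ^ (1 / 2 - β)
        * ∑ m ∈ Finset.Ioo l N, d m / (t m - t l) ^ (1 / 2 + ε)
      ≤ B (β - ε) 1 * T ^ (β - ε) * ∑ m ∈ Finset.Ico j N, d m := by
  simp_rw [Finset.mul_sum]
  rw [sum_Ico_sum_Ioo_comm]
  refine Finset.sum_le_sum fun m hm => ?_
  obtain ⟨hm1, hm2⟩ := Finset.mem_Ico.1 hm
  have hB' := hB (β - ε) 1 (by linarith) one_pos
  have hdm := hd m hm2
  have hb := hB'.1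
  rcases hm1.eq_or_lt with rfl | hm1
  · simp only [Finset.Ico_self, Finset.sum_empty]
    positivity
  have hk := (hB'.2 T N t hT h j m hm1 hm2.le).1
  have p : 0 < t m - t j := sub_pos.2 (h.strict hm1 hm2.le)
  calc ∑ l ∈ Finset.Ico j m, (t (l + 1) - t l) / (T - t l) ^ (1 / 2 - β)
          * (d m / (t m - t l) ^ (1 / 2 + ε))
      ≤ ∑ l ∈ Finset.Ico j m, d m * ((t (l + 1) - t l) / (t m - t l) ^ (1 - (β - ε))) := by
        refine Finset.sum_le_sum fun l hl => ?_
        obtain ⟨hl1, hl2⟩ := Finset.mem_Ico.1 hl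
        have hk := kernel_le (ε := ε) h hβ hl2 hm2.le
        calc _ = d m * ((t (l + 1) - t l) / (T - t l) ^ (1 / 2 - β) / (t m - t l) ^ (1 / 2 + ε)) := by
              simp only [div_eq_mul_inv]; ring
          _ ≤ _ := by gcongr
    _ ≤ d m * (B (β - ε) 1 * (t m - t j) ^ (β - ε)) := by
        rw [← Finset.mul_sum]; exact mul_le_mul_of_nonneg_left hk hdm
    _ ≤ d m * (B (β - ε) 1 * T ^ (β - ε)) := by
        have : (t m - t j) ^ (β - ε) ≤ T ^ (β - ε) := Real.rpow_le_rpow p.le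
          (by linarith [h.le_last hm2.le, h.nonneg (i := j) (by omega)]) (by linarith)
        gcongr
    _ = _ := by ring

end IteratedSums

/-! ### The discrete Gronwall inequality -/

/-- Exponential decay is traded for a small factor `lam ^ (-ε)`, at the price of a slightly stronger
singularity. -/
theorem exp_neg_mul_le {lam s ε : ℝ} (hlam : 0 < lam) (hs : 0 < s) (hε0 : 0 ≤ ε) (hε1 : ε ≤ 1) :
    Real.exp (-(lam * s)) ≤ 1 / (lam ^ ε * s ^ ε) := by
  have hx : 0 < lam * s := mul_pos hlam hs
  rw [Real.exp_neg, ← one_div, ← Real.mul_rpow hlam.le hs.le]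
  refine one_div_le_one_div_of_le (Real.rpow_pos_of_pos hx _) ?_
  rcases le_total (lam * s) 1 with h | h
  · exact (Real.rpow_le_one hx.le h hε0).trans (Real.one_le_exp hx.le)
  · calc (lam * s) ^ ε ≤ (lam * s) ^ (1 : ℝ) := Real.rpow_le_rpow_of_exponent_le h hε1
      _ = lam * s := Real.rpow_one _
      _ ≤ Real.exp (lam * s) := by linarith [Real.add_one_le_exp (lam * s)]

/-- Multiply `u` by `exp (lam * t)`. By `exp_neg_mul_le` the kernel gains a factor `lam ^ (-ε)`, and
by the double sum estimates the weighted sum of `v` is at most its data plus half of itself once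
`lam` is large. Absorbing that half gives the factor `2`, and removing the exponential weight gives
`exp (lam * T)`. -/
theorem exists_gronwallConstant {R T β Cu γ : ℝ} {B : ℝ → ℝ → ℝ} (hB : IsSumConstant R B)
    (hT : 0 < T) (hβ0 : 0 < β) (hβ1 : β ≤ 1 / 2) (hCu : 0 ≤ Cu) (hγ : 0 < γ) :
    ∃ c, IsGronwallConstant R T 0 β Cu γ c := by
  set ε := β / 2 with hε
  have hε0 : 0 < ε := by positivity
  have hεβ : ε < β := by linarith
  -- The maximum serves the sums over `Ioo` with parameter `γ` and the sums over `Ico`, whose Beta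
  -- constant has second argument `1`.
  set b := max (B (β - ε) γ) (B (β - ε) 1) with hb
  have hb0 : 0 ≤ b := (hB (β - ε) γ (by linarith) hγ).1.trans (le_max_left _ _)
  -- `A` is the required value of `lam ^ ε`: it makes the contraction factor at most one half. The
  -- summand `1` keeps it positive.
  set A := 2 * Cu * (b * T ^ (β - ε)) + 1 with hA
  have hTp := Real.rpow_pos_of_pos hT (β - ε)
  have hA0 : 0 < A := by positivity
  set lam := A ^ (1 / ε) with hlam
  have hlam0 : 0 < lam := Real.rpow_pos_of_pos hA0 _
  have hlamε : lam ^ ε = A := by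
    rw [hlam, ← Real.rpow_mul hA0.le, one_div_mul_cancel hε0.ne', Real.rpow_one]
  refine ⟨2 * Real.exp (lam * T), by positivity, ?_⟩
  intro N t h k hk u w hu hw hrec j hkj hjN
  set a : ℕ → ℝ := fun l => (t (l + 1) - t l) / (T - t l) ^ (1 / 2 - β) with ha
  set v : ℕ → ℝ := fun l => u l * Real.exp (lam * t l) with hv
  have ha0 : ∀ l, l < N → 0 ≤ a l := fun l hl => div_nonneg (h.step_pos hl).le
    (Real.rpow_nonneg (sub_nonneg.2 (h.le_last hl.le)) _)
  have hv0 : ∀ l, 0 ≤ v l := fun l => mul_nonneg (hu l) (Real.exp_pos _).le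
  have hexp : ∀ l, l ≤ N → 1 ≤ Real.exp (lam * t l) ∧ Real.exp (lam * t l) ≤ Real.exp (lam * T) :=
    fun l hl => ⟨Real.one_le_exp (mul_nonneg hlam0.le (h.nonneg hl)),
      Real.exp_le_exp.2 (mul_le_mul_of_nonneg_left (h.le_last hl) hlam0.le)⟩
  have hrec' : ∀ l, k ≤ l → l < N → v l ≤ Real.exp (lam * T) * w l
      + Cu / A * ∑ m ∈ Finset.Ioo l N, (v m * a m) / (t m - t l) ^ (1 / 2 + ε) := by
    intro l hkl hlN
    have h1 := mul_le_mul_of_nonneg_right (hrec l hkl hlN.le) (Real.exp_pos (lam * t l)).le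
    refine h1.trans ?_
    rw [add_mul]
    refine add_le_add ?_ ?_
    · rw [mul_comm]; exact mul_le_mul_of_nonneg_right (hexp l hlN.le).2 (hw l)
    rw [div_mul_eq_mul_div, mul_div_assoc, mul_assoc, Finset.sum_mul, Finset.sum_div]
    refine mul_le_mul_of_nonneg_left (Finset.sum_le_sum fun m hm => ?_) hCu
    obtain ⟨hm1, hm2⟩ := Finset.mem_Ioo.1 hm
    have p : 0 < t m - t l := sub_pos.2 (h.strict hm1 hm2.le)
    have e1 : Real.exp (lam * t l) = Real.exp (lam * t m) * Real.exp (-(lam * (t m - t l))) := by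
      rw [← Real.exp_add]; congr 1; ring
    have e2 := exp_neg_mul_le hlam0 p hε0.le (by linarith)
    rw [hlamε] at e2
    have e3 : (t m - t l) ^ (1 / 2 + ε) = (t m - t l) ^ (1 / 2 - 0 : ℝ) * (t m - t l) ^ ε := by
      rw [← Real.rpow_add p]; congr 1; ring
    have q1 := Real.rpow_pos_of_pos p (1 / 2 - 0 : ℝ)
    have q2 := Real.rpow_pos_of_pos p ε
    have ham := ha0 m hm2
    have hvm := hv0 m
    calc _ = (v m * a m) / (t m - t l) ^ (1 / 2 - 0 : ℝ) * Real.exp (-(lam * (t m - t l))) := by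
          rw [e1]; simp only [hv, ha, div_eq_mul_inv, mul_inv]; ring
      _ ≤ (v m * a m) / (t m - t l) ^ (1 / 2 - 0 : ℝ) * (1 / (A * (t m - t l) ^ ε)) := by
          gcongr
      _ = _ := by rw [e3]; simp only [div_eq_mul_inv, mul_inv]; ring
  have hfac : Cu / A * (b * T ^ (β - ε)) ≤ 1 / 2 := by
    rw [div_mul_eq_mul_div, div_le_iff₀ hA0, hA]
    linarith
  have hCA : 0 ≤ Cu / A := by positivity
  have hva0 : ∀ m, m < N → 0 ≤ v m * a m := fun m hm => mul_nonneg (hv0 m) (ha0 m hm)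
  refine ⟨?_, fun hγ1 => ?_⟩
  · have hq : ∀ l ∈ Finset.Ioo j N, 0 ≤ a l / (t l - t j) ^ (1 - γ) := fun l hl => by
      obtain ⟨hl1, hl2⟩ := Finset.mem_Ioo.1 hl
      exact div_nonneg (ha0 l hl2) (Real.rpow_nonneg (sub_nonneg.2 (h.mono hl1.le hl2.le)) _)
    have form : ∀ f : ℕ → ℝ, ∑ l ∈ Finset.Ioo j N,
        f l * (t (l + 1) - t l) / ((T - t l) ^ (1 / 2 - β) * (t l - t j) ^ (1 - γ))
        = ∑ l ∈ Finset.Ioo j N, a l / (t l - t j) ^ (1 - γ) * f l := fun f =>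
      Finset.sum_congr rfl fun l _ => by simp only [ha, div_eq_mul_inv, mul_inv]; ring
    rw [form, form]
    set S := ∑ l ∈ Finset.Ioo j N, a l / (t l - t j) ^ (1 - γ) * v l with hS
    set W := ∑ l ∈ Finset.Ioo j N, a l / (t l - t j) ^ (1 - γ) * w l with hW
    have hS0 : 0 ≤ S := Finset.sum_nonneg fun l hl => mul_nonneg (hq l hl) (hv0 l)
    have h1 : S ≤ Real.exp (lam * T) * W + Cu / A * (B (β - ε) γ * T ^ (β - ε) * S) := by
      have hds := double_sum_Ioo_le h hB hT hβ1 hεβ hγ hva0 j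
      have e : ∑ m ∈ Finset.Ioo j N, v m * a m / (t m - t j) ^ (1 - γ) = S :=
        Finset.sum_congr rfl fun l _ => by ring
      rw [e] at hds
      calc S ≤ ∑ l ∈ Finset.Ioo j N, a l / (t l - t j) ^ (1 - γ) * (Real.exp (lam * T) * w l
            + Cu / A * ∑ m ∈ Finset.Ioo l N, (v m * a m) / (t m - t l) ^ (1 / 2 + ε)) :=
            Finset.sum_le_sum fun l hl => by
              obtain ⟨hl1, hl2⟩ := Finset.mem_Ioo.1 hl
              exact mul_le_mul_of_nonneg_left (hrec' l (by omega) hl2) (hq l hl)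
        _ = Real.exp (lam * T) * W + Cu / A * ∑ l ∈ Finset.Ioo j N,
            (t (l + 1) - t l) / ((T - t l) ^ (1 / 2 - β) * (t l - t j) ^ (1 - γ))
            * ∑ m ∈ Finset.Ioo l N, v m * a m / (t m - t l) ^ (1 / 2 + ε) := by
            rw [hW, Finset.mul_sum, Finset.mul_sum, ← Finset.sum_add_distrib]
            refine Finset.sum_congr rfl fun l _ => ?_
            rw [mul_add]; congr 1
            · ring
            · simp only [ha, div_eq_mul_inv, mul_inv]; ring
        _ ≤ _ := by gcongr
    have h2 : Cu / A * (B (β - ε) γ * T ^ (β - ε) * S) ≤ 1 / 2 * S := by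
      calc _ ≤ Cu / A * (b * T ^ (β - ε) * S) := by
            gcongr; exact le_max_left _ _
        _ = Cu / A * (b * T ^ (β - ε)) * S := by ring
        _ ≤ _ := mul_le_mul_of_nonneg_right hfac hS0
    calc _ ≤ S := Finset.sum_le_sum fun l hl => by
            obtain ⟨hl1, hl2⟩ := Finset.mem_Ioo.1 hl
            exact mul_le_mul_of_nonneg_left
              (le_mul_of_one_le_right (hu l) (hexp l hl2.le).1) (hq l hl)
      _ ≤ _ := by linarith
  · subst hγ1
    have form : ∀ f : ℕ → ℝ, ∑ l ∈ Finset.Ico j N,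
        f l * (t (l + 1) - t l) / (T - t l) ^ (1 / 2 - β)
        = ∑ l ∈ Finset.Ico j N, a l * f l := fun f =>
      Finset.sum_congr rfl fun l _ => by simp only [ha, div_eq_mul_inv]; ring
    rw [form, form]
    have hq : ∀ l ∈ Finset.Ico j N, 0 ≤ a l := fun l hl => ha0 l (Finset.mem_Ico.1 hl).2
    set S := ∑ l ∈ Finset.Ico j N, a l * v l with hS
    set W := ∑ l ∈ Finset.Ico j N, a l * w l with hW
    have hS0 : 0 ≤ S := Finset.sum_nonneg fun l hl => mul_nonneg (hq l hl) (hv0 l)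
    have h1 : S ≤ Real.exp (lam * T) * W + Cu / A * (B (β - ε) 1 * T ^ (β - ε) * S) := by
      have hds := double_sum_Ico_le h hB hT hβ1 hεβ hva0 j
      have e : ∑ m ∈ Finset.Ico j N, v m * a m = S :=
        Finset.sum_congr rfl fun l _ => by ring
      rw [e] at hds
      calc S ≤ ∑ l ∈ Finset.Ico j N, a l * (Real.exp (lam * T) * w l
            + Cu / A * ∑ m ∈ Finset.Ioo l N, (v m * a m) / (t m - t l) ^ (1 / 2 + ε)) :=
            Finset.sum_le_sum fun l hl => by
              obtain ⟨hl1, hl2⟩ := Finset.mem_Ico.1 hl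
              exact mul_le_mul_of_nonneg_left (hrec' l (by omega) hl2) (hq l hl)
        _ = Real.exp (lam * T) * W + Cu / A * ∑ l ∈ Finset.Ico j N, a l
            * ∑ m ∈ Finset.Ioo l N, v m * a m / (t m - t l) ^ (1 / 2 + ε) := by
            rw [hW, Finset.mul_sum, Finset.mul_sum, ← Finset.sum_add_distrib]
            refine Finset.sum_congr rfl fun l _ => ?_
            rw [mul_add]; congr 1
            · ring
            · ring
        _ ≤ _ := by gcongr
    have h2 : Cu / A * (B (β - ε) 1 * T ^ (β - ε) * S) ≤ 1 / 2 * S := by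
      calc _ ≤ Cu / A * (b * T ^ (β - ε) * S) := by
            gcongr; exact le_max_right _ _
        _ = Cu / A * (b * T ^ (β - ε)) * S := by ring
        _ ≤ _ := mul_le_mul_of_nonneg_right hfac hS0
    calc _ ≤ S := Finset.sum_le_sum fun l hl => by
            obtain ⟨hl1, hl2⟩ := Finset.mem_Ico.1 hl
            exact mul_le_mul_of_nonneg_left
              (le_mul_of_one_le_right (hu l) (hexp l hl2.le).1) (hq l hl)
      _ ≤ _ := by linarith

theorem exists_isGronwallConstant {R T θ : ℝ} (hR : 0 ≤ R) (hT : 0 < T)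
    (hθ : θ ∈ Set.Ioc (0 : ℝ) 1) :
    ∃ G : ℝ → ℝ → ℝ, ∀ Cu γ : ℝ, 0 ≤ Cu → 0 < γ →
      IsGronwallConstant R T 0 (θ / 2) Cu γ (G Cu γ) := by
  obtain ⟨B, hB⟩ := exists_isSumConstant hR
  have : ∀ Cu γ : ℝ, ∃ c, 0 ≤ Cu → 0 < γ → IsGronwallConstant R T 0 (θ / 2) Cu γ c := by
    intro Cu γ
    by_cases h : 0 ≤ Cu ∧ 0 < γ
    · obtain ⟨c, hc⟩ := exists_gronwallConstant (β := θ / 2) hB hT (by linarith [hθ.1])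
        (by linarith [hθ.2]) h.1 h.2
      exact ⟨c, fun _ _ => hc⟩
    -- A default value outside the admissible range of `Cu` and `γ`.
    · exact ⟨0, fun h1 h2 => absurd ⟨h1, h2⟩ h⟩
  choose G hG using this
  exact ⟨G, hG⟩

end MWLS


/-! ### A priori bounds and error propagation for deterministic sequences. -/

namespace MWLS

section DeterministicBounds

variable {p : Params} {B G : ℝ → ℝ → ℝ} {N : ℕ} {t : ℕ → ℝ}

theorem sum_Ico_le_last (h : IsTimeGrid p.T p.R N t) (hB : IsSumConstant p.R B) (hT : 0 < p.T)
    {α : ℝ} (hα : 0 < α) {i : ℕ} (hi : i ≤ N) :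
    ∑ l ∈ Finset.Ico i N, (t (l + 1) - t l) / (p.T - t l) ^ (1 - α)
      ≤ B α 1 * (p.T - t i) ^ α := by
  rcases hi.eq_or_lt with rfl | hi
  · simp [h.last, Real.zero_rpow hα.ne']
  · have := ((hB α 1 hα one_pos).2 p.T N t hT h i N hi le_rfl).1
    rwa [h.last] at this

theorem sum_Ioo_le_last (h : IsTimeGrid p.T p.R N t) (hB : IsSumConstant p.R B) (hT : 0 < p.T)
    {α : ℝ} (hα : 0 < α) {i : ℕ} (hi : i < N) :
    ∑ l ∈ Finset.Ioo i N, (t (l + 1) - t l) / (p.T - t l) ^ (1 - α) / √(t l - t i)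
      ≤ B α (1 / 2) * (p.T - t i) ^ (α - 1 / 2) := by
  have := ((hB α (1 / 2) hα (by norm_num)).2 p.T N t hT h i N hi le_rfl).2
  rw [h.last] at this
  rw [show α - 1 / 2 = α + 1 / 2 - 1 by ring]
  refine le_trans (le_of_eq (Finset.sum_congr rfl fun l _ => ?_)) this
  rw [div_div, Real.sqrt_eq_rpow]; norm_num

/-- The recursion for `Y` has no singularity at the current time. Inserting this factor gives it the
kernel of the recursion for `Z`, so that both can be added. This is the origin of `√T` in `CM + √T`
and `CM + 2√T`. -/
theorem one_le_sqrt_div (h : IsTimeGrid p.T p.R N t) {i l : ℕ} (hil : i < l) (hl : l ≤ N) :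
    1 ≤ √p.T / √(t l - t i) := by
  have p0 : 0 < t l - t i := sub_pos.2 (h.strict hil hl)
  rw [one_le_div (Real.sqrt_pos.2 p0)]
  exact Real.sqrt_le_sqrt (by linarith [h.le_last hl, h.nonneg (i := i) (by omega)])

theorem double_sum_Ioo_half_le (h : IsTimeGrid p.T p.R N t) (hB : IsSumConstant p.R B)
    (hp : p.Admissible) {d : ℕ → ℝ} (hd : ∀ m, m < N → 0 ≤ d m) (j : ℕ) :
    ∑ l ∈ Finset.Ioo j N, (t (l + 1) - t l) / (p.T - t l) ^ ((1 - p.θL) / 2) / √(t l - t j)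
        * ∑ m ∈ Finset.Ioo l N, d m / √(t m - t l)
      ≤ B (p.θL / 2) (1 / 2) * p.T ^ (p.θL / 2) * ∑ m ∈ Finset.Ioo j N, d m / √(t m - t j) := by
  have := double_sum_Ioo_le (β := p.θL / 2) (ε := 0) (γ := 1 / 2) h hB hp.T_pos
    (by linarith [hp.θL_mem.2]) (by linarith [hp.θL_mem.1]) (by norm_num) hd j
  simp only [sub_zero, add_zero] at this
  rw [show (1 : ℝ) - 1 / 2 = 1 / 2 by norm_num] at this
  simpa only [← Real.sqrt_eq_rpow, div_div, show (1 - p.θL) / 2 = 1 / 2 - p.θL / 2 by ring]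
    using this

theorem double_sum_Ico_half_le (h : IsTimeGrid p.T p.R N t) (hB : IsSumConstant p.R B)
    (hp : p.Admissible) {d : ℕ → ℝ} (hd : ∀ m, m < N → 0 ≤ d m) (j : ℕ) :
    ∑ l ∈ Finset.Ico j N, (t (l + 1) - t l) / (p.T - t l) ^ ((1 - p.θL) / 2)
        * ∑ m ∈ Finset.Ioo l N, d m / √(t m - t l)
      ≤ B (p.θL / 2) 1 * p.T ^ (p.θL / 2) * ∑ m ∈ Finset.Ico j N, d m := by
  have := double_sum_Ico_le (β := p.θL / 2) (ε := 0) h hB hp.T_pos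
    (by linarith [hp.θL_mem.2]) (by linarith [hp.θL_mem.1]) hd j
  simp only [sub_zero, add_zero] at this
  simpa only [← Real.sqrt_eq_rpow, show (1 - p.θL) / 2 = 1 / 2 - p.θL / 2 by ring] using this

/-- The Gronwall inequality for sequences on `[i, N)`, with the weights
`a l = Δ l / (T - t l) ^ ((1 - θL) / 2)`. -/
theorem gronwall_le (h : IsTimeGrid p.T p.R N t)
    (hG : ∀ Cu γ : ℝ, 0 ≤ Cu → 0 < γ → IsGronwallConstant p.R p.T 0 (p.θL / 2) Cu γ (G Cu γ))
    {Cu : ℝ} (hCu : 0 ≤ Cu) {i : ℕ} (hi : i < N) {u w : ℕ → ℝ} (hu : ∀ l, 0 ≤ u l)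
    (hw : ∀ l, 0 ≤ w l)
    (hrec : ∀ j, i ≤ j → j < N → u j ≤ w j + Cu * ∑ l ∈ Finset.Ioo j N,
      (t (l + 1) - t l) / (p.T - t l) ^ ((1 - p.θL) / 2) / √(t l - t j) * u l) :
    ∑ l ∈ Finset.Ico i N, (t (l + 1) - t l) / (p.T - t l) ^ ((1 - p.θL) / 2) * u l
      ≤ G Cu 1 * ∑ l ∈ Finset.Ico i N,
        (t (l + 1) - t l) / (p.T - t l) ^ ((1 - p.θL) / 2) * w l ∧
    ∑ l ∈ Finset.Ioo i N,
        (t (l + 1) - t l) / (p.T - t l) ^ ((1 - p.θL) / 2) / √(t l - t i) * u l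
      ≤ G Cu (1 / 2) * ∑ l ∈ Finset.Ioo i N,
        (t (l + 1) - t l) / (p.T - t l) ^ ((1 - p.θL) / 2) / √(t l - t i) * w l := by
  have e : (1 - p.θL) / 2 = 1 / 2 - p.θL / 2 := by ring
  -- The Gronwall inequality also asks for the recursion at `j = N`, where nothing is known about
  -- `u`. Setting `u` to zero from `N` on makes it trivial there and changes no sum.
  have hrec' : ∀ j, i ≤ j → j ≤ N → (fun l => if l < N then u l else 0) j
      ≤ w j + Cu * ∑ l ∈ Finset.Ioo j N, (fun l => if l < N then u l else 0) l *
        (t (l + 1) - t l) / ((p.T - t l) ^ (1 / 2 - p.θL / 2) * (t l - t j) ^ (1 / 2 - 0 : ℝ)) := by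
    intro j hij hjN
    rcases hjN.eq_or_lt with rfl | hjN
    · simp [hw]
    simp only [hjN, if_true]
    refine (hrec j hij hjN).trans (le_of_eq ?_)
    congr 2
    refine Finset.sum_congr rfl fun l hl => ?_
    rw [if_pos (Finset.mem_Ioo.1 hl).2, Real.sqrt_eq_rpow, sub_zero, e]
    simp only [div_eq_mul_inv, mul_inv]; ring
  have hu' : ∀ l, 0 ≤ (fun l => if l < N then u l else 0) l := fun l => by
    dsimp only; split_ifs <;> [exact hu l; exact le_rfl]
  constructor
  · have := (((hG Cu 1 hCu one_pos).2 N t h i hi _ w hu' hw hrec') i le_rfl hi.le).2 rfl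
    rw [e]
    refine (le_of_eq ?_).trans (this.trans (le_of_eq ?_))
    · refine Finset.sum_congr rfl fun l hl => ?_
      simp only [(Finset.mem_Ico.1 hl).2, if_true]; ring
    · congr 1
      refine Finset.sum_congr rfl fun l hl => ?_
      ring
  · have := (((hG Cu (1 / 2) hCu (by norm_num)).2 N t h i hi _ w hu' hw hrec') i le_rfl hi.le).1
    rw [e]
    refine (le_of_eq ?_).trans (this.trans (le_of_eq ?_))
    · refine Finset.sum_congr rfl fun l hl => ?_
      simp only [(Finset.mem_Ioo.1 hl).2, if_true]
      rw [Real.sqrt_eq_rpow, show (1 : ℝ) - 1 / 2 = 1 / 2 by norm_num]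
      simp only [div_eq_mul_inv, mul_inv]; ring
    · congr 1
      refine Finset.sum_congr rfl fun l hl => ?_
      rw [Real.sqrt_eq_rpow, show (1 : ℝ) - 1 / 2 = 1 / 2 by norm_num]
      simp only [div_eq_mul_inv, mul_inv]; ring

/-- Bounds for sequences that satisfy the backward recursion of the dynamic programming
equation. -/
theorem stability_bounds (hp : p.Admissible) (h : IsTimeGrid p.T p.R N t)
    (hB : IsSumConstant p.R B)
    (hG : ∀ Cu γ : ℝ, 0 ≤ Cu → 0 < γ → IsGronwallConstant p.R p.T 0 (p.θL / 2) Cu γ (G Cu γ))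
    {i : ℕ} (hi : i < N) {Y Z F : ℕ → ℝ} (hY0 : ∀ j, 0 ≤ Y j) (hZ0 : ∀ j, 0 ≤ Z j)
    {c₀ D cf : ℝ} (hc₀ : 0 ≤ c₀) (hD : 0 ≤ D) (hcf : 0 ≤ cf)
    (hY : ∀ j, i ≤ j → j ≤ N → Y j ≤ c₀ + ∑ l ∈ Finset.Ico j N, F l * (t (l + 1) - t l))
    (hZ : ∀ j, i ≤ j → j < N → Z j ≤ p.CM * D / √(p.T - t j)
      + ∑ l ∈ Finset.Ioo j N, F l * (t (l + 1) - t l) * (p.CM / √(t l - t j)))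
    (hF : ∀ l, i ≤ l → l < N → F l ≤ cf / (p.T - t l) ^ (1 - p.θC)
      + p.Lf / (p.T - t l) ^ ((1 - p.θL) / 2) * (Y (l + 1) + Z l)) :
    Y i ≤ c₀ + p.Lf * G p.CuStab 1 * (p.CM * D * B (p.θL / 2) 1
        + B (1 / 2 + p.θL / 2) 1 * √p.T * c₀) * p.T ^ (p.θL / 2)
        + p.Cy2 B G * cf * B p.θC 1 * (p.T - t i) ^ p.θC ∧
    Z i ≤ p.Cz1 B G * D / √(p.T - t i)
        + p.Cz2 B G * cf * B p.θC (1 / 2) / (p.T - t i) ^ (1 / 2 - p.θC)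
        + p.Cz3 B G * c₀ * (p.T - t i) ^ (p.θL / 2) := by
  have hT := hp.T_pos
  have hL := hp.Lf_nonneg
  have hM := hp.CM_nonneg
  have hθ := hp.θL_mem.1
  have hCu : 0 ≤ p.CuStab := mul_nonneg hL (add_nonneg hM (Real.sqrt_nonneg _))
  set a : ℕ → ℝ := fun l => (t (l + 1) - t l) / (p.T - t l) ^ ((1 - p.θL) / 2) with ha
  set φ : ℕ → ℝ := fun l => (t (l + 1) - t l) / (p.T - t l) ^ (1 - p.θC) with hφ
  -- The driver at time `l` only sees this combination, so the two recursions close into one for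
  -- `u`.
  set u : ℕ → ℝ := fun l => Y (l + 1) + Z l with hu
  have ha0 : ∀ l, l < N → 0 ≤ a l := fun l hl => div_nonneg (h.step_pos hl).le
    (Real.rpow_nonneg (sub_nonneg.2 (h.le_last hl.le)) _)
  have hφ0 : ∀ l, l < N → 0 ≤ φ l := fun l hl => div_nonneg (h.step_pos hl).le
    (Real.rpow_nonneg (sub_nonneg.2 (h.le_last hl.le)) _)
  have hu0 : ∀ l, 0 ≤ u l := fun l => add_nonneg (hY0 _) (hZ0 _)
  have hFΔ : ∀ l, i ≤ l → l < N → F l * (t (l + 1) - t l) ≤ cf * φ l + p.Lf * (a l * u l) := by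
    intro l hil hlN
    refine (mul_le_mul_of_nonneg_right (hF l hil hlN) (h.step_pos hlN).le).trans (le_of_eq ?_)
    simp only [hφ, ha, hu, div_eq_mul_inv]; ring
  have hfu0 : ∀ l, l < N → 0 ≤ cf * φ l + p.Lf * (a l * u l) := fun l hl =>
    add_nonneg (mul_nonneg hcf (hφ0 l hl)) (mul_nonneg hL (mul_nonneg (ha0 l hl) (hu0 l)))
  -- The data: terminal size from `Y`, terminal deviation from `Z`, and the driver at zero
  -- accumulated by both.
  set w : ℕ → ℝ := fun j => c₀ + p.CM * D / √(p.T - t j)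
    + (p.CM + √p.T) * cf * ∑ l ∈ Finset.Ioo j N, φ l / √(t l - t j) with hw
  have hw0 : ∀ j, 0 ≤ w j := fun j => by
    have : 0 ≤ ∑ l ∈ Finset.Ioo j N, φ l / √(t l - t j) := Finset.sum_nonneg fun l hl =>
      div_nonneg (hφ0 l (Finset.mem_Ioo.1 hl).2) (Real.sqrt_nonneg _)
    simp only [hw]; positivity
  have hrec : ∀ j, i ≤ j → j < N → u j ≤ w j + p.CuStab * ∑ l ∈ Finset.Ioo j N,
      (t (l + 1) - t l) / (p.T - t l) ^ ((1 - p.θL) / 2) / √(t l - t j) * u l := by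
    intro j hij hjN
    have h1 := hY (j + 1) (by omega) hjN
    have h2 := hZ j hij hjN
    rw [← Ioo_eq_Ico_succ] at h1
    have h3 : ∑ l ∈ Finset.Ioo j N, F l * (t (l + 1) - t l)
        + ∑ l ∈ Finset.Ioo j N, F l * (t (l + 1) - t l) * (p.CM / √(t l - t j))
        ≤ ∑ l ∈ Finset.Ioo j N,
          (cf * φ l + p.Lf * (a l * u l)) * ((p.CM + √p.T) / √(t l - t j)) := by
      rw [← Finset.sum_add_distrib]
      refine Finset.sum_le_sum fun l hl => ?_
      obtain ⟨hl1, hl2⟩ := Finset.mem_Ioo.1 hl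
      have q := one_le_sqrt_div h hl1 hl2.le
      have q0 : 0 ≤ p.CM / √(t l - t j) := by positivity
      calc F l * (t (l + 1) - t l) + F l * (t (l + 1) - t l) * (p.CM / √(t l - t j))
          = F l * (t (l + 1) - t l) * (1 + p.CM / √(t l - t j)) := by ring
        _ ≤ (cf * φ l + p.Lf * (a l * u l)) * (1 + p.CM / √(t l - t j)) :=
            mul_le_mul_of_nonneg_right (hFΔ l (by omega) hl2) (by linarith)
        _ ≤ (cf * φ l + p.Lf * (a l * u l)) * (√p.T / √(t l - t j) + p.CM / √(t l - t j)) :=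
            mul_le_mul_of_nonneg_left (by linarith) (hfu0 l hl2)
        _ = _ := by ring
    have h4 : ∑ l ∈ Finset.Ioo j N,
          (cf * φ l + p.Lf * (a l * u l)) * ((p.CM + √p.T) / √(t l - t j))
        = (p.CM + √p.T) * cf * ∑ l ∈ Finset.Ioo j N, φ l / √(t l - t j)
          + p.CuStab * ∑ l ∈ Finset.Ioo j N, a l / √(t l - t j) * u l := by
      rw [Finset.mul_sum, Finset.mul_sum, ← Finset.sum_add_distrib]
      refine Finset.sum_congr rfl fun l _ => ?_
      rw [Params.CuStab]; ring
    calc u j = Y (j + 1) + Z j := rfl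
      _ ≤ _ := by simp only [hw]; linarith
  obtain ⟨g1, g2⟩ := gronwall_le h hG hCu hi hu0 hw0 hrec
  have hG1 := (hG p.CuStab 1 hCu one_pos).1
  have hG2 := (hG p.CuStab (1 / 2) hCu (by norm_num)).1
  have τ0 : 0 < p.T - t i := sub_pos.2 (h.lt_last hi)
  have τT : p.T - t i ≤ p.T := by linarith [h.nonneg (i := i) hi.le]
  have Tβ := Real.rpow_pos_of_pos hT (p.θL / 2)
  have τβ : (p.T - t i) ^ (p.θL / 2) ≤ p.T ^ (p.θL / 2) :=
    Real.rpow_le_rpow τ0.le τT (by linarith)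
  constructor
  · have s1 : ∑ l ∈ Finset.Ico i N, a l ≤ B (1 / 2 + p.θL / 2) 1 * (√p.T * p.T ^ (p.θL / 2)) := by
      have := sum_Ico_le_last h hB hT (α := 1 / 2 + p.θL / 2) (by linarith) hi.le
      rw [show 1 - (1 / 2 + p.θL / 2) = (1 - p.θL) / 2 by ring] at this
      refine this.trans (mul_le_mul_of_nonneg_left ?_ (hB _ _ (by linarith) one_pos).1)
      rw [Real.sqrt_eq_rpow, ← Real.rpow_add hT]
      exact Real.rpow_le_rpow τ0.le τT (by linarith)
    have s2 : ∑ l ∈ Finset.Ico i N, a l / √(p.T - t l)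
        ≤ B (p.θL / 2) 1 * p.T ^ (p.θL / 2) := by
      have := sum_Ico_le_last h hB hT (α := p.θL / 2) (by linarith) hi.le
      refine (le_of_eq (Finset.sum_congr rfl fun l hl => ?_)).trans (this.trans
        (mul_le_mul_of_nonneg_left τβ (hB _ _ (by linarith) one_pos).1))
      have : 0 < p.T - t l := sub_pos.2 (h.lt_last (Finset.mem_Ico.1 hl).2)
      simp only [ha]
      rw [div_div, Real.sqrt_eq_rpow, ← Real.rpow_add this]
      congr 2; ring
    have s3 := sum_Ico_le_last h hB hT hp.θC_mem.1 hi.le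
    have s4 := double_sum_Ico_half_le h hB hp hφ0 i
    have hBθ := (hB (p.θL / 2) 1 (by linarith) one_pos).1
    have hWs : ∑ l ∈ Finset.Ico i N, a l * w l
        = c₀ * ∑ l ∈ Finset.Ico i N, a l + p.CM * D * ∑ l ∈ Finset.Ico i N, a l / √(p.T - t l)
          + (p.CM + √p.T) * cf * ∑ l ∈ Finset.Ico i N,
            a l * ∑ m ∈ Finset.Ioo l N, φ m / √(t m - t l) := by
      rw [Finset.mul_sum, Finset.mul_sum, Finset.mul_sum, ← Finset.sum_add_distrib,
        ← Finset.sum_add_distrib]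
      refine Finset.sum_congr rfl fun l _ => ?_
      simp only [hw]; ring
    have hYi : Y i ≤ c₀ + cf * ∑ l ∈ Finset.Ico i N, φ l
        + p.Lf * ∑ l ∈ Finset.Ico i N, a l * u l := by
      refine (hY i le_rfl hi.le).trans ?_
      rw [add_assoc, Finset.mul_sum, Finset.mul_sum, ← Finset.sum_add_distrib]
      gcongr with l hl
      exact hFΔ l (Finset.mem_Ico.1 hl).1 (Finset.mem_Ico.1 hl).2
    calc Y i ≤ c₀ + cf * ∑ l ∈ Finset.Ico i N, φ l
          + p.Lf * (G p.CuStab 1 * (c₀ * (B (1 / 2 + p.θL / 2) 1 * (√p.T * p.T ^ (p.θL / 2)))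
            + p.CM * D * (B (p.θL / 2) 1 * p.T ^ (p.θL / 2))
            + (p.CM + √p.T) * cf * (B (p.θL / 2) 1 * p.T ^ (p.θL / 2)
              * ∑ l ∈ Finset.Ico i N, φ l))) := by
          refine hYi.trans ?_
          gcongr
          refine g1.trans ?_
          rw [hWs]
          gcongr
      _ = c₀ + p.Lf * G p.CuStab 1 * (p.CM * D * B (p.θL / 2) 1
          + B (1 / 2 + p.θL / 2) 1 * √p.T * c₀) * p.T ^ (p.θL / 2)
          + p.Cy2 B G * cf * ∑ l ∈ Finset.Ico i N, φ l := by
          rw [Params.Cy2]; ring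
      _ ≤ _ := by
          have : 0 ≤ p.Cy2 B G := by rw [Params.Cy2]; positivity
          rw [mul_assoc (p.Cy2 B G * cf)]
          gcongr
  · have s1 : ∑ l ∈ Finset.Ioo i N, a l / √(t l - t i)
        ≤ B (1 / 2 + p.θL / 2) (1 / 2) * (p.T - t i) ^ (p.θL / 2) := by
      have := sum_Ioo_le_last h hB hT (α := 1 / 2 + p.θL / 2) (by linarith) hi
      rwa [show 1 - (1 / 2 + p.θL / 2) = (1 - p.θL) / 2 by ring,
        show 1 / 2 + p.θL / 2 - 1 / 2 = p.θL / 2 by ring] at this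
    have s2 : ∑ l ∈ Finset.Ioo i N, a l / √(t l - t i) / √(p.T - t l)
        ≤ B (p.θL / 2) (1 / 2) * (p.T ^ (p.θL / 2) / √(p.T - t i)) := by
      have := sum_Ioo_le_last h hB hT (α := p.θL / 2) (by linarith) hi
      refine (le_of_eq (Finset.sum_congr rfl fun l hl => ?_)).trans (this.trans
        (mul_le_mul_of_nonneg_left ?_ (hB _ _ (by linarith) (by norm_num)).1))
      · have : 0 < p.T - t l := sub_pos.2 (h.lt_last (Finset.mem_Ioo.1 hl).2)
        simp only [ha]
        rw [show 1 - p.θL / 2 = (1 - p.θL) / 2 + 1 / 2 by ring, Real.rpow_add this,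
          ← Real.sqrt_eq_rpow]
        simp only [div_eq_mul_inv, mul_inv]; ring
      · rw [Real.rpow_sub τ0, ← Real.sqrt_eq_rpow]
        gcongr
    have s3 := sum_Ioo_le_last h hB hT hp.θC_mem.1 hi
    have s4 := double_sum_Ioo_half_le h hB hp hφ0 i
    have hBθ := (hB (p.θL / 2) (1 / 2) (by linarith) (by norm_num)).1
    have hWs : ∑ l ∈ Finset.Ioo i N, a l / √(t l - t i) * w l
        = c₀ * ∑ l ∈ Finset.Ioo i N, a l / √(t l - t i)
          + p.CM * D * ∑ l ∈ Finset.Ioo i N, a l / √(t l - t i) / √(p.T - t l)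
          + (p.CM + √p.T) * cf * ∑ l ∈ Finset.Ioo i N,
            a l / √(t l - t i) * ∑ m ∈ Finset.Ioo l N, φ m / √(t m - t l) := by
      rw [Finset.mul_sum, Finset.mul_sum, Finset.mul_sum, ← Finset.sum_add_distrib,
        ← Finset.sum_add_distrib]
      refine Finset.sum_congr rfl fun l _ => ?_
      simp only [hw]; ring
    have hZi : Z i ≤ p.CM * D / √(p.T - t i)
        + p.CM * (cf * ∑ l ∈ Finset.Ioo i N, φ l / √(t l - t i)
        + p.Lf * ∑ l ∈ Finset.Ioo i N, a l / √(t l - t i) * u l) := by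
      refine (hZ i le_rfl hi).trans (add_le_add le_rfl ?_)
      rw [Finset.mul_sum, Finset.mul_sum, ← Finset.sum_add_distrib, Finset.mul_sum]
      refine Finset.sum_le_sum fun l hl => ?_
      obtain ⟨hl1, hl2⟩ := Finset.mem_Ioo.1 hl
      calc _ ≤ (cf * φ l + p.Lf * (a l * u l)) * (p.CM / √(t l - t i)) :=
            mul_le_mul_of_nonneg_right (hFΔ l hl1.le hl2) (by positivity)
        _ = _ := by ring
    have eC : (p.T - t i) ^ (p.θC - 1 / 2) = 1 / (p.T - t i) ^ (1 / 2 - p.θC) := by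
      rw [show p.θC - 1 / 2 = -(1 / 2 - p.θC) by ring, Real.rpow_neg τ0.le]
      exact (one_div _).symm
    calc Z i ≤ p.CM * D / √(p.T - t i)
          + p.CM * (cf * ∑ l ∈ Finset.Ioo i N, φ l / √(t l - t i)
          + p.Lf * (G p.CuStab (1 / 2) * (c₀ * (B (1 / 2 + p.θL / 2) (1 / 2)
              * (p.T - t i) ^ (p.θL / 2))
            + p.CM * D * (B (p.θL / 2) (1 / 2) * (p.T ^ (p.θL / 2) / √(p.T - t i)))
            + (p.CM + √p.T) * cf * (B (p.θL / 2) (1 / 2) * p.T ^ (p.θL / 2)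
              * ∑ l ∈ Finset.Ioo i N, φ l / √(t l - t i))))) := by
          refine hZi.trans ?_
          gcongr
          refine g2.trans ?_
          rw [hWs]
          gcongr
      _ = p.Cz1 B G * D / √(p.T - t i)
          + p.Cz2 B G * cf * ∑ l ∈ Finset.Ioo i N, φ l / √(t l - t i)
          + p.Cz3 B G * c₀ * (p.T - t i) ^ (p.θL / 2) := by
          rw [Params.Cz1, Params.Cz2, Params.Cz3]; ring
      _ ≤ _ := by
          have : 0 ≤ p.Cz2 B G := by rw [Params.Cz2]; positivity
          rw [eC] at s3
          refine add_le_add (add_le_add le_rfl ?_) le_rfl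
          refine (mul_le_mul_of_nonneg_left s3 (mul_nonneg this hcf)).trans (le_of_eq ?_)
          ring

/-- Solution of the error recursion of the algorithm. -/
theorem errorRecursion_bounds (hp : p.Admissible) (h : IsTimeGrid p.T p.R N t)
    (hB : IsSumConstant p.R B)
    (hG : ∀ Cu γ : ℝ, 0 ≤ Cu → 0 < γ → IsGronwallConstant p.R p.T 0 (p.θL / 2) Cu γ (G Cu γ))
    {ηY ηZ barY barZ RY RZ DY DZ : ℕ → ℝ} (hηY0 : ∀ k, 0 ≤ ηY k) (hηZ0 : ∀ k, 0 ≤ ηZ k)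
    (hRY0 : ∀ k, k < N → 0 ≤ RY k) (hRZ0 : ∀ k, k < N → 0 ≤ RZ k)
    (hDY0 : ∀ k, k < N → 0 ≤ DY k) (hDZ0 : ∀ k, k < N → 0 ≤ DZ k)
    (hbarY : ∀ k, k < N → barY k ≤ √2 * ηY k + DY k) (hbarN : barY N ≤ 0)
    (hbarZ : ∀ k, k < N → barZ k ≤ √2 * ηZ k + DZ k)
    (hY : ∀ i, i < N → ηY i ≤ RY i
      + p.Lf * ((t (i + 1) - t i) / (p.T - t i) ^ ((1 - p.θL) / 2)) * ηZ i
      + ∑ k ∈ Finset.Ico i N, p.Lf * ((t (k + 1) - t k) / (p.T - t k) ^ ((1 - p.θL) / 2))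
        * (barY (k + 1) + if k = i then 0 else barZ k))
    (hZ : ∀ i, i < N → ηZ i ≤ RZ i
      + ∑ k ∈ Finset.Ioo i N, p.Lf * ((t (k + 1) - t k) / (p.T - t k) ^ ((1 - p.θL) / 2))
        * (p.CM / √(t k - t i)) * (barY (k + 1) + barZ k))
    {E : ℕ → ℝ} (hE : ∀ k, E k = (if k + 1 < N then RY (k + 1) + p.Lf * DY (k + 1) else 0)
      + RZ k + p.Lf * DZ k) {i : ℕ} (hi : i < N) :
    ηY i ≤ RY i + p.CMy B G * ∑ j ∈ Finset.Ico i N,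
      E j * (t (j + 1) - t j) / (p.T - t j) ^ ((1 - p.θL) / 2) ∧
    ηZ i ≤ RZ i + p.CMz B G * ∑ j ∈ Finset.Ioo i N,
      E j * (t (j + 1) - t j) / ((p.T - t j) ^ ((1 - p.θL) / 2) * √(t j - t i)) := by
  have hT := hp.T_pos
  have hL := hp.Lf_nonneg
  have hM := hp.CM_nonneg
  have hθ := hp.θL_mem.1
  have h20 : (0 : ℝ) ≤ √2 := Real.sqrt_nonneg _
  have h21 : (1 : ℝ) ≤ √2 := Real.one_le_sqrt.2 (by norm_num)
  have h22 : √2 ≤ (2 : ℝ) := Real.sqrt_le_iff.2 ⟨by norm_num, by norm_num⟩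
  have hT0 := Real.sqrt_nonneg p.T
  have hCu : 0 ≤ p.CuMC := mul_nonneg hL (by positivity)
  set a : ℕ → ℝ := fun l => (t (l + 1) - t l) / (p.T - t l) ^ ((1 - p.θL) / 2) with ha
  have ha0 : ∀ l, l < N → 0 ≤ a l := fun l hl => div_nonneg (h.step_pos hl).le
    (Real.rpow_nonneg (sub_nonneg.2 (h.le_last hl.le)) _)
  -- The cutoff records that the error for `Y` vanishes at time `N`, so nothing is assumed about `ηY
  -- N`.
  set v : ℕ → ℝ := fun k => (if k + 1 < N then ηY (k + 1) else 0) + ηZ k with hv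
  set D : ℕ → ℝ := fun k => (if k + 1 < N then DY (k + 1) else 0) + DZ k with hD
  have hv0 : ∀ k, 0 ≤ v k := fun k => by
    have := hηY0 (k + 1); have := hηZ0 k
    simp only [hv]; split_ifs <;> linarith
  have hD0 : ∀ k, k < N → 0 ≤ D k := fun k hk => by
    have := hDZ0 k hk
    simp only [hD]; split_ifs with h1
    · linarith [hDY0 (k + 1) h1]
    · linarith
  have hbarY' : ∀ k, k < N → barY (k + 1) ≤ √2 * (if k + 1 < N then ηY (k + 1) else 0)
      + (if k + 1 < N then DY (k + 1) else 0) := fun k hk => by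
    split_ifs with h1
    · exact hbarY _ h1
    · rw [show k + 1 = N by omega]; simpa using hbarN
  have hbar : ∀ k, k < N → barY (k + 1) + barZ k ≤ √2 * v k + D k := fun k hk => by
    have := hbarY' k hk; have := hbarZ k hk
    simp only [hv, hD]; linarith
  have hLD : ∀ k, k < N → p.Lf * D k ≤ E k := fun k hk => by
    have := hRZ0 k hk
    rw [hE]; simp only [hD]; split_ifs with h1
    · have := hRY0 _ h1; linarith
    · linarith
  have hRE : ∀ k, k < N → (if k + 1 < N then RY (k + 1) else 0) + RZ k ≤ E k := fun k hk => by
    have := mul_nonneg hL (hDZ0 k hk)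
    rw [hE]; split_ifs with h1
    · have := mul_nonneg hL (hDY0 _ h1); linarith
    · linarith
  have hE0 : ∀ k, k < N → 0 ≤ E k := fun k hk => (mul_nonneg hL (hD0 k hk)).trans (hLD k hk)
  have haE0 : ∀ k, k < N → 0 ≤ a k * E k := fun k hk => mul_nonneg (ha0 k hk) (hE0 k hk)
  have hY' : ∀ j, j < N → ηY j ≤ RY j + ∑ k ∈ Finset.Ico j N, a k * (√2 * p.Lf * v k + E k) := by
    intro j hj
    refine (hY j hj).trans ?_
    rw [add_assoc]
    refine add_le_add le_rfl ?_
    -- The term `k = j` is special: the error for `Z` there is the empirical one, since the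
    -- observation contains the function fitted on the same cloud. As `1 ≤ √2`, it fits the same
    -- bound as the other terms.
    rw [Finset.sum_eq_sum_Ico_succ_bot hj, Finset.sum_eq_sum_Ico_succ_bot hj, ← add_assoc]
    refine add_le_add ?_ (Finset.sum_le_sum fun k hk => ?_)
    · have h1 := hbarY' j hj
      have h2 := hLD j hj
      have h3 : ηZ j ≤ √2 * ηZ j := le_mul_of_one_le_left (hηZ0 j) h21
      have h4 := hDZ0 j hj
      have h5 : ηZ j + barY (j + 1) ≤ √2 * v j + D j := by simp only [hv, hD]; linarith
      rw [if_pos rfl, add_zero]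
      calc p.Lf * a j * ηZ j + p.Lf * a j * barY (j + 1)
          = a j * (p.Lf * (ηZ j + barY (j + 1))) := by ring
        _ ≤ a j * (p.Lf * (√2 * v j + D j)) := by have := ha0 j hj; gcongr
        _ ≤ _ := mul_le_mul_of_nonneg_left (by linarith) (ha0 j hj)
    · obtain ⟨hk1, hk2⟩ := Finset.mem_Ico.1 hk
      rw [if_neg (by omega)]
      have h2 := hLD k hk2
      calc p.Lf * a k * (barY (k + 1) + barZ k)
          = a k * (p.Lf * (barY (k + 1) + barZ k)) := by ring
        _ ≤ a k * (p.Lf * (√2 * v k + D k)) := by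
            have := ha0 k hk2; have := hbar k hk2; gcongr
        _ ≤ _ := mul_le_mul_of_nonneg_left (by linarith) (ha0 k hk2)
  have hZ' : ∀ j, j < N → ηZ j ≤ RZ j + p.CM * ∑ k ∈ Finset.Ioo j N,
      a k / √(t k - t j) * (√2 * p.Lf * v k + E k) := by
    intro j hj
    refine (hZ j hj).trans ?_
    rw [Finset.mul_sum]
    refine add_le_add le_rfl (Finset.sum_le_sum fun k hk => ?_)
    obtain ⟨hk1, hk2⟩ := Finset.mem_Ioo.1 hk
    have h0 := ha0 k hk2
    have h1 := hbar k hk2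
    have h2 := hLD k hk2
    calc p.Lf * a k * (p.CM / √(t k - t j)) * (barY (k + 1) + barZ k)
        ≤ p.Lf * a k * (p.CM / √(t k - t j)) * (√2 * v k + D k) := by gcongr
      _ = p.CM * (a k / √(t k - t j) * (√2 * p.Lf * v k + p.Lf * D k)) := by ring
      _ ≤ _ := by gcongr
  set w : ℕ → ℝ := fun j => if j < N then E j + (p.CM + 2 * √p.T) * ∑ k ∈ Finset.Ioo j N,
      (a k * E k) / √(t k - t j) else 0 with hw
  have hsum0 : ∀ j, 0 ≤ ∑ k ∈ Finset.Ioo j N, (a k * E k) / √(t k - t j) := fun j =>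
    Finset.sum_nonneg fun k hk => div_nonneg (haE0 k (Finset.mem_Ioo.1 hk).2) (Real.sqrt_nonneg _)
  have hw0 : ∀ j, 0 ≤ w j := fun j => by
    have := hsum0 j
    simp only [hw]; split_ifs with hj
    · have := hE0 j hj; positivity
    · exact le_rfl
  have hrec : ∀ j, i ≤ j → j < N → v j ≤ w j + p.CuMC * ∑ l ∈ Finset.Ioo j N,
      (t (l + 1) - t l) / (p.T - t l) ^ ((1 - p.θL) / 2) / √(t l - t j) * v l := by
    intro j _ hj
    have h1 : (if j + 1 < N then ηY (j + 1) else 0) ≤ (if j + 1 < N then RY (j + 1) else 0)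
        + ∑ k ∈ Finset.Ioo j N, a k * (√2 * p.Lf * v k + E k) := by
      split_ifs with hj1
      · rw [Ioo_eq_Ico_succ]; exact hY' _ hj1
      · rw [Ioo_eq_Ico_succ, Finset.Ico_eq_empty (by omega)]; simp
    have h2 := hZ' j hj
    have h3 := hRE j hj
    have h4 : ∑ k ∈ Finset.Ioo j N, a k * (√2 * p.Lf * v k + E k)
        ≤ √p.T * ∑ k ∈ Finset.Ioo j N, a k / √(t k - t j) * (√2 * p.Lf * v k + E k) := by
      rw [Finset.mul_sum]
      refine Finset.sum_le_sum fun k hk => ?_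
      obtain ⟨hk1, hk2⟩ := Finset.mem_Ioo.1 hk
      have q := one_le_sqrt_div h hk1 hk2.le
      have h0 : 0 ≤ a k * (√2 * p.Lf * v k + E k) := by
        have := ha0 k hk2; have := hv0 k; have := hE0 k hk2; positivity
      calc _ ≤ a k * (√2 * p.Lf * v k + E k) * (√p.T / √(t k - t j)) :=
            le_mul_of_one_le_right h0 q
        _ = _ := by ring
    have h5 : ∑ k ∈ Finset.Ioo j N, a k / √(t k - t j) * (√2 * p.Lf * v k + E k)
        = √2 * p.Lf * ∑ k ∈ Finset.Ioo j N, a k / √(t k - t j) * v k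
          + ∑ k ∈ Finset.Ioo j N, (a k * E k) / √(t k - t j) := by
      rw [Finset.mul_sum, ← Finset.sum_add_distrib]
      exact Finset.sum_congr rfl fun k _ => by ring
    rw [h5] at h4 h2
    have hV0 : 0 ≤ ∑ k ∈ Finset.Ioo j N, a k / √(t k - t j) * v k := Finset.sum_nonneg
      fun k hk => mul_nonneg (div_nonneg (ha0 k (Finset.mem_Ioo.1 hk).2) (Real.sqrt_nonneg _))
        (hv0 k)
    have hS0 := hsum0 j
    set V := ∑ k ∈ Finset.Ioo j N, a k / √(t k - t j) * v k with hVdef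
    set S := ∑ k ∈ Finset.Ioo j N, (a k * E k) / √(t k - t j) with hSdef
    have h6 : v j ≤ E j + (√p.T + p.CM) * (√2 * p.Lf * V + S) := by
      simp only [hv]; linarith
    -- The prescribed constants have slack: `√2 √T ≤ 4 √T` in the coefficient of `V` and `√T ≤ 2 √T`
    -- in that of `S`.
    have h7 : (√p.T + p.CM) * (√2 * p.Lf * V + S) ≤ (p.CM + 2 * √p.T) * S + p.CuMC * V := by
      have e1 : √2 * (√p.T * p.Lf * V) ≤ 4 * (√p.T * p.Lf * V) := by
        refine mul_le_mul_of_nonneg_right (by linarith) (by positivity)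
      have e2 : 0 ≤ √p.T * S := by positivity
      rw [Params.CuMC]; nlinarith
    simp only [hw, hj, if_true]
    exact h6.trans (by linarith)
  obtain ⟨g1, g2⟩ := gronwall_le h hG hCu hi hv0 hw0 hrec
  have hG1 := (hG p.CuMC 1 hCu one_pos).1
  have hG2 := (hG p.CuMC (1 / 2) hCu (by norm_num)).1
  have Tβ := Real.rpow_pos_of_pos hT (p.θL / 2)
  constructor
  · have s4 := double_sum_Ico_half_le h hB hp haE0 i
    have hBθ := (hB (p.θL / 2) 1 (by linarith) one_pos).1
    have hWs : ∑ l ∈ Finset.Ico i N, a l * w l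
        = ∑ l ∈ Finset.Ico i N, a l * E l + (p.CM + 2 * √p.T) * ∑ l ∈ Finset.Ico i N,
            a l * ∑ m ∈ Finset.Ioo l N, (a m * E m) / √(t m - t l) := by
      rw [Finset.mul_sum, ← Finset.sum_add_distrib]
      refine Finset.sum_congr rfl fun l hl => ?_
      simp only [hw, (Finset.mem_Ico.1 hl).2, if_true]; ring
    have form : ∑ j ∈ Finset.Ico i N,
      E j * (t (j + 1) - t j) / (p.T - t j) ^ ((1 - p.θL) / 2)
        = ∑ l ∈ Finset.Ico i N, a l * E l := Finset.sum_congr rfl fun l _ => by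
      simp only [ha]; ring
    rw [form]
    have hA0 : 0 ≤ ∑ l ∈ Finset.Ico i N, a l * E l := Finset.sum_nonneg fun l hl =>
      haE0 l (Finset.mem_Ico.1 hl).2
    set A := ∑ l ∈ Finset.Ico i N, a l * E l with hA
    refine (hY' i hi).trans (add_le_add le_rfl ?_)
    calc ∑ k ∈ Finset.Ico i N, a k * (√2 * p.Lf * v k + E k)
        = √2 * p.Lf * ∑ k ∈ Finset.Ico i N, a k * v k + A := by
          rw [Finset.mul_sum, ← Finset.sum_add_distrib]
          exact Finset.sum_congr rfl fun k _ => by ring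
      _ ≤ √2 * p.Lf * (G p.CuMC 1 * (A + (p.CM + 2 * √p.T) *
            (B (p.θL / 2) 1 * p.T ^ (p.θL / 2) * A))) + A := by
          gcongr
          refine g1.trans ?_
          rw [hWs]
          gcongr
      _ = (1 + √2 * (p.Lf * G p.CuMC 1 *
            (1 + B (p.θL / 2) 1 * p.T ^ (p.θL / 2) * (p.CM + 2 * √p.T)))) * A := by ring
      -- Again slack in the prescribed constant, through `1 ≤ 2` and `√2 ≤ 4`.
      _ ≤ (2 + 4 * (p.Lf * G p.CuMC 1 *
            (1 + B (p.θL / 2) 1 * p.T ^ (p.θL / 2) * (p.CM + 2 * √p.T)))) * A := by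
          gcongr
          · norm_num
          · linarith
      _ = _ := by rw [Params.CMy]; ring
  · have s4 := double_sum_Ioo_half_le h hB hp haE0 i
    have hBθ := (hB (p.θL / 2) (1 / 2) (by linarith) (by norm_num)).1
    have hWs : ∑ l ∈ Finset.Ioo i N, a l / √(t l - t i) * w l
        = ∑ l ∈ Finset.Ioo i N, a l * E l / √(t l - t i)
          + (p.CM + 2 * √p.T) * ∑ l ∈ Finset.Ioo i N,
            a l / √(t l - t i) * ∑ m ∈ Finset.Ioo l N, (a m * E m) / √(t m - t l) := by
      rw [Finset.mul_sum, ← Finset.sum_add_distrib]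
      refine Finset.sum_congr rfl fun l hl => ?_
      simp only [hw, (Finset.mem_Ioo.1 hl).2, if_true]; ring
    have form : ∑ j ∈ Finset.Ioo i N,
      E j * (t (j + 1) - t j) / ((p.T - t j) ^ ((1 - p.θL) / 2) * √(t j - t i))
        = ∑ l ∈ Finset.Ioo i N, a l * E l / √(t l - t i) := Finset.sum_congr rfl fun l _ => by
      simp only [ha, div_eq_mul_inv, mul_inv]; ring
    rw [form]
    have hA0 := hsum0 i
    set A := ∑ l ∈ Finset.Ioo i N, a l * E l / √(t l - t i) with hA
    refine (hZ' i hi).trans (add_le_add le_rfl ?_)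
    calc p.CM * ∑ k ∈ Finset.Ioo i N, a k / √(t k - t i) * (√2 * p.Lf * v k + E k)
        = p.CM * (√2 * p.Lf * ∑ k ∈ Finset.Ioo i N, a k / √(t k - t i) * v k + A) := by
          congr 1
          rw [Finset.mul_sum, ← Finset.sum_add_distrib]
          exact Finset.sum_congr rfl fun k _ => by ring
      _ ≤ p.CM * (√2 * p.Lf * (G p.CuMC (1 / 2) * (A + (p.CM + 2 * √p.T) *
            (B (p.θL / 2) (1 / 2) * p.T ^ (p.θL / 2) * A))) + A) := by
          gcongr
          refine g2.trans ?_
          rw [hWs]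
          gcongr
      _ = _ := by rw [Params.CMz]; ring

end DeterministicBounds

end MWLS


/-! ### Bounds on the driver and on the observations. -/

namespace MWLS

section ObservationBounds

variable {p : Params} {B G : ℝ → ℝ → ℝ}

/-- The lower bound `1` for `Cy1` is more than a sign condition: at time `N` the level `Cy` has to
dominate the terminal condition itself. -/
theorem Params.constants_nonneg (hp : p.Admissible) (hB : IsSumConstant p.R B)
    (hG : ∀ Cu γ : ℝ, 0 ≤ Cu → 0 < γ → IsGronwallConstant p.R p.T 0 (p.θL / 2) Cu γ (G Cu γ)) :
    1 ≤ p.Cy1 B G ∧ 0 ≤ p.Cy2 B G ∧ 0 ≤ p.Cz1 B G ∧ 0 ≤ p.Cz2 B G ∧ 0 ≤ p.Cz3 B G := by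
  have hL := hp.Lf_nonneg
  have hM := hp.CM_nonneg
  have hθ := hp.θL_mem.1
  have hCu : 0 ≤ p.CuStab := mul_nonneg hL (add_nonneg hM (Real.sqrt_nonneg _))
  have hG1 := (hG p.CuStab 1 hCu one_pos).1
  have hG2 := (hG p.CuStab (1 / 2) hCu (by norm_num)).1
  have b1 := (hB (p.θL / 2) 1 (by linarith) one_pos).1
  have b2 := (hB (p.θL / 2) (1 / 2) (by linarith) (by norm_num)).1
  have b3 := (hB (1 / 2 + p.θL / 2) 1 (by linarith) one_pos).1
  have b4 := (hB (1 / 2 + p.θL / 2) (1 / 2) (by linarith) (by norm_num)).1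
  have hT := Real.rpow_nonneg hp.T_pos.le (p.θL / 2)
  refine ⟨?_, ?_, ?_, ?_, ?_⟩
  · rw [Params.Cy1]; exact le_add_of_nonneg_right (by positivity)
  · rw [Params.Cy2]; positivity
  · rw [Params.Cz1]; positivity
  · rw [Params.Cz2]; positivity
  · rw [Params.Cz3]; positivity

variable {Ω : Type*} [MeasurableSpace Ω] {d q : ℕ} (𝓜 : Model Ω d q) (P : Measure Ω)

theorem Model.Cξ_nonneg : 0 ≤ 𝓜.Cξ P := ENNReal.toReal_nonneg

theorem Model.devξ_nonneg (i : ℕ) : 0 ≤ 𝓜.devξ P i := ENNReal.toReal_nonneg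

theorem Model.Cy_nonneg (hp : p.Admissible) (h : IsTimeGrid p.T p.R 𝓜.N 𝓜.t)
    (hB : IsSumConstant p.R B)
    (hG : ∀ Cu γ : ℝ, 0 ≤ Cu → 0 < γ → IsGronwallConstant p.R p.T 0 (p.θL / 2) Cu γ (G Cu γ))
    {i : ℕ} (hi : i ≤ 𝓜.N) : 0 ≤ 𝓜.Cy P p B G i := by
  obtain ⟨h1, h2, -⟩ := Params.constants_nonneg hp hB hG
  have b := (hB p.θC 1 hp.θC_mem.1 one_pos).1
  have hf := hp.Cf_nonneg
  have hξ := 𝓜.Cξ_nonneg P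
  have ht := Real.rpow_nonneg (sub_nonneg.2 (h.le_last hi)) p.θC
  have h1' : 0 ≤ p.Cy1 B G := by linarith
  rw [Model.Cy]; positivity

theorem Model.Cz_nonneg (hp : p.Admissible) (h : IsTimeGrid p.T p.R 𝓜.N 𝓜.t)
    (hB : IsSumConstant p.R B)
    (hG : ∀ Cu γ : ℝ, 0 ≤ Cu → 0 < γ → IsGronwallConstant p.R p.T 0 (p.θL / 2) Cu γ (G Cu γ))
    {i : ℕ} (hi : i ≤ 𝓜.N) : 0 ≤ 𝓜.Cz P p B G i := by
  obtain ⟨-, -, h1, h2, h3⟩ := Params.constants_nonneg hp hB hG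
  have b := (hB p.θC (1 / 2) hp.θC_mem.1 (by norm_num)).1
  have hf := hp.Cf_nonneg
  have hξ := 𝓜.Cξ_nonneg P
  have hd := 𝓜.devξ_nonneg P i
  have hτ := sub_nonneg.2 (h.le_last hi)
  have ht := Real.rpow_nonneg hτ (1 / 2 - p.θC)
  have ht' := Real.rpow_nonneg hτ (p.θL / 2)
  rw [Model.Cz]; positivity

/-- Bound on the driver along the truncated functions of the algorithm. -/
noncomputable def Model.driverBound (p : Params) (B G : ℝ → ℝ → ℝ) (k : ℕ) : ℝ :=
  p.Cf / (p.T - 𝓜.t k) ^ (1 - p.θC) + p.Lf / (p.T - 𝓜.t k) ^ ((1 - p.θL) / 2)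
    * (𝓜.Cy P p B G (k + 1) + √q * 𝓜.Cz P p B G k)

theorem Model.driverBound_nonneg (hp : p.Admissible) (h : IsTimeGrid p.T p.R 𝓜.N 𝓜.t)
    (hB : IsSumConstant p.R B)
    (hG : ∀ Cu γ : ℝ, 0 ≤ Cu → 0 < γ → IsGronwallConstant p.R p.T 0 (p.θL / 2) Cu γ (G Cu γ))
    {k : ℕ} (hk : k < 𝓜.N) : 0 ≤ 𝓜.driverBound P p B G k := by
  have h1 := 𝓜.Cy_nonneg P hp h hB hG (i := k + 1) hk
  have h2 := 𝓜.Cz_nonneg P hp h hB hG hk.le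
  have hf := hp.Cf_nonneg
  have hL := hp.Lf_nonneg
  have hτ := sub_nonneg.2 (h.le_last hk.le)
  have ht := Real.rpow_nonneg hτ (1 - p.θC)
  have ht' := Real.rpow_nonneg hτ ((1 - p.θL) / 2)
  rw [Model.driverBound]; positivity

/-- Written as a sum of pure powers of `T - t k`, the bound can be summed over the grid with one
constant `B` per term. The time `t (k + 1)` in `Cy` is moved to `t k` by monotonicity, and the
conditional deviation of `ξ` is replaced by its supremum. -/
theorem Model.driverBound_le (hp : p.Admissible) (h : IsTimeGrid p.T p.R 𝓜.N 𝓜.t)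
    (hB : IsSumConstant p.R B)
    (hG : ∀ Cu γ : ℝ, 0 ≤ Cu → 0 < γ → IsGronwallConstant p.R p.T 0 (p.θL / 2) Cu γ (G Cu γ))
    {k : ℕ} (hk : k < 𝓜.N) (hdev : 𝓜.devξ P k ≤ 𝓜.Cξ P) :
    𝓜.driverBound P p B G k ≤ p.Cf / (p.T - 𝓜.t k) ^ (1 - p.θC)
      + p.Lf * p.Cy1 B G * 𝓜.Cξ P / (p.T - 𝓜.t k) ^ (1 - (1 + p.θL) / 2)
      + p.Lf * p.Cy2 B G * p.Cf * B p.θC 1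
        / (p.T - 𝓜.t k) ^ (1 - (p.θC + (1 + p.θL) / 2))
      + p.Lf * √q * p.Cz1 B G * 𝓜.Cξ P / (p.T - 𝓜.t k) ^ (1 - p.θL / 2)
      + p.Lf * √q * p.Cz2 B G * p.Cf * B p.θC (1 / 2)
        / (p.T - 𝓜.t k) ^ (1 - (p.θC + p.θL / 2))
      + p.Lf * √q * p.Cz3 B G * 𝓜.Cξ P / (p.T - 𝓜.t k) ^ (1 - (p.θL + 1 / 2)) := by
  obtain ⟨-, h2, h3, h4, h5⟩ := Params.constants_nonneg hp hB hG
  have b1 := (hB p.θC 1 hp.θC_mem.1 one_pos).1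
  have hf := hp.Cf_nonneg
  have hL := hp.Lf_nonneg
  have τ0 : 0 < p.T - 𝓜.t k := sub_pos.2 (h.lt_last hk)
  have hstep : p.T - 𝓜.t (k + 1) ≤ p.T - 𝓜.t k := by linarith [h.lt k hk]
  have hτ' : (p.T - 𝓜.t (k + 1)) ^ p.θC ≤ (p.T - 𝓜.t k) ^ p.θC :=
    Real.rpow_le_rpow (sub_nonneg.2 (h.le_last hk)) hstep hp.θC_mem.1.le
  set τ := p.T - 𝓜.t k with hτ
  have e : ∀ x y : ℝ, 1 / τ ^ x * τ ^ y = 1 / τ ^ (x - y) := fun x y => by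
    rw [Real.rpow_sub τ0]; field_simp
  have e' : ∀ x y : ℝ, 1 / τ ^ x * (1 / τ ^ y) = 1 / τ ^ (x + y) := fun x y => by
    rw [Real.rpow_add τ0]; field_simp
  have hx := Real.rpow_pos_of_pos τ0 ((1 - p.θL) / 2)
  have q0 := Real.sqrt_nonneg (q : ℝ)
  calc 𝓜.driverBound P p B G k
      ≤ p.Cf / τ ^ (1 - p.θC) + p.Lf / τ ^ ((1 - p.θL) / 2)
        * ((p.Cy1 B G * 𝓜.Cξ P + p.Cy2 B G * p.Cf * B p.θC 1 * τ ^ p.θC)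
          + √q * (p.Cz1 B G * 𝓜.Cξ P / √τ
          + p.Cz2 B G * p.Cf * B p.θC (1 / 2) / τ ^ (1 / 2 - p.θC)
          + p.Cz3 B G * 𝓜.Cξ P * τ ^ (p.θL / 2))) := by
        rw [Model.driverBound, Model.Cy, Model.Cz]
        gcongr
    _ = p.Cf / τ ^ (1 - p.θC)
        + p.Lf * p.Cy1 B G * 𝓜.Cξ P * (1 / τ ^ ((1 - p.θL) / 2))
        + p.Lf * p.Cy2 B G * p.Cf * B p.θC 1 * (1 / τ ^ ((1 - p.θL) / 2) * τ ^ p.θC)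
        + p.Lf * √q * p.Cz1 B G * 𝓜.Cξ P
          * (1 / τ ^ ((1 - p.θL) / 2) * (1 / τ ^ (1 / 2 : ℝ)))
        + p.Lf * √q * p.Cz2 B G * p.Cf * B p.θC (1 / 2)
          * (1 / τ ^ ((1 - p.θL) / 2) * (1 / τ ^ (1 / 2 - p.θC)))
        + p.Lf * √q * p.Cz3 B G * 𝓜.Cξ P
          * (1 / τ ^ ((1 - p.θL) / 2) * τ ^ (p.θL / 2)) := by
        rw [Real.sqrt_eq_rpow τ]
        -- Powers in denominators become atoms for `ring`.
        generalize τ ^ ((1 - p.θL) / 2) = x1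
        generalize τ ^ (1 / 2 - p.θC) = x2
        generalize τ ^ (1 / 2 : ℝ) = x3
        ring
    _ = _ := by
        rw [e, e, e', e']
        rw [show (1 - p.θL) / 2 = 1 - (1 + p.θL) / 2 by ring,
          show 1 - (1 + p.θL) / 2 - p.θC = 1 - (p.θC + (1 + p.θL) / 2) by ring,
          show 1 - (1 + p.θL) / 2 + 1 / 2 = 1 - p.θL / 2 by ring,
          show 1 - (1 + p.θL) / 2 + (1 / 2 - p.θC) = 1 - (p.θC + p.θL / 2) by ring,
          show 1 - (1 + p.θL) / 2 - p.θL / 2 = 1 - (p.θL + 1 / 2) by ring]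
        simp only [mul_one_div]

/-- The six powers of `driverBound_le` sum to the terms of `c1` and `c2`. In the terms with `Cf` the
factor `(T - t i) ^ θC` is kept, and the remaining positive powers are bounded by powers of `T`. -/
theorem Model.sum_driverBound_le_Γy (hp : p.Admissible) (h : IsTimeGrid p.T p.R 𝓜.N 𝓜.t)
    (hB : IsSumConstant p.R B)
    (hG : ∀ Cu γ : ℝ, 0 ≤ Cu → 0 < γ → IsGronwallConstant p.R p.T 0 (p.θL / 2) Cu γ (G Cu γ))
    (hdev : ∀ k, k < 𝓜.N → 𝓜.devξ P k ≤ 𝓜.Cξ P) {i : ℕ} (hi : i < 𝓜.N) :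
    𝓜.Cξ P + ∑ k ∈ Finset.Ico i 𝓜.N,
      𝓜.driverBound P p B G k * (𝓜.t (k + 1) - 𝓜.t k) ≤ 𝓜.Γy P p B G i := by
  obtain ⟨h1, h2, h3, h4, h5⟩ := Params.constants_nonneg hp hB hG
  have h1' : 0 ≤ p.Cy1 B G := by linarith
  have hL := hp.Lf_nonneg
  have hf := hp.Cf_nonneg
  have hξ := 𝓜.Cξ_nonneg P
  have hθ := hp.θL_mem.1
  have hθC := hp.θC_mem.1
  have b1 := (hB p.θC 1 hθC one_pos).1
  have b2 := (hB p.θC (1 / 2) hθC (by norm_num)).1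
  have q0 := Real.sqrt_nonneg (q : ℝ)
  have τ0 : 0 < p.T - 𝓜.t i := sub_pos.2 (h.lt_last hi)
  have τT : p.T - 𝓜.t i ≤ p.T := by linarith [h.nonneg (i := i) hi.le]
  have S : ∀ α : ℝ, 0 < α → ∑ l ∈ Finset.Ico i 𝓜.N,
      1 / (p.T - 𝓜.t l) ^ (1 - α) * (𝓜.t (l + 1) - 𝓜.t l)
      ≤ B α 1 * (p.T - 𝓜.t i) ^ α := fun α hα => by
    refine (le_of_eq ?_).trans (sum_Ico_le_last h hB hp.T_pos hα hi.le)
    exact Finset.sum_congr rfl fun l _ => by ring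
  have S' : ∀ α : ℝ, 0 < α → ∑ l ∈ Finset.Ico i 𝓜.N,
      1 / (p.T - 𝓜.t l) ^ (1 - α) * (𝓜.t (l + 1) - 𝓜.t l) ≤ B α 1 * p.T ^ α := fun α hα =>
    (S α hα).trans (mul_le_mul_of_nonneg_left (Real.rpow_le_rpow τ0.le τT hα.le)
      (hB α 1 hα one_pos).1)
  have S'' : ∀ α : ℝ, 0 < α → ∑ l ∈ Finset.Ico i 𝓜.N,
      1 / (p.T - 𝓜.t l) ^ (1 - (p.θC + α)) * (𝓜.t (l + 1) - 𝓜.t l)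
      ≤ B (p.θC + α) 1 * (p.T ^ α * (p.T - 𝓜.t i) ^ p.θC) := fun α hα =>
    (S _ (by linarith)).trans (mul_le_mul_of_nonneg_left (by
      rw [add_comm, Real.rpow_add τ0]
      exact mul_le_mul_of_nonneg_right (Real.rpow_le_rpow τ0.le τT hα.le)
        (Real.rpow_nonneg τ0.le _)) (hB _ 1 (by linarith) one_pos).1)
  have T0 := S p.θC hθC
  have T1 := S' ((1 + p.θL) / 2) (by linarith)
  have T2 := S'' ((1 + p.θL) / 2) (by linarith)
  have T3 := S' (p.θL / 2) (by linarith)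
  have T4 := S'' (p.θL / 2) (by linarith)
  have T5 := S' (p.θL + 1 / 2) (by linarith)
  have key : ∑ k ∈ Finset.Ico i 𝓜.N, 𝓜.driverBound P p B G k * (𝓜.t (k + 1) - 𝓜.t k)
      ≤ p.Cf * (B p.θC 1 * (p.T - 𝓜.t i) ^ p.θC)
      + p.Lf * p.Cy1 B G * 𝓜.Cξ P * (B ((1 + p.θL) / 2) 1 * p.T ^ ((1 + p.θL) / 2))
      + p.Lf * p.Cy2 B G * p.Cf * B p.θC 1 * (B (p.θC + (1 + p.θL) / 2) 1 *
          (p.T ^ ((1 + p.θL) / 2) * (p.T - 𝓜.t i) ^ p.θC))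
      + p.Lf * √q * p.Cz1 B G * 𝓜.Cξ P * (B (p.θL / 2) 1 * p.T ^ (p.θL / 2))
      + p.Lf * √q * p.Cz2 B G * p.Cf * B p.θC (1 / 2) * (B (p.θC + p.θL / 2) 1 *
          (p.T ^ (p.θL / 2) * (p.T - 𝓜.t i) ^ p.θC))
      + p.Lf * √q * p.Cz3 B G * 𝓜.Cξ P * (B (p.θL + 1 / 2) 1 * p.T ^ (p.θL + 1 / 2)) := by
    calc _ ≤ p.Cf * (∑ l ∈ Finset.Ico i 𝓜.N,
          1 / (p.T - 𝓜.t l) ^ (1 - p.θC) * (𝓜.t (l + 1) - 𝓜.t l))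
        + p.Lf * p.Cy1 B G * 𝓜.Cξ P * (∑ l ∈ Finset.Ico i 𝓜.N,
          1 / (p.T - 𝓜.t l) ^ (1 - (1 + p.θL) / 2) * (𝓜.t (l + 1) - 𝓜.t l))
        + p.Lf * p.Cy2 B G * p.Cf * B p.θC 1 * (∑ l ∈ Finset.Ico i 𝓜.N,
          1 / (p.T - 𝓜.t l) ^ (1 - (p.θC + (1 + p.θL) / 2)) * (𝓜.t (l + 1) - 𝓜.t l))
        + p.Lf * √q * p.Cz1 B G * 𝓜.Cξ P * (∑ l ∈ Finset.Ico i 𝓜.N,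
          1 / (p.T - 𝓜.t l) ^ (1 - p.θL / 2) * (𝓜.t (l + 1) - 𝓜.t l))
        + p.Lf * √q * p.Cz2 B G * p.Cf * B p.θC (1 / 2) * (∑ l ∈ Finset.Ico i 𝓜.N,
          1 / (p.T - 𝓜.t l) ^ (1 - (p.θC + p.θL / 2)) * (𝓜.t (l + 1) - 𝓜.t l))
        + p.Lf * √q * p.Cz3 B G * 𝓜.Cξ P * (∑ l ∈ Finset.Ico i 𝓜.N,
          1 / (p.T - 𝓜.t l) ^ (1 - (p.θL + 1 / 2)) * (𝓜.t (l + 1) - 𝓜.t l)) := by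
          simp only [Finset.mul_sum]
          simp only [← Finset.sum_add_distrib]
          refine Finset.sum_le_sum fun l hl => ?_
          have hl2 := (Finset.mem_Ico.1 hl).2
          refine (mul_le_mul_of_nonneg_right (𝓜.driverBound_le P hp h hB hG hl2 (hdev l hl2))
            (h.step_pos hl2).le).trans (le_of_eq ?_)
          ring
      _ ≤ _ := by gcongr
  rw [Model.Γy, Params.c1, Params.c2]
  refine (add_le_add le_rfl key).trans (le_of_eq ?_)
  ring

/-- As for `Y`, with the two-sided constants `B α (1 / 2)`. The weights add a singularity at `t i`,
which lowers each exponent of `T - t i` by one half. The sum is what the triangle inequality yields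
for the observation when the weights are bounded by `CM / √(t k - t i)`. -/
theorem Model.sum_driverBound_le_Γz (hp : p.Admissible) (h : IsTimeGrid p.T p.R 𝓜.N 𝓜.t)
    (hB : IsSumConstant p.R B)
    (hG : ∀ Cu γ : ℝ, 0 ≤ Cu → 0 < γ → IsGronwallConstant p.R p.T 0 (p.θL / 2) Cu γ (G Cu γ))
    (hdev : ∀ k, k < 𝓜.N → 𝓜.devξ P k ≤ 𝓜.Cξ P) {i : ℕ} (hi : i < 𝓜.N) :
    𝓜.Cξ P * (p.CM / √(p.T - 𝓜.t i)) + ∑ k ∈ Finset.Ioo i 𝓜.N,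
      𝓜.driverBound P p B G k * (𝓜.t (k + 1) - 𝓜.t k) * (p.CM / √(𝓜.t k - 𝓜.t i))
      ≤ 𝓜.Γz P p B G i := by
  obtain ⟨h1, h2, h3, h4, h5⟩ := Params.constants_nonneg hp hB hG
  have h1' : 0 ≤ p.Cy1 B G := by linarith
  have hL := hp.Lf_nonneg
  have hf := hp.Cf_nonneg
  have hM := hp.CM_nonneg
  have hξ := 𝓜.Cξ_nonneg P
  have hθ := hp.θL_mem.1
  have hθC := hp.θC_mem.1
  have b1 := (hB p.θC 1 hθC one_pos).1
  have b2 := (hB p.θC (1 / 2) hθC (by norm_num)).1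
  have q0 := Real.sqrt_nonneg (q : ℝ)
  have τ0 : 0 < p.T - 𝓜.t i := sub_pos.2 (h.lt_last hi)
  have τT : p.T - 𝓜.t i ≤ p.T := by linarith [h.nonneg (i := i) hi.le]
  have S : ∀ α : ℝ, 0 < α → ∑ l ∈ Finset.Ioo i 𝓜.N,
      1 / (p.T - 𝓜.t l) ^ (1 - α) * (𝓜.t (l + 1) - 𝓜.t l) * (1 / √(𝓜.t l - 𝓜.t i))
      ≤ B α (1 / 2) * (p.T - 𝓜.t i) ^ (α - 1 / 2) := fun α hα => by
    refine (le_of_eq ?_).trans (sum_Ioo_le_last h hB hp.T_pos hα hi)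
    exact Finset.sum_congr rfl fun l _ => by ring
  have S' : ∀ α : ℝ, 0 < α → ∑ l ∈ Finset.Ioo i 𝓜.N,
      1 / (p.T - 𝓜.t l) ^ (1 - α) * (𝓜.t (l + 1) - 𝓜.t l) * (1 / √(𝓜.t l - 𝓜.t i))
        ≤ B α (1 / 2) * (p.T ^ α * (p.T - 𝓜.t i) ^ (-(1 / 2) : ℝ)) := fun α hα =>
    (S α hα).trans (mul_le_mul_of_nonneg_left (by
      rw [show α - 1 / 2 = α + (-(1 / 2) : ℝ) by ring, Real.rpow_add τ0]
      exact mul_le_mul_of_nonneg_right (Real.rpow_le_rpow τ0.le τT hα.le)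
        (Real.rpow_nonneg τ0.le _)) (hB α (1 / 2) hα (by norm_num)).1)
  have S'' : ∀ α : ℝ, 0 < α → ∑ l ∈ Finset.Ioo i 𝓜.N,
      1 / (p.T - 𝓜.t l) ^ (1 - (p.θC + α)) * (𝓜.t (l + 1) - 𝓜.t l) * (1 / √(𝓜.t l - 𝓜.t i))
      ≤ B (p.θC + α) (1 / 2) * (p.T ^ α * (p.T - 𝓜.t i) ^ (p.θC - 1 / 2)) := fun α hα =>
    (S _ (by linarith)).trans (mul_le_mul_of_nonneg_left (by
      rw [show p.θC + α - 1 / 2 = α + (p.θC - 1 / 2) by ring, Real.rpow_add τ0]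
      exact mul_le_mul_of_nonneg_right (Real.rpow_le_rpow τ0.le τT hα.le)
        (Real.rpow_nonneg τ0.le _)) (hB _ (1 / 2) (by linarith) (by norm_num)).1)
  have T0 := S p.θC hθC
  have T1 := S' ((1 + p.θL) / 2) (by linarith)
  have T2 := S'' ((1 + p.θL) / 2) (by linarith)
  have T3 := S' (p.θL / 2) (by linarith)
  have T4 := S'' (p.θL / 2) (by linarith)
  have T5 := S' (p.θL + 1 / 2) (by linarith)
  have key : ∑ k ∈ Finset.Ioo i 𝓜.N, 𝓜.driverBound P p B G k * (𝓜.t (k + 1) - 𝓜.t k)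
        * (p.CM / √(𝓜.t k - 𝓜.t i))
      ≤ p.CM * (p.Cf * (B p.θC (1 / 2) * (p.T - 𝓜.t i) ^ (p.θC - 1 / 2))
      + p.Lf * p.Cy1 B G * 𝓜.Cξ P * (B ((1 + p.θL) / 2) (1 / 2) * (p.T ^ ((1 + p.θL) / 2)
          * (p.T - 𝓜.t i) ^ (-(1 / 2) : ℝ)))
      + p.Lf * p.Cy2 B G * p.Cf * B p.θC 1 * (B (p.θC + (1 + p.θL) / 2) (1 / 2) *
          (p.T ^ ((1 + p.θL) / 2) * (p.T - 𝓜.t i) ^ (p.θC - 1 / 2)))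
      + p.Lf * √q * p.Cz1 B G * 𝓜.Cξ P * (B (p.θL / 2) (1 / 2) * (p.T ^ (p.θL / 2)
          * (p.T - 𝓜.t i) ^ (-(1 / 2) : ℝ)))
      + p.Lf * √q * p.Cz2 B G * p.Cf * B p.θC (1 / 2) * (B (p.θC + p.θL / 2) (1 / 2) *
          (p.T ^ (p.θL / 2) * (p.T - 𝓜.t i) ^ (p.θC - 1 / 2)))
      + p.Lf * √q * p.Cz3 B G * 𝓜.Cξ P * (B (p.θL + 1 / 2) (1 / 2) * (p.T ^ (p.θL + 1 / 2)
          * (p.T - 𝓜.t i) ^ (-(1 / 2) : ℝ)))) := by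
    calc _ ≤ p.CM * (p.Cf * (∑ l ∈ Finset.Ioo i 𝓜.N, 1 / (p.T - 𝓜.t l) ^ (1 - p.θC)
            * (𝓜.t (l + 1) - 𝓜.t l) * (1 / √(𝓜.t l - 𝓜.t i)))
        + p.Lf * p.Cy1 B G * 𝓜.Cξ P * (∑ l ∈ Finset.Ioo i 𝓜.N,
          1 / (p.T - 𝓜.t l) ^ (1 - (1 + p.θL) / 2)
            * (𝓜.t (l + 1) - 𝓜.t l) * (1 / √(𝓜.t l - 𝓜.t i)))
        + p.Lf * p.Cy2 B G * p.Cf * B p.θC 1 * (∑ l ∈ Finset.Ioo i 𝓜.N,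
          1 / (p.T - 𝓜.t l) ^ (1 - (p.θC + (1 + p.θL) / 2))
            * (𝓜.t (l + 1) - 𝓜.t l) * (1 / √(𝓜.t l - 𝓜.t i)))
        + p.Lf * √q * p.Cz1 B G * 𝓜.Cξ P * (∑ l ∈ Finset.Ioo i 𝓜.N,
          1 / (p.T - 𝓜.t l) ^ (1 - p.θL / 2)
            * (𝓜.t (l + 1) - 𝓜.t l) * (1 / √(𝓜.t l - 𝓜.t i)))
        + p.Lf * √q * p.Cz2 B G * p.Cf * B p.θC (1 / 2) * (∑ l ∈ Finset.Ioo i 𝓜.N,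
          1 / (p.T - 𝓜.t l) ^ (1 - (p.θC + p.θL / 2))
            * (𝓜.t (l + 1) - 𝓜.t l) * (1 / √(𝓜.t l - 𝓜.t i)))
        + p.Lf * √q * p.Cz3 B G * 𝓜.Cξ P * (∑ l ∈ Finset.Ioo i 𝓜.N,
          1 / (p.T - 𝓜.t l) ^ (1 - (p.θL + 1 / 2))
            * (𝓜.t (l + 1) - 𝓜.t l) * (1 / √(𝓜.t l - 𝓜.t i)))) := by
          simp only [Finset.mul_sum]
          simp only [← Finset.sum_add_distrib, Finset.mul_sum]
          refine Finset.sum_le_sum fun l hl => ?_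
          have hl2 := (Finset.mem_Ioo.1 hl).2
          refine (mul_le_mul_of_nonneg_right (mul_le_mul_of_nonneg_right
            (𝓜.driverBound_le P hp h hB hG hl2 (hdev l hl2))
            (h.step_pos hl2).le) (by positivity)).trans (le_of_eq ?_)
          generalize √(𝓜.t l - 𝓜.t i) = x
          ring
      _ ≤ _ := by gcongr
  have e : p.CM / √(p.T - 𝓜.t i) = p.CM * (p.T - 𝓜.t i) ^ (-(1 / 2) : ℝ) := by
    rw [Real.rpow_neg τ0.le, ← Real.sqrt_eq_rpow, div_eq_mul_inv]
  rw [Model.Γz, Params.c3, Params.c4, e]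
  refine (add_le_add le_rfl key).trans (le_of_eq ?_)
  ring

theorem Model.Γy_nonneg (hp : p.Admissible) (h : IsTimeGrid p.T p.R 𝓜.N 𝓜.t)
    (hB : IsSumConstant p.R B)
    (hG : ∀ Cu γ : ℝ, 0 ≤ Cu → 0 < γ → IsGronwallConstant p.R p.T 0 (p.θL / 2) Cu γ (G Cu γ))
    (hdev : ∀ k, k < 𝓜.N → 𝓜.devξ P k ≤ 𝓜.Cξ P) {i : ℕ} (hi : i < 𝓜.N) :
    0 ≤ 𝓜.Γy P p B G i := by
  refine le_trans ?_ (𝓜.sum_driverBound_le_Γy P hp h hB hG hdev hi)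
  exact add_nonneg (𝓜.Cξ_nonneg P) (Finset.sum_nonneg fun k hk =>
    mul_nonneg (𝓜.driverBound_nonneg P hp h hB hG (Finset.mem_Ico.1 hk).2)
      (h.step_pos (Finset.mem_Ico.1 hk).2).le)

theorem Model.Γz_nonneg (hp : p.Admissible) (h : IsTimeGrid p.T p.R 𝓜.N 𝓜.t)
    (hB : IsSumConstant p.R B)
    (hG : ∀ Cu γ : ℝ, 0 ≤ Cu → 0 < γ → IsGronwallConstant p.R p.T 0 (p.θL / 2) Cu γ (G Cu γ))
    (hdev : ∀ k, k < 𝓜.N → 𝓜.devξ P k ≤ 𝓜.Cξ P) {i : ℕ} (hi : i < 𝓜.N) :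
    0 ≤ 𝓜.Γz P p B G i := by
  refine le_trans ?_ (𝓜.sum_driverBound_le_Γz P hp h hB hG hdev hi)
  have hM := hp.CM_nonneg
  exact add_nonneg (mul_nonneg (𝓜.Cξ_nonneg P) (by positivity))
    (Finset.sum_nonneg fun k hk => mul_nonneg
      (mul_nonneg (𝓜.driverBound_nonneg P hp h hB hG (Finset.mem_Ioo.1 hk).2)
      (h.step_pos (Finset.mem_Ioo.1 hk).2).le) (by positivity))

end ObservationBounds

end MWLS


namespace MWLS

/-! ### Counting the superlevel sets of a truncated vector space -/

section Combinatorics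

open Classical in
/-- The traces on `J` of the superlevel sets of `φ - g - r`, with `φ ∈ V`, cut off at `g + r ≤ L`. -/
noncomputable def superlevelSets {J : Type*} [Fintype J] (V : Submodule ℝ (J → ℝ)) (g : J → ℝ)
    (L : ℝ) : Finset (Finset J) :=
  Finset.univ.filter fun A => ∃ φ ∈ V, ∃ r : ℝ,
    A = Finset.univ.filter fun j => g j + r ≤ φ j ∧ g j + r ≤ L

/-- Let `i₀` maximize `g` on `s`. If a trace is required to contain `i₀`, then `g i₀ + r ≤ L`, and
the cutoff becomes void at all other points of `s`. The rest is the classical dimension argument. If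
`s` had more points, some nonzero `c` on `s.erase i₀` would be orthogonal to `V` and to the
constants. Choosing the trace `{c > 0}` shows that `∑ c g ≤ 0`, strictly if `c` has a negative
entry. Applying this to `c` and to `-c` is contradictory. The two extra dimensions account for the
constants and for `i₀`. -/
theorem card_le_of_shatters {J : Type*} [Fintype J] [DecidableEq J] {V : Submodule ℝ (J → ℝ)}
    {g : J → ℝ} {L : ℝ} {s : Finset J} (hs : (superlevelSets V g L).Shatters s) :
    s.card ≤ Module.finrank ℝ V + 2 := by
  classical
  by_contra! hcard
  have hne : s.Nonempty := Finset.card_pos.1 (by omega)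
  obtain ⟨i₀, hi₀, hmax⟩ := s.exists_max_image g hne
  set s' := s.erase i₀ with hs'
  have hs'card : s'.card = s.card - 1 := Finset.card_erase_of_mem hi₀
  set W : Submodule ℝ (J → ℝ) := V ⊔ Submodule.span ℝ {fun _ => 1} with hW
  have hWdim : Module.finrank ℝ W ≤ Module.finrank ℝ V + 1 := by
    refine (Submodule.finrank_add_le_finrank_add_finrank _ _).trans ?_
    exact Nat.add_le_add_left ((finrank_span_le_card _).trans (by simp)) _
  -- a nonzero vector supported on `s'` and orthogonal to `W`
  let ℓ : (s' → ℝ) →ₗ[ℝ] (W →ₗ[ℝ] ℝ) := LinearMap.mk₂ ℝ (fun c w => ∑ j : s', c j * w.1 j)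
    (fun c c' w => by simp [add_mul, Finset.sum_add_distrib])
    (fun a c w => by simp [Finset.mul_sum, mul_assoc])
    (fun c w w' => by simp [mul_add, Finset.sum_add_distrib])
    (fun a c w => by simp [Finset.mul_sum, mul_left_comm])
  have hker : LinearMap.ker ℓ ≠ ⊥ := by
    refine LinearMap.ker_ne_bot_of_finrank_lt ?_
    have : Module.finrank ℝ (W →ₗ[ℝ] ℝ) = Module.finrank ℝ W := Subspace.dual_finrank_eq
    rw [this, Module.finrank_fintype_fun_eq_card, Fintype.card_coe]
    omega
  obtain ⟨c, hc, hc0⟩ := Submodule.exists_mem_ne_zero_of_ne_bot hker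
  have horth : ∀ w ∈ W, ∑ j : s', c j * w j = 0 := fun w hw => by
    have := LinearMap.congr_fun (LinearMap.mem_ker.1 hc) ⟨w, hw⟩
    simpa [ℓ] using this
  -- any such vector is nonpositive on `g`, strictly if it has a negative entry
  have key : ∀ c : s' → ℝ, (∀ w ∈ W, ∑ j : s', c j * w j = 0) →
      ∑ j : s', c j * g j ≤ 0 ∧ ((∃ j, c j < 0) → ∑ j : s', c j * g j < 0) := by
    intro c horth
    -- The set to be cut out is the positivity set of `c`, together with `i₀` in order to neutralize
    -- the cutoff.
    set τ : Finset J := insert i₀ ((Finset.univ.filter fun j : s' => 0 < c j).image (↑)) with hτ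
    have hτs : τ ⊆ s := by
      intro x hx
      rcases Finset.mem_insert.1 hx with rfl | hx
      · exact hi₀
      · obtain ⟨j, -, rfl⟩ := Finset.mem_image.1 hx
        exact Finset.mem_of_mem_erase j.2
    obtain ⟨A, hA, hsA⟩ := hs hτs
    obtain ⟨φ, hφ, r, rfl⟩ := (Finset.mem_filter.1 hA).2
    have hi₀A : g i₀ + r ≤ L := by
      have : i₀ ∈ τ := Finset.mem_insert_self i₀ _
      rw [← hsA] at this
      exact (Finset.mem_filter.1 (Finset.mem_inter.1 this).2).2.2
    have hmem : ∀ j : s', 0 < c j ↔ g j + r ≤ φ j := by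
      intro j
      have hj : (j : J) ∈ s := Finset.mem_of_mem_erase j.2
      have hji : (j : J) ≠ i₀ := Finset.ne_of_mem_erase j.2
      have h1 : (j : J) ∈ τ ↔ 0 < c j := by
        rw [hτ, Finset.mem_insert, Finset.mem_image]
        constructor
        · rintro (h | ⟨x, hx, hxj⟩)
          · exact absurd h hji
          · rw [← Subtype.ext hxj]; exact (Finset.mem_filter.1 hx).2
        · exact fun h => Or.inr ⟨j, Finset.mem_filter.2 ⟨Finset.mem_univ _, h⟩, rfl⟩
      rw [← h1, ← hsA, Finset.mem_inter, Finset.mem_filter]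
      have := hmax j hj
      exact ⟨fun h => h.2.2.1, fun h => ⟨hj, Finset.mem_univ _, h, by linarith⟩⟩
    have hw : (φ - r • fun _ => (1 : ℝ)) ∈ W := Submodule.sub_mem _
      (Submodule.mem_sup_left hφ)
      (Submodule.smul_mem _ _ (Submodule.mem_sup_right (Submodule.mem_span_singleton_self _)))
    have h0 := horth _ hw
    simp only [Pi.sub_apply, Pi.smul_apply, smul_eq_mul, mul_one] at h0
    -- By the choice of the trace, `c j` and `φ j - r - g j` have the same sign. The orthogonality
    -- relation removes `φ - r` from the sum.
    have hterm : ∀ j : s', 0 ≤ c j * (φ j - r) - c j * g j := fun j => by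
      rcases lt_or_ge 0 (c j) with h | h
      · have := (hmem j).1 h
        nlinarith
      · have : φ j < g j + r := lt_of_not_ge fun h' => absurd ((hmem j).2 h') (not_lt.2 h)
        nlinarith
    have hsum : ∑ j : s', (c j * (φ j - r) - c j * g j) = - ∑ j : s', c j * g j := by
      rw [Finset.sum_sub_distrib, h0, zero_sub]
    constructor
    · have := Finset.sum_nonneg fun j (_ : j ∈ (Finset.univ : Finset s')) => hterm j
      linarith
    · rintro ⟨j, hj⟩
      have : 0 < ∑ j : s', (c j * (φ j - r) - c j * g j) :=
        Finset.sum_pos' (fun j _ => hterm j) ⟨j, Finset.mem_univ _, by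
          have : φ j < g j + r :=
            lt_of_not_ge fun h' => absurd ((hmem j).2 h') (not_lt.2 hj.le)
          nlinarith⟩
      linarith
  have k1 := key c horth
  have k2 := key (-c) fun w hw => by simpa using horth w hw
  simp only [Pi.neg_apply, neg_mul, Finset.sum_neg_distrib, Left.neg_nonpos_iff,
    Left.neg_neg_iff] at k2
  obtain ⟨j, hj⟩ := Function.ne_iff.1 hc0
  rcases lt_or_gt_of_ne hj with h | h
  · have := k1.2 ⟨j, h⟩; linarith [k2.1]
  · have := k2.2 ⟨j, h⟩; linarith [k1.1]

/-- Termwise comparison with the binomial expansion, through `n.choose k ≤ n ^ k`. -/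
theorem sum_choose_le_pow (n v : ℕ) : ∑ k ∈ Finset.Iic v, n.choose k ≤ (n + 1) ^ v := by
  rw [add_pow]
  have : Finset.Iic v = Finset.range (v + 1) := by ext; simp
  rw [this]
  refine Finset.sum_le_sum fun k hk => ?_
  have hk' : k ≤ v := Nat.lt_succ_iff.1 (Finset.mem_range.1 hk)
  rw [one_pow, mul_one]
  exact (Nat.choose_le_pow n k).trans (Nat.le_mul_of_pos_right _ (Nat.choose_pos hk'))

/-- The Sauer–Shelah lemma with the bound on shattered sets from `card_le_of_shatters`. -/
theorem card_superlevelSets_le {J : Type*} [Fintype J] {V : Submodule ℝ (J → ℝ)}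
    {g : J → ℝ} {L : ℝ} {K : ℕ} (hV : Module.finrank ℝ V ≤ K) :
    (superlevelSets V g L).card ≤ (Fintype.card J + 1) ^ (K + 2) := by
  classical
  refine (Finset.card_le_card_shatterer _).trans ?_
  refine Finset.card_shatterer_le_sum_vcDim.trans ?_
  refine (sum_choose_le_pow _ _).trans ?_
  refine Nat.pow_le_pow_right (Nat.succ_pos _) ?_
  exact Finset.sup_le fun s hs =>
    (card_le_of_shatters (Finset.mem_shatterer.1 hs)).trans (by omega)

theorem neg_trunc {L : ℝ} (hL : 0 ≤ L) (x : ℝ) : -trunc L x = trunc L (-x) := by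
  unfold trunc
  simp only [min_def, max_def]
  split_ifs <;> linarith

theorem abs_trunc_le {L : ℝ} (hL : 0 ≤ L) (x : ℝ) : |trunc L x| ≤ L := by
  unfold trunc
  exact abs_le.2 ⟨le_max_left _ _, max_le (by linarith) (min_le_right _ _)⟩

/-- Above `-L`, truncation acts on superlevel sets only through the condition `y ≤ L`. This explains
the form of `superlevelSets`. -/
theorem le_trunc_iff {L x y : ℝ} (hy : -L < y) : y ≤ trunc L x ↔ y ≤ x ∧ y ≤ L := by
  unfold trunc
  rw [le_max_iff, le_min_iff]
  exact ⟨fun h => h.resolve_left (not_le.2 hy), Or.inr⟩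

/-- The superlevel sets of `(T_L φ - g)²` belong to a small family. -/
theorem exists_superlevel_family {J : Type*} [Fintype J] [DecidableEq J]
    {V : Submodule ℝ (J → ℝ)} {g : J → ℝ} {L : ℝ} {K : ℕ} (hV : Module.finrank ℝ V ≤ K)
    (hg : ∀ j, |g j| ≤ L) :
    ∃ 𝒜 : Finset (Finset J), 𝒜.Nonempty ∧ 𝒜.card ≤ (Fintype.card J + 1) ^ (2 * (K + 2)) ∧
      ∀ φ ∈ V, ∀ s : ℝ, 0 < s →
        (Finset.univ.filter fun j => s ≤ (trunc L (φ j) - g j) ^ 2) ∈ 𝒜 := by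
  classical
  -- A squared deviation is at least `s` when the truncation of `φ` exceeds `g + √s` or that of `-φ`
  -- exceeds `-g + √s`. The second case is the first for `-φ` and `-g`, whence unions of two
  -- superlevel sets.
  set 𝒜 := Finset.image₂ (· ∪ ·) (superlevelSets V g L) (superlevelSets V (-g) L) with h𝒜
  have main : ∀ φ ∈ V, ∀ s : ℝ, 0 < s →
        (Finset.univ.filter fun j => s ≤ (trunc L (φ j) - g j) ^ 2) ∈ 𝒜 := by
    intro φ hφ s hs
    refine Finset.mem_image₂.2
      ⟨Finset.univ.filter fun j => g j + √s ≤ φ j ∧ g j + √s ≤ L,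
        Finset.mem_filter.2 ⟨Finset.mem_univ _, φ, hφ, √s, rfl⟩,
        Finset.univ.filter fun j => (-g) j + √s ≤ (-φ) j ∧ (-g) j + √s ≤ L,
        Finset.mem_filter.2 ⟨Finset.mem_univ _, -φ, V.neg_mem hφ, √s, rfl⟩, ?_⟩
    ext j
    have hs' : 0 < √s := Real.sqrt_pos.2 hs
    have hgj := abs_le.1 (hg j)
    have hL : 0 ≤ L := (abs_nonneg _).trans (hg j)
    simp only [Finset.mem_union, Finset.mem_filter, Finset.mem_univ, true_and, Pi.neg_apply]
    rw [← le_trunc_iff (by linarith), ← le_trunc_iff (by linarith), ← neg_trunc hL]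
    rw [← Real.sqrt_le_sqrt_iff (sq_nonneg _), Real.sqrt_sq_eq_abs, le_abs]
    constructor
    · rintro (h | h)
      · left; linarith
      · right; linarith
    · rintro (h | h)
      · left; linarith
      · right; linarith
  refine ⟨𝒜, ⟨_, main 0 V.zero_mem 1 one_pos⟩, ?_, main⟩
  refine (Finset.card_image₂_le _ _ _).trans ?_
  rw [two_mul, pow_add]
  exact Nat.mul_le_mul (card_superlevelSets_le hV) (card_superlevelSets_le hV)

end Combinatorics

/-! ### Symmetrization over signs -/

section Signs

/-- Layer-cake formula: `h j` is the integral over `s ∈ (0, C)` of the indicator of `s ≤ h j`. A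
weighted sum of a bounded function is thus controlled by its weights on superlevel sets. -/
theorem sum_mul_le_of_superlevel {J : Type*} [Fintype J] {c h : J → ℝ} {C K : ℝ} (hC : 0 ≤ C)
    (h0 : ∀ j, 0 ≤ h j) (hhC : ∀ j, h j ≤ C)
    (hK : ∀ s : ℝ, 0 < s → ∑ j with s ≤ h j, c j ≤ K) : ∑ j, c j * h j ≤ C * K := by
  have e : ∀ j, h j = ∫ s in (0 : ℝ)..C, Set.indicator {s | s ≤ h j} (fun _ => (1 : ℝ)) s := by
    intro j
    rw [intervalIntegral.integral_indicator ⟨h0 j, hhC j⟩]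
    simp
  have hint : ∀ j, IntervalIntegrable
      (fun s => Set.indicator {s | s ≤ h j} (fun _ => (1 : ℝ)) s) volume 0 C := fun j =>
    (intervalIntegrable_const (c := (1 : ℝ))).mono_fun'
      ((measurable_const.indicator measurableSet_Iic).aestronglyMeasurable)
      (Filter.Eventually.of_forall fun s => by
        by_cases hs : s ≤ h j <;> simp [Set.indicator, hs])
  calc ∑ j, c j * h j
      = ∑ j, ∫ s in (0 : ℝ)..C, c j * Set.indicator {s | s ≤ h j} (fun _ => (1 : ℝ)) s := by
        refine Finset.sum_congr rfl fun j _ => ?_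
        rw [intervalIntegral.integral_const_mul, ← e]
    _ = ∫ s in (0 : ℝ)..C, ∑ j, c j * Set.indicator {s | s ≤ h j} (fun _ => (1 : ℝ)) s :=
        (intervalIntegral.integral_finsetSum fun j _ => (hint j).const_mul _).symm
    _ ≤ ∫ _ in (0 : ℝ)..C, K := by
        have hI := IntervalIntegrable.sum Finset.univ fun j _ => (hint j).const_mul (c j)
        rw [Finset.sum_fn] at hI
        refine intervalIntegral.integral_mono_on_of_le_Ioo hC hI intervalIntegrable_const fun s hs => ?_
        refine (le_of_eq ?_).trans (hK s hs.1)
        rw [Finset.sum_filter]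
        refine Finset.sum_congr rfl fun j _ => ?_
        by_cases hs : s ≤ h j <;> simp [Set.indicator, hs]
    _ = C * K := by simp

variable {ι : Type*} [Fintype ι] [DecidableEq ι]

/-- Excess of the number of ghost points in `A` over twice the number of sample points in `A`;
the sample points are the points `(m, σ m)`, the ghost points are the points `(m, !σ m)`. -/
def signExcess (A : Finset (ι × Bool)) (σ : ι → Bool) : ℝ :=
  ∑ m, ((if (m, !σ m) ∈ A then 1 else 0) - 2 * (if (m, σ m) ∈ A then 1 else 0))

/-- The exponential factorizes over the pairs. The exponent `log (3 / 2)` makes each pair contribute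
at most `2`: the contribution is `2` if no point is in `A`, `3 / 2 + 4 / 9` for one point, and `4 /
3` for both. The factor `2` in front of the sample points provides the negative drift. -/
theorem sum_exp_signExcess_le (A : Finset (ι × Bool)) :
    ∑ σ : ι → Bool, Real.exp (Real.log (3 / 2) * signExcess A σ) ≤ 2 ^ Fintype.card ι := by
  set g : ι → Bool → ℝ := fun m b => Real.exp (Real.log (3 / 2) *
    ((if (m, !b) ∈ A then 1 else 0) - 2 * (if (m, b) ∈ A then 1 else 0))) with hg
  have e : ∀ σ : ι → Bool, Real.exp (Real.log (3 / 2) * signExcess A σ) = ∏ m, g m (σ m) := by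
    intro σ
    rw [signExcess, Finset.mul_sum, Real.exp_sum]
  have hprod : ∑ σ : ι → Bool, ∏ m, g m (σ m) = ∏ m, ∑ b, g m b := by
    rw [Finset.prod_univ_sum, Fintype.piFinset_univ]
  simp_rw [e]
  rw [hprod]
  refine (Finset.prod_le_prod (fun m _ => Finset.sum_nonneg fun b _ => (Real.exp_pos _).le)
    (g := fun _ => (2 : ℝ)) fun m _ => ?_).trans (by simp)
  have h1 : Real.exp (Real.log (3 / 2)) = 3 / 2 := Real.exp_log (by norm_num)
  have h2 : Real.exp (Real.log (3 / 2) * -2) = 4 / 9 := by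
    rw [mul_comm, neg_mul, Real.exp_neg, two_mul, Real.exp_add, h1]; norm_num
  have h3 : Real.exp (Real.log (3 / 2) * -1) = 2 / 3 := by
    rw [mul_comm, neg_mul, Real.exp_neg, one_mul, h1]; norm_num
  rw [Fintype.sum_bool]
  simp only [Bool.not_true, Bool.not_false]
  by_cases ha : (m, true) ∈ A <;> by_cases hb : (m, false) ∈ A
  · simp only [ha, hb, if_true]
    rw [show (1 : ℝ) - 2 * 1 = -1 by norm_num, h3]; norm_num
  · simp only [ha, hb, if_true, if_false, mul_zero, mul_one, sub_zero, zero_sub]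
    rw [h1, h2]; norm_num
  · simp only [ha, hb, if_true, if_false, mul_zero, mul_one, sub_zero, zero_sub]
    rw [h1, h2]; norm_num
  · simp only [ha, hb, if_false, mul_zero, sub_zero, Real.exp_zero]; norm_num

/-- The function may depend on the signs, so the excess has to be controlled for all sets of `𝒜` at
once. Averaging an exponential moment bound over `𝒜` costs `log |𝒜|`, and the layer-cake formula
passes from sets to functions. -/
theorem sum_sign_le {𝒜 : Finset (Finset (ι × Bool))} (h𝒜 : 𝒜.Nonempty) {C : ℝ} (hC : 0 ≤ C)
    {h : (ι → Bool) → ι × Bool → ℝ} (h0 : ∀ σ j, 0 ≤ h σ j) (hhC : ∀ σ j, h σ j ≤ C)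
    (hlev : ∀ σ, ∀ s : ℝ, 0 < s → (Finset.univ.filter fun j => s ≤ h σ j) ∈ 𝒜) :
    ∑ σ : ι → Bool, ∑ m, (h σ (m, !σ m) - 2 * h σ (m, σ m))
      ≤ 2 ^ Fintype.card ι * (C * (Real.log 𝒜.card / Real.log (3 / 2))) := by
  set c := Real.log (3 / 2) with hc
  have hc0 : 0 < c := Real.log_pos (by norm_num)
  have hS : (0 : ℝ) < 𝒜.card := Nat.cast_pos.2 h𝒜.card_pos
  -- A linear majorant of the maximal excess, from `x + 1 ≤ exp x` at `x = c * signExcess - log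
  -- |𝒜|`. It can be averaged over the signs directly, and its average is at most `log |𝒜| / c`,
  -- since the `-1` cancels the averaged exponentials.
  set K : (ι → Bool) → ℝ := fun σ =>
    (Real.log 𝒜.card - 1 + (∑ A ∈ 𝒜, Real.exp (c * signExcess A σ)) / 𝒜.card) / c with hKdef
  have hAK : ∀ σ, ∀ A ∈ 𝒜, signExcess A σ ≤ K σ := by
    intro σ A hA
    rw [hKdef, le_div_iff₀ hc0]
    have h1 := Real.add_one_le_exp (c * signExcess A σ - Real.log 𝒜.card)
    rw [Real.exp_sub, Real.exp_log hS] at h1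
    have h2 : Real.exp (c * signExcess A σ) ≤ ∑ A ∈ 𝒜, Real.exp (c * signExcess A σ) :=
      Finset.single_le_sum (f := fun A => Real.exp (c * signExcess A σ))
        (fun A _ => (Real.exp_pos _).le) hA
    have h3 := div_le_div_of_nonneg_right h2 hS.le
    linarith
  have hσ : ∀ σ, ∑ m, (h σ (m, !σ m) - 2 * h σ (m, σ m)) ≤ C * K σ := by
    intro σ
    have hform : ∀ F : ι × Bool → ℝ, ∑ m, (F (m, !σ m) - 2 * F (m, σ m))
        = ∑ j : ι × Bool, (if j.2 = σ j.1 then -2 else 1) * F j := by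
      intro F
      rw [Fintype.sum_prod_type]
      refine Finset.sum_congr rfl fun m _ => ?_
      rw [Fintype.sum_bool]
      cases σ m <;> simp <;> ring
    rw [hform]
    refine sum_mul_le_of_superlevel hC (h0 σ) (hhC σ) fun s hs => ?_
    refine (le_of_eq ?_).trans (hAK σ _ (hlev σ s hs))
    rw [signExcess]
    have := hform (fun j => if j ∈ Finset.univ.filter (fun j => s ≤ h σ j) then 1 else 0)
    rw [this, Finset.sum_filter]
    refine Finset.sum_congr rfl fun j _ => ?_
    by_cases hj : s ≤ h σ j <;> simp [hj]
  calc _ ≤ ∑ σ, C * K σ := Finset.sum_le_sum fun σ _ => hσ σ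
    _ = C * ((2 ^ Fintype.card ι * (Real.log 𝒜.card - 1)
          + (∑ A ∈ 𝒜, ∑ σ : ι → Bool, Real.exp (c * signExcess A σ)) / 𝒜.card) / c) := by
        rw [← Finset.mul_sum]
        simp only [hKdef]
        rw [← Finset.sum_div, Finset.sum_add_distrib, ← Finset.sum_div, Finset.sum_comm, Finset.sum_const,
          Finset.card_univ, Fintype.card_fun, Fintype.card_bool, nsmul_eq_mul]
        push_cast
        rfl
    _ ≤ C * ((2 ^ Fintype.card ι * (Real.log 𝒜.card - 1)
          + (∑ _A ∈ 𝒜, (2 : ℝ) ^ Fintype.card ι) / 𝒜.card) / c) := by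
        gcongr with A _
        exact sum_exp_signExcess_le A
    _ = _ := by
        rw [Finset.sum_const, nsmul_eq_mul]
        field_simp
        ring

/-- Averaged over all exchanges of sample points and ghost points, the squared error of a
truncated function on the ghost sample is at most twice that on the sample, up to a
complexity term. -/
theorem sum_sign_trunc_le {V : Submodule ℝ (ι × Bool → ℝ)} {g : ι × Bool → ℝ} {L : ℝ} {K : ℕ}
    (hV : Module.finrank ℝ V ≤ K) (hL : 0 ≤ L) (hg : ∀ j, |g j| ≤ L)
    {φ : (ι → Bool) → ι × Bool → ℝ} (hφ : ∀ σ, φ σ ∈ V) (hι : 1 ≤ Fintype.card ι) :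
    ∑ σ : ι → Bool, ∑ m, ((trunc L (φ σ (m, !σ m)) - g (m, !σ m)) ^ 2
        - 2 * (trunc L (φ σ (m, σ m)) - g (m, σ m)) ^ 2)
      ≤ 2 ^ Fintype.card ι * (2028 * (K + 1) * Real.log (3 * Fintype.card ι) * L ^ 2) := by
  obtain ⟨𝒜, h𝒜, hcard, hlev⟩ := exists_superlevel_family hV hg
  have hsq : ∀ σ j, (trunc L (φ σ j) - g j) ^ 2 ≤ 4 * L ^ 2 := by
    intro σ j
    have h1 := abs_le.1 (abs_trunc_le hL (φ σ j))
    have h2 := abs_le.1 (hg j)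
    nlinarith
  refine (sum_sign_le h𝒜 (C := 4 * L ^ 2) (by positivity)
    (h := fun σ j => (trunc L (φ σ j) - g j) ^ 2) (fun σ j => sq_nonneg _) hsq
    (fun σ s hs => hlev _ (hφ σ) s hs)).trans ?_
  have hn : (1 : ℝ) ≤ Fintype.card ι := by exact_mod_cast hι
  set n : ℝ := (Fintype.card ι : ℝ) with hn'
  have hlog3 : 0 ≤ Real.log (3 * n) := Real.log_nonneg (by linarith)
  have hlog : Real.log 𝒜.card ≤ 4 * (K + 1) * Real.log (3 * n) := by
    have hS : (0 : ℝ) < 𝒜.card := Nat.cast_pos.2 h𝒜.card_pos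
    have h1 : (𝒜.card : ℝ) ≤ (2 * n + 1) ^ (2 * (K + 2)) := by
      have : (𝒜.card : ℝ) ≤ ((Fintype.card (ι × Bool) + 1 : ℕ) : ℝ) ^ (2 * (K + 2)) := by
        exact_mod_cast hcard
      refine this.trans (le_of_eq ?_)
      rw [Fintype.card_prod, Fintype.card_bool]
      push_cast
      rw [hn']; ring
    calc Real.log 𝒜.card ≤ Real.log ((2 * n + 1) ^ (2 * (K + 2))) := Real.log_le_log hS h1
      _ = 2 * (K + 2) * Real.log (2 * n + 1) := by rw [Real.log_pow]; push_cast; ring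
      _ ≤ 2 * (K + 2) * Real.log (3 * n) := by
          gcongr; linarith
      _ ≤ _ := by
          gcongr ?_ * _
          have : (0 : ℝ) ≤ K := Nat.cast_nonneg K
          linarith
  have hc : (1 : ℝ) / 3 ≤ Real.log (3 / 2) := by
    have := Real.one_sub_inv_le_log_of_pos (x := 3 / 2) (by norm_num)
    norm_num at this ⊢
    linarith
  have hdiv : Real.log 𝒜.card / Real.log (3 / 2) ≤ 12 * (K + 1) * Real.log (3 * n) := by
    rw [div_le_iff₀ (by linarith)]
    have : 0 ≤ (K + 1) * Real.log (3 * n) := by positivity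
    nlinarith
  refine mul_le_mul_of_nonneg_left ?_ (by positivity)
  -- The estimate has the constant `4 * 12 = 48`, well below the prescribed `2028`.
  calc 4 * L ^ 2 * (Real.log 𝒜.card / Real.log (3 / 2))
      ≤ 4 * L ^ 2 * (12 * (K + 1) * Real.log (3 * n)) := by gcongr
    _ ≤ _ := by
        have : 0 ≤ (K + 1) * Real.log (3 * n) * L ^ 2 := by positivity
        nlinarith

end Signs

end MWLS


namespace MWLS

/-! ### Comparison of the empirical and the true norm by a ghost sample -/

section GhostSample

variable {E 𝒳 𝒰 Ω' : Type*} [MeasurableSpace E] [MeasurableSpace 𝒳] [MeasurableSpace 𝒰]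
  [MeasurableSpace Ω']

/-- The exchange acts separately on the pairs formed by a sample point and its ghost, and `μ.prod μ`
is invariant under swapping. The two outer maps only regroup the coordinates into pairs. -/
theorem measurePreserving_exchange (μ : Measure E) [IsProbabilityMeasure μ] {n : ℕ}
    (σ : Fin n → Bool) :
    MeasurePreserving (fun D : (Fin n → E) × (Fin n → E) =>
      ((fun m => if σ m then D.2 m else D.1 m), (fun m => if σ m then D.1 m else D.2 m)))
      ((Measure.pi fun _ => μ).prod (Measure.pi fun _ => μ))
      ((Measure.pi fun _ => μ).prod (Measure.pi fun _ => μ)) := by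
  have h1 := measurePreserving_arrowProdEquivProdArrow E E (Fin n) (fun _ => μ) (fun _ => μ)
  have h2 : MeasurePreserving
      (fun (a : Fin n → E × E) m => (if σ m then Prod.swap else id) (a m))
      (Measure.pi fun _ => μ.prod μ) (Measure.pi fun _ => μ.prod μ) := by
    refine measurePreserving_pi _ _ (f := fun m => if σ m then Prod.swap else id) fun m => ?_
    cases σ m
    · simpa using MeasurePreserving.id _
    · simpa using Measure.measurePreserving_swap
  have h3 := (h1.comp h2).comp (h1.symm _)
  refine (Eq.subst (motive := fun f => MeasurePreserving f _ _) ?_ h3)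
  funext D
  refine Prod.ext ?_ ?_ <;> funext m <;>
  · simp only [Function.comp, MeasurableEquiv.arrowProdEquivProdArrow,
      Equiv.arrowProdEquivProdArrow]
    cases h : σ m <;> simp [h]

variable {n K : ℕ}

theorem measurable_trunc (L : ℝ) : Measurable (trunc L) := by
  unfold trunc; fun_prop

theorem sq_trunc_sub_le {L : ℝ} (hL : 0 ≤ L) {y : ℝ} (hy : |y| ≤ L) (x : ℝ) :
    (trunc L x - y) ^ 2 ≤ 4 * L ^ 2 := by
  have h1 := abs_le.1 (abs_trunc_le hL x)
  have h2 := abs_le.1 hy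
  nlinarith

theorem integrable_of_bounded {α : Type*} [MeasurableSpace α] {μ : Measure α}
    [IsFiniteMeasure μ] {f : α → ℝ} (hf : Measurable f) {C : ℝ} (hC : ∀ a, |f a| ≤ C) :
    Integrable f μ :=
  (integrable_const C).mono' hf.aestronglyMeasurable (Eventually.of_forall hC)

/-- On the ghost sample, independent of the fitted function, the mean empirical norm equals the mean
true norm. The exchanges preserve the joint law, so the integrand may be averaged over all of them,
and `sum_sign_trunc_le` bounds this average pointwise. After each exchange the fitted function is a
different one, but all of them have traces in one space of dimension at most `K` on the same `2n`
points. The span condition is stated only at these points. -/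
theorem integral_ghost_le (μ : Measure E) [IsProbabilityMeasure μ] {π : E → 𝒳}
    (hπ : Measurable π) (hn : 1 ≤ n) (b : Fin K → 𝒳 → ℝ) {g : 𝒳 → ℝ} (hg : Measurable g)
    {L : ℝ} (hL : 0 ≤ L) (hgL : ∀ x, |g x| ≤ L) {ψ : (Fin n → E) → 𝒳 → ℝ}
    (hψ : Measurable (Function.uncurry ψ))
    (hspan : ∀ᵐ D ∂((Measure.pi fun _ : Fin n => μ).prod (Measure.pi fun _ : Fin n => μ)),
      ∃ φ ∈ Submodule.span ℝ (Set.range b), ∀ m, φ (π (D.1 m)) = ψ D.1 (π (D.1 m)) ∧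
        φ (π (D.2 m)) = ψ D.1 (π (D.2 m))) :
    ∫ D, ∫ x, (trunc L (ψ D x) - g x) ^ 2 ∂(μ.map π) ∂(Measure.pi fun _ : Fin n => μ)
      ≤ 2 * ∫ D, (1 / n : ℝ) * ∑ m, (trunc L (ψ D (π (D m))) - g (π (D m))) ^ 2
          ∂(Measure.pi fun _ : Fin n => μ)
        + 2028 * (K + 1) * Real.log (3 * n) / n * L ^ 2 := by
  set ρ := Measure.pi fun _ : Fin n => μ with hρ
  have hn0 : (0 : ℝ) < n := by exact_mod_cast hn
  have := Measure.isProbabilityMeasure_map (μ := μ) hπ.aemeasurable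
  set F : (Fin n → E) → 𝒳 → ℝ := fun D x => (trunc L (ψ D x) - g x) ^ 2 with hF
  have hFm : Measurable (Function.uncurry F) :=
    (((measurable_trunc L).comp hψ).sub (hg.comp measurable_snd)).pow_const 2
  have hF4 : ∀ D x, |F D x| ≤ 4 * L ^ 2 := fun D x => by
    rw [abs_of_nonneg (sq_nonneg _)]; exact sq_trunc_sub_le hL (hgL x) _
  have hFs : ∀ m, Measurable fun D : Fin n → E => F D (π (D m)) := fun m =>
    hFm.comp (measurable_id.prodMk (hπ.comp (measurable_pi_apply m)))
  have hFg : ∀ m, Measurable fun D : (Fin n → E) × (Fin n → E) => F D.1 (π (D.2 m)) := fun m =>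
    hFm.comp (measurable_fst.prodMk (hπ.comp ((measurable_pi_apply m).comp measurable_snd)))
  have hFs' : ∀ m, Measurable fun D : (Fin n → E) × (Fin n → E) => F D.1 (π (D.1 m)) := fun m =>
    (hFs m).comp measurable_fst
  -- the two norms as integrals over sample and ghost sample
  have eghost : ∀ m, ∫ D, F D.1 (π (D.2 m)) ∂(ρ.prod ρ) = ∫ D, ∫ x, F D x ∂(μ.map π) ∂ρ := by
    intro m
    rw [integral_prod _ (integrable_of_bounded (hFg m) fun D => hF4 _ _)]
    refine integral_congr_ae (Eventually.of_forall fun D => ?_)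
    have hmp := measurePreserving_eval (fun _ : Fin n => μ) m
    have hFD : Measurable fun x => F D x := hFm.comp measurable_prodMk_left
    have e1 : μ.map π = ρ.map (fun D' => π (D' m)) := by
      rw [← hmp.map_eq, Measure.map_map hπ hmp.measurable]; rfl
    simp only
    have hpm : Measurable fun D' : Fin n → E => π (D' m) := hπ.comp (measurable_pi_apply m)
    rw [e1, integral_map hpm.aemeasurable hFD.aestronglyMeasurable]
  have esample : ∀ m, ∫ D, F D.1 (π (D.1 m)) ∂(ρ.prod ρ) = ∫ D, F D (π (D m)) ∂ρ := by
    intro m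
    have := (measurePreserving_fst (μ := ρ) (ν := ρ)).map_eq
    conv_rhs => rw [← this]
    rw [integral_map measurable_fst.aemeasurable (hFs m).aestronglyMeasurable]
  set R : (Fin n → E) × (Fin n → E) → ℝ := fun D =>
    ∑ m, (F D.1 (π (D.2 m)) - 2 * F D.1 (π (D.1 m))) with hR
  have hRm : Measurable R := Finset.measurable_sum _ fun m _ => (hFg m).sub ((hFs' m).const_mul 2)
  have hRint : Integrable R (ρ.prod ρ) := integrable_finsetSum _ fun m _ =>
    (integrable_of_bounded (hFg m) fun D => hF4 _ _).sub
      ((integrable_of_bounded (hFs' m) fun D => hF4 _ _).const_mul 2)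
  have eR : ∫ D, R D ∂(ρ.prod ρ) = n * (∫ D, ∫ x, F D x ∂(μ.map π) ∂ρ)
      - 2 * ∑ m, ∫ D, F D (π (D m)) ∂ρ := by
    have hsumint : ∀ m ∈ (Finset.univ : Finset (Fin n)), Integrable
        (fun D : (Fin n → E) × (Fin n → E) => F D.1 (π (D.2 m)) - 2 * F D.1 (π (D.1 m)))
        (ρ.prod ρ) := fun m _ => (integrable_of_bounded (hFg m) fun D => hF4 _ _).sub
        ((integrable_of_bounded (hFs' m) fun D => hF4 _ _).const_mul 2)
    simp only [hR]
    rw [integral_finsetSum _ hsumint]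
    have : ∀ m, ∫ D, (F D.1 (π (D.2 m)) - 2 * F D.1 (π (D.1 m))) ∂(ρ.prod ρ)
        = (∫ D, ∫ x, F D x ∂(μ.map π) ∂ρ) - 2 * ∫ D, F D (π (D m)) ∂ρ := fun m => by
      rw [integral_sub (integrable_of_bounded (hFg m) fun D => hF4 _ _)
        ((integrable_of_bounded (hFs' m) fun D => hF4 _ _).const_mul 2),
        integral_const_mul, eghost, esample]
    simp_rw [this]
    rw [Finset.sum_sub_distrib, ← Finset.mul_sum]
    simp
  -- symmetrization
  set s : (Fin n → Bool) → (Fin n → E) × (Fin n → E) → (Fin n → E) × (Fin n → E) := fun σ D =>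
    ((fun m => if σ m then D.2 m else D.1 m), (fun m => if σ m then D.1 m else D.2 m)) with hs
  have hsmp : ∀ σ, MeasurePreserving (s σ) (ρ.prod ρ) (ρ.prod ρ) :=
    fun σ => measurePreserving_exchange μ σ
  have hsR : ∀ σ, ∫ D, R (s σ D) ∂(ρ.prod ρ) = ∫ D, R D ∂(ρ.prod ρ) := fun σ => by
    conv_rhs => rw [← (hsmp σ).map_eq]
    rw [integral_map (hsmp σ).measurable.aemeasurable hRm.aestronglyMeasurable]
  have hsRint : ∀ σ, Integrable (fun D => R (s σ D)) (ρ.prod ρ) := fun σ =>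
    (hsmp σ).integrable_comp_of_integrable hRint
  have hgood : ∀ᵐ D ∂(ρ.prod ρ), ∀ σ, ∃ φ ∈ Submodule.span ℝ (Set.range b), ∀ m,
      φ (π ((s σ D).1 m)) = ψ (s σ D).1 (π ((s σ D).1 m)) ∧
        φ (π ((s σ D).2 m)) = ψ (s σ D).1 (π ((s σ D).2 m)) := by
    rw [ae_all_iff]
    intro σ
    exact (hsmp σ).quasiMeasurePreserving.ae hspan
  have hpt : ∀ᵐ D ∂(ρ.prod ρ), ∑ σ, R (s σ D)
      ≤ 2 ^ n * (2028 * (K + 1) * Real.log (3 * n) * L ^ 2) := by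
    filter_upwards [hgood] with D hD
    choose φ hφ hφψ using hD
    -- The `2n` points do not depend on `σ`; the signs only tell which of them form the sample.
    set pt : Fin n × Bool → 𝒳 := fun j => π (if j.2 then D.2 j.1 else D.1 j.1) with hpt
    set ℓ : (𝒳 → ℝ) →ₗ[ℝ] (Fin n × Bool → ℝ) := LinearMap.funLeft ℝ ℝ pt with hℓ
    have hdim : Module.finrank ℝ ((Submodule.span ℝ (Set.range b)).map ℓ) ≤ K := by
      rw [Submodule.map_span, ← Set.range_comp]
      refine (finrank_range_le_card (R := ℝ) (ℓ ∘ b)).trans ?_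
      simp
    have := sum_sign_trunc_le (V := (Submodule.span ℝ (Set.range b)).map ℓ)
      (g := fun j => g (pt j)) (φ := fun σ => ℓ (φ σ)) hdim hL (fun j => hgL _)
      (fun σ => Submodule.mem_map_of_mem (hφ σ)) (by simpa using hn)
    rw [Fintype.card_fin] at this
    refine (le_of_eq ?_).trans this
    refine Finset.sum_congr rfl fun σ _ => Finset.sum_congr rfl fun m _ => ?_
    have e1 : π ((s σ D).2 m) = pt (m, !σ m) := by
      simp only [hs, hpt]; cases σ m <;> simp
    have e2 : π ((s σ D).1 m) = pt (m, σ m) := by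
      simp only [hs, hpt]
    simp only [hF]
    rw [← (hφψ σ m).1, ← (hφψ σ m).2, e1, e2]
    rfl
  have hmain : 2 ^ n * ∫ D, R D ∂(ρ.prod ρ)
      ≤ 2 ^ n * (2028 * (K + 1) * Real.log (3 * n) * L ^ 2) := by
    have h1 := integral_mono_ae (integrable_finsetSum _ fun σ _ => hsRint σ)
      (integrable_const _) hpt
    rw [integral_finsetSum _ fun σ _ => hsRint σ] at h1
    simp_rw [hsR] at h1
    simpa using h1
  have hR' := le_of_mul_le_mul_left hmain (by positivity)
  rw [eR] at hR'
  have e3 : ∫ D, (1 / n : ℝ) * ∑ m, (trunc L (ψ D (π (D m))) - g (π (D m))) ^ 2 ∂ρ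
      = (1 / n : ℝ) * ∑ m, ∫ D, F D (π (D m)) ∂ρ := by
    rw [integral_const_mul, integral_finsetSum _ fun m _ =>
      integrable_of_bounded (hFs m) fun D => hF4 _ _]
  rw [e3]
  have h5 : ∫ D, ∫ x, F D x ∂(μ.map π) ∂ρ
      ≤ (2 * ∑ m, ∫ D, F D (π (D m)) ∂ρ + 2028 * (K + 1) * Real.log (3 * n) * L ^ 2) / n := by
    rw [le_div_iff₀ hn0]; linarith
  refine h5.trans (le_of_eq ?_)
  ring

/-- The span is closed and rational combinations are dense in it, so membership is a countable
condition. Measurability is needed to transport an almost sure membership to an image law. -/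
theorem measurableSet_mem_span {α : Type*} [MeasurableSpace α] {V : Type*}
    [NormedAddCommGroup V] [NormedSpace ℝ V] [FiniteDimensional ℝ V] [MeasurableSpace V]
    [BorelSpace V] {w : Fin K → α → V} (hw : ∀ k, Measurable (w k)) {v : α → V}
    (hv : Measurable v) :
    MeasurableSet {a | v a ∈ Submodule.span ℝ (Set.range fun k => w k a)} := by
  have : ProperSpace V := FiniteDimensional.proper_real V
  have e : {a | v a ∈ Submodule.span ℝ (Set.range fun k => w k a)}
      = ⋂ j : ℕ, ⋃ c : Fin K → ℚ, {a | ‖v a - ∑ k, (c k : ℝ) • w k a‖ < 1 / (j + 1 : ℝ)} := by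
    ext a
    simp only [Set.mem_ofPred_eq, Set.mem_iInter, Set.mem_iUnion]
    constructor
    · intro h j
      obtain ⟨c, hc⟩ := (Submodule.mem_span_range_iff_exists_fun ℝ).1 h
      have hcont : Continuous fun c : Fin K → ℝ => ‖v a - ∑ k, c k • w k a‖ := by fun_prop
      have hopen : IsOpen {c : Fin K → ℝ | ‖v a - ∑ k, c k • w k a‖ < 1 / (j + 1 : ℝ)} :=
        isOpen_lt hcont continuous_const
      have hdense : DenseRange (Pi.map fun (_ : Fin K) (x : ℚ) => (x : ℝ)) :=
        DenseRange.piMap fun _ => Rat.denseRange_cast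
      obtain ⟨c', hc'⟩ := hdense.exists_mem_open hopen ⟨c, by
        simp only [Set.mem_ofPred_eq, hc, sub_self, norm_zero]; positivity⟩
      exact ⟨c', hc'⟩
    · intro h
      have hcl : IsClosed (Submodule.span ℝ (Set.range fun k => w k a) : Set V) :=
        Submodule.closed_of_finiteDimensional _
      have : v a ∈ closure (Submodule.span ℝ (Set.range fun k => w k a) : Set V) := by
        rw [Metric.mem_closure_iff]
        intro ε hε
        obtain ⟨j, hj⟩ := exists_nat_one_div_lt hε
        obtain ⟨c, hc⟩ := h j
        refine ⟨∑ k, (c k : ℝ) • w k a, Submodule.sum_mem _ fun k _ =>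
          Submodule.smul_mem _ _ (Submodule.subset_span ⟨k, rfl⟩), ?_⟩
        rw [dist_eq_norm]; exact hc.trans hj
      rwa [hcl.closure_eq] at this
  rw [e]
  refine MeasurableSet.iInter fun j => MeasurableSet.iUnion fun c => ?_
  refine measurableSet_lt ?_ measurable_const
  exact (hv.sub (Finset.measurable_sum _ fun k _ => (hw k).const_smul _)).norm

/-- Comparison of the norms for a random function that depends on the sample `D` and on an
independent variable `U`. -/
theorem integral_sq_le_of_law {P' : Measure Ω'} [IsProbabilityMeasure P'] {μ : Measure E}
    [IsProbabilityMeasure μ] {U : Ω' → 𝒰} (hU : Measurable U) {D : Ω' → Fin n → E}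
    (hD : Measurable D)
    (hlaw : P'.map (fun ω => (U ω, D ω)) = (P'.map U).prod (Measure.pi fun _ => μ))
    {π : E → 𝒳} (hπ : Measurable π) (hn : 1 ≤ n) {b : Fin K → 𝒳 → ℝ}
    (hb : ∀ k, Measurable (b k)) {g : 𝒳 → ℝ} (hg : Measurable g) {L : ℝ} (hL : 0 ≤ L)
    (hgL : ∀ᵐ x ∂(μ.map π), |g x| ≤ L)
    {ψ : (𝒰 × (Fin n → E)) × 𝒳 → ℝ} (hψ : Measurable ψ)
    (hspan : ∀ᵐ ω ∂P', (fun x => ψ ((U ω, D ω), x)) ∈ Submodule.span ℝ (Set.range b))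
    (hDg : ∀ᵐ ω ∂P', ∀ m, |g (π (D ω m))| ≤ L) :
    ∫ ω, ∫ x, (g x - trunc L (ψ ((U ω, D ω), x))) ^ 2 ∂(μ.map π) ∂P'
      ≤ 2 * ∫ ω, (1 / n : ℝ) * ∑ m, (g (π (D ω m)) - trunc L (ψ ((U ω, D ω), π (D ω m)))) ^ 2 ∂P'
        + 2028 * (K + 1) * Real.log (3 * n) / n * L ^ 2 := by
  have := Measure.isProbabilityMeasure_map (μ := μ) hπ.aemeasurable
  have := Measure.isProbabilityMeasure_map (μ := P') hU.aemeasurable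
  -- The bound on `g` only holds almost everywhere; its truncation is bounded everywhere and equals
  -- `g` where that matters.
  set g' : 𝒳 → ℝ := fun x => trunc L (g x) with hg'
  have hg'm : Measurable g' := (measurable_trunc L).comp hg
  have hg'L : ∀ x, |g' x| ≤ L := fun x => abs_trunc_le hL _
  have hgg' : ∀ y : ℝ, |y| ≤ L → trunc L y = y := fun y hy => by
    obtain ⟨h1, h2⟩ := abs_le.1 hy
    unfold trunc; rw [min_eq_left h2, max_eq_right h1]
  have hUD : Measurable fun ω => (U ω, D ω) := hU.prodMk hD
  set F : (𝒰 × (Fin n → E)) × 𝒳 → ℝ := fun a => (trunc L (ψ a) - g' a.2) ^ 2 with hF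
  have hFm : Measurable F := ((measurable_trunc L).comp hψ |>.sub (hg'm.comp measurable_snd)).pow_const 2
  have hF4 : ∀ a, |F a| ≤ 4 * L ^ 2 := fun a => by
    rw [abs_of_nonneg (sq_nonneg _)]; exact sq_trunc_sub_le hL (hg'L _) _
  set A : 𝒰 × (Fin n → E) → ℝ := fun a => ∫ x, F (a, x) ∂(μ.map π) with hA
  set S : 𝒰 × (Fin n → E) → ℝ := fun a => (1 / n : ℝ) * ∑ m, F (a, π (a.2 m)) with hS
  have hAm : Measurable A := (hFm.stronglyMeasurable.integral_prod_right').measurable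
  have hSm : Measurable S := (Finset.measurable_sum _ fun m _ => hFm.comp
    (measurable_id.prodMk (hπ.comp ((measurable_pi_apply m).comp measurable_snd)))).const_mul _
  have hn0 : (0 : ℝ) < n := by exact_mod_cast hn
  have hA4 : ∀ a, |A a| ≤ 4 * L ^ 2 := fun a => by
    have := norm_integral_le_of_norm_le_const (μ := μ.map π) (f := fun x => F (a, x))
      (Eventually.of_forall fun x => hF4 (a, x))
    simpa using this
  have hS4 : ∀ a, |S a| ≤ 4 * L ^ 2 := fun a => by
    have h1 : |∑ m, F (a, π (a.2 m))| ≤ n * (4 * L ^ 2) := by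
      refine (Finset.abs_sum_le_sum_abs _ _).trans ?_
      refine (Finset.sum_le_sum fun m _ => hF4 _).trans ?_
      simp
    simp only [hS]
    rw [abs_mul, abs_of_nonneg (by positivity : (0 : ℝ) ≤ 1 / n)]
    calc (1 / n : ℝ) * |∑ m, F (a, π (a.2 m))| ≤ 1 / n * (n * (4 * L ^ 2)) := by gcongr
      _ = _ := by field_simp
  set ρ := Measure.pi fun _ : Fin n => μ with hρ
  have hspan' : ∀ᵐ u ∂(P'.map U), ∀ᵐ d ∂(ρ.prod ρ),
      ∃ φ ∈ Submodule.span ℝ (Set.range b), ∀ m, φ (π (d.1 m)) = ψ ((u, d.1), π (d.1 m)) ∧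
        φ (π (d.2 m)) = ψ ((u, d.1), π (d.2 m)) := by
    let pt : (𝒰 × (Fin n → E)) × (Fin n → E) → Fin n × Bool → 𝒳 := fun a j =>
      π (if j.2 then a.2 j.1 else a.1.2 j.1)
    have hpt : ∀ j, Measurable fun a => pt a j := fun j => by
      refine hπ.comp ?_
      cases h : j.2
      · simp only [Bool.false_eq_true, if_false]; fun_prop
      · simp only [if_true]; fun_prop
    -- Membership of a function in the span need not be measurable. Evaluated at the `2n` points it
    -- becomes membership in a span in a finite-dimensional space, which is.
    set good : Set ((𝒰 × (Fin n → E)) × (Fin n → E)) :=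
      {a | (fun j => ψ (a.1, pt a j)) ∈ Submodule.span ℝ (Set.range fun k j => b k (pt a j))}
      with hgood
    have hmeas : MeasurableSet good := measurableSet_mem_span
      (fun k => measurable_pi_lambda _ fun j => (hb k).comp (hpt j))
      (measurable_pi_lambda _ fun j => hψ.comp (measurable_fst.prodMk (hpt j)))
    have hP : ∀ᵐ a ∂(P'.prod ρ), ((U a.1, D a.1), a.2) ∈ good := by
      have : ∀ᵐ a ∂(P'.prod ρ),
          (fun x => ψ ((U a.1, D a.1), x)) ∈ Submodule.span ℝ (Set.range b) :=
        (Measure.quasiMeasurePreserving_fst (μ := P') (ν := ρ)).ae hspan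
      filter_upwards [this] with a ha
      have := Submodule.mem_map_of_mem (f := LinearMap.funLeft ℝ ℝ (pt ((U a.1, D a.1), a.2))) ha
      rw [Submodule.map_span, ← Set.range_comp] at this
      exact this
    have hmap : (P'.prod ρ).map (fun a => ((U a.1, D a.1), a.2))
        = ((P'.map U).prod ρ).prod ρ := by
      have := Measure.map_prod_map P' ρ hUD measurable_id
      rw [Measure.map_id, hlaw] at this
      rw [this]; rfl
    have hae : ∀ᵐ a ∂(((P'.map U).prod ρ).prod ρ), a ∈ good := by
      have hm : AEMeasurable (fun a : Ω' × (Fin n → E) => ((U a.1, D a.1), a.2)) (P'.prod ρ) := by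
        fun_prop
      rw [← hmap]
      exact (ae_map_iff hm hmeas).2 hP
    -- Regrouping the factors isolates `u`, so that the condition holds for almost every fixed `u`
    -- and almost every pair of samples.
    have hassoc : ∀ᵐ a ∂((P'.map U).prod (ρ.prod ρ)), ((a.1, a.2.1), a.2.2) ∈ good := by
      have h1 := (measurePreserving_prodAssoc (P'.map U) ρ ρ).symm
      exact h1.quasiMeasurePreserving.ae hae
    filter_upwards [Measure.ae_ae_of_ae_prod hassoc] with u hu
    filter_upwards [hu] with d hd
    have hd' : (fun j => ψ ((u, d.1), pt ((u, d.1), d.2) j))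
        ∈ (Submodule.span ℝ (Set.range b)).map (LinearMap.funLeft ℝ ℝ (pt ((u, d.1), d.2))) := by
      rw [Submodule.map_span, ← Set.range_comp]
      exact hd
    obtain ⟨φ, hφ, hφe⟩ := hd'
    refine ⟨φ, hφ, fun m => ⟨?_, ?_⟩⟩
    · simpa [pt, LinearMap.funLeft_apply] using congrFun hφe (m, false)
    · simpa [pt, LinearMap.funLeft_apply] using congrFun hφe (m, true)
  have e1 : ∫ ω, ∫ x, (g x - trunc L (ψ ((U ω, D ω), x))) ^ 2 ∂(μ.map π) ∂P'
      = ∫ u, ∫ d, A (u, d) ∂ρ ∂(P'.map U) := by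
    rw [← integral_prod A (by exact integrable_of_bounded hAm hA4), ← hlaw,
      integral_map hUD.aemeasurable hAm.aestronglyMeasurable]
    refine integral_congr_ae (Eventually.of_forall fun ω => ?_)
    refine integral_congr_ae (hgL.mono fun x hx => ?_)
    simp only [hF, hg', hgg' _ hx]; ring
  have e2 : ∫ ω, (1 / n : ℝ) * ∑ m, (g (π (D ω m)) - trunc L (ψ ((U ω, D ω), π (D ω m)))) ^ 2 ∂P'
      = ∫ u, ∫ d, S (u, d) ∂ρ ∂(P'.map U) := by
    rw [← integral_prod S (by exact integrable_of_bounded hSm hS4), ← hlaw,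
      integral_map hUD.aemeasurable hSm.aestronglyMeasurable]
    refine integral_congr_ae (hDg.mono fun ω hω => ?_)
    simp only [hS, hF, hg']
    congr 1
    refine Finset.sum_congr rfl fun m _ => ?_
    rw [hgg' _ (hω m)]; ring
  have hAint : Integrable A ((P'.map U).prod ρ) := integrable_of_bounded hAm hA4
  have hSint : Integrable S ((P'.map U).prod ρ) := integrable_of_bounded hSm hS4
  rw [e1, e2]
  have hu : ∀ᵐ u ∂(P'.map U), ∫ d, A (u, d) ∂ρ ≤ 2 * ∫ d, S (u, d) ∂ρ
      + 2028 * (K + 1) * Real.log (3 * n) / n * L ^ 2 := by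
    filter_upwards [hspan'] with u hu
    exact integral_ghost_le μ hπ hn b hg'm hL hg'L (ψ := fun d x => ψ ((u, d), x))
      (hψ.comp ((measurable_const.prodMk measurable_fst).prodMk measurable_snd)) hu
  refine (integral_mono_ae hAint.integral_prod_left
    ((hSint.integral_prod_left.const_mul 2).add (integrable_const _)) hu).trans (le_of_eq ?_)
  rw [integral_add' (hSint.integral_prod_left.const_mul 2) (integrable_const _),
    integral_const_mul]
  simp

end GhostSample

end MWLS


namespace MWLS

/-! ### Least squares projection -/

section Projection

variable {H : Type*} [NormedAddCommGroup H] [InnerProductSpace ℝ H] [FiniteDimensional ℝ H]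

theorem starProjection_eq_of_isMin {V : Submodule ℝ H} {s ψ : H} (hψ : ψ ∈ V)
    (hmin : ∀ w ∈ V, ‖ψ - s‖ ≤ ‖w - s‖) : V.starProjection s = ψ := by
  refine Submodule.eq_starProjection_of_mem_of_inner_eq_zero hψ ?_
  refine (V.norm_eq_iInf_iff_real_inner_eq_zero hψ).1 ?_
  refine le_antisymm (le_ciInf fun w => ?_) (ciInf_le ⟨0, ?_⟩ (⟨ψ, hψ⟩ : V))
  · rw [norm_sub_rev, norm_sub_rev s]; exact hmin w w.2
  · rintro _ ⟨w, rfl⟩; exact norm_nonneg _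

theorem norm_sub_starProjection_le (V : Submodule ℝ H) (v φ : H) (hφ : φ ∈ V) :
    ‖v - V.starProjection v‖ ≤ ‖v - φ‖ := by
  rw [V.starProjection_minimal]
  refine ciInf_le ⟨0, ?_⟩ (⟨φ, hφ⟩ : V)
  rintro _ ⟨w, rfl⟩; exact norm_nonneg _

/-- The Gram–Schmidt vectors are orthogonal, each a unit vector or zero, and span the same space, so
the coefficients along them give the projection. Unlike a chosen orthonormal basis, they depend
measurably on `f` even where its rank drops. -/
theorem norm_starProjection_span_gramSchmidt_le {K : ℕ} (f : Fin K → H) (ε : H) :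
    ‖(Submodule.span ℝ (Set.range f)).starProjection ε‖ ^ 2 ≤
      ∑ k, (inner ℝ (InnerProductSpace.gramSchmidtNormed ℝ f k) ε) ^ 2 := by
  classical
  set e := InnerProductSpace.gramSchmidtNormed ℝ f with he
  have horth : ∀ i j, i ≠ j → inner ℝ (e i) (e j) = 0 := by
    intro i j hij
    have h := InnerProductSpace.gramSchmidt_pairwise_orthogonal ℝ f hij
    simp only [he, InnerProductSpace.gramSchmidtNormed, inner_smul_left, inner_smul_right]
    have h' : inner ℝ (InnerProductSpace.gramSchmidt ℝ f i) (InnerProductSpace.gramSchmidt ℝ f j)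
      = 0 := h
    rw [h']; simp
  have hunit : ∀ i, e i = 0 ∨ ‖e i‖ = 1 := by
    intro i
    by_cases h : e i = 0
    · exact Or.inl h
    · exact Or.inr (InnerProductSpace.gramSchmidtNormed_unit_length' (𝕜 := ℝ) h)
  have hself : ∀ i, inner ℝ (e i) ε * inner ℝ (e i) (e i) = inner ℝ (e i) ε := by
    intro i
    rcases hunit i with h | h
    · simp [h]
    · rw [real_inner_self_eq_norm_sq, h]; simp
  have hinner : ∀ i, inner ℝ (e i) (∑ k, inner ℝ (e k) ε • e k) = inner ℝ (e i) ε := by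
    intro i
    rw [inner_sum, Finset.sum_eq_single i]
    · rw [inner_smul_right, hself]
    · intro j _ hj
      rw [inner_smul_right, horth i j (Ne.symm hj), mul_zero]
    · simp
  have hproj : (Submodule.span ℝ (Set.range f)).starProjection ε = ∑ k, inner ℝ (e k) ε • e k := by
    rw [← InnerProductSpace.span_gramSchmidt ℝ f,
      ← InnerProductSpace.span_gramSchmidtNormed_range (𝕜 := ℝ) f]
    refine Submodule.eq_starProjection_of_mem_of_inner_eq_zero
      (Submodule.sum_mem _ fun k _ => Submodule.smul_mem _ _ (Submodule.subset_span ⟨k, rfl⟩)) ?_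
    intro w hw
    induction hw using Submodule.span_induction with
    | mem x hx =>
      obtain ⟨k, rfl⟩ := hx
      rw [real_inner_comm, inner_sub_right, hinner, sub_self]
    | zero => simp
    | add x y _ _ hx hy => rw [inner_add_right, hx, hy, add_zero]
    | smul a x _ hx => rw [inner_smul_right, hx, mul_zero]
  rw [hproj, ← real_inner_self_eq_norm_sq, sum_inner]
  refine le_of_eq (Finset.sum_congr rfl fun k _ => ?_)
  rw [inner_smul_left, hinner, sq]; simp

omit [FiniteDimensional ℝ H] in
theorem norm_gramSchmidtNormed_le_one {K : ℕ} (f : Fin K → H) (k : Fin K) :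
    ‖InnerProductSpace.gramSchmidtNormed ℝ f k‖ ≤ 1 := by
  by_cases h : InnerProductSpace.gramSchmidtNormed ℝ f k = 0
  · rw [h]; simp
  · exact (InnerProductSpace.gramSchmidtNormed_unit_length' (𝕜 := ℝ) h).le

/-- By induction through the explicit recursion. It makes the projection directions measurable
functions of the design points. -/
theorem measurable_gramSchmidtNormed [MeasurableSpace H] [BorelSpace H] {α : Type*}
    [MeasurableSpace α] {K : ℕ} {f : α → Fin K → H} (hf : ∀ k, Measurable fun a => f a k)
    (k : Fin K) : Measurable fun a => InnerProductSpace.gramSchmidtNormed ℝ (f a) k := by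
  have key : ∀ k : Fin K, Measurable fun a => InnerProductSpace.gramSchmidt ℝ (f a) k := by
    intro k
    induction k using WellFoundedLT.induction with
    | ind k ih =>
      have hdef : (fun a => InnerProductSpace.gramSchmidt ℝ (f a) k) = fun a => f a k -
          ∑ i ∈ Finset.Iio k, (inner ℝ (InnerProductSpace.gramSchmidt ℝ (f a) i) (f a k) /
            ‖InnerProductSpace.gramSchmidt ℝ (f a) i‖ ^ 2) •
              InnerProductSpace.gramSchmidt ℝ (f a) i := by
        funext a
        rw [InnerProductSpace.gramSchmidt_def]
        simp only [Submodule.starProjection_singleton]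
        rfl
      rw [hdef]
      refine (hf k).sub (Finset.measurable_fun_sum _ fun i hi => ?_)
      have h := ih i (Finset.mem_Iio.1 hi)
      exact ((h.inner (hf k)).div ((h.norm.pow_const 2))).smul h
  simp_rw [InnerProductSpace.gramSchmidtNormed]
  exact (((key k).norm).inv).smul (key k)

end Projection

/-! ### Resampling one coordinate -/

section Noise

variable {E 𝒳 : Type*} [MeasurableSpace E] [MeasurableSpace 𝒳]

/-- Replacing one coordinate by an independent copy keeps the product law. Integrating out the copy
conditions on all other coordinates. -/
theorem measurePreserving_update (μ : Measure E) [IsProbabilityMeasure μ] {n : ℕ} (m : Fin n) :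
    MeasurePreserving (fun a : (Fin n → E) × E => Function.update a.1 m a.2)
      ((Measure.pi fun _ => μ).prod μ) (Measure.pi fun _ => μ) := by
  refine ⟨measurable_update' , ?_⟩
  refine (Measure.pi_eq fun s hs => ?_).symm
  rw [Measure.map_apply measurable_update' (MeasurableSet.univ_pi hs)]
  have : (fun a : (Fin n → E) × E => Function.update a.1 m a.2) ⁻¹' (Set.univ.pi s)
      = (Set.univ.pi fun i => if i = m then Set.univ else s i) ×ˢ s m := by
    ext a
    simp only [Set.mem_preimage, Set.mem_pi, Set.mem_univ, true_imp_iff, Set.mem_prod]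
    constructor
    · intro h
      refine ⟨fun i => ?_, by simpa using h m⟩
      by_cases hi : i = m
      · simp [hi]
      · simpa [hi] using h i
    · rintro ⟨h1, h2⟩ i
      by_cases hi : i = m
      · subst hi; simpa using h2
      · simpa [hi] using h1 i
  rw [this, Measure.prod_prod, Measure.pi_pi]
  rw [← Finset.prod_erase_mul Finset.univ
      (fun i => μ (if i = m then Set.univ else s i)) (Finset.mem_univ m),
    ← Finset.prod_erase_mul Finset.univ (fun i => μ (s i)) (Finset.mem_univ m)]
  simp only [↓reduceIte, measure_univ, mul_one]
  congr 1
  refine Finset.prod_congr rfl fun i hi => ?_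
  rw [if_neg (Finset.ne_of_mem_erase hi)]

variable {F : Type*} [NormedAddCommGroup F] [InnerProductSpace ℝ F] [FiniteDimensional ℝ F]
  [MeasurableSpace F] [BorelSpace F]

/-- The second moment of the coefficient of a centered noise along a unit vector which is a
function of the design. -/
theorem integral_inner_sq_le {μ : Measure E} [IsProbabilityMeasure μ] {n : ℕ} {π : E → 𝒳}
    (hπ : Measurable π) {ε : E → F} (hε : Measurable ε) (hε2 : MemLp ε 2 μ) {Γ : ℝ}
    (horth : ∀ h : 𝒳 → F, Measurable h → (∃ C, ∀ x, ‖h x‖ ≤ C) →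
      ∫ a, inner ℝ (h (π a)) (ε a) ∂μ = 0)
    (hvar : ∀ h : 𝒳 → F, Measurable h → (∃ C, ∀ x, ‖h x‖ ≤ C) →
      ∫ a, inner ℝ (h (π a)) (ε a) ^ 2 ∂μ ≤ Γ ^ 2 * ∫ a, ‖h (π a)‖ ^ 2 ∂μ)
    {e : (Fin n → 𝒳) → Fin n → F} (he : Measurable e) (he1 : ∀ x, ∑ m, ‖e x m‖ ^ 2 ≤ 1) :
    Integrable (fun D : Fin n → E => (∑ m, inner ℝ (e (fun l => π (D l)) m) (ε (D m))) ^ 2)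
      (Measure.pi fun _ => μ) ∧
    ∫ D, (∑ m, inner ℝ (e (fun l => π (D l)) m) (ε (D m))) ^ 2 ∂(Measure.pi fun _ => μ)
      ≤ Γ ^ 2 := by
  set ρ : Measure (Fin n → E) := Measure.pi fun _ => μ with hρ
  have hem : ∀ m, Measurable fun x => e x m := fun m => (measurable_pi_apply m).comp he
  have hle : ∀ x m, ‖e x m‖ ≤ 1 := by
    intro x m
    have h : ‖e x m‖ ^ 2 ≤ 1 :=
      (Finset.single_le_sum (f := fun m => ‖e x m‖ ^ 2) (fun _ _ => sq_nonneg _)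
        (Finset.mem_univ m)).trans (he1 x)
    nlinarith [norm_nonneg (e x m)]
  have hπn : Measurable fun (D : Fin n → E) l => π (D l) :=
    measurable_pi_lambda _ fun l => hπ.comp (measurable_pi_apply l)
  set a : Fin n → (Fin n → E) → ℝ := fun m D => inner ℝ (e (fun l => π (D l)) m) (ε (D m)) with ha
  have ham : ∀ m, Measurable (a m) := fun m =>
    ((hem m).comp hπn).inner (hε.comp (measurable_pi_apply m))
  have ha2 : ∀ m, MemLp (a m) 2 ρ := by
    intro m
    have h1 : MemLp (fun D : Fin n → E => ε (D m)) 2 ρ :=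
      hε2.comp_measurePreserving (measurePreserving_eval (fun _ : Fin n => μ) m)
    refine h1.of_le (ham m).aestronglyMeasurable (Eventually.of_forall fun D => ?_)
    calc ‖a m D‖ ≤ ‖e (fun l => π (D l)) m‖ * ‖ε (D m)‖ := norm_inner_le_norm _ _
      _ ≤ 1 * ‖ε (D m)‖ := by gcongr; exact hle _ _
      _ = _ := one_mul _
  have hint : ∀ m l, Integrable (fun D => a m D * a l D) ρ := fun m l =>
    (ha2 m).integrable_mul (ha2 l)
  have hexp : ∀ D, (∑ m, a m D) ^ 2 = ∑ m, ∑ l, a m D * a l D := by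
    intro D; rw [sq, Finset.sum_mul_sum]
  have hupd : ∀ (D : Fin n → E) (m : Fin n) (b : E),
      (fun l => π (Function.update D m b l)) = Function.update (fun l => π (D l)) m (π b) := by
    intro D m b; ext l
    by_cases h : l = m
    · subst h; simp
    · simp [h]
  have hres : ∀ (m : Fin n) (f : (Fin n → E) → ℝ), Measurable f → Integrable f ρ →
      ∫ D, f D ∂ρ = ∫ D, ∫ b, f (Function.update D m b) ∂μ ∂ρ := by
    intro m f hf hfi
    have hmp : MeasurePreserving _ (ρ.prod μ) ρ := measurePreserving_update μ m
    rw [← hmp.map_eq] at hfi ⊢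
    rw [integral_map hmp.measurable.aemeasurable hf.aestronglyMeasurable, integral_prod]
    · rw [hmp.map_eq]
    · exact hfi.comp_measurable hmp.measurable
  have hupdm : ∀ (x : Fin n → 𝒳) (m : Fin n), Measurable fun y => Function.update x m y :=
    fun x m => measurable_update x
  -- Resample coordinate `m`. The vector `e` still depends on it through the design, in the
  -- coordinate `l` as well, but the whole factor in front of the noise `ε` of coordinate `m` is a
  -- bounded function of the new design point, hence orthogonal to the noise.
  have hcross : ∀ m l, m ≠ l → ∫ D, a m D * a l D ∂ρ = 0 := by
    intro m l hml
    rw [hres m (fun D => a m D * a l D) ((ham m).mul (ham l)) (hint m l)]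
    refine integral_eq_zero_of_ae (Eventually.of_forall fun D => ?_)
    simp only [ha, hupd, Function.update_self, Function.update_of_ne hml.symm, Pi.zero_apply]
    have h := horth (fun y => (inner ℝ (e (Function.update (fun l => π (D l)) m y) l) (ε (D l)))
      • e (Function.update (fun l => π (D l)) m y) m)
      ((((hem l).comp (hupdm _ m)).inner measurable_const).smul ((hem m).comp (hupdm _ m)))
      ⟨‖ε (D l)‖, fun y => ?_⟩
    · rw [← h]
      refine integral_congr_ae (Eventually.of_forall fun b => ?_)
      simp only [inner_smul_left]
      simp [mul_comm]
    · rw [norm_smul]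
      calc _ ≤ (‖e (Function.update (fun l => π (D l)) m y) l‖ * ‖ε (D l)‖) *
            ‖e (Function.update (fun l => π (D l)) m y) m‖ := by
            gcongr; exact norm_inner_le_norm _ _
        _ ≤ (1 * ‖ε (D l)‖) * 1 := by gcongr <;> exact hle _ _
        _ = _ := by ring
  have hne2 : ∀ m, Integrable (fun D : Fin n → E => ‖e (fun l => π (D l)) m‖ ^ 2) ρ := by
    intro m
    refine Integrable.of_bound (((hem m).comp hπn).norm.pow_const 2).aestronglyMeasurable 1
      (Eventually.of_forall fun D => ?_)
    rw [Real.norm_of_nonneg (sq_nonneg _)]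
    exact pow_le_one₀ (norm_nonneg _) (hle _ _)
  -- Resampling coordinate `m` turns this into the conditional variance bound `hvar` for a fixed
  -- function of the new design point.
  have hdiag : ∀ m, ∫ D, a m D * a m D ∂ρ ≤ Γ ^ 2 * ∫ D, ‖e (fun l => π (D l)) m‖ ^ 2 ∂ρ := by
    intro m
    have hmp : MeasurePreserving _ (ρ.prod μ) ρ := measurePreserving_update μ m
    rw [hres m (fun D => a m D * a m D) ((ham m).mul (ham m)) (hint m m),
      hres m (fun D => ‖e (fun l => π (D l)) m‖ ^ 2) (((hem m).comp hπn).norm.pow_const 2) (hne2 m), ← integral_const_mul]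
    have hi1 : Integrable (fun D => ∫ b, a m (Function.update D m b) * a m (Function.update D m b)
        ∂μ) ρ := by
      have h := hint m m
      rw [← hmp.map_eq] at h
      exact (h.comp_measurable hmp.measurable).integral_prod_left
    have hi2 : Integrable (fun D => ∫ b, ‖e (fun l => π (Function.update D m b l)) m‖ ^ 2 ∂μ) ρ := by
      have h := hne2 m
      rw [← hmp.map_eq] at h
      exact (h.comp_measurable hmp.measurable).integral_prod_left
    refine integral_mono hi1 (hi2.const_mul _) fun D => ?_
    simp only [ha, hupd, Function.update_self]
    have h := hvar (fun y => e (Function.update (fun l => π (D l)) m y) m)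
      ((hem m).comp (hupdm _ m)) ⟨1, fun y => hle _ _⟩
    simpa only [sq] using h
  refine ⟨?_, ?_⟩
  · exact (integrable_finsetSum _ fun m _ => integrable_finsetSum _ fun l _ => hint m l).congr
      (Eventually.of_forall fun D => (hexp D).symm)
  calc ∫ D, (∑ m, a m D) ^ 2 ∂ρ = ∑ m, ∑ l, ∫ D, a m D * a l D ∂ρ := by
        simp only [hexp]
        rw [integral_finsetSum _ fun m _ => integrable_finsetSum _ fun l _ => hint m l]
        exact Finset.sum_congr rfl fun m _ => integral_finsetSum _ fun l _ => hint m l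
    _ = ∑ m, ∫ D, a m D * a m D ∂ρ := by
        refine Finset.sum_congr rfl fun m _ => ?_
        exact Finset.sum_eq_single m (fun l _ hl => hcross m l (Ne.symm hl)) (by simp)
    _ ≤ ∑ m, Γ ^ 2 * ∫ D, ‖e (fun l => π (D l)) m‖ ^ 2 ∂ρ := Finset.sum_le_sum fun m _ => hdiag m
    _ = Γ ^ 2 * ∫ D, ∑ m, ‖e (fun l => π (D l)) m‖ ^ 2 ∂ρ := by
        rw [← Finset.mul_sum, integral_finsetSum _ fun m _ => hne2 m]
    _ ≤ Γ ^ 2 * ∫ _, 1 ∂ρ := by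
        refine mul_le_mul_of_nonneg_left ?_ (sq_nonneg _)
        exact integral_mono (integrable_finsetSum _ fun m _ => hne2 m) (integrable_const _)
          fun D => he1 _
    _ = Γ ^ 2 := by simp

end Noise

end MWLS


namespace MWLS

/-! ### Disintegration along the regressor -/

section Disintegration

theorem eLpNorm_two_sq {α ε : Type*} [MeasurableSpace α] [ENorm ε] {μ : Measure α} (f : α → ε) :
    eLpNorm f 2 μ ^ 2 = ∫⁻ a, ‖f a‖ₑ ^ 2 ∂μ := by
  have h := eLpNorm_nnreal_pow_eq_lintegral (f := f) (μ := μ) (p := 2) two_ne_zero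
  simpa using h

theorem eLpNorm_two_le_of_sq_le {α ε : Type*} [MeasurableSpace α] [ENorm ε] {μ : Measure α}
    {f : α → ε} {c : ENNReal} (h : ∫⁻ a, ‖f a‖ₑ ^ 2 ∂μ ≤ c ^ 2) : eLpNorm f 2 μ ≤ c := by
  rw [← eLpNorm_two_sq] at h
  exact (ENNReal.pow_le_pow_left_iff two_ne_zero).1 h

variable {E 𝒳 𝒰 : Type*} [MeasurableSpace E] [MeasurableSpace 𝒳] [MeasurableSpace 𝒰]
  {μ : Measure E} [IsProbabilityMeasure μ] {π : E → 𝒳} {κ : Kernel 𝒳 E} [IsMarkovKernel κ]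

theorem lintegral_eq_lintegral_kernel (hπ : Measurable π)
    (hκ : μ.map (fun e => (π e, e)) = (μ.map π) ⊗ₘ κ) {g : 𝒳 × E → ENNReal} (hg : Measurable g) :
    ∫⁻ e, g (π e, e) ∂μ = ∫⁻ x, ∫⁻ e, g (x, e) ∂κ x ∂(μ.map π) := by
  have := Measure.isProbabilityMeasure_map (μ := μ) hπ.aemeasurable
  have hm : Measurable fun e => (π e, e) := hπ.prodMk measurable_id
  rw [← Measure.lintegral_compProd hg, ← hκ, lintegral_map hg hm]

theorem integral_eq_integral_kernel (hπ : Measurable π)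
    (hκ : μ.map (fun e => (π e, e)) = (μ.map π) ⊗ₘ κ) {g : 𝒳 × E → ℝ} (hg : Measurable g)
    (hgi : Integrable (fun e => g (π e, e)) μ) :
    ∫ e, g (π e, e) ∂μ = ∫ x, ∫ e, g (x, e) ∂κ x ∂(μ.map π) := by
  have := Measure.isProbabilityMeasure_map (μ := μ) hπ.aemeasurable
  have hm : Measurable fun e => (π e, e) := hπ.prodMk measurable_id
  have hgi' : Integrable g ((μ.map π) ⊗ₘ κ) := by
    rw [← hκ]
    exact (integrable_map_measure hg.aestronglyMeasurable hm.aemeasurable).2 hgi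
  rw [← Measure.integral_compProd hgi', ← hκ, integral_map hm.aemeasurable hg.aestronglyMeasurable]

theorem ae_kernel_of_ae (hπ : Measurable π)
    (hκ : μ.map (fun e => (π e, e)) = (μ.map π) ⊗ₘ κ) {s : E → Prop} (hs : ∀ᵐ e ∂μ, s e) :
    ∀ᵐ x ∂(μ.map π), ∀ᵐ e ∂κ x, s e := by
  have := Measure.isProbabilityMeasure_map (μ := μ) hπ.aemeasurable
  refine Measure.ae_ae_of_ae_compProd (p := fun a => s a.2) ?_
  refine ae_of_ae_map measurable_snd.aemeasurable ?_
  have hm : Measurable fun e => (π e, e) := hπ.prodMk measurable_id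
  rw [← hκ, Measure.map_map measurable_snd hm]
  have : (Prod.snd ∘ fun e => (π e, e)) = id := rfl
  rw [this, Measure.map_id]
  exact hs

variable {F : Type*} [NormedAddCommGroup F] [InnerProductSpace ℝ F] [FiniteDimensional ℝ F]
  [MeasurableSpace F] [BorelSpace F]

theorem norm_integral_le_of_eLpNorm_two_le {S : E → F} {Γ : ℝ} (hΓ : 0 ≤ Γ) {ρ : Measure E}
    [IsProbabilityMeasure ρ] (hS : Measurable S) (h : eLpNorm S 2 ρ ≤ ENNReal.ofReal Γ) :
    ‖∫ e, S e ∂ρ‖ ≤ Γ := by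
  have h1 : ‖∫ e, S e ∂ρ‖ₑ ≤ ENNReal.ofReal Γ := by
    refine (enorm_integral_le_lintegral_enorm _).trans ?_
    rw [← eLpNorm_one_eq_lintegral_enorm]
    exact (eLpNorm_le_eLpNorm_of_exponent_le one_le_two hS.aestronglyMeasurable).trans h
  rw [← ofReal_norm] at h1
  exact (ENNReal.ofReal_le_ofReal_iff hΓ).1 h1

theorem integral_norm_sq_le_of_eLpNorm_two_le {α F : Type*} [MeasurableSpace α]
    [NormedAddCommGroup F] {S : α → F} {Γ : ℝ} (hΓ : 0 ≤ Γ) {ρ : Measure α}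
    (hS : AEStronglyMeasurable S ρ) (h : eLpNorm S 2 ρ ≤ ENNReal.ofReal Γ) :
    ∫ e, ‖S e‖ ^ 2 ∂ρ ≤ Γ ^ 2 := by
  have hm : MemLp S 2 ρ := ⟨hS, h.trans_lt ENNReal.ofReal_lt_top⟩
  have h1 : ENNReal.ofReal (∫ e, ‖S e‖ ^ 2 ∂ρ) ≤ ENNReal.ofReal (Γ ^ 2) := by
    rw [ofReal_integral_eq_lintegral_ofReal ((memLp_two_iff_integrable_sq_norm hS).1 hm)
      (Eventually.of_forall fun _ => sq_nonneg _), ENNReal.ofReal_pow hΓ]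
    refine le_trans (le_of_eq ?_) (pow_le_pow_left' h 2)
    rw [eLpNorm_two_sq]
    refine lintegral_congr fun e => ?_
    rw [ENNReal.ofReal_pow (norm_nonneg _), ofReal_norm]
  exact (ENNReal.ofReal_le_ofReal_iff (sq_nonneg Γ)).1 h1

theorem measurable_integral_kernel {S : 𝒰 × E → F} (hS : Measurable S) :
    Measurable fun a : 𝒰 × 𝒳 => ∫ e, S (a.1, e) ∂κ a.2 := by
  have h := MeasureTheory.StronglyMeasurable.integral_kernel_prod_right'
    (κ := Kernel.prodMkLeft 𝒰 κ) (f := fun a : (𝒰 × 𝒳) × E => S (a.1.1, a.2))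
    (hS.comp (measurable_fst.fst.prodMk measurable_snd)).stronglyMeasurable
  exact h.measurable

/-- Orthogonality and conditional variance of the noise in a regression problem. -/
theorem noise_properties (hπ : Measurable π)
    (hκ : μ.map (fun e => (π e, e)) = (μ.map π) ⊗ₘ κ) {S : E → F} (hS : Measurable S) {Γ : ℝ}
    (hΓ : 0 ≤ Γ) (hSΓ : ∀ᵐ x ∂(μ.map π), eLpNorm S 2 (κ x) ≤ ENNReal.ofReal Γ) {r : 𝒳 → F}
    (hr : Measurable r) (hrS : ∀ x, r x = ∫ e, S e ∂κ x) :
    MemLp (fun e => S e - r (π e)) 2 μ ∧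
    (∀ h : 𝒳 → F, Measurable h → (∃ C, ∀ x, ‖h x‖ ≤ C) →
      ∫ a, inner ℝ (h (π a)) (S a - r (π a)) ∂μ = 0) ∧
    (∀ h : 𝒳 → F, Measurable h → (∃ C, ∀ x, ‖h x‖ ≤ C) →
      ∫ a, inner ℝ (h (π a)) (S a - r (π a)) ^ 2 ∂μ ≤ Γ ^ 2 * ∫ a, ‖h (π a)‖ ^ 2 ∂μ) := by
  have hprob := Measure.isProbabilityMeasure_map (μ := μ) hπ.aemeasurable
  have hS2 : MemLp S 2 μ := by
    refine ⟨hS.aestronglyMeasurable, lt_of_le_of_lt (b := ENNReal.ofReal Γ)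
      (eLpNorm_two_le_of_sq_le ?_) ENNReal.ofReal_lt_top⟩
    rw [lintegral_eq_lintegral_kernel hπ hκ (g := fun a => ‖S a.2‖ₑ ^ 2)
      ((hS.comp measurable_snd).enorm.pow_const 2)]
    calc _ ≤ ∫⁻ _, ENNReal.ofReal Γ ^ 2 ∂(μ.map π) := by
          refine lintegral_mono_ae ?_
          filter_upwards [hSΓ] with x hx
          rw [← eLpNorm_two_sq]; exact pow_le_pow_left' hx 2
      _ = _ := by simp
  have hrb : ∀ᵐ x ∂(μ.map π), ‖r x‖ ≤ Γ := by
    filter_upwards [hSΓ] with x hx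
    rw [hrS]; exact norm_integral_le_of_eLpNorm_two_le hΓ hS hx
  have hr2 : MemLp (fun e => r (π e)) 2 μ :=
    MemLp.of_bound (hr.comp hπ).aestronglyMeasurable Γ (ae_of_ae_map hπ.aemeasurable hrb)
  have hε2 : MemLp (fun e => S e - r (π e)) 2 μ := hS2.sub hr2
  have hSi : ∀ᵐ x ∂(μ.map π), MemLp S 2 (κ x) := by
    filter_upwards [hSΓ] with x hx
    exact ⟨hS.aestronglyMeasurable, hx.trans_lt ENNReal.ofReal_lt_top⟩
  have hinn : ∀ h : 𝒳 → F, Measurable h → (∃ C, ∀ x, ‖h x‖ ≤ C) →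
      MemLp (fun a => inner ℝ (h (π a)) (S a - r (π a))) 2 μ := by
    rintro h hh ⟨C, hC⟩
    refine hε2.of_le_mul (c := C)
      ((hh.comp hπ).inner (hS.sub (hr.comp hπ))).aestronglyMeasurable
      (Eventually.of_forall fun a => (norm_inner_le_norm _ _).trans ?_)
    gcongr
    exact hC _
  have hmeas : ∀ h : 𝒳 → F, Measurable h →
      Measurable fun a : 𝒳 × E => inner ℝ (h a.1) (S a.2 - r a.1) := fun h hh =>
    (hh.comp measurable_fst).inner ((hS.comp measurable_snd).sub (hr.comp measurable_fst))
  have hzero : ∀ (h : 𝒳 → F) (x : 𝒳), Integrable S (κ x) →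
      ∫ e, inner ℝ (h x) (S e) ∂κ x = inner ℝ (h x) (r x) := by
    intro h x hx
    rw [integral_inner hx, hrS]
  refine ⟨hε2, fun h hh hC => ?_, fun h hh hC => ?_⟩
  · rw [integral_eq_integral_kernel hπ hκ (hmeas h hh) ((hinn h hh hC).integrable one_le_two)]
    refine integral_eq_zero_of_ae ?_
    filter_upwards [hSi] with x hx
    have hi := hx.integrable one_le_two
    simp only [inner_sub_right, Pi.zero_apply]
    rw [integral_sub (hi.const_inner _) (integrable_const _), hzero h x hi]
    simp
  · have hsq : Integrable (fun e => inner ℝ (h (π e)) (S e - r (π e)) ^ 2) μ :=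
      (hinn h hh hC).integrable_sq
    rw [integral_eq_integral_kernel hπ hκ (g := fun a => inner ℝ (h a.1) (S a.2 - r a.1) ^ 2)
      ((hmeas h hh).pow_const 2) hsq]
    have hn : ∫ a, ‖h (π a)‖ ^ 2 ∂μ = ∫ x, ‖h x‖ ^ 2 ∂(μ.map π) :=
      (integral_map (f := fun x => ‖h x‖ ^ 2) hπ.aemeasurable
        (hh.norm.pow_const 2).aestronglyMeasurable).symm
    rw [hn, ← integral_const_mul]
    have hni : Integrable (fun x => ‖h x‖ ^ 2) (μ.map π) := by
      obtain ⟨C, hC⟩ := hC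
      refine Integrable.of_bound (hh.norm.pow_const 2).aestronglyMeasurable (C ^ 2)
        (Eventually.of_forall fun x => ?_)
      rw [Real.norm_of_nonneg (sq_nonneg _)]
      exact pow_le_pow_left₀ (norm_nonneg _) (hC x) 2
    refine integral_mono_of_nonneg (Eventually.of_forall fun x =>
      integral_nonneg fun e => sq_nonneg _) (hni.const_mul _) ?_
    filter_upwards [hSi, hSΓ] with x hx hxΓ
    have hi := hx.integrable one_le_two
    -- Given the regressor the noise is centered, so its second moment is a variance, at most the
    -- second moment of the observation itself.
    have hv : ∫ e, inner ℝ (h x) (S e - r x) ^ 2 ∂κ x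
        = Var[fun e => inner ℝ (h x) (S e); κ x] := by
      rw [variance_eq_integral (measurable_const.inner hS).aemeasurable, hzero h x hi]
      simp only [inner_sub_right]
    have hs : ∫ e, ‖S e‖ ^ 2 ∂κ x ≤ Γ ^ 2 :=
      integral_norm_sq_le_of_eLpNorm_two_le hΓ hS.aestronglyMeasurable hxΓ
    have hsi : Integrable (fun e => ‖S e‖ ^ 2) (κ x) :=
      (memLp_two_iff_integrable_sq_norm hS.aestronglyMeasurable).1 hx
    calc ∫ e, inner ℝ (h x) (S e - r x) ^ 2 ∂κ x
        ≤ ∫ e, inner ℝ (h x) (S e) ^ 2 ∂κ x := by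
          rw [hv]
          exact variance_le_expectation_sq (measurable_const.inner hS).aestronglyMeasurable
      _ ≤ ∫ e, ‖h x‖ ^ 2 * ‖S e‖ ^ 2 ∂κ x := by
          refine integral_mono_of_nonneg (Eventually.of_forall fun e => sq_nonneg _)
            (hsi.const_mul _) (Eventually.of_forall fun e => ?_)
          change inner ℝ (h x) (S e) ^ 2 ≤ ‖h x‖ ^ 2 * ‖S e‖ ^ 2
          rw [← mul_pow, ← sq_abs]
          exact pow_le_pow_left₀ (abs_nonneg _) (abs_real_inner_le_norm _ _) 2
      _ = ‖h x‖ ^ 2 * ∫ e, ‖S e‖ ^ 2 ∂κ x := integral_const_mul _ _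
      _ ≤ ‖h x‖ ^ 2 * Γ ^ 2 := by gcongr
      _ = _ := mul_comm _ _

omit [FiniteDimensional ℝ F] in
/-- Conditional Cauchy–Schwarz inequality for a sum of products. -/
theorem eLpNorm_integral_kernel_le (hπ : Measurable π)
    (hκ : μ.map (fun e => (π e, e)) = (μ.map π) ⊗ₘ κ) {ν : Measure 𝒰} [IsProbabilityMeasure ν]
    {ι : Type*} (I : Finset ι) {g : ι → 𝒰 × E → ℝ} (hg : ∀ k ∈ I, Measurable (g k))
    {h : ι → E → F} (hh : ∀ k ∈ I, Measurable (h k)) {c : ι → ℝ}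
    (hc : ∀ k ∈ I, ∀ᵐ x ∂(μ.map π), eLpNorm (h k) 2 (κ x) ≤ ENNReal.ofReal (c k)) :
    eLpNorm (fun a : 𝒰 × 𝒳 => ∫ e, ∑ k ∈ I, g k (a.1, e) • h k e ∂κ a.2) 2 (ν.prod (μ.map π))
      ≤ ∑ k ∈ I, ENNReal.ofReal (c k) * eLpNorm (g k) 2 (ν.prod μ) := by
  have hprob := Measure.isProbabilityMeasure_map (μ := μ) hπ.aemeasurable
  -- The conditional Cauchy–Schwarz bound of the `k`-th summand. Minkowski's inequality then adds
  -- these bounds, and integrating over the regressor undoes the conditioning.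
  set β : ι → 𝒰 × 𝒳 → ENNReal := fun k a =>
    ENNReal.ofReal (c k) * (∫⁻ e, ‖g k (a.1, e)‖ₑ ^ 2 ∂κ a.2) ^ (1 / 2 : ℝ) with hβ
  have hgm : ∀ k ∈ I, Measurable fun a : 𝒰 × 𝒳 => ∫⁻ e, ‖g k (a.1, e)‖ₑ ^ 2 ∂κ a.2 := by
    intro k hk
    have := Measurable.lintegral_kernel_prod_right' (κ := Kernel.prodMkLeft 𝒰 κ)
      (f := fun a : (𝒰 × 𝒳) × E => ‖g k (a.1.1, a.2)‖ₑ ^ 2)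
      (((hg k hk).comp (measurable_fst.fst.prodMk measurable_snd)).enorm.pow_const 2)
    exact this
  have hβm : ∀ k ∈ I, Measurable (β k) := fun k hk =>
    ((hgm k hk).pow_const _).const_mul _
  have hβn : ∀ k ∈ I, eLpNorm (β k) 2 (ν.prod (μ.map π))
      ≤ ENNReal.ofReal (c k) * eLpNorm (g k) 2 (ν.prod μ) := by
    intro k hk
    refine eLpNorm_two_le_of_sq_le ?_
    rw [mul_pow, eLpNorm_two_sq, lintegral_prod _ (((hg k hk).enorm.pow_const 2).aemeasurable)]
    have h1 : ∀ a, ‖β k a‖ₑ ^ 2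
        = ENNReal.ofReal (c k) ^ 2 * ∫⁻ e, ‖g k (a.1, e)‖ₑ ^ 2 ∂κ a.2 := by
      intro a
      rw [hβ, enorm_eq_self, mul_pow, ← ENNReal.rpow_natCast (_ ^ (1 / 2 : ℝ)),
        ← ENNReal.rpow_mul]
      norm_num
    simp only [h1]
    rw [lintegral_const_mul _ (hgm k hk), lintegral_prod _ (hgm k hk).aemeasurable]
    refine le_of_eq ?_
    congr 1
    refine lintegral_congr fun u => ?_
    exact (lintegral_eq_lintegral_kernel hπ hκ (g := fun a => ‖g k (u, a.2)‖ₑ ^ 2)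
      (((hg k hk).comp (measurable_const.prodMk measurable_snd)).enorm.pow_const 2)).symm
  have hc' : ∀ᵐ a ∂(ν.prod (μ.map π)), ∀ k ∈ I, eLpNorm (h k) 2 (κ a.2) ≤ ENNReal.ofReal (c k) :=
    Measure.quasiMeasurePreserving_snd.ae ((Finset.eventually_all I).2 hc)
  calc _ ≤ eLpNorm (∑ k ∈ I, β k) 2 (ν.prod (μ.map π)) := by
        refine eLpNorm_mono_enorm_ae ?_
        filter_upwards [hc'] with a ha
        rw [enorm_eq_self, Finset.sum_apply]
        calc _ ≤ ∫⁻ e, ‖∑ k ∈ I, g k (a.1, e) • h k e‖ₑ ∂κ a.2 :=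
              enorm_integral_le_lintegral_enorm _
          _ ≤ ∫⁻ e, ∑ k ∈ I, ‖g k (a.1, e)‖ₑ * ‖h k e‖ₑ ∂κ a.2 := by
              refine lintegral_mono fun e => (enorm_sum_le _ _).trans ?_
              exact Finset.sum_le_sum fun k _ => (enorm_smul _ _).le
          _ = ∑ k ∈ I, ∫⁻ e, ‖g k (a.1, e)‖ₑ * ‖h k e‖ₑ ∂κ a.2 :=
              lintegral_finsetSum _ fun k hk =>
                ((hg k hk).comp (measurable_const.prodMk measurable_id)).enorm.mul (hh k hk).enorm
          _ ≤ ∑ k ∈ I, β k a := by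
              refine Finset.sum_le_sum fun k hk => ?_
              refine (ENNReal.lintegral_mul_le_Lp_mul_Lq (κ a.2) Real.HolderConjugate.two_two
                ((hg k hk).comp (measurable_const.prodMk measurable_id)).enorm.aemeasurable
                (hh k hk).enorm.aemeasurable).trans ?_
              rw [hβ, mul_comm]
              have := ha k hk
              rw [eLpNorm_eq_lintegral_rpow_enorm_toReal (by norm_num) (by norm_num)] at this
              simp only [ENNReal.toReal_ofNat] at this
              refine mul_le_mul' this (le_of_eq ?_)
              simp
    _ ≤ ∑ k ∈ I, eLpNorm (β k) 2 (ν.prod (μ.map π)) :=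
        eLpNorm_sum_le (fun k hk => (hβm k hk).aestronglyMeasurable) one_le_two
    _ ≤ _ := Finset.sum_le_sum hβn

end Disintegration

end MWLS


namespace MWLS

/-! ### Error of a least-squares regression on simulated data -/

section RegressionError

variable {E 𝒳 𝒰 Ω' : Type*} [MeasurableSpace E] [MeasurableSpace 𝒳] [MeasurableSpace 𝒰]
  [MeasurableSpace Ω'] {μ : Measure E} [IsProbabilityMeasure μ] {π : E → 𝒳}
  {P' : Measure Ω'} [IsProbabilityMeasure P'] {n : ℕ} {U : Ω' → 𝒰} {D : Ω' → Fin n → E}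

/-- Each simulation, taken jointly with the later clouds, is an independent path; this lets sample
averages be computed under the true law. -/
theorem map_prod_eval_eq (hU : Measurable U) (hD : Measurable D)
    (hlaw : P'.map (fun ω => (U ω, D ω)) = (P'.map U).prod (Measure.pi fun _ => μ)) (m : Fin n) :
    P'.map (fun ω => (U ω, D ω m)) = (P'.map U).prod μ := by
  have := Measure.isProbabilityMeasure_map (μ := P') hU.aemeasurable
  have h := (MeasurePreserving.id (P'.map U)).prod (measurePreserving_eval (fun _ : Fin n => μ) m)
  rw [← h.map_eq, ← hlaw, Measure.map_map h.measurable (hU.prodMk hD)]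
  rfl

variable {F : Type*} [NormedAddCommGroup F] [InnerProductSpace ℝ F] [FiniteDimensional ℝ F]
  [MeasurableSpace F] [BorelSpace F]

omit [InnerProductSpace ℝ F] [FiniteDimensional ℝ F] [MeasurableSpace F] [BorelSpace F] in
theorem enorm_toLp_sq (f : Fin n → F) :
    ‖(WithLp.toLp 2 f : PiLp 2 fun _ : Fin n => F)‖ₑ ^ 2 = ∑ m, ‖f m‖ₑ ^ 2 := by
  rw [← ofReal_norm, ← ENNReal.ofReal_pow (norm_nonneg _), PiLp.norm_sq_eq_of_L2,
    ENNReal.ofReal_sum_of_nonneg fun _ _ => sq_nonneg _]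
  refine Finset.sum_congr rfl fun m _ => ?_
  rw [ENNReal.ofReal_pow (norm_nonneg _), ofReal_norm]

omit [InnerProductSpace ℝ F] [FiniteDimensional ℝ F] in
-- The function does not depend on the sample itself, so each of the `n` points contributes the same
-- true mean square.
theorem eLpNorm_sample [SecondCountableTopology F] (hU : Measurable U) (hD : Measurable D)
    (hlaw : P'.map (fun ω => (U ω, D ω)) = (P'.map U).prod (Measure.pi fun _ => μ))
    {g : 𝒰 × E → F} (hg : Measurable g) :
    eLpNorm (fun ω => (WithLp.toLp 2 fun m => g (U ω, D ω m) : PiLp 2 fun _ : Fin n => F)) 2 P'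
      ≤ ENNReal.ofReal √n * eLpNorm g 2 ((P'.map U).prod μ) := by
  refine eLpNorm_two_le_of_sq_le ?_
  simp only [enorm_toLp_sq]
  have hm : ∀ m, Measurable fun ω => (U ω, D ω m) := fun m =>
    hU.prodMk ((measurable_pi_apply m).comp hD)
  have hgm : ∀ m, Measurable fun ω => ‖g (U ω, D ω m)‖ₑ ^ 2 := fun m =>
    (hg.comp (hm m)).enorm.pow_const 2
  rw [lintegral_finsetSum _ fun m _ => hgm m]
  have h1 : ∀ m, ∫⁻ ω, ‖g (U ω, D ω m)‖ₑ ^ 2 ∂P' = eLpNorm g 2 ((P'.map U).prod μ) ^ 2 := by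
    intro m
    rw [eLpNorm_two_sq, ← map_prod_eval_eq hU hD hlaw m,
      lintegral_map (hg.enorm.pow_const 2) (hm m)]
  simp only [h1, Finset.sum_const, Finset.card_univ, Fintype.card_fin, nsmul_eq_mul]
  rw [mul_pow, ← ENNReal.ofReal_pow (Real.sqrt_nonneg _), Real.sq_sqrt (Nat.cast_nonneg n),
    ENNReal.ofReal_natCast]

variable {κ : Kernel 𝒳 E} [IsMarkovKernel κ]

/-- By independence the variable `U` can be frozen. What remains is `integral_inner_sq_le` for a
fixed observation function. -/
theorem lintegral_noise_le (hU : Measurable U) (hD : Measurable D)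
    (hlaw : P'.map (fun ω => (U ω, D ω)) = (P'.map U).prod (Measure.pi fun _ => μ))
    (hπ : Measurable π) (hκ : μ.map (fun e => (π e, e)) = (μ.map π) ⊗ₘ κ)
    {S : 𝒰 × E → F} (hS : Measurable S) {Γ : ℝ} (hΓ : 0 ≤ Γ)
    (hSΓ : ∀ u, ∀ᵐ x ∂(μ.map π), eLpNorm (fun e => S (u, e)) 2 (κ x) ≤ ENNReal.ofReal Γ)
    {e : (Fin n → 𝒳) → Fin n → F} (he : Measurable e) (he1 : ∀ x, ∑ m, ‖e x m‖ ^ 2 ≤ 1) :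
    ∫⁻ ω, ENNReal.ofReal ((∑ m, inner ℝ (e (fun l => π (D ω l)) m)
      (S (U ω, D ω m) - ∫ a, S (U ω, a) ∂κ (π (D ω m)))) ^ 2) ∂P' ≤ ENNReal.ofReal (Γ ^ 2) := by
  have hprob := Measure.isProbabilityMeasure_map (μ := P') hU.aemeasurable
  have hr := measurable_integral_kernel (κ := κ) hS
  have hem : ∀ m, Measurable fun x => e x m := fun m => (measurable_pi_apply m).comp he
  have hev : ∀ m : Fin n, Measurable fun a : 𝒰 × (Fin n → E) => a.2 m := fun m =>
    (measurable_pi_apply m).comp measurable_snd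
  have hmeas : Measurable fun a : 𝒰 × (Fin n → E) =>
      ENNReal.ofReal ((∑ m, inner ℝ (e (fun l => π (a.2 l)) m)
        (S (a.1, a.2 m) - ∫ b, S (a.1, b) ∂κ (π (a.2 m)))) ^ 2) := by
    refine ((Finset.measurable_fun_sum _ fun m _ => ?_).pow_const 2).ennreal_ofReal
    refine ((hem m).comp (measurable_pi_lambda _ fun l => hπ.comp (hev l))).inner ?_
    exact (hS.comp (measurable_fst.prodMk (hev m))).sub
      (hr.comp (measurable_fst.prodMk (hπ.comp (hev m))))
  rw [← lintegral_map (f := fun a : 𝒰 × (Fin n → E) =>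
      ENNReal.ofReal ((∑ m, inner ℝ (e (fun l => π (a.2 l)) m)
        (S (a.1, a.2 m) - ∫ b, S (a.1, b) ∂κ (π (a.2 m)))) ^ 2)) hmeas (hU.prodMk hD), hlaw,
    lintegral_prod _ hmeas.aemeasurable]
  calc _ ≤ ∫⁻ _, ENNReal.ofReal (Γ ^ 2) ∂(P'.map U) := by
        refine lintegral_mono fun u => ?_
        have hSu : Measurable fun a => S (u, a) := hS.comp (measurable_const.prodMk measurable_id)
        have hru : Measurable fun x => ∫ b, S (u, b) ∂κ x :=
          hr.comp (measurable_const.prodMk measurable_id)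
        obtain ⟨h1, h2, h3⟩ := noise_properties hπ hκ hSu hΓ (hSΓ u) hru (fun _ => rfl)
        obtain ⟨h4, h5⟩ := integral_inner_sq_le hπ (hSu.sub (hru.comp hπ)) h1 h2 h3 he he1
        refine le_trans (le_of_eq ?_) (ENNReal.ofReal_le_ofReal h5)
        exact (ofReal_integral_eq_lintegral_ofReal h4
          (Eventually.of_forall fun _ => sq_nonneg _)).symm
    _ = _ := by simp

/-- Mean square error, in the empirical norm, of a least-squares regression: approximation error,
statistical error, bias of the observations, and residuals. -/
theorem eLpNorm_regression_le (hU : Measurable U) (hD : Measurable D)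
    (hlaw : P'.map (fun ω => (U ω, D ω)) = (P'.map U).prod (Measure.pi fun _ => μ))
    (hπ : Measurable π) (hκ : μ.map (fun e => (π e, e)) = (μ.map π) ⊗ₘ κ)
    {S : 𝒰 × E → F} (hS : Measurable S) {Γ : ℝ} (hΓ : 0 ≤ Γ)
    (hSΓ : ∀ u, ∀ᵐ x ∂(μ.map π), eLpNorm (fun e => S (u, e)) 2 (κ x) ≤ ENNReal.ofReal Γ)
    {S₀ : E → F} (hS₀ : MemLp S₀ 2 μ) {v : 𝒳 → F} (hv : Measurable v)
    (hvS : ∀ᵐ x ∂(μ.map π), v x = ∫ e, S₀ e ∂κ x)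
    {ι : Type*} (I : Finset ι) {g : ι → 𝒰 × E → ℝ} (hg : ∀ k ∈ I, Measurable (g k))
    {h : ι → E → F} (hh : ∀ k ∈ I, Measurable (h k)) {c : ι → ℝ}
    (hc : ∀ k ∈ I, ∀ᵐ x ∂(μ.map π), eLpNorm (h k) 2 (κ x) ≤ ENNReal.ofReal (c k))
    (hdiff : ∀ u e, S (u, e) - S₀ e = ∑ k ∈ I, g k (u, e) • h k e)
    {K : ℕ} {b : Fin K → 𝒳 → F} (hb : ∀ k, Measurable (b k))
    {s : Ω' → Fin n → F} {ρ : Ω' → ℝ} (hρ : AEStronglyMeasurable ρ P')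
    (hs : ∀ᵐ ω ∂P', ‖(WithLp.toLp 2 fun m => s ω m - S (U ω, D ω m) : PiLp 2 fun _ : Fin n => F)‖
      ≤ ρ ω)
    {ψ : Ω' → 𝒳 → F} (hψ : ∀ᵐ ω ∂P', ψ ω ∈ Submodule.span ℝ (Set.range b))
    (hmin : ∀ᵐ ω ∂P', ∀ φ ∈ Submodule.span ℝ (Set.range b),
      ∑ m, ‖ψ ω (π (D ω m)) - s ω m‖ ^ 2 ≤ ∑ m, ‖φ (π (D ω m)) - s ω m‖ ^ 2)
    {φ : 𝒳 → F} (hφm : Measurable φ) (hφ : φ ∈ Submodule.span ℝ (Set.range b)) :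
    eLpNorm (fun ω => (WithLp.toLp 2 fun m => v (π (D ω m)) - ψ ω (π (D ω m)) :
        PiLp 2 fun _ : Fin n => F)) 2 P'
      ≤ ENNReal.ofReal √n * eLpNorm (fun x => v x - φ x) 2 (μ.map π)
        + ENNReal.ofReal (Γ * √K)
        + ENNReal.ofReal √n *
          ∑ k ∈ I, ENNReal.ofReal (c k) * eLpNorm (g k) 2 ((P'.map U).prod μ)
        + eLpNorm ρ 2 P' := by
  have hprob := Measure.isProbabilityMeasure_map (μ := P') hU.aemeasurable
  have hprob' := Measure.isProbabilityMeasure_map (μ := μ) hπ.aemeasurable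
  have hr := measurable_integral_kernel (κ := κ) hS
  set r : 𝒰 × 𝒳 → F := fun a => ∫ e, S (a.1, e) ∂κ a.2 with hr_def
  have hDm : ∀ m : Fin n, Measurable fun ω => D ω m := fun m => (measurable_pi_apply m).comp hD
  have hπD : ∀ m : Fin n, Measurable fun ω => π (D ω m) := fun m => hπ.comp (hDm m)
  have hvec : ∀ {f : Ω' → Fin n → F}, (∀ m, Measurable fun ω => f ω m) →
      Measurable fun ω => (WithLp.toLp 2 (f ω) : PiLp 2 fun _ : Fin n => F) := fun hf =>
    (WithLp.measurable_toLp 2 _).comp (measurable_pi_lambda _ hf)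
  -- the four error terms
  set A₁ : Ω' → PiLp 2 fun _ : Fin n => F := fun ω =>
    WithLp.toLp 2 fun m => v (π (D ω m)) - φ (π (D ω m)) with hA₁
  set A₂ : Ω' → PiLp 2 fun _ : Fin n => F := fun ω =>
    WithLp.toLp 2 fun m => S (U ω, D ω m) - r (U ω, π (D ω m)) with hA₂
  set A₃ : Ω' → PiLp 2 fun _ : Fin n => F := fun ω =>
    WithLp.toLp 2 fun m => r (U ω, π (D ω m)) - v (π (D ω m)) with hA₃
  set e : (Fin n → 𝒳) → Fin K → PiLp 2 fun _ : Fin n => F := fun x =>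
    InnerProductSpace.gramSchmidtNormed ℝ
      (fun k => (WithLp.toLp 2 fun m => b k (x m) : PiLp 2 fun _ : Fin n => F)) with he
  set noise : Ω' → ℝ := fun ω =>
    √(∑ k, inner ℝ (e (fun l => π (D ω l)) k) (A₂ ω) ^ 2) with hnoise
  have hem : ∀ k, Measurable fun x => e x k := by
    intro k
    refine measurable_gramSchmidtNormed (fun k => ?_) k
    exact (WithLp.measurable_toLp 2 _).comp
      (measurable_pi_lambda _ fun m => (hb k).comp (measurable_pi_apply m))
  have hA₁m : Measurable A₁ := hvec fun m => (hv.comp (hπD m)).sub (hφm.comp (hπD m))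
  have hA₂m : Measurable A₂ := hvec fun m =>
    (hS.comp (hU.prodMk (hDm m))).sub (hr.comp (hU.prodMk (hπD m)))
  have hA₃m : Measurable A₃ := hvec fun m => (hr.comp (hU.prodMk (hπD m))).sub (hv.comp (hπD m))
  have hem' : ∀ k, Measurable fun ω => e (fun l => π (D ω l)) k := fun k =>
    (hem k).comp (measurable_pi_lambda _ hπD)
  have hnm : Measurable noise :=
    (Finset.measurable_fun_sum _ fun k _ => ((hem' k).inner hA₂m).pow_const 2).sqrt
  -- the pathwise estimate
  have hpath : ∀ᵐ ω ∂P', ‖(WithLp.toLp 2 fun m => v (π (D ω m)) - ψ ω (π (D ω m)) :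
      PiLp 2 fun _ : Fin n => F)‖ ≤ ‖A₁ ω‖ + noise ω + ‖A₃ ω‖ + ρ ω := by
    filter_upwards [hs, hψ, hmin] with ω hsω hψω hminω
    set ev : (𝒳 → F) →ₗ[ℝ] PiLp 2 fun _ : Fin n => F :=
      { toFun := fun f => WithLp.toLp 2 fun m => f (π (D ω m))
        map_add' := fun _ _ => rfl
        map_smul' := fun _ _ => rfl } with hev
    set V : Submodule ℝ (PiLp 2 fun _ : Fin n => F) :=
      Submodule.span ℝ (Set.range fun k => ev (b k)) with hV
    have hVmap : V = (Submodule.span ℝ (Set.range b)).map ev := by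
      rw [Submodule.map_span, ← Set.range_comp]; rfl
    set sv : PiLp 2 fun _ : Fin n => F := WithLp.toLp 2 (s ω) with hsv
    have hsub : ∀ f : 𝒳 → F, ‖ev f - sv‖ ^ 2 = ∑ m, ‖f (π (D ω m)) - s ω m‖ ^ 2 := by
      intro f
      rw [PiLp.norm_sq_eq_of_L2]
      rfl
    have hψV : ev (ψ ω) ∈ V := hVmap ▸ Submodule.mem_map_of_mem hψω
    have hproj : V.starProjection sv = ev (ψ ω) := by
      refine starProjection_eq_of_isMin hψV fun w hw => ?_
      rw [hVmap] at hw
      obtain ⟨f, hf, rfl⟩ := hw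
      refine (sq_le_sq₀ (norm_nonneg _) (norm_nonneg _)).1 ?_
      rw [hsub, hsub]
      exact hminω f hf
    set R : PiLp 2 fun _ : Fin n => F := WithLp.toLp 2 fun m => s ω m - S (U ω, D ω m) with hR
    -- Observations as exact values, noise, bias and residual.
    have hdec : sv = ev v + A₂ ω + A₃ ω + R := by
      ext m
      change s ω m = v (π (D ω m)) + (S (U ω, D ω m) - r (U ω, π (D ω m)))
        + (r (U ω, π (D ω m)) - v (π (D ω m))) + (s ω m - S (U ω, D ω m))
      abel
    -- The projection is linear: the exact values leave their distance to `V`, and bias and residual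
    -- are contracted. Only for the noise is it essential to keep the projection, which reduces its
    -- size from `√n` to `√K`.
    have hLHS : (WithLp.toLp 2 fun m => v (π (D ω m)) - ψ ω (π (D ω m)) :
        PiLp 2 fun _ : Fin n => F) = (ev v - V.starProjection (ev v)) - V.starProjection (A₂ ω)
          - V.starProjection (A₃ ω) - V.starProjection R := by
      have : (WithLp.toLp 2 fun m => v (π (D ω m)) - ψ ω (π (D ω m)) :
        PiLp 2 fun _ : Fin n => F) = ev v - ev (ψ ω) := rfl
      rw [this, ← hproj, hdec, map_add, map_add, map_add]
      abel
    have h1 : ‖ev v - V.starProjection (ev v)‖ ≤ ‖A₁ ω‖ :=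
      norm_sub_starProjection_le V (ev v) (ev φ) (hVmap ▸ Submodule.mem_map_of_mem hφ)
    have h2 : ‖V.starProjection (A₂ ω)‖ ≤ noise ω :=
      Real.le_sqrt_of_sq_le (norm_starProjection_span_gramSchmidt_le _ _)
    have h3 : ‖V.starProjection (A₃ ω)‖ ≤ ‖A₃ ω‖ := V.norm_starProjection_apply_le _
    have h4 : ‖V.starProjection R‖ ≤ ρ ω := (V.norm_starProjection_apply_le _).trans hsω
    rw [hLHS]
    refine (norm_sub_le _ _).trans (add_le_add ((norm_sub_le _ _).trans (add_le_add
      ((norm_sub_le _ _).trans (add_le_add h1 h2)) h3)) h4)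
  -- the moments
  have hN : eLpNorm noise 2 P' ≤ ENNReal.ofReal (Γ * √K) := by
    refine eLpNorm_two_le_of_sq_le ?_
    have h1 : ∀ ω, ‖noise ω‖ₑ ^ 2
        = ∑ k, ENNReal.ofReal (inner ℝ (e (fun l => π (D ω l)) k) (A₂ ω) ^ 2) := by
      intro ω
      rw [← ofReal_norm, ← ENNReal.ofReal_pow (norm_nonneg _), Real.norm_eq_abs, sq_abs, hnoise,
        Real.sq_sqrt (Finset.sum_nonneg fun _ _ => sq_nonneg _),
        ENNReal.ofReal_sum_of_nonneg fun _ _ => sq_nonneg _]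
    simp only [h1]
    rw [lintegral_finsetSum _ fun k _ => (((hem' k).inner hA₂m).pow_const 2).ennreal_ofReal]
    calc _ ≤ ∑ _k : Fin K, ENNReal.ofReal (Γ ^ 2) := by
          refine Finset.sum_le_sum fun k _ => ?_
          have h2 := lintegral_noise_le hU hD hlaw hπ hκ hS hΓ hSΓ
            (e := fun x m => e x k m)
            ((WithLp.measurable_ofLp 2 _).comp (hem k)) (fun x => ?_)
          · refine le_trans (le_of_eq ?_) h2
            refine lintegral_congr fun ω => ?_
            rw [PiLp.inner_apply]
          · rw [← PiLp.norm_sq_eq_of_L2]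
            exact pow_le_one₀ (norm_nonneg _) (norm_gramSchmidtNormed_le_one _ _)
      _ = ENNReal.ofReal (Γ * √K) ^ 2 := by
          rw [← ENNReal.ofReal_pow (by positivity), mul_pow, Real.sq_sqrt (Nat.cast_nonneg K)]
          simp only [Finset.sum_const, Finset.card_univ, Fintype.card_fin, nsmul_eq_mul]
          rw [mul_comm, ENNReal.ofReal_mul (sq_nonneg _), ENNReal.ofReal_natCast]
  have hA₁n : eLpNorm A₁ 2 P' ≤ ENNReal.ofReal √n * eLpNorm (fun x => v x - φ x) 2 (μ.map π) := by
    have h1 := eLpNorm_sample hU hD hlaw (g := fun a : 𝒰 × E => v (π a.2) - φ (π a.2))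
      ((hv.comp (hπ.comp measurable_snd)).sub (hφm.comp (hπ.comp measurable_snd)))
    refine h1.trans (le_of_eq ?_)
    congr 1
    have h2 : μ.map π = ((P'.map U).prod μ).map (fun a => π a.2) := by
      have h3 : (fun a : 𝒰 × E => π a.2) = π ∘ Prod.snd := rfl
      rw [h3, ← Measure.map_map hπ measurable_snd, Measure.map_snd_prod]
      simp
    rw [h2]
    exact (eLpNorm_map_measure (f := fun a : 𝒰 × E => π a.2) (g := fun x => v x - φ x)
      (hv.sub hφm).aestronglyMeasurable (hπ.comp measurable_snd).aemeasurable).symm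
  have hA₃n : eLpNorm A₃ 2 P' ≤ ENNReal.ofReal √n *
      ∑ k ∈ I, ENNReal.ofReal (c k) * eLpNorm (g k) 2 ((P'.map U).prod μ) := by
    have h1 := eLpNorm_sample hU hD hlaw (g := fun a : 𝒰 × E => r (a.1, π a.2) - v (π a.2))
      ((hr.comp (measurable_fst.prodMk (hπ.comp measurable_snd))).sub
        (hv.comp (hπ.comp measurable_snd)))
    refine h1.trans ?_
    gcongr
    refine le_trans (le_of_eq ?_) (eLpNorm_integral_kernel_le hπ hκ (ν := P'.map U) I hg hh hc)
    have h2 : (P'.map U).prod (μ.map π)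
        = ((P'.map U).prod μ).map (fun a => (a.1, π a.2)) := by
      have h3 := Measure.map_prod_map (P'.map U) μ measurable_id hπ
      rw [Measure.map_id] at h3
      rw [h3]; rfl
    have hS₀i : ∀ᵐ x ∂(μ.map π), Integrable S₀ (κ x) := by
      have h4 : Integrable (fun a : 𝒳 × E => S₀ a.2) ((μ.map π) ⊗ₘ κ) := by
        have hm : Measurable fun e => (π e, e) := hπ.prodMk measurable_id
        have h5 : ((μ.map π) ⊗ₘ κ).map Prod.snd = μ := by
          rw [← hκ, Measure.map_map measurable_snd hm]
          exact Measure.map_id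
        have h6 : Integrable S₀ (((μ.map π) ⊗ₘ κ).map Prod.snd) := by
          rw [h5]; exact hS₀.integrable one_le_two
        exact h6.comp_measurable measurable_snd
      exact h4.ae_of_compProd
    -- The bias is the conditional mean of the difference of the two observations. Both have to be
    -- integrable under almost every kernel measure for the integral to split.
    have hcong : (fun a : 𝒰 × 𝒳 => ∫ e, ∑ k ∈ I, g k (a.1, e) • h k e ∂κ a.2)
        =ᵐ[(P'.map U).prod (μ.map π)] fun a => r a - v a.2 := by
      have h1' : ∀ᵐ a ∂((P'.map U).prod (μ.map π)), v a.2 = ∫ e, S₀ e ∂κ a.2 :=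
        Measure.quasiMeasurePreserving_snd.ae hvS
      have h2' : ∀ᵐ a ∂((P'.map U).prod (μ.map π)), Integrable S₀ (κ a.2) :=
        Measure.quasiMeasurePreserving_snd.ae hS₀i
      have h3' : ∀ᵐ a ∂((P'.map U).prod (μ.map π)), Integrable (fun e => S (a.1, e)) (κ a.2) := by
        have hms : MeasurableSet {a : 𝒰 × 𝒳 | Integrable (fun e => S (a.1, e)) (κ a.2)} :=
          measurableSet_kernel_integrable (κ := Kernel.prodMkLeft 𝒰 κ)
            (f := fun (a : 𝒰 × 𝒳) e => S (a.1, e))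
            (hS.comp (measurable_fst.fst.prodMk measurable_snd)).stronglyMeasurable
        refine (Measure.ae_prod_iff_ae_ae hms).2 (Eventually.of_forall fun u => ?_)
        filter_upwards [hSΓ u] with x hx
        exact MemLp.integrable one_le_two
          ⟨(hS.comp (measurable_const.prodMk measurable_id)).aestronglyMeasurable,
            hx.trans_lt ENNReal.ofReal_lt_top⟩
      filter_upwards [h1', h2', h3'] with a ha1 ha2 ha3
      simp only [← hdiff]
      rw [integral_sub ha3 ha2, ha1]
    rw [eLpNorm_congr_ae hcong, h2]
    exact (eLpNorm_map_measure (f := fun a : 𝒰 × E => (a.1, π a.2)) (g := fun a => r a - v a.2)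
      (hr.sub (hv.comp measurable_snd)).aestronglyMeasurable
      (measurable_fst.prodMk (hπ.comp measurable_snd)).aemeasurable).symm
  calc _ ≤ eLpNorm (fun ω => ‖A₁ ω‖ + noise ω + ‖A₃ ω‖ + ρ ω) 2 P' := eLpNorm_mono_ae_real hpath
    _ ≤ eLpNorm (fun ω => ‖A₁ ω‖ + noise ω + ‖A₃ ω‖) 2 P' + eLpNorm ρ 2 P' :=
        eLpNorm_add_le ((hA₁m.norm.add hnm).add hA₃m.norm).aestronglyMeasurable hρ one_le_two
    _ ≤ eLpNorm (fun ω => ‖A₁ ω‖ + noise ω) 2 P' + eLpNorm (fun ω => ‖A₃ ω‖) 2 P'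
          + eLpNorm ρ 2 P' := by
        gcongr
        exact eLpNorm_add_le (hA₁m.norm.add hnm).aestronglyMeasurable
          hA₃m.norm.aestronglyMeasurable one_le_two
    _ ≤ eLpNorm (fun ω => ‖A₁ ω‖) 2 P' + eLpNorm noise 2 P' + eLpNorm (fun ω => ‖A₃ ω‖) 2 P'
          + eLpNorm ρ 2 P' := by
        gcongr
        exact eLpNorm_add_le hA₁m.norm.aestronglyMeasurable hnm.aestronglyMeasurable one_le_two
    _ ≤ _ := by
        rw [eLpNorm_norm, eLpNorm_norm]
        gcongr

end RegressionError

end MWLS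


namespace MWLS

/-! ### Root mean square norms -/

section RootMeanSquare

variable {Ω : Type*} [mΩ : MeasurableSpace Ω] {F : Type*} [NormedAddCommGroup F]

/-- The root mean square of `f` under the measure `μ`. -/
noncomputable def rms (μ : Measure Ω) (f : Ω → F) : ℝ := √(∫ ω, ‖f ω‖ ^ 2 ∂μ)

variable {μ : Measure Ω} {f g : Ω → F}

theorem rms_nonneg (μ : Measure Ω) (f : Ω → F) : 0 ≤ rms μ f := Real.sqrt_nonneg _

theorem rms_sq (μ : Measure Ω) (f : Ω → F) : rms μ f ^ 2 = ∫ ω, ‖f ω‖ ^ 2 ∂μ :=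
  Real.sq_sqrt (integral_nonneg fun _ => sq_nonneg _)

theorem rms_congr_ae (h : f =ᵐ[μ] g) : rms μ f = rms μ g := by
  rw [rms, rms]
  congr 1
  refine integral_congr_ae ?_
  filter_upwards [h] with ω hω
  rw [hω]

theorem ofReal_rms (hf : MemLp f 2 μ) : ENNReal.ofReal (rms μ f) = eLpNorm f 2 μ := by
  suffices h : ENNReal.ofReal (rms μ f) ^ 2 = eLpNorm f 2 μ ^ 2 from
    le_antisymm ((ENNReal.pow_le_pow_left_iff two_ne_zero).1 h.le)
      ((ENNReal.pow_le_pow_left_iff two_ne_zero).1 h.ge)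
  rw [eLpNorm_two_sq, ← ENNReal.ofReal_pow (rms_nonneg _ _), rms_sq,
    ofReal_integral_eq_lintegral_ofReal ((memLp_two_iff_integrable_sq_norm hf.1).1 hf)
      (Eventually.of_forall fun _ => sq_nonneg _)]
  refine lintegral_congr fun ω => ?_
  rw [ENNReal.ofReal_pow (norm_nonneg _), ofReal_norm]

theorem rms_eq_toReal (hf : MemLp f 2 μ) : rms μ f = (eLpNorm f 2 μ).toReal := by
  rw [← ofReal_rms hf, ENNReal.toReal_ofReal (rms_nonneg _ _)]

theorem rms_add_le (hf : MemLp f 2 μ) (hg : MemLp g 2 μ) :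
    rms μ (fun ω => f ω + g ω) ≤ rms μ f + rms μ g := by
  have h := eLpNorm_add_le hf.1 hg.1 (one_le_two (α := ENNReal))
  rw [rms_eq_toReal hf, rms_eq_toReal hg, ← ENNReal.toReal_add hf.2.ne hg.2.ne]
  have h2 : MemLp (fun ω => f ω + g ω) 2 μ := hf.add hg
  rw [rms_eq_toReal h2]
  exact ENNReal.toReal_mono (ENNReal.add_ne_top.2 ⟨hf.2.ne, hg.2.ne⟩) h

theorem rms_sum_le {ι : Type*} (I : Finset ι) {f : ι → Ω → F} (hf : ∀ k ∈ I, MemLp (f k) 2 μ) :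
    rms μ (fun ω => ∑ k ∈ I, f k ω) ≤ ∑ k ∈ I, rms μ (f k) := by
  classical
  induction I using Finset.induction_on with
  | empty => simp [rms]
  | insert a I ha ih =>
    simp only [Finset.sum_insert ha]
    have hI : ∀ k ∈ I, MemLp (f k) 2 μ := fun k hk => hf k (Finset.mem_insert_of_mem hk)
    refine (rms_add_le (hf a (Finset.mem_insert_self _ _)) (memLp_finsetSum I hI)).trans ?_
    gcongr
    exact ih hI

theorem rms_mono {F' : Type*} [NormedAddCommGroup F'] {g : Ω → F'} (hg : MemLp g 2 μ)
    (h : ∀ᵐ ω ∂μ, ‖f ω‖ ≤ ‖g ω‖) : rms μ f ≤ rms μ g := by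
  refine Real.sqrt_le_sqrt ?_
  refine integral_mono_of_nonneg (Eventually.of_forall fun _ => sq_nonneg _)
    ((memLp_two_iff_integrable_sq_norm hg.1).1 hg) ?_
  filter_upwards [h] with ω hω
  exact pow_le_pow_left₀ (norm_nonneg _) hω 2

theorem rms_le_of_bound [IsFiniteMeasure μ] {C : ℝ} (hC : 0 ≤ C) (h : ∀ᵐ ω ∂μ, ‖f ω‖ ≤ C) :
    rms μ f ≤ C * √(μ.real Set.univ) := by
  have h1 : rms μ f ≤ rms μ (fun _ : Ω => C) :=
    rms_mono (memLp_const C) (by simpa [abs_of_nonneg hC] using h)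
  refine h1.trans (le_of_eq ?_)
  rw [rms]
  simp only [integral_const, smul_eq_mul, Real.norm_eq_abs, sq_abs]
  rw [Real.sqrt_mul measureReal_nonneg, Real.sqrt_sq hC, mul_comm]

theorem rms_const_mul [NormedSpace ℝ F] (c : ℝ) : rms μ (fun ω => c • f ω) = |c| * rms μ f := by
  rw [rms, rms, ← Real.sqrt_sq_eq_abs, ← Real.sqrt_mul (sq_nonneg c), ← integral_const_mul]
  congr 2
  ext ω
  rw [norm_smul, mul_pow, Real.norm_eq_abs, sq_abs]

end RootMeanSquare

/-! ### Conditional expectations -/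

section CondExp

variable {Ω : Type*} {m mΩ : MeasurableSpace Ω} {P : Measure Ω} [IsProbabilityMeasure P]
  {F : Type*} [NormedAddCommGroup F] [InnerProductSpace ℝ F] [CompleteSpace F]

omit [IsProbabilityMeasure P] in
/-- Conditional Cauchy–Schwarz inequality, for a weight with bounded conditional variance. -/
theorem condExp_smul_norm_sq_le {V : Ω → ℝ} {H : Ω → F} {c : ℝ} (hc : 0 ≤ c)
    (hV : MemLp V 2 P) (hH : MemLp H 2 P)
    (hHc : ∀ᵐ ω ∂P, √((P[fun ω' => ‖H ω'‖ ^ 2 | m]) ω) ≤ c) :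
    ∀ᵐ ω ∂P, ‖(P[fun ω' => V ω' • H ω' | m]) ω‖ ^ 2
      ≤ c ^ 2 * (P[fun ω' => V ω' ^ 2 | m]) ω := by
  have hV2 : Integrable (fun ω => V ω ^ 2) P := hV.integrable_sq
  have hH2 : Integrable (fun ω => ‖H ω‖ ^ 2) P := (memLp_two_iff_integrable_sq_norm hH.1).1 hH
  have hVH : Integrable (fun ω => ‖V ω • H ω‖) P :=
    (MemLp.integrable_mul hV.norm hH.norm).congr
      (Eventually.of_forall fun ω => (norm_smul _ _).symm)
  -- Young's inequality with parameter `s`, taken conditionally. Rational parameters allow one null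
  -- set for all of them; real ones follow by continuity, and the discriminant of the resulting
  -- quadratic in `s` gives Cauchy–Schwarz.
  have key : ∀ s : ℚ, 0 < s → ∀ᵐ ω ∂P, 2 * ‖(P[fun ω' => V ω' • H ω' | m]) ω‖ ≤
      s * (P[fun ω' => V ω' ^ 2 | m]) ω + c ^ 2 / s := by
    intro s hs
    have hs' : (0 : ℝ) < s := by exact_mod_cast hs
    have hle : (fun ω => ‖V ω • H ω‖) ≤ᵐ[P]
        (((s : ℝ) / 2) • fun ω => V ω ^ 2) + ((1 / (2 * s) : ℝ) • fun ω => ‖H ω‖ ^ 2) := by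
      refine Eventually.of_forall fun ω => ?_
      simp only [Pi.add_apply, Pi.smul_apply, smul_eq_mul, norm_smul, Real.norm_eq_abs]
      have h1 : 0 ≤ (s * |V ω| - ‖H ω‖) ^ 2 / (2 * s) := by positivity
      have h2 : (s * |V ω| - ‖H ω‖) ^ 2 / (2 * s)
          = s / 2 * V ω ^ 2 + 1 / (2 * s) * ‖H ω‖ ^ 2 - |V ω| * ‖H ω‖ := by
        rw [← sq_abs (V ω)]; field_simp; ring
      linarith
    have h1 := condExp_mono (m := m) hVH ((hV2.smul _).add (hH2.smul _)) hle
    filter_upwards [h1, condExp_add (hV2.smul ((s : ℝ) / 2)) (hH2.smul (1 / (2 * s) : ℝ)) m,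
      condExp_smul (μ := P) ((s : ℝ) / 2) (fun ω => V ω ^ 2) m,
      condExp_smul (μ := P) (1 / (2 * s) : ℝ) (fun ω => ‖H ω‖ ^ 2) m,
      norm_condExp_le (μ := P) (m := m) (fun ω => V ω • H ω), hHc,
      condExp_nonneg (μ := P) (m := m) (f := fun ω => ‖H ω‖ ^ 2)
        (Eventually.of_forall fun _ => sq_nonneg _)] with ω h1 h2 h3 h4 h5 h6 h7
    rw [h2, Pi.add_apply, h3, h4, Pi.smul_apply, Pi.smul_apply, smul_eq_mul, smul_eq_mul] at h1
    have h8 : (P[fun ω' => ‖H ω'‖ ^ 2 | m]) ω ≤ c ^ 2 := by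
      rw [← Real.sqrt_le_sqrt_iff (sq_nonneg c), Real.sqrt_sq hc]; exact h6
    have h9 : 1 / (2 * (s : ℝ)) * (P[fun ω' => ‖H ω'‖ ^ 2 | m]) ω ≤ 1 / (2 * s) * c ^ 2 := by
      gcongr
    have h10 : c ^ 2 / s = 2 * (1 / (2 * (s : ℝ)) * c ^ 2) := by field_simp
    rw [h10]
    linarith
  have key' : ∀ᵐ ω ∂P, ∀ s : ℚ, 0 < s → 2 * ‖(P[fun ω' => V ω' • H ω' | m]) ω‖ ≤
      s * (P[fun ω' => V ω' ^ 2 | m]) ω + c ^ 2 / s := by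
    rw [ae_all_iff]; intro s
    by_cases hs : 0 < s
    · filter_upwards [key s hs] with ω h _ using h
    · exact Eventually.of_forall fun ω h => absurd h hs
  filter_upwards [key', condExp_nonneg (μ := P) (m := m) (f := fun ω => V ω ^ 2)
    (Eventually.of_forall fun _ => sq_nonneg _)] with ω h h0
  set a := (P[fun ω' => V ω' ^ 2 | m]) ω
  set x := ‖(P[fun ω' => V ω' • H ω' | m]) ω‖
  have hx : 0 ≤ x := norm_nonneg _
  have h0' : 0 ≤ a := h0
  -- A negative value at some real `s` would persist on a neighbourhood, which contains a positive
  -- rational.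
  have hpos : ∀ s : ℝ, 0 < s → 0 ≤ a * s ^ 2 + (-2 * x) * s + c ^ 2 := by
    have hrat : ∀ s : ℚ, 0 < s → 0 ≤ a * (s : ℝ) ^ 2 + (-2 * x) * s + c ^ 2 := by
      intro s hs
      have hs' : (0 : ℝ) < s := by exact_mod_cast hs
      have h1 := mul_le_mul_of_nonneg_right (h s hs) hs'.le
      have h2 : (s * a + c ^ 2 / s) * s = a * (s : ℝ) ^ 2 + c ^ 2 := by field_simp
      linarith
    intro s hs
    by_contra hneg
    push Not at hneg
    have hcont : ContinuousAt (fun s : ℝ => a * s ^ 2 + (-2 * x) * s + c ^ 2) s := by fun_prop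
    have hev : ∀ᶠ r in nhds s, a * r ^ 2 + (-2 * x) * r + c ^ 2 < 0 ∧ 0 < r :=
      (hcont.eventually_lt continuousAt_const hneg).and (lt_mem_nhds hs)
    obtain ⟨r, hr⟩ := Rat.denseRange_cast (𝕜 := ℝ) |>.exists_mem_open
      (isOpen_interior) (mem_interior_iff_mem_nhds.2 hev |> fun h => ⟨s, h⟩)
    have hr' := interior_subset hr
    have hr0 : (0 : ℚ) < r := by exact_mod_cast hr'.2
    exact absurd (hrat r hr0) (not_le.2 hr'.1)
  have hdis : discrim a (-2 * x) (c ^ 2) ≤ 0 := by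
    refine discrim_le_zero fun s => ?_
    rcases lt_or_ge 0 s with hs | hs
    · have := hpos s hs; nlinarith
    · have h1 : 0 ≤ -2 * x * s := by nlinarith
      have h2 : 0 ≤ a * (s * s) := mul_nonneg h0' (mul_self_nonneg s)
      nlinarith [sq_nonneg c]
  rw [discrim] at hdis
  nlinarith

/-- Restriction to the events of `m` commutes with the conditional expectation. It makes mean square
estimates fine enough to yield almost sure bounds. -/
theorem rms_condExp_smul_le (hm : m ≤ mΩ) {V : Ω → ℝ} {H : Ω → F} {c : ℝ} (hc : 0 ≤ c)
    (hV : MemLp V 2 P) (hH : MemLp H 2 P)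
    (hHc : ∀ᵐ ω ∂P, √((P[fun ω' => ‖H ω'‖ ^ 2 | m]) ω) ≤ c) {A : Set Ω} (hA : MeasurableSet[m] A) :
    rms (P.restrict A) (P[fun ω' => V ω' • H ω' | m]) ≤ c * rms (P.restrict A) V := by
  refine Real.sqrt_le_iff.2 ⟨mul_nonneg hc (rms_nonneg _ _), ?_⟩
  rw [mul_pow, rms_sq]
  have hV2 : Integrable (fun ω => V ω ^ 2) P := hV.integrable_sq
  calc _ ≤ ∫ ω in A, c ^ 2 * (P[fun ω' => V ω' ^ 2 | m]) ω ∂P := by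
        refine integral_mono_of_nonneg (Eventually.of_forall fun _ => sq_nonneg _)
          (integrable_condExp.const_mul _).integrableOn
          (ae_restrict_of_ae (condExp_smul_norm_sq_le hc hV hH hHc))
    _ = c ^ 2 * ∫ ω in A, ‖V ω‖ ^ 2 ∂P := by
        rw [integral_const_mul, setIntegral_condExp hm hV2 hA]
        simp only [Real.norm_eq_abs, sq_abs]

theorem rms_condExp_le (hm : m ≤ mΩ) {V : Ω → ℝ} (hV : MemLp V 2 P) {A : Set Ω}
    (hA : MeasurableSet[m] A) : rms (P.restrict A) (P[V | m]) ≤ rms (P.restrict A) V := by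
  have h := rms_condExp_smul_le (H := fun _ => (1 : ℝ)) hm zero_le_one hV (memLp_const 1)
    (by simp [condExp_const hm]) hA
  simpa using h

/-- The conditional expectation is the best approximation. -/
theorem rms_sub_condExp_le (hm : m ≤ mΩ) {V : Ω → ℝ} (hV : MemLp V 2 P) {A : Set Ω}
    (hA : MeasurableSet[m] A) :
    rms (P.restrict A) (fun ω => V ω - (P[V | m]) ω) ≤ rms (P.restrict A) V := by
  refine Real.sqrt_le_sqrt ?_
  simp only [Real.norm_eq_abs, sq_abs]
  have h1 : Integrable (fun ω => (V ω - (P[V | m]) ω) ^ 2) P :=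
    (hV.sub (hV.condExp one_le_two)).integrable_sq
  have h2 : Integrable (V ^ 2) P := hV.integrable_sq
  have e1 := setIntegral_condExp hm h1 hA
  have e2 := setIntegral_condExp hm h2 hA
  rw [← e1]
  refine le_trans ?_ e2.le
  exact setIntegral_mono_ae integrable_condExp.integrableOn integrable_condExp.integrableOn
    (condVar_ae_le_condExp_sq hm hV)

/-- Test the hypothesis on the event where the norm exceeds `C`: there `‖f‖ ^ 2 - C ^ 2` is positive
with nonpositive integral, so the event is null. -/
theorem ae_norm_le_of_rms_le {F : Type*} [NormedAddCommGroup F] [MeasurableSpace F]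
    [OpensMeasurableSpace F] (hm : m ≤ mΩ) {f : Ω → F} (hf : Measurable[m] f)
    (hf2 : MemLp f 2 P) {C : ℝ} (hC : 0 ≤ C)
    (h : ∀ A, MeasurableSet[m] A → rms (P.restrict A) f ≤ C * √(P.real A)) :
    ∀ᵐ ω ∂P, ‖f ω‖ ≤ C := by
  set A : Set Ω := {ω | C < ‖f ω‖} with hA
  have hAm : MeasurableSet[m] A := hf (measurableSet_lt measurable_const measurable_norm)
  have h1 := h A hAm
  have h2 : ∫ ω in A, ‖f ω‖ ^ 2 ∂P ≤ C ^ 2 * P.real A := by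
    rw [← rms_sq, ← Real.sq_sqrt (measureReal_nonneg (μ := P) (s := A)), ← mul_pow]
    exact pow_le_pow_left₀ (rms_nonneg _ _) h1 2
  have hi : Integrable (fun ω => ‖f ω‖ ^ 2 - C ^ 2) (P.restrict A) :=
    (((memLp_two_iff_integrable_sq_norm hf2.1).1 hf2).sub (integrable_const _)).integrableOn
  have hpos : ∀ ω ∈ A, 0 < ‖f ω‖ ^ 2 - C ^ 2 := fun ω hω => by
    have : C < ‖f ω‖ := hω
    nlinarith
  have h3 : ∫ ω in A, (‖f ω‖ ^ 2 - C ^ 2) ∂P ≤ 0 := by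
    rw [integral_sub ((memLp_two_iff_integrable_sq_norm hf2.1).1 hf2).integrableOn
      (integrable_const _)]
    simp only [integral_const, smul_eq_mul, measureReal_restrict_apply_univ]
    linarith
  have h4 : ∀ᵐ ω ∂(P.restrict A), ‖f ω‖ ^ 2 - C ^ 2 = 0 := by
    have hnn : 0 ≤ᵐ[P.restrict A] fun ω => ‖f ω‖ ^ 2 - C ^ 2 :=
      (ae_restrict_iff' (hm _ hAm)).2 (Eventually.of_forall fun ω hω => (hpos ω hω).le)
    exact (integral_eq_zero_iff_of_nonneg_ae hnn hi).1
      (le_antisymm h3 (integral_nonneg_of_ae hnn))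
  filter_upwards [(ae_restrict_iff' (hm _ hAm)).1 h4] with ω hω
  by_contra hlt
  have hωA : ω ∈ A := not_le.1 hlt
  exact absurd (hω hωA) (hpos ω hωA).ne'

/-- Freezing lemma: the conditional expectation of a function of independent noise and of a
variable which is known. -/
theorem setIntegral_freeze {Γ Λ 𝒳 : Type*} [MeasurableSpace Γ] [MeasurableSpace Λ]
    [MeasurableSpace 𝒳] {F : Type*} [NormedAddCommGroup F] [NormedSpace ℝ F] [CompleteSpace F]
    [MeasurableSpace F] [BorelSpace F] [SecondCountableTopology F]
    {V : Ω → Γ} {W : Ω → Λ} (hV : Measurable V) (hW : Measurable W) (hVW : IndepFun V W P)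
    {X : Λ → 𝒳} (hX : Measurable X) {f : Γ × 𝒳 → F} (hf : Measurable f) {R : Ω → F}
    (hR : Integrable R P) (hRf : R =ᵐ[P] fun ω => f (V ω, X (W ω))) :
    Measurable (fun x => ∫ a, f (a, x) ∂(P.map V)) ∧
    Integrable (fun ω => ∫ a, f (a, X (W ω)) ∂(P.map V)) P ∧
    ∀ A : Set Λ, MeasurableSet A → ∫ ω in W ⁻¹' A, (∫ a, f (a, X (W ω)) ∂(P.map V)) ∂P
      = ∫ ω in W ⁻¹' A, R ω ∂P := by
  have hpV := Measure.isProbabilityMeasure_map (μ := P) hV.aemeasurable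
  have hpW := Measure.isProbabilityMeasure_map (μ := P) hW.aemeasurable
  have hlaw : P.map (fun ω => (V ω, W ω)) = (P.map V).prod (P.map W) :=
    (indepFun_iff_map_prod_eq_prod_map_map hV.aemeasurable hW.aemeasurable).1 hVW
  set f' : Γ × Λ → F := fun a => f (a.1, X a.2) with hf'
  have hf'm : Measurable f' := hf.comp (measurable_fst.prodMk (hX.comp measurable_snd))
  have hmeas : Measurable (fun x => ∫ a, f (a, x) ∂(P.map V)) :=
    (hf.stronglyMeasurable.integral_prod_left').measurable
  have hi : Integrable f' ((P.map V).prod (P.map W)) := by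
    rw [← hlaw, integrable_map_measure hf'm.aestronglyMeasurable (hV.prodMk hW).aemeasurable]
    exact hR.congr hRf
  have hi2 : Integrable (fun w => ∫ a, f' (a, w) ∂(P.map V)) (P.map W) := hi.integral_prod_right
  refine ⟨hmeas, ?_, fun A hA => ?_⟩
  · exact (integrable_map_measure (hmeas.comp hX).aestronglyMeasurable hW.aemeasurable).1 hi2
  · have e1 : ∫ ω in W ⁻¹' A, (∫ a, f (a, X (W ω)) ∂(P.map V)) ∂P
        = ∫ w in A, ∫ a, f' (a, w) ∂(P.map V) ∂(P.map W) :=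
      (setIntegral_map hA (hmeas.comp hX).aestronglyMeasurable hW.aemeasurable).symm
    have e2 : ∫ ω in W ⁻¹' A, R ω ∂P
        = ∫ a in Set.univ ×ˢ A, f' a ∂((P.map V).prod (P.map W)) := by
      rw [← hlaw, setIntegral_map (MeasurableSet.univ.prod hA) hf'm.aestronglyMeasurable
        (hV.prodMk hW).aemeasurable]
      have : (fun ω => (V ω, W ω)) ⁻¹' (Set.univ ×ˢ A) = W ⁻¹' A := by ext; simp
      rw [this]
      exact integral_congr_ae (ae_restrict_of_ae hRf)
    rw [e1, e2, ← Measure.prod_restrict, Measure.restrict_univ, integral_prod_symm]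
    have := hi.integrableOn (s := Set.univ ×ˢ A)
    rwa [IntegrableOn, ← Measure.prod_restrict, Measure.restrict_univ] at this

/-- The freezing lemma with both variables equal to the identity of `Ω`, once with the σ-algebra of
the noise and once with that of the past. The function `g` is the mean over the noise. -/
theorem exists_condExp_eq_comp {𝒢 ℱ : MeasurableSpace Ω} (h𝒢 : 𝒢 ≤ mΩ) (hℱ : ℱ ≤ mΩ)
    (hind : Indep 𝒢 ℱ P) {𝒳 : Type*} [MeasurableSpace 𝒳]
    {F : Type*} [NormedAddCommGroup F] [NormedSpace ℝ F] [CompleteSpace F]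
    [MeasurableSpace F] [BorelSpace F] [SecondCountableTopology F]
    {X : Ω → 𝒳} (hX : Measurable[ℱ] X) {f : Ω × 𝒳 → F} (hf : Measurable[𝒢.prod inferInstance] f)
    {R : Ω → F} (hRf : R =ᵐ[P] fun ω => f (ω, X ω)) :
    ∃ g : 𝒳 → F, Measurable g ∧ (fun ω => g (X ω)) =ᵐ[P] P[R | ℱ] := by
  by_cases hR : Integrable R P
  · obtain ⟨h1, h2, h3⟩ := @setIntegral_freeze Ω mΩ P _ Ω Ω 𝒳 𝒢 ℱ _ F _ _ _ _ _ _ id id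
      (measurable_id'' h𝒢) (measurable_id'' hℱ)
      ((@IndepFun_iff_Indep Ω Ω Ω mΩ 𝒢 ℱ id id P).2
        (by rwa [MeasurableSpace.comap_id, MeasurableSpace.comap_id])) X hX f hf R hR hRf
    refine ⟨_, h1, ?_⟩
    refine ae_eq_condExp_of_forall_setIntegral_eq hℱ hR (fun _ _ _ => h2.integrableOn)
      (fun A hA _ => h3 A hA) ?_
    exact ((h1.comp hX).stronglyMeasurable).aestronglyMeasurable
  -- The conditional expectation of a non-integrable variable is zero by convention.
  · refine ⟨fun _ => 0, measurable_const, ?_⟩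
    rw [condExp_of_not_integrable hR]
    exact EventuallyEq.rfl

end CondExp

end MWLS


namespace MWLS

/-! ### The solution of the dynamic programming equation -/

theorem ae_norm_le_toReal_eLpNorm_top {Ω F : Type*} [MeasurableSpace Ω] [NormedAddCommGroup F]
    {P : Measure Ω} {f : Ω → F} (hf : MemLp f ⊤ P) :
    ∀ᵐ ω ∂P, ‖f ω‖ ≤ (eLpNorm f ⊤ P).toReal := by
  filter_upwards [ae_le_eLpNormEssSup (f := f) (μ := P)] with ω hω
  rw [← eLpNorm_exponent_top] at hω
  rw [← toReal_enorm]
  exact ENNReal.toReal_mono hf.2.ne hω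

theorem toReal_eLpNorm_top_le {Ω F : Type*} [MeasurableSpace Ω] [NormedAddCommGroup F]
    {P : Measure Ω} {f : Ω → F} {C : ℝ} (hC : 0 ≤ C) (h : ∀ᵐ ω ∂P, ‖f ω‖ ≤ C) :
    (eLpNorm f ⊤ P).toReal ≤ C := by
  rw [eLpNorm_exponent_top]
  exact ENNReal.toReal_le_of_le_ofReal hC (eLpNormEssSup_le_of_ae_bound h)

namespace Model

variable {Ω : Type*} [mΩ : MeasurableSpace Ω] {d q : ℕ} (𝓜 : Model Ω d q) {P : Measure Ω}
  {p : Params}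

/-- The driver at time `k` along the path `x`. -/
noncomputable def drv (y : ℕ → Vec d → ℝ) (z : ℕ → Vec d → Vec q) (k : ℕ) (x : ℕ → Vec d) : ℝ :=
  𝓜.f k (x k) (y (k + 1) (x (k + 1))) (z k (x k))

theorem obsY_eq (y : ℕ → Vec d → ℝ) (z : ℕ → Vec d → Vec q) (i : ℕ) (x : ℕ → Vec d) :
    𝓜.obsY y z i x = 𝓜.Φ (x 𝓜.N)
      + ∑ k ∈ Finset.Ico i 𝓜.N, 𝓜.drv y z k x * (𝓜.t (k + 1) - 𝓜.t k) := rfl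

theorem obsZ_eq (y : ℕ → Vec d → ℝ) (z : ℕ → Vec d → Vec q) (i : ℕ) (h : ℕ → Vec q)
    (x : ℕ → Vec d) :
    𝓜.obsZ y z i h x = 𝓜.Φ (x 𝓜.N) • h 𝓜.N
      + ∑ k ∈ Finset.Ioo i 𝓜.N, (𝓜.drv y z k x * (𝓜.t (k + 1) - 𝓜.t k)) • h k := rfl

variable {𝓜}

theorem obsY_congr {y y' : ℕ → Vec d → ℝ} {z z' : ℕ → Vec d → Vec q} {i : ℕ} (hi : i ≤ 𝓜.N)
    {x x' : ℕ → Vec d} (hx : ∀ j, i ≤ j → j ≤ 𝓜.N → x j = x' j)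
    (hy : ∀ j, i < j → j ≤ 𝓜.N → y j = y' j) (hz : ∀ j, i ≤ j → j < 𝓜.N → z j = z' j) :
    𝓜.obsY y z i x = 𝓜.obsY y' z' i x' := by
  rw [obsY_eq, obsY_eq, hx _ hi le_rfl]
  congr 1
  refine Finset.sum_congr rfl fun k hk => ?_
  obtain ⟨h1, h2⟩ := Finset.mem_Ico.1 hk
  rw [drv, drv, hx k h1 h2.le, hx (k + 1) (by omega) h2, hy (k + 1) (by omega) h2, hz k h1 h2]

/-- The index ranges give the order of computation. The observation for `Z` at time `i` uses `y`
from `i + 2` on and `z` from `i + 1` on. The one for `Y` also uses `y (i + 1)` and `z i`, so `z i`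
has to be found before `y i`. -/
theorem obsZ_congr {y y' : ℕ → Vec d → ℝ} {z z' : ℕ → Vec d → Vec q} {i : ℕ} (hi : i < 𝓜.N)
    {h h' : ℕ → Vec q} {x x' : ℕ → Vec d} (hh : ∀ j, i < j → j ≤ 𝓜.N → h j = h' j)
    (hx : ∀ j, i < j → j ≤ 𝓜.N → x j = x' j)
    (hy : ∀ j, i + 1 < j → j ≤ 𝓜.N → y j = y' j) (hz : ∀ j, i < j → j < 𝓜.N → z j = z' j) :
    𝓜.obsZ y z i h x = 𝓜.obsZ y' z' i h' x' := by
  rw [obsZ_eq, obsZ_eq, hx _ hi le_rfl, hh _ hi le_rfl]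
  congr 1
  refine Finset.sum_congr rfl fun k hk => ?_
  obtain ⟨h1, h2⟩ := Finset.mem_Ioo.1 hk
  rw [drv, drv, hx k h1 h2.le, hx (k + 1) (by omega) h2, hy (k + 1) (by omega) h2, hz k h1 h2,
    hh k h1 h2.le]

variable (h : 𝓜.MarkovAssumptions P p)
include h

theorem measurable_drv {Γ : Type*} [MeasurableSpace Γ] {y : Γ → ℕ → Vec d → ℝ}
    {z : Γ → ℕ → Vec d → Vec q} {k : ℕ} (hk : k < 𝓜.N) {x : ℕ → Γ → Vec d}
    (hy : Measurable fun a => y a (k + 1) (x (k + 1) a)) (hz : Measurable fun a => z a k (x k a))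
    (hx : Measurable (x k)) : Measurable fun a => 𝓜.drv (y a) (z a) k (fun j => x j a) :=
  (h.f_measurable k hk).comp (hx.prodMk (hy.prodMk hz))

theorem measurable_obsY {Γ : Type*} [MeasurableSpace Γ] {y : Γ → ℕ → Vec d → ℝ}
    {z : Γ → ℕ → Vec d → Vec q} {i : ℕ} (hi : i ≤ 𝓜.N) {x : ℕ → Γ → Vec d}
    (hy : ∀ j, i < j → j ≤ 𝓜.N → Measurable fun a => y a j (x j a))
    (hz : ∀ j, i ≤ j → j < 𝓜.N → Measurable fun a => z a j (x j a))
    (hx : ∀ j, i ≤ j → j ≤ 𝓜.N → Measurable (x j)) :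
    Measurable fun a => 𝓜.obsY (y a) (z a) i (fun j => x j a) := by
  simp only [obsY_eq]
  refine (h.Φ_measurable.comp (hx _ hi le_rfl)).add (Finset.measurable_fun_sum _ fun k hk => ?_)
  obtain ⟨h1, h2⟩ := Finset.mem_Ico.1 hk
  exact (measurable_drv h h2 (hy _ (by omega) h2) (hz _ h1 h2) (hx _ h1 h2.le)).mul_const _

theorem measurable_obsZ {Γ : Type*} [MeasurableSpace Γ] {y : Γ → ℕ → Vec d → ℝ}
    {z : Γ → ℕ → Vec d → Vec q} {i : ℕ} (hi : i < 𝓜.N) {x : ℕ → Γ → Vec d} {w : ℕ → Γ → Vec q}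
    (hy : ∀ j, i + 1 < j → j ≤ 𝓜.N → Measurable fun a => y a j (x j a))
    (hz : ∀ j, i < j → j < 𝓜.N → Measurable fun a => z a j (x j a))
    (hx : ∀ j, i < j → j ≤ 𝓜.N → Measurable (x j))
    (hw : ∀ j, i < j → j ≤ 𝓜.N → Measurable (w j)) :
    Measurable fun a => 𝓜.obsZ (y a) (z a) i (fun j => w j a) (fun j => x j a) := by
  simp only [obsZ_eq]
  refine ((h.Φ_measurable.comp (hx _ hi le_rfl)).smul (hw _ hi le_rfl)).add
    (Finset.measurable_fun_sum _ fun k hk => ?_)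
  obtain ⟨h1, h2⟩ := Finset.mem_Ioo.1 hk
  exact ((measurable_drv h h2 (hy _ (by omega) h2) (hz _ h1 h2) (hx _ h1 h2.le)).mul_const _).smul
    (hw _ h1 h2.le)

theorem measurable_X {i : ℕ} (hi : i ≤ 𝓜.N) : Measurable (𝓜.X i) :=
  (h.X_adapted i hi).mono (𝓜.ℱ.le i) le_rfl

theorem measurable_H {i j : ℕ} (hij : i < j) (hj : j ≤ 𝓜.N) : Measurable (𝓜.H i j) :=
  (h.H_measurable i j hij hj).mono (𝓜.ℱ.le _) le_rfl

variable [IsProbabilityMeasure P]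

/-- The observations are functions of the current state and of independent noise, and so their
conditional expectations are functions of the current state. -/
theorem exists_regression_functions {i : ℕ} (hi : i < 𝓜.N) {y : ℕ → Vec d → ℝ}
    {z : ℕ → Vec d → Vec q} (hy : ∀ j, j ≤ 𝓜.N → Measurable (y j))
    (hz : ∀ j, j < 𝓜.N → Measurable (z j)) :
    (∃ g : Vec d → ℝ, Measurable g ∧
      (fun ω => g (𝓜.X i ω)) =ᵐ[P] P[fun ω => 𝓜.obsY y z i (fun j => 𝓜.X j ω) | 𝓜.ℱ i]) ∧
    (∃ g : Vec d → Vec q, Measurable g ∧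
      (fun ω => g (𝓜.X i ω)) =ᵐ[P]
        P[fun ω => 𝓜.obsZ y z i (fun j => 𝓜.H i j ω) (fun j => 𝓜.X j ω) | 𝓜.ℱ i]) := by
  classical
  obtain ⟨𝒢, hind, hflow⟩ := h.flow i hi
  have h𝒢' : 𝒢.1 ≤ mΩ := le_trans 𝒢.2 (𝓜.ℱ.le _)
  choose V hV using fun j (h1 : i < j) (h2 : j ≤ 𝓜.N) => (hflow j h1 h2).1
  choose W hW using fun j (h1 : i < j) (h2 : j ≤ 𝓜.N) => (hflow j h1 h2).2
  -- The flow is completed by the current state at `j = i`, so that all states in the observation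
  -- are functions of noise and current state. The value beyond `N` plays no role.
  set V' : ℕ → Ω × Vec d → Vec d := fun j a =>
    if hj : i < j ∧ j ≤ 𝓜.N then V j hj.1 hj.2 a.1 a.2 else a.2 with hV'
  set W' : ℕ → Ω × Vec d → Vec q := fun j a =>
    if hj : i < j ∧ j ≤ 𝓜.N then W j hj.1 hj.2 a.1 a.2 else 0 with hW'
  have hV'm : ∀ j, i ≤ j → j ≤ 𝓜.N → Measurable[𝒢.1.prod inferInstance] (V' j) := by
    intro j h1 h2
    by_cases hj : i < j
    · have : V' j = fun a => V j hj h2 a.1 a.2 := by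
        funext a; simp [hV', hj, h2]
      rw [this]; exact (hV j hj h2).1
    · have : V' j = Prod.snd := by
        funext a; simp [hV', hj]
      rw [this]; exact @measurable_snd Ω (Vec d) 𝒢.1 _
  have hW'm : ∀ j, i < j → j ≤ 𝓜.N → Measurable[𝒢.1.prod inferInstance] (W' j) := by
    intro j hj h2
    have : W' j = fun a => W j hj h2 a.1 a.2 := by
      funext a; simp [hW', hj, h2]
    rw [this]; exact (hW j hj h2).1
  have hX : ∀ᵐ ω ∂P, ∀ j ∈ Finset.Icc i 𝓜.N, 𝓜.X j ω = V' j (ω, 𝓜.X i ω) := by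
    rw [Filter.eventually_all_finset]
    intro j hj
    obtain ⟨h1, h2⟩ := Finset.mem_Icc.1 hj
    by_cases hj : i < j
    · filter_upwards [(hV j hj h2).2] with ω hω
      simpa [hV', hj, h2] using hω
    · have : j = i := by omega
      subst this
      exact Eventually.of_forall fun ω => by simp [hV']
  have hH : ∀ᵐ ω ∂P, ∀ j ∈ Finset.Ioc i 𝓜.N, 𝓜.H i j ω = W' j (ω, 𝓜.X i ω) := by
    rw [Filter.eventually_all_finset]
    intro j hj
    obtain ⟨h1, h2⟩ := Finset.mem_Ioc.1 hj
    filter_upwards [(hW j h1 h2).2] with ω hω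
    simpa [hW', h1, h2] using hω
  constructor
  · refine exists_condExp_eq_comp h𝒢' (𝓜.ℱ.le i) hind (h.X_adapted i hi.le)
      (f := fun a => 𝓜.obsY y z i (fun j => V' j a)) ?_ ?_
    · exact @measurable_obsY Ω mΩ d q 𝓜 P p h (Ω × Vec d) (𝒢.1.prod inferInstance) (fun _ => y)
        (fun _ => z) i hi.le V' (fun j h1 h2 => (hy j h2).comp (hV'm j h1.le h2))
        (fun j h1 h2 => (hz j h2).comp (hV'm j h1 h2.le)) hV'm
    · filter_upwards [hX] with ω hω
      exact obsY_congr hi.le (fun j h1 h2 => hω j (Finset.mem_Icc.2 ⟨h1, h2⟩))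
        (fun _ _ _ => rfl) (fun _ _ _ => rfl)
  · refine exists_condExp_eq_comp h𝒢' (𝓜.ℱ.le i) hind (h.X_adapted i hi.le)
      (f := fun a => 𝓜.obsZ y z i (fun j => W' j a) (fun j => V' j a)) ?_ ?_
    · exact @measurable_obsZ Ω mΩ d q 𝓜 P p h (Ω × Vec d) (𝒢.1.prod inferInstance) (fun _ => y)
        (fun _ => z) i hi V' W' (fun j h1 h2 => (hy j h2).comp (hV'm j (by omega) h2))
        (fun j h1 h2 => (hz j h2).comp (hV'm j h1.le h2.le)) (fun j h1 h2 => hV'm j h1.le h2) hW'm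
    · filter_upwards [hX, hH] with ω hω hω'
      exact obsZ_congr hi (fun j h1 h2 => hω' j (Finset.mem_Ioc.2 ⟨h1, h2⟩))
        (fun j h1 h2 => hω j (Finset.mem_Icc.2 ⟨h1.le, h2⟩)) (fun _ _ _ => rfl) (fun _ _ _ => rfl)

/-- Backward construction: at each time first `z i`, then `y i` is installed by `Function.update`.
The equations at later times are untouched, since their observations do not see the functions at
time `i`. -/
theorem exists_isMarkovSolution : ∃ y z, 𝓜.IsMarkovSolution P y z := by
  have key : ∀ n, n ≤ 𝓜.N → ∃ (y : ℕ → Vec d → ℝ) (z : ℕ → Vec d → Vec q),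
      (∀ j, Measurable (y j)) ∧ (∀ j, Measurable (z j)) ∧
      (∀ i, 𝓜.N - n ≤ i → i ≤ 𝓜.N → (fun ω => y i (𝓜.X i ω)) =ᵐ[P]
        P[fun ω => 𝓜.obsY y z i (fun j => 𝓜.X j ω) | 𝓜.ℱ i]) ∧
      (∀ i, 𝓜.N - n ≤ i → i < 𝓜.N → (fun ω => z i (𝓜.X i ω)) =ᵐ[P]
        P[fun ω => 𝓜.obsZ y z i (fun j => 𝓜.H i j ω) (fun j => 𝓜.X j ω) | 𝓜.ℱ i]) := by
    intro n
    induction n with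
    | zero =>
      intro _
      refine ⟨fun _ => 𝓜.Φ, fun _ _ => 0, fun _ => h.Φ_measurable, fun _ => measurable_const,
        fun i h1 h2 => ?_, fun i h1 h2 => by omega⟩
      have hi : i = 𝓜.N := by omega
      subst hi
      obtain ⟨C, hC⟩ := h.Φ_bounded
      have hm : Measurable[𝓜.ℱ 𝓜.N] fun ω => 𝓜.Φ (𝓜.X 𝓜.N ω) :=
        h.Φ_measurable.comp (h.X_adapted _ le_rfl)
      have hobs : (fun ω => 𝓜.obsY (fun _ => 𝓜.Φ) (fun _ _ => 0) 𝓜.N (fun j => 𝓜.X j ω))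
          = fun ω => 𝓜.Φ (𝓜.X 𝓜.N ω) := by
        funext ω; simp [obsY_eq]
      rw [hobs, condExp_of_stronglyMeasurable (𝓜.ℱ.le _) hm.stronglyMeasurable]
      exact Integrable.of_bound
        (h.Φ_measurable.comp (measurable_X h le_rfl)).aestronglyMeasurable C
        (Eventually.of_forall fun ω => hC _)
    | succ n ih =>
      intro hn
      obtain ⟨y, z, hy, hz, hY, hZ⟩ := ih (by omega)
      set i := 𝓜.N - (n + 1) with hi
      have hiN : i < 𝓜.N := by omega
      obtain ⟨g, hg, hgZ⟩ := (exists_regression_functions h hiN (fun j _ => hy j)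
        (fun j _ => hz j)).2
      set z' := Function.update z i g with hz'
      have hz'm : ∀ j, Measurable (z' j) := by
        intro j
        by_cases hj : j = i
        · subst hj; simpa [hz'] using hg
        · simpa [hz', hj] using hz j
      obtain ⟨g', hg', hgY⟩ := (exists_regression_functions h hiN (fun j _ => hy j)
        (fun j _ => hz'm j)).1
      set y' := Function.update y i g' with hy'
      have hy'm : ∀ j, Measurable (y' j) := by
        intro j
        by_cases hj : j = i
        · subst hj; simpa [hy'] using hg'
        · simpa [hy', hj] using hy j
      have hyne : ∀ j, i < j → y' j = y j := fun j hj => by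
        simp [hy', (ne_of_gt hj)]
      have hzne : ∀ j, i < j → z' j = z j := fun j hj => by
        simp [hz', (ne_of_gt hj)]
      refine ⟨y', z', hy'm, hz'm, fun l h1 h2 => ?_, fun l h1 h2 => ?_⟩
      · by_cases hl : l = i
        · subst hl
          have : (fun ω => 𝓜.obsY y' z' i (fun j => 𝓜.X j ω))
              = fun ω => 𝓜.obsY y z' i (fun j => 𝓜.X j ω) := by
            funext ω
            exact obsY_congr h2 (fun _ _ _ => rfl) (fun j hj _ => hyne j hj) (fun _ _ _ => rfl)
          rw [this]
          simpa [hy'] using hgY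
        · have hl' : i < l := by omega
          have : (fun ω => 𝓜.obsY y' z' l (fun j => 𝓜.X j ω))
              = fun ω => 𝓜.obsY y z l (fun j => 𝓜.X j ω) := by
            funext ω
            exact obsY_congr h2 (fun _ _ _ => rfl) (fun j hj _ => hyne j (by omega))
              (fun j hj _ => hzne j (by omega))
          rw [this, hyne l hl']
          exact hY l (by omega) h2
      · by_cases hl : l = i
        · subst hl
          have : (fun ω => 𝓜.obsZ y' z' i (fun j => 𝓜.H i j ω) (fun j => 𝓜.X j ω))
              = fun ω => 𝓜.obsZ y z i (fun j => 𝓜.H i j ω) (fun j => 𝓜.X j ω) := by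
            funext ω
            exact obsZ_congr h2 (fun _ _ _ => rfl) (fun _ _ _ => rfl)
              (fun j hj _ => hyne j (by omega)) (fun j hj _ => hzne j hj)
          rw [this]
          simpa [hz'] using hgZ
        · have hl' : i < l := by omega
          have : (fun ω => 𝓜.obsZ y' z' l (fun j => 𝓜.H l j ω) (fun j => 𝓜.X j ω))
              = fun ω => 𝓜.obsZ y z l (fun j => 𝓜.H l j ω) (fun j => 𝓜.X j ω) := by
            funext ω
            exact obsZ_congr h2 (fun _ _ _ => rfl) (fun _ _ _ => rfl)
              (fun j hj _ => hyne j (by omega)) (fun j hj _ => hzne j (by omega))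
          rw [this, hzne l hl']
          exact hZ l (by omega) h2
  obtain ⟨y, z, hy, hz, hY, hZ⟩ := key 𝓜.N le_rfl
  exact ⟨y, z, fun i _ => hy i, fun i _ => hz i, fun i hi => hY i (by omega) hi,
    fun i hi => hZ i (by omega) hi⟩

end Model

end MWLS


/-! ### Almost sure bounds on the solution. -/

namespace MWLS

/-- The weights are only square integrable, but their conditional second moments are bounded; the
conditional Cauchy–Schwarz inequality turns this into boundedness. -/
theorem memLp_top_condExp_smul {Ω : Type*} {m mΩ : MeasurableSpace Ω} {P : Measure Ω}
    [IsProbabilityMeasure P] {F : Type*} [NormedAddCommGroup F] [InnerProductSpace ℝ F]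
    [CompleteSpace F] (hm : m ≤ mΩ) {V : Ω → ℝ} {H : Ω → F} {c : ℝ} (hc : 0 ≤ c)
    (hV : MemLp V ⊤ P) (hH : MemLp H 2 P)
    (hHc : ∀ᵐ ω ∂P, √((P[fun ω' => ‖H ω'‖ ^ 2 | m]) ω) ≤ c) :
    MemLp (P[fun ω' => V ω' • H ω' | m]) ⊤ P := by
  have hV2 : MemLp V 2 P := hV.mono_exponent le_top
  set C := (eLpNorm V ⊤ P).toReal with hC
  have hC0 : 0 ≤ C := ENNReal.toReal_nonneg
  have hE : P[fun ω => V ω ^ 2 | m] ≤ᵐ[P] fun _ => C ^ 2 := by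
    have h1 : (fun ω => V ω ^ 2) ≤ᵐ[P] fun _ => C ^ 2 := by
      filter_upwards [ae_norm_le_toReal_eLpNorm_top hV] with ω hω
      rw [← sq_abs]
      exact pow_le_pow_left₀ (abs_nonneg _) hω 2
    have h2 := condExp_mono (m := m) hV2.integrable_sq (integrable_const _) h1
    rwa [condExp_const hm] at h2
  refine memLp_top_of_bound (stronglyMeasurable_condExp.mono hm).aestronglyMeasurable (c * C) ?_
  filter_upwards [condExp_smul_norm_sq_le (m := m) hc hV2 hH hHc, hE] with ω h1 h2
  refine (sq_le_sq₀ (norm_nonneg _) (mul_nonneg hc hC0)).1 (h1.trans ?_)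
  rw [mul_pow]
  gcongr

namespace Model

variable {Ω : Type*} [mΩ : MeasurableSpace Ω] {d q : ℕ} {𝓜 : Model Ω d q} {P : Measure Ω}
  {p : Params} (h : 𝓜.MarkovAssumptions P p)
include h

theorem ae_abs_f_le {i : ℕ} (hi : i < 𝓜.N) : ∀ᵐ x ∂(P.map (𝓜.X i)), ∀ (a : ℝ) (b : Vec q),
    |𝓜.f i x a b| ≤ p.Cf / (p.T - 𝓜.t i) ^ (1 - p.θC)
      + p.Lf / (p.T - 𝓜.t i) ^ ((1 - p.θL) / 2) * (|a| + ‖b‖) := by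
  filter_upwards [h.f_lipschitz i hi, h.f_zero i hi] with x h1 h2 a b
  have h3 := h1 a 0 b 0
  rw [sub_zero, sub_zero] at h3
  have h4 : 𝓜.f i x a b = 𝓜.f i x 0 0 + (𝓜.f i x a b - 𝓜.f i x 0 0) := by ring
  rw [h4]
  exact (abs_add_le _ _).trans (add_le_add h2 h3)

theorem ae_abs_drv_le {i : ℕ} (hi : i < 𝓜.N) (y : ℕ → Vec d → ℝ) (z : ℕ → Vec d → Vec q) :
    ∀ᵐ ω ∂P, |𝓜.drv y z i (fun j => 𝓜.X j ω)| ≤ p.Cf / (p.T - 𝓜.t i) ^ (1 - p.θC)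
      + p.Lf / (p.T - 𝓜.t i) ^ ((1 - p.θL) / 2) *
        (|y (i + 1) (𝓜.X (i + 1) ω)| + ‖z i (𝓜.X i ω)‖) := by
  filter_upwards [ae_of_ae_map (measurable_X h hi.le).aemeasurable (ae_abs_f_le h hi)] with ω hω
  exact hω _ _

theorem memLp_top_ξ : MemLp 𝓜.ξ ⊤ P := by
  obtain ⟨C, hC⟩ := h.Φ_bounded
  exact memLp_top_of_bound (h.Φ_measurable.comp (measurable_X h le_rfl)).aestronglyMeasurable C
    (Eventually.of_forall fun ω => hC _)

theorem ae_norm_ξ_le : ∀ᵐ ω ∂P, ‖𝓜.ξ ω‖ ≤ 𝓜.Cξ P :=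
  ae_norm_le_toReal_eLpNorm_top (memLp_top_ξ h)

variable [IsProbabilityMeasure P]

omit [IsProbabilityMeasure P] in
theorem memLp_top_drv (hp : p.Admissible) {i : ℕ} (hi : i < 𝓜.N) {y : ℕ → Vec d → ℝ}
    {z : ℕ → Vec d → Vec q} (hym : Measurable (y (i + 1))) (hzm : Measurable (z i))
    (hy : MemLp (fun ω => y (i + 1) (𝓜.X (i + 1) ω)) ⊤ P)
    (hz : MemLp (fun ω => z i (𝓜.X i ω)) ⊤ P) :
    MemLp (fun ω => 𝓜.drv y z i (fun j => 𝓜.X j ω)) ⊤ P := by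
  refine memLp_top_of_bound (measurable_drv h hi (y := fun _ => y) (z := fun _ => z)
    (hym.comp (measurable_X h hi)) (hzm.comp (measurable_X h hi.le))
    (measurable_X h hi.le)).aestronglyMeasurable
    (p.Cf / (p.T - 𝓜.t i) ^ (1 - p.θC) + p.Lf / (p.T - 𝓜.t i) ^ ((1 - p.θL) / 2) *
      ((eLpNorm (fun ω => y (i + 1) (𝓜.X (i + 1) ω)) ⊤ P).toReal
        + (eLpNorm (fun ω => z i (𝓜.X i ω)) ⊤ P).toReal)) ?_
  filter_upwards [ae_abs_drv_le h hi y z, ae_norm_le_toReal_eLpNorm_top hy,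
    ae_norm_le_toReal_eLpNorm_top hz] with ω h1 h2 h3
  refine h1.trans ?_
  have h4 : 0 ≤ p.T - 𝓜.t i := by
    have := h.grid.le_last hi.le; linarith
  have h5 := hp.Lf_nonneg
  gcongr
  exact h2

omit h [IsProbabilityMeasure P] in
theorem CM_div_nonneg (hp : p.Admissible) (i j : ℕ) : 0 ≤ p.CM / √(𝓜.t j - 𝓜.t i) :=
  div_nonneg hp.CM_nonneg (Real.sqrt_nonneg _)

theorem integrable_smul_H {i j : ℕ} (hij : i < j) (hj : j ≤ 𝓜.N) {V : Ω → ℝ}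
    (hV : MemLp V ⊤ P) : Integrable (fun ω => V ω • 𝓜.H i j ω) P :=
  ((h.H_memLp i j hij hj).smul hV (r := 2)).integrable one_le_two

theorem condExp_smul_H_add_sum {i : ℕ} (hi : i < 𝓜.N) {V : Ω → ℝ} {W : ℕ → Ω → ℝ}
    (hV : MemLp V ⊤ P) (hW : ∀ k ∈ Finset.Ioo i 𝓜.N, MemLp (W k) ⊤ P) :
    P[fun ω => V ω • 𝓜.H i 𝓜.N ω + ∑ k ∈ Finset.Ioo i 𝓜.N, W k ω • 𝓜.H i k ω | 𝓜.ℱ i]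
      =ᵐ[P] fun ω => (P[fun ω => V ω • 𝓜.H i 𝓜.N ω | 𝓜.ℱ i]) ω
        + ∑ k ∈ Finset.Ioo i 𝓜.N, (P[fun ω => W k ω • 𝓜.H i k ω | 𝓜.ℱ i]) ω := by
  have h1 : ∀ k ∈ Finset.Ioo i 𝓜.N, Integrable (fun ω => W k ω • 𝓜.H i k ω) P := fun k hk =>
    integrable_smul_H h (Finset.mem_Ioo.1 hk).1 (Finset.mem_Ioo.1 hk).2.le (hW k hk)
  have h2 := condExp_add (integrable_smul_H h hi le_rfl hV) (integrable_finsetSum' _ h1) (𝓜.ℱ i)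
  have h3 := condExp_finsetSum h1 (𝓜.ℱ i)
  have h4 : (fun ω => V ω • 𝓜.H i 𝓜.N ω + ∑ k ∈ Finset.Ioo i 𝓜.N, W k ω • 𝓜.H i k ω)
      = (fun ω => V ω • 𝓜.H i 𝓜.N ω) + ∑ k ∈ Finset.Ioo i 𝓜.N, fun ω => W k ω • 𝓜.H i k ω := by
    funext ω; simp [Finset.sum_apply]
  rw [h4]
  filter_upwards [h2, h3] with ω h2 h3
  rw [h2, Pi.add_apply, h3, Finset.sum_apply]

/-- The weight is conditionally centered, so a part of `V` known at time `i` may be subtracted. This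
is how the conditional deviation of `ξ`, instead of its supremum, enters the bound on `Z`. -/
theorem condExp_smul_H_centered {i j : ℕ} (hij : i < j) (hj : j ≤ 𝓜.N) {V : Ω → ℝ}
    (hV : MemLp V ⊤ P) :
    P[fun ω => V ω • 𝓜.H i j ω | 𝓜.ℱ i]
      =ᵐ[P] P[fun ω => (V ω - (P[V | 𝓜.ℱ i]) ω) • 𝓜.H i j ω | 𝓜.ℱ i] := by
  have hE : MemLp (P[V | 𝓜.ℱ i]) ⊤ P := hV.condExp le_top
  have h1 := condExp_smul_of_aestronglyMeasurable_left (m := 𝓜.ℱ i) (μ := P)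
    (f := P[V | 𝓜.ℱ i]) (g := 𝓜.H i j) stronglyMeasurable_condExp.aestronglyMeasurable
    (integrable_smul_H h hij hj hE) ((h.H_memLp i j hij hj).integrable one_le_two)
  have h2 := condExp_sub (integrable_smul_H h hij hj hV) (integrable_smul_H h hij hj hE) (𝓜.ℱ i)
  have h3 : (fun ω => (V ω - (P[V | 𝓜.ℱ i]) ω) • 𝓜.H i j ω)
      = (fun ω => V ω • 𝓜.H i j ω) - fun ω => (P[V | 𝓜.ℱ i]) ω • 𝓜.H i j ω := by
    funext ω; simp [sub_smul]
  rw [h3]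
  filter_upwards [h1, h2, h.H_centered i j hij hj] with ω h1 h2 h4
  rw [h2, Pi.sub_apply]
  have h5 : (P[fun ω => (P[V | 𝓜.ℱ i]) ω • 𝓜.H i j ω | 𝓜.ℱ i]) ω = 0 := by
    have h6 : (fun ω => (P[V | 𝓜.ℱ i]) ω • 𝓜.H i j ω) = P[V | 𝓜.ℱ i] • 𝓜.H i j := rfl
    rw [h6, h1, Pi.smul_apply', h4]
    simp
  rw [h5, sub_zero]

/-- Every solution of the dynamic programming equation is bounded. -/
theorem IsMarkovSolution.memLp_top (hp : p.Admissible) {y : ℕ → Vec d → ℝ} {z : ℕ → Vec d → Vec q}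
    (hyz : 𝓜.IsMarkovSolution P y z) :
    (∀ i, i ≤ 𝓜.N → MemLp (fun ω => y i (𝓜.X i ω)) ⊤ P) ∧
    (∀ i, i < 𝓜.N → MemLp (fun ω => z i (𝓜.X i ω)) ⊤ P) := by
  obtain ⟨hym, hzm, hY, hZ⟩ := hyz
  have key : ∀ n i, i ≤ 𝓜.N → 𝓜.N - i = n → MemLp (fun ω => y i (𝓜.X i ω)) ⊤ P ∧
      (i < 𝓜.N → MemLp (fun ω => z i (𝓜.X i ω)) ⊤ P) := by
    intro n
    induction n using Nat.strong_induction_on with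
    | h n ih =>
      intro i hi hn
      have ihy : ∀ j, i < j → j ≤ 𝓜.N → MemLp (fun ω => y j (𝓜.X j ω)) ⊤ P := fun j h1 h2 =>
        (ih (𝓜.N - j) (by omega) j h2 rfl).1
      have ihz : ∀ j, i < j → j < 𝓜.N → MemLp (fun ω => z j (𝓜.X j ω)) ⊤ P := fun j h1 h2 =>
        (ih (𝓜.N - j) (by omega) j h2.le rfl).2 h2
      have hF : ∀ k ∈ Finset.Ioo i 𝓜.N, MemLp (fun ω => 𝓜.drv y z k (fun j => 𝓜.X j ω)
          * (𝓜.t (k + 1) - 𝓜.t k)) ⊤ P := by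
        intro k hk
        obtain ⟨h1, h2⟩ := Finset.mem_Ioo.1 hk
        have := memLp_top_drv h hp h2 (hym _ h2) (hzm _ h2) (ihy _ (by omega) h2) (ihz _ h1 h2)
        simpa only [mul_comm] using this.const_mul (𝓜.t (k + 1) - 𝓜.t k)
      have hzi : i < 𝓜.N → MemLp (fun ω => z i (𝓜.X i ω)) ⊤ P := by
        intro hi
        refine (memLp_congr_ae ((hZ i hi).trans (condExp_smul_H_add_sum h hi (memLp_top_ξ h)
          hF))).2 ?_
        refine (memLp_top_condExp_smul (𝓜.ℱ.le i) (CM_div_nonneg hp _ _) (memLp_top_ξ h)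
          (h.H_memLp i _ hi le_rfl) (h.H_bound i _ hi le_rfl)).add (memLp_finsetSum _ fun k hk => ?_)
        obtain ⟨h1, h2⟩ := Finset.mem_Ioo.1 hk
        exact memLp_top_condExp_smul (𝓜.ℱ.le i) (CM_div_nonneg hp _ _) (hF k hk)
          (h.H_memLp i _ h1 h2.le) (h.H_bound i _ h1 h2.le)
      refine ⟨(memLp_congr_ae (hY i hi)).2 (MemLp.condExp le_top ?_), hzi⟩
      refine (memLp_top_ξ h).add (memLp_finsetSum _ fun k hk => ?_)
      obtain ⟨h1, h2⟩ := Finset.mem_Ico.1 hk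
      have hzk : MemLp (fun ω => z k (𝓜.X k ω)) ⊤ P := by
        rcases h1.eq_or_lt with rfl | h1
        · exact hzi h2
        · exact ihz k h1 h2
      have := memLp_top_drv h hp h2 (hym _ h2) (hzm _ h2) (ihy _ (by omega) h2) hzk
      exact (this.const_mul (𝓜.t (k + 1) - 𝓜.t k)).congr_norm
        (this.1.mul_const _) (Eventually.of_forall fun ω => by rw [mul_comm]; rfl)
  exact ⟨fun i hi => (key _ i hi rfl).1, fun i hi => (key _ i hi.le rfl).2 hi⟩

/-- A conditional variance is at most the conditional second moment. Membership in `L∞` also ensures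
that `toReal` in `devξ` does not return its default value at infinity. -/
theorem devξ_memLp {i : ℕ} : MemLp (fun ω => √((P[fun ω' => (𝓜.ξ ω' - (P[𝓜.ξ | 𝓜.ℱ i]) ω') ^ 2
    | 𝓜.ℱ i]) ω)) ⊤ P ∧ 𝓜.devξ P i ≤ 𝓜.Cξ P := by
  have hξ := memLp_top_ξ h
  have hb : ∀ᵐ ω ∂P, ‖√((P[fun ω' => (𝓜.ξ ω' - (P[𝓜.ξ | 𝓜.ℱ i]) ω') ^ 2 | 𝓜.ℱ i]) ω)‖
      ≤ 𝓜.Cξ P := by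
    have h1 := condVar_ae_le_condExp_sq (𝓜.ℱ.le i) (hξ.mono_exponent (p := 2) le_top)
    have h2 : 𝓜.ξ ^ 2 ≤ᵐ[P] fun _ => 𝓜.Cξ P ^ 2 := by
      filter_upwards [ae_norm_ξ_le h] with ω hω
      rw [Pi.pow_apply, ← sq_abs]
      exact pow_le_pow_left₀ (abs_nonneg _) hω 2
    have h3 := condExp_mono (m := 𝓜.ℱ i) (hξ.mono_exponent (p := 2) le_top).integrable_sq
      (integrable_const _) h2
    rw [condExp_const (𝓜.ℱ.le i)] at h3
    filter_upwards [h1, h3] with ω h1 h3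
    rw [Real.norm_of_nonneg (Real.sqrt_nonneg _)]
    exact Real.sqrt_le_iff.2 ⟨𝓜.Cξ_nonneg P, h1.trans h3⟩
  have hm : AEStronglyMeasurable (fun ω => √((P[fun ω' => (𝓜.ξ ω' - (P[𝓜.ξ | 𝓜.ℱ i]) ω') ^ 2
      | 𝓜.ℱ i]) ω)) P :=
    (stronglyMeasurable_condExp.mono (𝓜.ℱ.le i)).measurable.sqrt.aestronglyMeasurable
  exact ⟨memLp_top_of_bound hm _ hb, toReal_eLpNorm_top_le (𝓜.Cξ_nonneg P) hb⟩

theorem rms_ξ_sub_condExp_le {i : ℕ} {A : Set Ω} (hA : MeasurableSet[𝓜.ℱ i] A) :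
    rms (P.restrict A) (fun ω => 𝓜.ξ ω - (P[𝓜.ξ | 𝓜.ℱ i]) ω) ≤ 𝓜.devξ P i * √(P.real A) := by
  have hξ2 : MemLp 𝓜.ξ 2 P := (memLp_top_ξ h).mono_exponent le_top
  have hi : Integrable (fun ω => (𝓜.ξ ω - (P[𝓜.ξ | 𝓜.ℱ i]) ω) ^ 2) P :=
    (hξ2.sub (hξ2.condExp one_le_two)).integrable_sq
  refine Real.sqrt_le_iff.2 ⟨mul_nonneg (𝓜.devξ_nonneg P i) (Real.sqrt_nonneg _), ?_⟩
  rw [mul_pow, Real.sq_sqrt measureReal_nonneg]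
  simp only [Real.norm_eq_abs, sq_abs]
  rw [← setIntegral_condExp (𝓜.ℱ.le i) hi hA]
  have h1 : ∀ᵐ ω ∂P, (P[fun ω' => (𝓜.ξ ω' - (P[𝓜.ξ | 𝓜.ℱ i]) ω') ^ 2 | 𝓜.ℱ i]) ω
      ≤ 𝓜.devξ P i ^ 2 := by
    filter_upwards [ae_norm_le_toReal_eLpNorm_top (devξ_memLp h (i := i)).1] with ω hω
    rw [Real.norm_of_nonneg (Real.sqrt_nonneg _)] at hω
    exact (Real.sqrt_le_left (𝓜.devξ_nonneg P i)).1 hω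
  calc _ ≤ ∫ _ in A, 𝓜.devξ P i ^ 2 ∂P :=
        setIntegral_mono_ae integrable_condExp.integrableOn (integrable_const _) h1
    _ = _ := by simp [mul_comm]

/-- The almost sure bounds on a solution of the dynamic programming equation. -/
theorem IsMarkovSolution.ae_bounds (hp : p.Admissible) {B G : ℝ → ℝ → ℝ}
    (hB : IsSumConstant p.R B)
    (hG : ∀ Cu γ : ℝ, 0 ≤ Cu → 0 < γ → IsGronwallConstant p.R p.T 0 (p.θL / 2) Cu γ (G Cu γ))
    {y : ℕ → Vec d → ℝ} {z : ℕ → Vec d → Vec q} (hyz : 𝓜.IsMarkovSolution P y z) {i : ℕ}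
    (hi : i < 𝓜.N) :
    (∀ᵐ ω ∂P, |y i (𝓜.X i ω)| ≤ 𝓜.Cy P p B G i) ∧
    (∀ᵐ ω ∂P, ‖z i (𝓜.X i ω)‖ ≤ 𝓜.Cz P p B G i) := by
  obtain ⟨hyb, hzb⟩ := hyz.memLp_top h hp
  obtain ⟨hym, hzm, hY, hZ⟩ := hyz
  have hξ := memLp_top_ξ h
  have hξ2 : MemLp 𝓜.ξ 2 P := hξ.mono_exponent le_top
  have hFb : ∀ k, k < 𝓜.N → MemLp (fun ω => 𝓜.drv y z k (fun j => 𝓜.X j ω)) ⊤ P := fun k hk =>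
    memLp_top_drv h hp hk (hym _ hk) (hzm _ hk) (hyb _ hk) (hzb _ hk)
  have hFΔ : ∀ k, k < 𝓜.N → MemLp (fun ω => 𝓜.drv y z k (fun j => 𝓜.X j ω)
      * (𝓜.t (k + 1) - 𝓜.t k)) ⊤ P := fun k hk =>
    ((hFb k hk).const_mul (𝓜.t (k + 1) - 𝓜.t k)).congr_norm ((hFb k hk).1.mul_const _)
      (Eventually.of_forall fun ω => by rw [mul_comm])
  have hΔ : ∀ k, k < 𝓜.N → 0 ≤ 𝓜.t (k + 1) - 𝓜.t k := fun k hk => by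
    have := h.grid.lt k hk; linarith
  have hTt : ∀ k, k < 𝓜.N → 0 ≤ p.T - 𝓜.t k := fun k hk => by
    have := h.grid.le_last hk.le; linarith
  have hrF : ∀ (A : Set Ω) k, k < 𝓜.N → rms (P.restrict A)
      (fun ω => 𝓜.drv y z k (fun j => 𝓜.X j ω) * (𝓜.t (k + 1) - 𝓜.t k))
      = rms (P.restrict A) (fun ω => 𝓜.drv y z k (fun j => 𝓜.X j ω)) * (𝓜.t (k + 1) - 𝓜.t k) := by
    intro A k hk
    have := rms_const_mul (μ := P.restrict A) (f := fun ω => 𝓜.drv y z k (fun j => 𝓜.X j ω))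
      (𝓜.t (k + 1) - 𝓜.t k)
    rw [abs_of_nonneg (hΔ k hk)] at this
    rw [mul_comm, ← this]
    simp only [smul_eq_mul, mul_comm]
  have hr2 : ∀ {F : Type} [NormedAddCommGroup F] {f : Ω → F} (A : Set Ω), MemLp f ⊤ P →
      MemLp f 2 (P.restrict A) := fun A hf => (hf.mono_exponent le_top).restrict A
  -- The deterministic recursion holds for the root mean squares over any event `A` of the past, and
  -- all data scale with `√(P.real A)`. The bound `D` on the deviations of `ξ` is left free, since
  -- `Y` and `Z` use different ones.
  have hmain : ∀ (A : Set Ω), MeasurableSet[𝓜.ℱ i] A → ∀ D, 0 ≤ D →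
      (∀ j, i ≤ j → j < 𝓜.N →
        rms (P.restrict A) (fun ω => 𝓜.ξ ω - (P[𝓜.ξ | 𝓜.ℱ j]) ω) ≤ D) → _ :=
    fun A hA D hD hDle => stability_bounds hp h.grid hB hG hi
      (Y := fun j => rms (P.restrict A) fun ω => y j (𝓜.X j ω))
      (Z := fun j => rms (P.restrict A) fun ω => z j (𝓜.X j ω))
      (F := fun j => rms (P.restrict A) fun ω => 𝓜.drv y z j (fun l => 𝓜.X l ω))
      (fun _ => rms_nonneg _ _) (fun _ => rms_nonneg _ _)
      (c₀ := 𝓜.Cξ P * √(P.real A)) (D := D) (cf := p.Cf * √(P.real A))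
      (mul_nonneg (𝓜.Cξ_nonneg P) (Real.sqrt_nonneg _)) hD
      (mul_nonneg hp.Cf_nonneg (Real.sqrt_nonneg _))
      (by
        intro j hij hj
        have hAj : MeasurableSet[𝓜.ℱ j] A := 𝓜.ℱ.mono hij _ hA
        have hS : ∀ k ∈ Finset.Ico j 𝓜.N, MemLp (fun ω => 𝓜.drv y z k (fun j => 𝓜.X j ω)
            * (𝓜.t (k + 1) - 𝓜.t k)) ⊤ P := fun k hk => hFΔ k (Finset.mem_Ico.1 hk).2
        rw [rms_congr_ae (ae_restrict_of_ae (hY j hj))]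
        refine (rms_condExp_le (𝓜.ℱ.le j)
          ((hξ.add (memLp_finsetSum _ hS)).mono_exponent le_top) hAj).trans ?_
        refine (rms_add_le (hr2 A hξ) (hr2 A (memLp_finsetSum _ hS))).trans ?_
        refine add_le_add ?_ ?_
        · have := rms_le_of_bound (μ := P.restrict A) (𝓜.Cξ_nonneg P)
            (ae_restrict_of_ae (ae_norm_ξ_le h))
          simpa using this
        · refine (rms_sum_le _ fun k hk => hr2 A (hS k hk)).trans (le_of_eq ?_)
          exact Finset.sum_congr rfl fun k hk => hrF A k (Finset.mem_Ico.1 hk).2)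
      (by
        intro j hij hj
        have hAj : MeasurableSet[𝓜.ℱ j] A := 𝓜.ℱ.mono hij _ hA
        have hS : ∀ k ∈ Finset.Ioo j 𝓜.N, MemLp (fun ω => 𝓜.drv y z k (fun j => 𝓜.X j ω)
            * (𝓜.t (k + 1) - 𝓜.t k)) ⊤ P := fun k hk => hFΔ k (Finset.mem_Ioo.1 hk).2
        have hcE : MemLp (fun ω => 𝓜.ξ ω - (P[𝓜.ξ | 𝓜.ℱ j]) ω) ⊤ P := hξ.sub (hξ.condExp le_top)
        have e1 : (fun ω => z j (𝓜.X j ω)) =ᵐ[P] fun ω =>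
            (P[fun ω => (𝓜.ξ ω - (P[𝓜.ξ | 𝓜.ℱ j]) ω) • 𝓜.H j 𝓜.N ω | 𝓜.ℱ j]) ω
            + ∑ k ∈ Finset.Ioo j 𝓜.N, (P[fun ω => (𝓜.drv y z k (fun j => 𝓜.X j ω)
              * (𝓜.t (k + 1) - 𝓜.t k)) • 𝓜.H j k ω | 𝓜.ℱ j]) ω := by
          filter_upwards [(hZ j hj).trans (condExp_smul_H_add_sum h hj hξ hS),
            condExp_smul_H_centered h hj le_rfl hξ] with ω h1 h2
          rw [h1, h2]
          rfl
        rw [rms_congr_ae (ae_restrict_of_ae e1)]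
        have hc := fun k => CM_div_nonneg (𝓜 := 𝓜) hp j k
        refine (rms_add_le (hr2 A (memLp_top_condExp_smul (𝓜.ℱ.le j) (hc _) hcE
          (h.H_memLp j _ hj le_rfl) (h.H_bound j _ hj le_rfl)))
          (hr2 A (memLp_finsetSum _ fun k hk => memLp_top_condExp_smul (𝓜.ℱ.le j) (hc k) (hS k hk)
          (h.H_memLp j _ (Finset.mem_Ioo.1 hk).1 (Finset.mem_Ioo.1 hk).2.le)
          (h.H_bound j _ (Finset.mem_Ioo.1 hk).1 (Finset.mem_Ioo.1 hk).2.le)))).trans ?_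
        refine add_le_add ?_ ?_
        · refine (rms_condExp_smul_le (𝓜.ℱ.le j) (hc _) (hcE.mono_exponent le_top)
            (h.H_memLp j _ hj le_rfl) (h.H_bound j _ hj le_rfl) hAj).trans ?_
          rw [h.grid.last]
          have h1 := mul_le_mul_of_nonneg_left (hDle j hij hj)
            (div_nonneg hp.CM_nonneg (Real.sqrt_nonneg (p.T - 𝓜.t j)))
          refine h1.trans (le_of_eq ?_)
          ring
        · refine (rms_sum_le _ fun k hk => hr2 A (memLp_top_condExp_smul (𝓜.ℱ.le j) (hc k) (hS k hk)
            (h.H_memLp j _ (Finset.mem_Ioo.1 hk).1 (Finset.mem_Ioo.1 hk).2.le)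
            (h.H_bound j _ (Finset.mem_Ioo.1 hk).1 (Finset.mem_Ioo.1 hk).2.le))).trans ?_
          refine Finset.sum_le_sum fun k hk => ?_
          obtain ⟨h1, h2⟩ := Finset.mem_Ioo.1 hk
          refine (rms_condExp_smul_le (𝓜.ℱ.le j) (hc k) ((hS k hk).mono_exponent le_top)
            (h.H_memLp j _ h1 h2.le) (h.H_bound j _ h1 h2.le) hAj).trans (le_of_eq ?_)
          rw [hrF A k h2, mul_comm])
      (by
        intro l hil hl
        have hL : 0 ≤ p.Lf / (p.T - 𝓜.t l) ^ ((1 - p.θL) / 2) :=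
          div_nonneg hp.Lf_nonneg (Real.rpow_nonneg (hTt l hl) _)
        have hC : 0 ≤ p.Cf / (p.T - 𝓜.t l) ^ (1 - p.θC) :=
          div_nonneg hp.Cf_nonneg (Real.rpow_nonneg (hTt l hl) _)
        have m1 : MemLp (fun ω => ‖y (l + 1) (𝓜.X (l + 1) ω)‖) 2 (P.restrict A) :=
          (hr2 A (hyb _ hl)).norm
        have m2 : MemLp (fun ω => ‖z l (𝓜.X l ω)‖) 2 (P.restrict A) := (hr2 A (hzb _ hl)).norm
        have m3 : MemLp (fun ω => (p.Lf / (p.T - 𝓜.t l) ^ ((1 - p.θL) / 2)) •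
            (‖y (l + 1) (𝓜.X (l + 1) ω)‖ + ‖z l (𝓜.X l ω)‖)) 2 (P.restrict A) :=
          (m1.add m2).const_smul (p.Lf / (p.T - 𝓜.t l) ^ ((1 - p.θL) / 2))
        have m0 : MemLp (fun _ : Ω => p.Cf / (p.T - 𝓜.t l) ^ (1 - p.θC)) 2 (P.restrict A) :=
          memLp_const _
        have m4 : MemLp (fun ω => p.Cf / (p.T - 𝓜.t l) ^ (1 - p.θC) +
            (p.Lf / (p.T - 𝓜.t l) ^ ((1 - p.θL) / 2)) •
            (‖y (l + 1) (𝓜.X (l + 1) ω)‖ + ‖z l (𝓜.X l ω)‖)) 2 (P.restrict A) := m0.add m3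
        have hle : rms (P.restrict A) (fun ω => 𝓜.drv y z l (fun l => 𝓜.X l ω)) ≤ _ :=
          rms_mono m4 (by
            filter_upwards [ae_restrict_of_ae (ae_abs_drv_le h hl y z)] with ω hω
            rw [Real.norm_eq_abs, Real.norm_eq_abs]
            refine hω.trans (le_trans (le_of_eq ?_) (le_abs_self _))
            rfl)
        refine hle.trans ((rms_add_le m0 m3).trans (add_le_add ?_ ?_))
        · have := rms_le_of_bound (μ := P.restrict A) (f := fun _ : Ω =>
            p.Cf / (p.T - 𝓜.t l) ^ (1 - p.θC)) hC
            (Eventually.of_forall fun _ => (Real.norm_of_nonneg hC).le)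
          refine this.trans (le_of_eq ?_)
          rw [measureReal_restrict_apply_univ]; ring
        · rw [rms_const_mul, abs_of_nonneg hL]
          refine mul_le_mul_of_nonneg_left ((rms_add_le m1 m2).trans (le_of_eq ?_)) hL
          simp only [rms, norm_norm])
  constructor
  · refine ae_norm_le_of_rms_le (𝓜.ℱ.le i) (f := fun ω => y i (𝓜.X i ω))
      ((hym i hi.le).comp (h.X_adapted i hi.le)) ((hyb i hi.le).mono_exponent le_top)
      (𝓜.Cy_nonneg P hp h.grid hB hG hi.le) fun A hA => ?_
    -- With `D` equal to the terminal size, the two terminal contributions merge into `Cy1`.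
    have h1 := (hmain A hA (𝓜.Cξ P * √(P.real A))
      (mul_nonneg (𝓜.Cξ_nonneg P) (Real.sqrt_nonneg _)) (fun j hij hj => by
        refine (rms_sub_condExp_le (𝓜.ℱ.le j) hξ2 (𝓜.ℱ.mono hij _ hA)).trans ?_
        have := rms_le_of_bound (μ := P.restrict A) (𝓜.Cξ_nonneg P)
            (ae_restrict_of_ae (ae_norm_ξ_le h))
        simpa using this)).1
    refine h1.trans (le_of_eq ?_)
    rw [Cy, Params.Cy1]
    ring
  · refine ae_norm_le_of_rms_le (𝓜.ℱ.le i) (f := fun ω => z i (𝓜.X i ω))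
      ((hzm i hi).comp (h.X_adapted i hi.le)) ((hzb i hi).mono_exponent le_top)
      (𝓜.Cz_nonneg P hp h.grid hB hG hi.le) fun A hA => ?_
    -- At a later time `j` the deviation of `ξ` from its conditional mean is no larger than the one
    -- at time `i`: it is the error of the best approximation, given time `j`, of `ξ` minus its
    -- conditional mean at time `i`.
    have h1 := (hmain A hA (𝓜.devξ P i * √(P.real A))
      (mul_nonneg (𝓜.devξ_nonneg P i) (Real.sqrt_nonneg _)) (fun j hij hj => by
        have hc : MemLp (fun ω => 𝓜.ξ ω - (P[𝓜.ξ | 𝓜.ℱ i]) ω) 2 P :=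
          hξ2.sub (hξ2.condExp one_le_two)
        have e1 := rms_sub_condExp_le (𝓜.ℱ.le j) hc (𝓜.ℱ.mono hij _ hA)
        refine le_trans (le_of_eq (rms_congr_ae (ae_restrict_of_ae ?_)))
          (e1.trans (rms_ξ_sub_condExp_le h hA))
        have e2 := condExp_sub (m := 𝓜.ℱ j) (hξ2.integrable one_le_two)
          (integrable_condExp (μ := P) (m := 𝓜.ℱ i) (f := 𝓜.ξ))
        have e3 : P[P[𝓜.ξ | 𝓜.ℱ i] | 𝓜.ℱ j] = P[𝓜.ξ | 𝓜.ℱ i] :=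
          condExp_of_stronglyMeasurable (𝓜.ℱ.le j)
            (stronglyMeasurable_condExp.mono (𝓜.ℱ.mono hij)) integrable_condExp
        have e4 : (fun ω => 𝓜.ξ ω - (P[𝓜.ξ | 𝓜.ℱ i]) ω) = 𝓜.ξ - P[𝓜.ξ | 𝓜.ℱ i] := rfl
        rw [e4]
        filter_upwards [e2] with ω h2
        rw [h2, Pi.sub_apply, e3]
        ring)).2
    refine h1.trans (le_of_eq ?_)
    rw [Cz]
    ring

end Model

end MWLS


namespace MWLS

/-! ### Paths -/

/-- The space of paths of the weights and of the chain, indexed by all natural numbers. -/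
abbrev PathSpace (d q : ℕ) := (ℕ → Vec q) × (ℕ → Vec d)

/-- Extension by zero of a path between the times `i` and `N`. -/
noncomputable def extendPath {d q : ℕ} (N i : ℕ)
    (a : (Set.Ioc i N → Vec q) × (Set.Icc i N → Vec d)) : PathSpace d q :=
  (fun j => if hj : i < j ∧ j ≤ N then a.1 ⟨j, hj⟩ else 0,
    fun j => if hj : i ≤ j ∧ j ≤ N then a.2 ⟨j, hj⟩ else 0)

section

variable {d q N i : ℕ}

theorem measurable_extendPath : Measurable (extendPath N i (d := d) (q := q)) := by
  refine (measurable_pi_lambda _ fun j => ?_).prodMk (measurable_pi_lambda _ fun j => ?_)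
  · by_cases hj : i < j ∧ j ≤ N
    · simp only [hj, and_self, dite_true]
      exact (measurable_pi_apply _).comp measurable_fst
    · simp only [hj, dite_false]; exact measurable_const
  · by_cases hj : i ≤ j ∧ j ≤ N
    · simp only [hj, and_self, dite_true]
      exact (measurable_pi_apply _).comp measurable_snd
    · simp only [hj, dite_false]; exact measurable_const

variable {α : Type*} (w : ℕ → α → Vec q) (x : ℕ → α → Vec d) (a : α) {j : ℕ}

theorem extendPath_pathAt_fst (h1 : i < j) (h2 : j ≤ N) :
    (extendPath N i (pathAt N i w x a)).1 j = w j a := by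
  simp [extendPath, pathAt, h1, h2]

theorem extendPath_pathAt_snd (h1 : i ≤ j) (h2 : j ≤ N) :
    (extendPath N i (pathAt N i w x a)).2 j = x j a := by
  simp [extendPath, pathAt, h1, h2]

theorem measurable_path_fst (j : ℕ) : Measurable fun e : PathSpace d q => e.1 j :=
  (measurable_pi_apply j).comp measurable_fst

theorem measurable_path_snd (j : ℕ) : Measurable fun e : PathSpace d q => e.2 j :=
  (measurable_pi_apply j).comp measurable_snd

end

namespace Model

variable {Ω : Type*} [mΩ : MeasurableSpace Ω] {d q : ℕ} (𝓜 : Model Ω d q) (P : Measure Ω)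
  {p : Params}

/-- The path of the weights and of the chain from time `i` on. -/
noncomputable def path (i : ℕ) (ω : Ω) : PathSpace d q :=
  extendPath 𝓜.N i (pathAt 𝓜.N i (𝓜.H i) 𝓜.X ω)

/-- The law of the path from time `i` on. -/
noncomputable def pathLaw (i : ℕ) : Measure (PathSpace d q) := P.map (𝓜.path i)

/-- The conditional law of the path from time `i` on, given the state at time `i`. -/
noncomputable def pathKernel [IsFiniteMeasure P] (i : ℕ) : Kernel (Vec d) (PathSpace d q) :=
  condDistrib (𝓜.path i) (𝓜.X i) P

instance [IsFiniteMeasure P] (i : ℕ) : IsMarkovKernel (𝓜.pathKernel P i) := by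
  unfold pathKernel; infer_instance

variable {𝓜 P}

variable (h : 𝓜.MarkovAssumptions P p)
include h

theorem measurable_pathAt (i : ℕ) : Measurable (pathAt 𝓜.N i (𝓜.H i) 𝓜.X) :=
  (measurable_pi_lambda _ fun j => measurable_H h j.2.1 j.2.2).prodMk
    (measurable_pi_lambda _ fun j => measurable_X h j.2.2)

theorem measurable_path (i : ℕ) : Measurable (𝓜.path i) :=
  measurable_extendPath.comp (measurable_pathAt h i)

omit h in
theorem path_snd {i j : ℕ} (h1 : i ≤ j) (h2 : j ≤ 𝓜.N) (ω : Ω) : (𝓜.path i ω).2 j = 𝓜.X j ω :=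
  extendPath_pathAt_snd _ _ _ h1 h2

omit h in
theorem path_fst {i j : ℕ} (h1 : i < j) (h2 : j ≤ 𝓜.N) (ω : Ω) : (𝓜.path i ω).1 j = 𝓜.H i j ω :=
  extendPath_pathAt_fst _ _ _ h1 h2

theorem map_pathLaw {i j : ℕ} (h1 : i ≤ j) (h2 : j ≤ 𝓜.N) :
    (𝓜.pathLaw P i).map (fun e => e.2 j) = P.map (𝓜.X j) := by
  rw [pathLaw, Measure.map_map (measurable_path_snd j) (measurable_path h i)]
  congr 1
  funext ω
  exact path_snd h1 h2 ω

theorem ae_pathLaw_state {i j : ℕ} (h1 : i ≤ j) (h2 : j ≤ 𝓜.N) {s : Vec d → Prop}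
    (hs : ∀ᵐ x ∂(P.map (𝓜.X j)), s x) : ∀ᵐ e ∂(𝓜.pathLaw P i), s (e.2 j) := by
  rw [← map_pathLaw h h1 h2] at hs
  exact ae_of_ae_map (measurable_path_snd j).aemeasurable hs

variable [IsProbabilityMeasure P]

theorem isProbabilityMeasure_pathLaw (i : ℕ) : IsProbabilityMeasure (𝓜.pathLaw P i) :=
  Measure.isProbabilityMeasure_map (measurable_path h i).aemeasurable

theorem map_pathLaw_eq_compProd {i : ℕ} (hi : i ≤ 𝓜.N) :
    (𝓜.pathLaw P i).map (fun e => (e.2 i, e))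
      = ((𝓜.pathLaw P i).map (fun e => e.2 i)) ⊗ₘ 𝓜.pathKernel P i := by
  rw [map_pathLaw h le_rfl hi, pathKernel,
    compProd_map_condDistrib (measurable_path h i).aemeasurable, pathLaw,
    Measure.map_map (g := fun e : PathSpace d q => (e.2 i, e))
      ((measurable_path_snd i).prodMk measurable_id) (measurable_path h i)]
  congr 1
  funext ω
  exact Prod.ext (path_snd le_rfl hi ω) rfl

/-- A conditional expectation given the past which is a function of the state at time `i` can be
computed with the conditional law of the path. -/
theorem ae_eq_integral_pathKernel {F : Type*} [NormedAddCommGroup F] [NormedSpace ℝ F]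
    [CompleteSpace F] [MeasurableSpace F] [BorelSpace F] [SecondCountableTopology F]
    {i : ℕ} (hi : i ≤ 𝓜.N) {f : PathSpace d q → F} (hf : Measurable f)
    (hfi : Integrable (fun ω => f (𝓜.path i ω)) P) {g : Vec d → F} (hg : Measurable g)
    (hgf : (fun ω => g (𝓜.X i ω)) =ᵐ[P] P[fun ω => f (𝓜.path i ω) | 𝓜.ℱ i]) :
    ∀ᵐ x ∂(P.map (𝓜.X i)), g x = ∫ e, f e ∂(𝓜.pathKernel P i x) := by
  have hX := measurable_X h hi
  have hm : MeasurableSpace.comap (𝓜.X i) inferInstance ≤ 𝓜.ℱ i :=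
    (h.X_adapted i hi).comap_le
  have h1 := condExp_ae_eq_integral_condDistrib (μ := P) hX (measurable_path h i).aemeasurable
    hf.stronglyMeasurable hfi
  -- Being a function of the state, the conditional expectation given the past is also the one given
  -- the state, by the tower property. The latter is the integral against the conditional law.
  have h2 : (fun ω => g (𝓜.X i ω)) =ᵐ[P]
      P[fun ω => f (𝓜.path i ω) | MeasurableSpace.comap (𝓜.X i) inferInstance] := by
    have h3 := condExp_condExp_of_le (μ := P) (f := fun ω => f (𝓜.path i ω)) hm (𝓜.ℱ.le i)
    refine EventuallyEq.trans ?_ h3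
    refine EventuallyEq.trans ?_ (condExp_congr_ae hgf)
    rw [condExp_of_stronglyMeasurable (f := fun ω => g (𝓜.X i ω)) hX.comap_le
      (hg.comp (comap_measurable (𝓜.X i))).stronglyMeasurable
      (integrable_condExp.congr hgf.symm)]
  have h4 : Measurable fun x => ∫ e, f e ∂(𝓜.pathKernel P i x) :=
    (hf.stronglyMeasurable.comp_measurable measurable_snd).integral_kernel_prod_right'
      (κ := 𝓜.pathKernel P i) |>.measurable
  exact (ae_map_iff hX.aemeasurable (measurableSet_eq_fun hg h4)).2 (h2.trans h1)

/-- The bound given the past passes to the coarser σ-algebra of the state by the tower property, and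
from there to the conditional law of the path. -/
theorem ae_eLpNorm_weight_le (hp : p.Admissible) {i k : ℕ} (hik : i < k) (hk : k ≤ 𝓜.N) :
    ∀ᵐ x ∂(P.map (𝓜.X i)), eLpNorm (fun e : PathSpace d q => e.1 k) 2 (𝓜.pathKernel P i x)
      ≤ ENNReal.ofReal (p.CM / √(𝓜.t k - 𝓜.t i)) := by
  have hi : i ≤ 𝓜.N := by omega
  have hX := measurable_X h hi
  have hc := CM_div_nonneg (𝓜 := 𝓜) hp i k
  have hm : MeasurableSpace.comap (𝓜.X i) inferInstance ≤ 𝓜.ℱ i :=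
    (h.X_adapted i hi).comap_le
  have hf : Measurable fun e : PathSpace d q => ‖e.1 k‖ ^ 2 :=
    (measurable_path_fst k).norm.pow_const 2
  have hH : ∀ ω, (𝓜.path i ω).1 k = 𝓜.H i k ω := path_fst hik hk
  have hfi : Integrable (fun ω => ‖(𝓜.path i ω).1 k‖ ^ 2) P := by
    simp only [hH]
    exact (h.H_memLp i k hik hk).integrable_norm_pow two_ne_zero
  have h1 := condExp_ae_eq_integral_condDistrib (μ := P) hX (measurable_path h i).aemeasurable
    hf.stronglyMeasurable hfi
  have h2 : P[fun ω => ‖(𝓜.path i ω).1 k‖ ^ 2 | 𝓜.ℱ i]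
      ≤ᵐ[P] fun _ => (p.CM / √(𝓜.t k - 𝓜.t i)) ^ 2 := by
    simp only [hH]
    filter_upwards [h.H_bound i k hik hk] with ω hω
    exact (Real.sqrt_le_left hc).1 hω
  have h3 := condExp_condExp_of_le (μ := P) (f := fun ω => ‖(𝓜.path i ω).1 k‖ ^ 2) hm (𝓜.ℱ.le i)
  have h4 := condExp_mono (m := MeasurableSpace.comap (𝓜.X i) inferInstance) integrable_condExp
    (integrable_const ((p.CM / √(𝓜.t k - 𝓜.t i)) ^ 2)) h2
  rw [condExp_const hX.comap_le] at h4
  have h5 : Measurable fun x => ∫ e, ‖e.1 k‖ ^ 2 ∂(𝓜.pathKernel P i x) :=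
    (hf.stronglyMeasurable.comp_measurable measurable_snd).integral_kernel_prod_right'
      (κ := 𝓜.pathKernel P i) |>.measurable
  have h6 : ∀ᵐ x ∂(P.map (𝓜.X i)), ∫ e, ‖e.1 k‖ ^ 2 ∂(𝓜.pathKernel P i x)
      ≤ (p.CM / √(𝓜.t k - 𝓜.t i)) ^ 2 := by
    refine (ae_map_iff hX.aemeasurable (measurableSet_le h5 measurable_const)).2 ?_
    filter_upwards [h1, h3, h4] with ω e1 e3 e4
    exact (e1.symm.trans e3.symm).le.trans e4
  have h7 : ∀ᵐ x ∂(P.map (𝓜.X i)), Integrable (fun e => ‖e.1 k‖ ^ 2) (𝓜.pathKernel P i x) := by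
    have h8 : Integrable (fun a : Vec d × PathSpace d q => ‖a.2.1 k‖ ^ 2)
        (P.map fun ω => (𝓜.X i ω, 𝓜.path i ω)) :=
      (integrable_map_measure (hf.comp measurable_snd).aestronglyMeasurable
        (hX.prodMk (measurable_path h i)).aemeasurable).2 hfi
    exact h8.condDistrib_ae_map (measurable_path h i).aemeasurable
  filter_upwards [h6, h7] with x hx hxi
  refine eLpNorm_two_le_of_sq_le ?_
  rw [← ENNReal.ofReal_pow hc]
  refine le_trans (le_of_eq ?_) (ENNReal.ofReal_le_ofReal hx)
  rw [ofReal_integral_eq_lintegral_ofReal hxi (Eventually.of_forall fun e => by positivity)]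
  refine lintegral_congr fun e => ?_
  rw [ENNReal.ofReal_pow (norm_nonneg _), ofReal_norm]

end Model

end MWLS


namespace MWLS

/-! ### Observations on the path space -/

theorem eLpNorm_smul_le_of_bound {α F : Type*} [MeasurableSpace α] [NormedAddCommGroup F]
    [NormedSpace ℝ F] {ρ : Measure α} {V : α → ℝ} {w : α → F} {b c : ℝ} (hb : 0 ≤ b)
    (hV : ∀ᵐ a ∂ρ, |V a| ≤ b) (hw : eLpNorm w 2 ρ ≤ ENNReal.ofReal c) :
    eLpNorm (fun a => V a • w a) 2 ρ ≤ ENNReal.ofReal (b * c) := by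
  rw [ENNReal.ofReal_mul hb]
  refine (eLpNorm_le_mul_eLpNorm_of_ae_le_mul (c := b) (g := w) ?_ 2).trans (by gcongr)
  filter_upwards [hV] with a ha
  rw [norm_smul, Real.norm_eq_abs]
  gcongr

theorem memLp_two_of_kernel {𝒳 E F : Type*} [MeasurableSpace 𝒳] [MeasurableSpace E]
    [NormedAddCommGroup F] [MeasurableSpace F] [BorelSpace F] [SecondCountableTopology F]
    {μ : Measure E} [IsProbabilityMeasure μ] {π : E → 𝒳} (hπ : Measurable π) {κ : Kernel 𝒳 E}
    [IsMarkovKernel κ] (hκ : μ.map (fun e => (π e, e)) = (μ.map π) ⊗ₘ κ) {S : E → F}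
    (hS : Measurable S) {Γ : ℝ} (hSΓ : ∀ᵐ x ∂(μ.map π), eLpNorm S 2 (κ x) ≤ ENNReal.ofReal Γ) :
    MemLp S 2 μ := by
  refine ⟨hS.aestronglyMeasurable, ?_⟩
  refine lt_of_le_of_lt (eLpNorm_two_le_of_sq_le (c := ENNReal.ofReal Γ) ?_) ENNReal.ofReal_lt_top
  have := Measure.isProbabilityMeasure_map (μ := μ) hπ.aemeasurable
  rw [lintegral_eq_lintegral_kernel hπ hκ (g := fun a => ‖S a.2‖ₑ ^ 2)
    ((hS.comp measurable_snd).enorm.pow_const 2)]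
  calc _ ≤ ∫⁻ _, ENNReal.ofReal Γ ^ 2 ∂(μ.map π) := by
        refine lintegral_mono_ae ?_
        filter_upwards [hSΓ] with x hx
        rw [← eLpNorm_two_sq]
        gcongr
    _ = _ := by simp

namespace Model

variable {Ω : Type*} [mΩ : MeasurableSpace Ω] {d q : ℕ} {𝓜 : Model Ω d q} {P : Measure Ω}
  {p : Params} {B G : ℝ → ℝ → ℝ} (h : 𝓜.MarkovAssumptions P p)
include h

theorem ae_pathLaw_abs_drv_le (hp : p.Admissible) {i k : ℕ} (hik : i ≤ k) (hk : k < 𝓜.N)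
    {y : ℕ → Vec d → ℝ} {z : ℕ → Vec d → Vec q}
    (hy : ∀ᵐ x ∂(P.map (𝓜.X (k + 1))), |y (k + 1) x| ≤ 𝓜.Cy P p B G (k + 1))
    (hz : ∀ᵐ x ∂(P.map (𝓜.X k)), ‖z k x‖ ≤ √q * 𝓜.Cz P p B G k) :
    ∀ᵐ e ∂(𝓜.pathLaw P i), |𝓜.drv y z k e.2| ≤ 𝓜.driverBound P p B G k := by
  filter_upwards [ae_pathLaw_state h hik hk.le (ae_abs_f_le h hk),
    ae_pathLaw_state h (by omega : i ≤ k + 1) hk hy, ae_pathLaw_state h hik hk.le hz]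
    with e h1 h2 h3
  refine (h1 _ _).trans ?_
  have h4 : 0 ≤ p.T - 𝓜.t k := by
    have := h.grid.le_last hk.le; linarith
  have h5 := hp.Lf_nonneg
  unfold driverBound
  gcongr

theorem ae_pathLaw_abs_Φ_le {i : ℕ} (hi : i ≤ 𝓜.N) :
    ∀ᵐ e ∂(𝓜.pathLaw P i), |𝓜.Φ (e.2 𝓜.N)| ≤ 𝓜.Cξ P := by
  refine ae_pathLaw_state h hi le_rfl (s := fun x => |𝓜.Φ x| ≤ 𝓜.Cξ P) ?_
  exact (ae_map_iff (measurable_X h le_rfl).aemeasurable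
    (measurableSet_le h.Φ_measurable.abs measurable_const)).2 (ae_norm_ξ_le h)

variable [IsProbabilityMeasure P] (hp : p.Admissible) (hB : IsSumConstant p.R B)
  (hG : ∀ Cu γ : ℝ, 0 ≤ Cu → 0 < γ → IsGronwallConstant p.R p.T 0 (p.θL / 2) Cu γ (G Cu γ))
include hp hB hG

omit hp hB hG [IsProbabilityMeasure P] in
theorem measurable_path_drv {k : ℕ} (hk : k < 𝓜.N) {y : ℕ → Vec d → ℝ} {z : ℕ → Vec d → Vec q}
    (hym : Measurable (y (k + 1))) (hzm : Measurable (z k)) :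
    Measurable fun e : PathSpace d q => 𝓜.drv y z k e.2 :=
  measurable_drv h hk (y := fun _ => y) (z := fun _ => z) (x := fun j (e : PathSpace d q) => e.2 j)
    (hym.comp (measurable_path_snd _)) (hzm.comp (measurable_path_snd _)) (measurable_path_snd _)

/-- Minkowski's inequality under the conditional law, with bounded coefficients in front of the
weights; the constants add up to `Γz`. The hypotheses suit both the exact functions and the
truncated ones of the algorithm. -/
theorem ae_eLpNorm_obsZ_le {i : ℕ} (hi : i < 𝓜.N) {y : ℕ → Vec d → ℝ} {z : ℕ → Vec d → Vec q}
    (hym : ∀ j, i + 1 < j → j ≤ 𝓜.N → Measurable (y j))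
    (hzm : ∀ j, i < j → j < 𝓜.N → Measurable (z j))
    (hy : ∀ j, i < j → j ≤ 𝓜.N → ∀ᵐ x ∂(P.map (𝓜.X j)), |y j x| ≤ 𝓜.Cy P p B G j)
    (hz : ∀ j, i < j → j < 𝓜.N → ∀ᵐ x ∂(P.map (𝓜.X j)), ‖z j x‖ ≤ √q * 𝓜.Cz P p B G j) :
    ∀ᵐ x ∂(P.map (𝓜.X i)), eLpNorm (fun e : PathSpace d q => 𝓜.obsZ y z i e.1 e.2) 2
      (𝓜.pathKernel P i x) ≤ ENNReal.ofReal (𝓜.Γz P p B G i) := by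
  have hdev : ∀ k, k < 𝓜.N → 𝓜.devξ P k ≤ 𝓜.Cξ P := fun k _ => (devξ_memLp h).2
  have hpr := isProbabilityMeasure_pathLaw h i
  have hκ := map_pathLaw_eq_compProd h hi.le
  have hmap := map_pathLaw h (P := P) le_rfl hi.le
  have hw : ∀ᵐ x ∂(P.map (𝓜.X i)), ∀ k ∈ Finset.Ioc i 𝓜.N,
      eLpNorm (fun e : PathSpace d q => e.1 k) 2 (𝓜.pathKernel P i x)
        ≤ ENNReal.ofReal (p.CM / √(𝓜.t k - 𝓜.t i)) := by
    rw [Filter.eventually_all_finset]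
    intro k hk
    obtain ⟨h1, h2⟩ := Finset.mem_Ioc.1 hk
    exact ae_eLpNorm_weight_le h hp h1 h2
  have hb : ∀ᵐ x ∂(P.map (𝓜.X i)), ∀ k ∈ Finset.Ioo i 𝓜.N, ∀ᵐ e ∂(𝓜.pathKernel P i x),
      |𝓜.drv y z k e.2| ≤ 𝓜.driverBound P p B G k := by
    rw [Filter.eventually_all_finset, ← hmap]
    intro k hk
    obtain ⟨h1, h2⟩ := Finset.mem_Ioo.1 hk
    exact ae_kernel_of_ae (measurable_path_snd i) hκ (ae_pathLaw_abs_drv_le h hp h1.le h2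
      (hy _ (by omega) h2) (hz _ h1 h2))
  have hΦ : ∀ᵐ x ∂(P.map (𝓜.X i)), ∀ᵐ e ∂(𝓜.pathKernel P i x), |𝓜.Φ (e.2 𝓜.N)| ≤ 𝓜.Cξ P := by
    rw [← hmap]
    exact ae_kernel_of_ae (measurable_path_snd i) hκ (ae_pathLaw_abs_Φ_le h hi.le)
  filter_upwards [hw, hb, hΦ] with x h1 h2 h3
  have h4 : ∀ k ∈ Finset.Ioo i 𝓜.N, eLpNorm (fun e : PathSpace d q =>
      (𝓜.drv y z k e.2 * (𝓜.t (k + 1) - 𝓜.t k)) • e.1 k) 2 (𝓜.pathKernel P i x)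
      ≤ ENNReal.ofReal (𝓜.driverBound P p B G k * (𝓜.t (k + 1) - 𝓜.t k)
        * (p.CM / √(𝓜.t k - 𝓜.t i))) := by
    intro k hk
    obtain ⟨hk1, hk2⟩ := Finset.mem_Ioo.1 hk
    have hΔ := (h.grid.step_pos hk2).le
    refine eLpNorm_smul_le_of_bound
      (mul_nonneg (driverBound_nonneg 𝓜 P hp h.grid hB hG hk2) hΔ) ?_
      (h1 k (Finset.mem_Ioc.2 ⟨hk1, hk2.le⟩))
    filter_upwards [h2 k hk] with e he
    rw [abs_mul, abs_of_nonneg hΔ]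
    gcongr
  have h5 : eLpNorm (fun e : PathSpace d q => 𝓜.Φ (e.2 𝓜.N) • e.1 𝓜.N) 2 (𝓜.pathKernel P i x)
      ≤ ENNReal.ofReal (𝓜.Cξ P * (p.CM / √(p.T - 𝓜.t i))) := by
    refine eLpNorm_smul_le_of_bound (𝓜.Cξ_nonneg P) h3 ?_
    have := h1 𝓜.N (Finset.mem_Ioc.2 ⟨hi, le_rfl⟩)
    rwa [h.grid.last] at this
  have hm5 : Measurable fun e : PathSpace d q => 𝓜.Φ (e.2 𝓜.N) • e.1 𝓜.N :=
    (h.Φ_measurable.comp (measurable_path_snd _)).smul (measurable_path_fst _)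
  have hm4 : ∀ k ∈ Finset.Ioo i 𝓜.N, Measurable fun e : PathSpace d q =>
      (𝓜.drv y z k e.2 * (𝓜.t (k + 1) - 𝓜.t k)) • e.1 k := by
    intro k hk
    obtain ⟨hk1, hk2⟩ := Finset.mem_Ioo.1 hk
    exact ((measurable_path_drv h hk2 (hym _ (by omega) hk2) (hzm _ hk1 hk2)).mul_const _).smul
      (measurable_path_fst _)
  simp only [obsZ_eq]
  refine (eLpNorm_add_le hm5.aestronglyMeasurable
    (Finset.measurable_fun_sum _ hm4).aestronglyMeasurable (by norm_num)).trans ?_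
  have h6 : eLpNorm (fun e : PathSpace d q => ∑ k ∈ Finset.Ioo i 𝓜.N,
      (𝓜.drv y z k e.2 * (𝓜.t (k + 1) - 𝓜.t k)) • e.1 k) 2 (𝓜.pathKernel P i x)
      ≤ ∑ k ∈ Finset.Ioo i 𝓜.N, ENNReal.ofReal (𝓜.driverBound P p B G k *
        (𝓜.t (k + 1) - 𝓜.t k) * (p.CM / √(𝓜.t k - 𝓜.t i))) := by
    have := eLpNorm_sum_le (p := 2) (μ := 𝓜.pathKernel P i x)
      (fun k hk => (hm4 k hk).aestronglyMeasurable) (by norm_num)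
    rw [Finset.sum_fn] at this
    exact this.trans (Finset.sum_le_sum h4)
  refine (add_le_add h5 h6).trans ?_
  rw [← ENNReal.ofReal_sum_of_nonneg, ← ENNReal.ofReal_add]
  · exact ENNReal.ofReal_le_ofReal (sum_driverBound_le_Γz 𝓜 P hp h.grid hB hG hdev hi)
  · exact mul_nonneg (𝓜.Cξ_nonneg P) (div_nonneg hp.CM_nonneg (Real.sqrt_nonneg _))
  · refine Finset.sum_nonneg fun k hk => ?_
    obtain ⟨hk1, hk2⟩ := Finset.mem_Ioo.1 hk
    exact mul_nonneg (mul_nonneg (driverBound_nonneg 𝓜 P hp h.grid hB hG hk2)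
      (h.grid.step_pos hk2).le) (CM_div_nonneg hp i k)
  · intro k hk
    obtain ⟨hk1, hk2⟩ := Finset.mem_Ioo.1 hk
    exact mul_nonneg (mul_nonneg (driverBound_nonneg 𝓜 P hp h.grid hB hG hk2)
      (h.grid.step_pos hk2).le) (CM_div_nonneg hp i k)

/-- Without weights the observation is almost surely bounded by `Γy`, and this passes to almost
every conditional law. -/
theorem ae_eLpNorm_obsY_le {i : ℕ} (hi : i < 𝓜.N) {y : ℕ → Vec d → ℝ} {z : ℕ → Vec d → Vec q}
    (hy : ∀ j, i < j → j ≤ 𝓜.N → ∀ᵐ x ∂(P.map (𝓜.X j)), |y j x| ≤ 𝓜.Cy P p B G j)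
    (hz : ∀ j, i ≤ j → j < 𝓜.N → ∀ᵐ x ∂(P.map (𝓜.X j)), ‖z j x‖ ≤ √q * 𝓜.Cz P p B G j) :
    ∀ᵐ x ∂(P.map (𝓜.X i)), eLpNorm (fun e : PathSpace d q => 𝓜.obsY y z i e.2) 2
      (𝓜.pathKernel P i x) ≤ ENNReal.ofReal (𝓜.Γy P p B G i) := by
  have hdev : ∀ k, k < 𝓜.N → 𝓜.devξ P k ≤ 𝓜.Cξ P := fun k _ => (devξ_memLp h).2
  have hpr := isProbabilityMeasure_pathLaw h i
  have h1 : ∀ᵐ e ∂(𝓜.pathLaw P i), |𝓜.obsY y z i e.2| ≤ 𝓜.Γy P p B G i := by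
    have h2 : ∀ᵐ e ∂(𝓜.pathLaw P i), ∀ k ∈ Finset.Ico i 𝓜.N,
        |𝓜.drv y z k e.2| ≤ 𝓜.driverBound P p B G k := by
      rw [Filter.eventually_all_finset]
      intro k hk
      obtain ⟨h1, h2⟩ := Finset.mem_Ico.1 hk
      exact ae_pathLaw_abs_drv_le h hp h1 h2 (hy _ (by omega) h2) (hz _ h1 h2)
    filter_upwards [h2, ae_pathLaw_abs_Φ_le h hi.le] with e h3 h4
    rw [obsY_eq]
    refine (abs_add_le _ _).trans (le_trans (add_le_add h4 ((Finset.abs_sum_le_sum_abs _ _).trans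
      (Finset.sum_le_sum fun k hk => ?_))) (sum_driverBound_le_Γy 𝓜 P hp h.grid hB hG hdev hi))
    have hΔ := (h.grid.step_pos (Finset.mem_Ico.1 hk).2).le
    rw [abs_mul, abs_of_nonneg hΔ]
    exact mul_le_mul_of_nonneg_right (h3 k hk) hΔ
  have h2 := ae_kernel_of_ae (measurable_path_snd i) (map_pathLaw_eq_compProd h hi.le) h1
  rw [map_pathLaw h le_rfl hi.le] at h2
  filter_upwards [h2] with x hx
  refine (eLpNorm_le_of_ae_bound hx).trans ?_
  simp

omit hB hG [IsProbabilityMeasure P] hp in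
theorem measurable_path_obsZ {i : ℕ} (hi : i < 𝓜.N) {y : ℕ → Vec d → ℝ}
    {z : ℕ → Vec d → Vec q} (hym : ∀ j, i + 1 < j → j ≤ 𝓜.N → Measurable (y j))
    (hzm : ∀ j, i < j → j < 𝓜.N → Measurable (z j)) :
    Measurable fun e : PathSpace d q => 𝓜.obsZ y z i e.1 e.2 :=
  measurable_obsZ h hi (y := fun _ => y) (z := fun _ => z)
    (x := fun j (e : PathSpace d q) => e.2 j) (w := fun j e => e.1 j)
    (fun j h1 h2 => (hym j h1 h2).comp (measurable_path_snd _))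
    (fun j h1 h2 => (hzm j h1 h2).comp (measurable_path_snd _))
    (fun j _ _ => measurable_path_snd _) (fun j _ _ => measurable_path_fst _)

omit hB hG [IsProbabilityMeasure P] hp in
theorem measurable_path_obsY {i : ℕ} (hi : i < 𝓜.N) {y : ℕ → Vec d → ℝ}
    {z : ℕ → Vec d → Vec q} (hym : ∀ j, i < j → j ≤ 𝓜.N → Measurable (y j))
    (hzm : ∀ j, i ≤ j → j < 𝓜.N → Measurable (z j)) :
    Measurable fun e : PathSpace d q => 𝓜.obsY y z i e.2 :=
  measurable_obsY h hi.le (y := fun _ => y) (z := fun _ => z)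
    (x := fun j (e : PathSpace d q) => e.2 j)
    (fun j h1 h2 => (hym j h1 h2).comp (measurable_path_snd _))
    (fun j h1 h2 => (hzm j h1 h2).comp (measurable_path_snd _))
    (fun j _ _ => measurable_path_snd _)

theorem IsMarkovSolution.ae_map_bounds {y : ℕ → Vec d → ℝ} {z : ℕ → Vec d → Vec q}
    (hyz : 𝓜.IsMarkovSolution P y z) :
    (∀ j, j < 𝓜.N → ∀ᵐ x ∂(P.map (𝓜.X j)), |y j x| ≤ 𝓜.Cy P p B G j) ∧
    (∀ j, j < 𝓜.N → ∀ᵐ x ∂(P.map (𝓜.X j)), ‖z j x‖ ≤ 𝓜.Cz P p B G j) :=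
  ⟨fun j hj => (ae_map_iff (measurable_X h hj.le).aemeasurable
      (measurableSet_le (hyz.1 j hj.le).abs measurable_const)).2 (hyz.ae_bounds h hp hB hG hj).1,
    fun j hj => (ae_map_iff (measurable_X h hj.le).aemeasurable
      (measurableSet_le (hyz.2.1 j hj).norm measurable_const)).2 (hyz.ae_bounds h hp hB hG hj).2⟩

omit [IsProbabilityMeasure P] in
theorem ae_map_abs_Φ_le : ∀ᵐ x ∂(P.map (𝓜.X 𝓜.N)), |𝓜.Φ x| ≤ 𝓜.Cy P p B G 𝓜.N := by
  refine (ae_map_iff (measurable_X h le_rfl).aemeasurable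
    (measurableSet_le h.Φ_measurable.abs measurable_const)).2 ?_
  filter_upwards [ae_norm_ξ_le h] with ω hω
  obtain ⟨h1, h2, -⟩ := Params.constants_nonneg hp hB hG
  have h3 := 𝓜.Cξ_nonneg P
  have h4 := hp.Cf_nonneg
  have h5 := (hB p.θC 1 hp.θC_mem.1 one_pos).1
  have h6 : 0 ≤ (p.T - 𝓜.t 𝓜.N) ^ p.θC := Real.rpow_nonneg (by rw [h.grid.last]; simp) _
  calc |𝓜.Φ (𝓜.X 𝓜.N ω)| ≤ 1 * 𝓜.Cξ P + 0 := by simpa [Model.ξ] using hω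
    _ ≤ _ := by
      unfold Cy
      refine add_le_add (mul_le_mul_of_nonneg_right h1 h3) ?_
      positivity

omit hp hB hG in
theorem IsMarkovSolution.terminal_ae {y : ℕ → Vec d → ℝ} {z : ℕ → Vec d → Vec q}
    (hyz : 𝓜.IsMarkovSolution P y z) : ∀ᵐ x ∂(P.map (𝓜.X 𝓜.N)), y 𝓜.N x = 𝓜.Φ x := by
  refine (ae_map_iff (measurable_X h le_rfl).aemeasurable
    (measurableSet_eq_fun (hyz.1 _ le_rfl) h.Φ_measurable)).2 ?_
  have h1 := hyz.2.2.1 𝓜.N le_rfl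
  have h2 : Measurable[𝓜.ℱ 𝓜.N] 𝓜.ξ := h.Φ_measurable.comp (h.X_adapted _ le_rfl)
  simp only [Finset.Ico_self, Finset.sum_empty, add_zero] at h1
  rw [condExp_of_stronglyMeasurable (f := fun ω => 𝓜.ξ ω) (𝓜.ℱ.le _) h2.stronglyMeasurable
    ((memLp_top_ξ h).integrable le_top)] at h1
  exact h1

omit [IsProbabilityMeasure P] in
-- The exact `z` satisfies the stronger bound `Cz`. The factor `√q` of coordinatewise truncation is
-- inserted to treat both kinds of functions alike; for `q = 0` it vanishes, but so does `v`.
theorem le_sqrt_mul_Cz {j : ℕ} (hj : j ≤ 𝓜.N) {v : Vec q} (hv : ‖v‖ ≤ 𝓜.Cz P p B G j) :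
    ‖v‖ ≤ √q * 𝓜.Cz P p B G j := by
  rcases Nat.eq_zero_or_pos q with rfl | hq
  · simp [Subsingleton.elim v 0]
  · have h1 : (1 : ℝ) ≤ √q := by
      rw [Real.one_le_sqrt]; exact_mod_cast hq
    exact hv.trans (le_mul_of_one_le_left (𝓜.Cz_nonneg P hp h.grid hB hG hj) h1)

/-- Puts the dynamic programming equation in the form required by `eLpNorm_regression_le`: the exact
functions are regression functions of square integrable observations on the path space. -/
theorem IsMarkovSolution.obs_properties {y : ℕ → Vec d → ℝ} {z : ℕ → Vec d → Vec q}
    (hyz : 𝓜.IsMarkovSolution P y z) {i : ℕ} (hi : i < 𝓜.N) :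
    (MemLp (fun e : PathSpace d q => 𝓜.obsY y z i e.2) 2 (𝓜.pathLaw P i) ∧
      ∀ᵐ x ∂(P.map (𝓜.X i)), y i x = ∫ e, 𝓜.obsY y z i e.2 ∂(𝓜.pathKernel P i x)) ∧
    (MemLp (fun e : PathSpace d q => 𝓜.obsZ y z i e.1 e.2) 2 (𝓜.pathLaw P i) ∧
      ∀ᵐ x ∂(P.map (𝓜.X i)), z i x = ∫ e, 𝓜.obsZ y z i e.1 e.2 ∂(𝓜.pathKernel P i x)) := by
  have hpr := isProbabilityMeasure_pathLaw h i
  have hκ := map_pathLaw_eq_compProd h hi.le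
  have hmap := map_pathLaw h (P := P) le_rfl hi.le
  obtain ⟨hy, hz⟩ := hyz.ae_map_bounds h hp hB hG
  have hy' : ∀ j, j ≤ 𝓜.N → ∀ᵐ x ∂(P.map (𝓜.X j)), |y j x| ≤ 𝓜.Cy P p B G j := by
    intro j hj
    rcases hj.lt_or_eq with hj | rfl
    · exact hy j hj
    · filter_upwards [hyz.terminal_ae h, ae_map_abs_Φ_le h hp hB hG] with x h1 h2
      rwa [h1]
  have hz' : ∀ j, j < 𝓜.N → ∀ᵐ x ∂(P.map (𝓜.X j)), ‖z j x‖ ≤ √q * 𝓜.Cz P p B G j := by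
    intro j hj
    filter_upwards [hz j hj] with x hx
    exact le_sqrt_mul_Cz h hp hB hG hj.le hx
  have hmY := measurable_path_obsY h hi (y := y) (z := z) (fun j _ h2 => hyz.1 j h2)
    (fun j _ h2 => hyz.2.1 j h2)
  have hmZ := measurable_path_obsZ h hi (y := y) (z := z) (fun j _ h2 => hyz.1 j h2)
    (fun j _ h2 => hyz.2.1 j h2)
  have hLY := ae_eLpNorm_obsY_le h hp hB hG hi (y := y) (z := z) (fun j _ => hy' j)
    (fun j _ => hz' j)
  have hLZ := ae_eLpNorm_obsZ_le h hp hB hG hi (y := y) (z := z) (fun j _ h2 => hyz.1 j h2)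
    (fun j _ h2 => hyz.2.1 j h2) (fun j _ => hy' j) (fun j _ => hz' j)
  rw [← hmap] at hLY hLZ
  have hMY := memLp_two_of_kernel (measurable_path_snd i) hκ hmY hLY
  have hMZ := memLp_two_of_kernel (measurable_path_snd i) hκ hmZ hLZ
  have hpm := measurable_path h (P := P) i
  refine ⟨⟨hMY, ?_⟩, hMZ, ?_⟩
  · refine ae_eq_integral_pathKernel h hi.le hmY ?_ (hyz.1 i hi.le) ?_
    · exact (integrable_map_measure hmY.aestronglyMeasurable hpm.aemeasurable).1
        (hMY.integrable one_le_two)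
    · have : (fun ω => 𝓜.obsY y z i (𝓜.path i ω).2) = fun ω => 𝓜.obsY y z i fun j => 𝓜.X j ω := by
        funext ω
        exact obsY_congr hi.le (fun j h1 h2 => path_snd h1 h2 ω) (fun _ _ _ => rfl)
          (fun _ _ _ => rfl)
      rw [this]
      exact hyz.2.2.1 i hi.le
  · refine ae_eq_integral_pathKernel h hi.le hmZ ?_ (hyz.2.1 i hi) ?_
    · exact (integrable_map_measure hmZ.aestronglyMeasurable hpm.aemeasurable).1
        (hMZ.integrable one_le_two)
    · have : (fun ω => 𝓜.obsZ y z i (𝓜.path i ω).1 (𝓜.path i ω).2)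
          = fun ω => 𝓜.obsZ y z i (fun j => 𝓜.H i j ω) fun j => 𝓜.X j ω := by
        funext ω
        exact obsZ_congr hi (fun j h1 h2 => path_fst h1 h2 ω)
          (fun j h1 h2 => path_snd h1.le h2 ω) (fun _ _ _ => rfl) (fun _ _ _ => rfl)
      rw [this]
      exact hyz.2.2.2 i hi

end Model

end MWLS


namespace MWLS

/-! ### The clouds -/

namespace Clouds

variable {Ω Ω' : Type*} [MeasurableSpace Ω] [mΩ' : MeasurableSpace Ω'] {d q : ℕ} {M : ℕ → ℕ}
  (𝓢 : Clouds Ω' d q M)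

/-- The simulations of the cloud at time `i`. -/
noncomputable def sample (N i : ℕ) (ω : Ω') (m : Fin (M i)) : PathSpace d q :=
  extendPath N i (pathAt N i (𝓢.H i m) (𝓢.X i m) ω)

/-- The sample space with the information of the clouds at the times `i, …, N - 1`. -/
def Future (_ : Clouds Ω' d q M) (_ _ : ℕ) := Ω'

instance (N i : ℕ) : MeasurableSpace (𝓢.Future N i) := 𝓢.sigmaFrom N i

/-- The identity map. -/
def toFuture (N i : ℕ) (ω : Ω') : 𝓢.Future N i := ω

/-- The identity map. -/
def ofFuture {N i : ℕ} (u : 𝓢.Future N i) : Ω' := u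

omit mΩ' in
@[simp]
theorem ofFuture_toFuture (N i : ℕ) (ω : Ω') : 𝓢.ofFuture (𝓢.toFuture N i ω) = ω := rfl

omit mΩ' in
theorem comap_toFuture (N i : ℕ) :
    MeasurableSpace.comap (𝓢.toFuture N i) inferInstance = 𝓢.sigmaFrom N i :=
  MeasurableSpace.comap_id

omit mΩ' in
theorem comap_pathAt_le_sample {N i : ℕ} (m : Fin (M i)) :
    MeasurableSpace.comap (pathAt N i (𝓢.H i m) (𝓢.X i m)) inferInstance
      ≤ MeasurableSpace.comap (𝓢.sample N i) inferInstance := by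
  let r : (Fin (M i) → PathSpace d q) → (Set.Ioc i N → Vec q) × (Set.Icc i N → Vec d) :=
    fun D => (fun j => (D m).1 j, fun j => (D m).2 j)
  have hr : Measurable r := by
    refine (measurable_pi_lambda _ fun j => ?_).prodMk (measurable_pi_lambda _ fun j => ?_)
    · exact (measurable_path_fst _).comp (measurable_pi_apply m)
    · exact (measurable_path_snd _).comp (measurable_pi_apply m)
  have h1 : pathAt N i (𝓢.H i m) (𝓢.X i m) = r ∘ 𝓢.sample N i := by
    funext ω
    refine Prod.ext (funext fun j => ?_) (funext fun j => ?_)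
    · exact (extendPath_pathAt_fst _ _ ω j.2.1 j.2.2).symm
    · exact (extendPath_pathAt_snd _ _ ω j.2.1 j.2.2).symm
  rw [h1, ← MeasurableSpace.comap_comp]
  exact MeasurableSpace.comap_mono hr.comap_le

omit mΩ' in
-- The index set splits into `j = i`, covered by the sample, and `j ≥ i + 1`, covered by the later
-- clouds.
theorem sigmaFrom_le_comap {N i : ℕ} :
    𝓢.sigmaFrom N i ≤ MeasurableSpace.comap
      (fun ω => (𝓢.toFuture N (i + 1) ω, 𝓢.sample N i ω)) inferInstance := by
  refine le_trans (iSup_le ?_) (MeasurableSpace.comap_prodMk (𝓢.toFuture N (i + 1))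
    (𝓢.sample N i)).ge
  rintro ⟨⟨⟨j, hj⟩, m⟩, hij⟩
  rcases Nat.lt_or_ge i j with h1 | h1
  · refine le_sup_of_le_left ?_
    rw [comap_toFuture]
    exact le_iSup (fun a : {a : Σ j : Fin N, Fin (M j) // i + 1 ≤ a.1} =>
      MeasurableSpace.comap (pathAt N a.1.1 (𝓢.H a.1.1 a.1.2) (𝓢.X a.1.1 a.1.2)) inferInstance)
      ⟨⟨⟨j, hj⟩, m⟩, h1⟩
  · have h2 : j = i := le_antisymm h1 hij
    subst h2
    exact le_sup_of_le_right (𝓢.comap_pathAt_le_sample m)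

omit mΩ' in
/-- A random function that depends on the clouds from time `i` on only is a function of the
simulations at time `i` and of the later clouds. -/
theorem exists_factor {F : Type*} [Nonempty F] [MeasurableSpace F] [StandardBorelSpace F] {N i : ℕ}
    {ψ : Ω' → Vec d → F}
    (hψ : Measurable[(𝓢.sigmaFrom N i).prod inferInstance] (fun a : Ω' × Vec d => ψ a.1 a.2)) :
    ∃ Ψ : (𝓢.Future N (i + 1) × (Fin (M i) → PathSpace d q)) × Vec d → F, Measurable Ψ ∧
      ∀ ω x, ψ ω x = Ψ ((𝓢.toFuture N (i + 1) ω, 𝓢.sample N i ω), x) := by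
  let g : Ω' → 𝓢.Future N (i + 1) × (Fin (M i) → PathSpace d q) :=
    fun ω => (𝓢.toFuture N (i + 1) ω, 𝓢.sample N i ω)
  have h1 : (𝓢.sigmaFrom N i).prod (inferInstance : MeasurableSpace (Vec d))
      ≤ MeasurableSpace.comap (Prod.map g (id : Vec d → Vec d)) inferInstance := by
    rw [Prod.instMeasurableSpace, MeasurableSpace.comap_prodMap]
    simp only [MeasurableSpace.prod, MeasurableSpace.comap_id]
    exact sup_le_sup (MeasurableSpace.comap_mono 𝓢.sigmaFrom_le_comap) le_rfl
  -- The Doob–Dynkin factorization; it needs a standard Borel target.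
  obtain ⟨Ψ, hΨ, hΨ'⟩ := (hψ.mono h1 le_rfl).exists_eq_measurable_comp
  exact ⟨Ψ, hΨ, fun ω x => congrFun hΨ' (ω, x)⟩

variable {𝓢} {P' : Measure Ω'} {𝓜 : Model Ω d q} {P : Measure Ω}
  (hsim : 𝓢.AreSimulations P' 𝓜 P)
include hsim

theorem AreSimulations.sigmaFrom_le (i : ℕ) : 𝓢.sigmaFrom 𝓜.N i ≤ mΩ' :=
  iSup_le fun a => (hsim.measurable _ a.1.1.2 _).comap_le

theorem AreSimulations.measurable_toFuture (i : ℕ) : Measurable (𝓢.toFuture 𝓜.N i) :=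
  (comap_toFuture 𝓢 𝓜.N i ▸ hsim.sigmaFrom_le i :
    MeasurableSpace.comap (𝓢.toFuture 𝓜.N i) inferInstance ≤ mΩ') |> measurable_iff_comap_le.2

theorem AreSimulations.measurable_sample {i : ℕ} (hi : i < 𝓜.N) : Measurable (𝓢.sample 𝓜.N i) :=
  measurable_pi_lambda _ fun m => measurable_extendPath.comp (hsim.measurable i hi m)

/-- The two families of simulations have disjoint index sets. -/
theorem AreSimulations.indepFun {i : ℕ} (hi : i < 𝓜.N) :
    IndepFun (𝓢.toFuture 𝓜.N (i + 1)) (𝓢.sample 𝓜.N i) P' := by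
  let σ : (Σ i : Fin 𝓜.N, Fin (M i)) → MeasurableSpace Ω' := fun a =>
    MeasurableSpace.comap (pathAt 𝓜.N a.1 (𝓢.H a.1 a.2) (𝓢.X a.1 a.2)) inferInstance
  have h1 := indep_iSup_of_disjoint (m := σ) (μ := P')
    (fun a => (hsim.measurable _ a.1.2 _).comap_le) hsim.indep
    (S := {a | i + 1 ≤ a.1}) (T := {a | (a.1 : ℕ) = i}) (by
      rw [Set.disjoint_left]
      intro a h1 h2
      simp only [Set.mem_ofPred_eq] at h1 h2
      omega)
  refine indep_of_indep_of_le_left (indep_of_indep_of_le_right h1 ?_) ?_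
  · rw [← measurable_iff_comap_le]
    refine @measurable_pi_lambda _ _ _ (_) _ _ fun m => ?_
    have h2 : σ ⟨⟨i, hi⟩, m⟩ ≤ ⨆ a ∈ {a : Σ i : Fin 𝓜.N, Fin (M i) | (a.1 : ℕ) = i}, σ a :=
      le_iSup₂_of_le ⟨⟨i, hi⟩, m⟩ rfl le_rfl
    exact measurable_extendPath.comp ((comap_measurable _).mono h2 le_rfl)
  · refine (𝓢.comap_toFuture 𝓜.N (i + 1)).le.trans (iSup_le fun a => ?_)
    exact le_iSup₂_of_le a.1 a.2 le_rfl

variable [IsProbabilityMeasure P']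

theorem AreSimulations.map_sample {i : ℕ} (hi : i < 𝓜.N) :
    P'.map (𝓢.sample 𝓜.N i) = Measure.pi fun _ => 𝓜.pathLaw P i := by
  have h1 : iIndepFun (fun (m : Fin (M i)) ω => 𝓢.sample 𝓜.N i ω m) P' := by
    have h2 := hsim.indep.comp (fun a => extendPath 𝓜.N a.1) fun a => measurable_extendPath
    exact h2.precomp (g := fun m : Fin (M i) => (⟨⟨i, hi⟩, m⟩ : Σ i : Fin 𝓜.N, Fin (M i)))
      (fun m m' hm => by simpa using hm)
  have h3 : ∀ m, Measurable fun ω => 𝓢.sample 𝓜.N i ω m := fun m =>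
    (measurable_pi_apply m).comp (hsim.measurable_sample hi)
  have h4 := (iIndepFun_iff_map_fun_eq_pi_map fun m => (h3 m).aemeasurable).1 h1
  refine h4.trans ?_
  congr 1
  funext m
  exact ((hsim.copies i hi m).comp measurable_extendPath).map_eq

/-- This product form of the joint law is the probabilistic input of both the regression estimate
and the ghost sample estimate. -/
theorem AreSimulations.map_toFuture_sample {i : ℕ} (hi : i < 𝓜.N) :
    P'.map (fun ω => (𝓢.toFuture 𝓜.N (i + 1) ω, 𝓢.sample 𝓜.N i ω))
      = (P'.map (𝓢.toFuture 𝓜.N (i + 1))).prod (Measure.pi fun _ => 𝓜.pathLaw P i) := by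
  rw [← hsim.map_sample hi]
  exact (indepFun_iff_map_prod_eq_prod_map_map (hsim.measurable_toFuture _).aemeasurable
    (hsim.measurable_sample hi).aemeasurable).1 (hsim.indepFun hi)

variable {p : Params} (h : 𝓜.MarkovAssumptions P p)
include h

omit [IsProbabilityMeasure P'] in
/-- An almost sure property of the state at time `j` holds almost surely along all simulations. -/
theorem AreSimulations.ae_sample {i j : ℕ} (hi : i < 𝓜.N) (h1 : i ≤ j) (h2 : j ≤ 𝓜.N)
    {s : Vec d → Prop} (hs : ∀ᵐ x ∂(P.map (𝓜.X j)), s x) :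
    ∀ᵐ ω ∂P', ∀ m, s ((𝓢.sample 𝓜.N i ω m).2 j) := by
  rw [eventually_countable_forall]
  intro m
  have h3 : P'.map (fun ω => 𝓢.sample 𝓜.N i ω m) = 𝓜.pathLaw P i :=
    ((hsim.copies i hi m).comp measurable_extendPath).map_eq
  have h4 := Model.ae_pathLaw_state h h1 h2 hs
  rw [← h3] at h4
  exact ae_of_ae_map ((measurable_pi_apply m).comp (hsim.measurable_sample hi)).aemeasurable h4

end Clouds

end MWLS


namespace MWLS

/-! ### Truncation and empirical norms -/

/-- Truncation is the projection on an interval that contains `a`, so it can only reduce the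
distance to `a`. -/
theorem abs_sub_trunc_le {L a : ℝ} (ha : |a| ≤ L) (x : ℝ) : |a - trunc L x| ≤ |a - x| := by
  obtain ⟨h1, h2⟩ := abs_le.1 ha
  unfold trunc
  rcases le_total x L with h3 | h3
  · rw [min_eq_left h3]
    rcases le_total (-L) x with h4 | h4
    · rw [max_eq_right h4]
    · rw [max_eq_left h4, abs_of_nonneg (by linarith), abs_of_nonneg (by linarith)]
      linarith
  · rw [min_eq_right h3, max_eq_right (by linarith), abs_of_nonpos (by linarith),
      abs_of_nonpos (by linarith)]
    linarith

theorem abs_apply_le_norm {n : ℕ} (a : Vec n) (l : Fin n) : |a l| ≤ ‖a‖ := by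
  simpa using PiLp.norm_apply_le a l

theorem norm_sub_truncVec_le {n : ℕ} {L : ℝ} {a : Vec n} (ha : ‖a‖ ≤ L) (x : Vec n) :
    ‖a - truncVec L x‖ ≤ ‖a - x‖ := by
  rw [EuclideanSpace.norm_eq, EuclideanSpace.norm_eq]
  refine Real.sqrt_le_sqrt (Finset.sum_le_sum fun l _ => ?_)
  exact pow_le_pow_left₀ (norm_nonneg _)
    (abs_sub_trunc_le ((abs_apply_le_norm a l).trans ha) (x l)) 2

theorem norm_truncVec_le {n : ℕ} {L : ℝ} (hL : 0 ≤ L) (x : Vec n) :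
    ‖truncVec L x‖ ≤ √n * L := by
  rw [EuclideanSpace.norm_eq, Real.sqrt_le_left (by positivity), mul_pow,
    Real.sq_sqrt (Nat.cast_nonneg n)]
  calc _ ≤ ∑ _ : Fin n, L ^ 2 := Finset.sum_le_sum fun l _ =>
        pow_le_pow_left₀ (norm_nonneg _) (abs_trunc_le hL _) 2
    _ = _ := by simp

theorem measurable_truncVec {n : ℕ} (L : ℝ) : Measurable (truncVec L : Vec n → Vec n) := by
  refine (WithLp.measurable_toLp 2 _).comp (measurable_pi_lambda _ fun l => ?_)
  exact (measurable_trunc L).comp ((measurable_pi_apply l).comp (WithLp.measurable_ofLp 2 _))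

theorem le_sqrt_iInf {ι : Type*} [Nonempty ι] {a : ι → ℝ} {r : ℝ} (h : ∀ i, r ≤ √(a i)) :
    r ≤ √(⨅ i, a i) := by
  rcases le_or_gt r 0 with hr | hr
  · exact hr.trans (Real.sqrt_nonneg _)
  · refine Real.le_sqrt_of_sq_le (le_ciInf fun i => ?_)
    exact (Real.le_sqrt' hr).1 (h i)

/-- An estimate valid for every competitor passes to the infimum, so no minimizer is needed. -/
theorem le_appError_add {Ω : Type*} [MeasurableSpace Ω] {P : Measure Ω} {d K : ℕ} {F : Type*}
    [NormedAddCommGroup F] [NormedSpace ℝ F] {X : Ω → Vec d} {b : Fin K → Vec d → F}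
    {v : Vec d → F} {η r : ℝ} (h : ∀ φ ∈ Submodule.span ℝ (Set.range b),
      η ≤ √(∫ ω, ‖φ (X ω) - v (X ω)‖ ^ 2 ∂P) + r) : η ≤ appError P X b v + r := by
  have : η - r ≤ appError P X b v := le_sqrt_iInf fun φ => by linarith [h φ.1 φ.2]
  linarith

theorem memLp_of_mem_span {Ω : Type*} [MeasurableSpace Ω] {P : Measure Ω} {d K : ℕ} {F : Type*}
    [NormedAddCommGroup F] [NormedSpace ℝ F] [MeasurableSpace F] [BorelSpace F]
    [SecondCountableTopology F] {X : Ω → Vec d} {b : Fin K → Vec d → F}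
    (hb : ∀ k, Measurable (b k)) (hbX : ∀ k, MemLp (fun ω => b k (X ω)) 2 P) {φ : Vec d → F}
    (hφ : φ ∈ Submodule.span ℝ (Set.range b)) :
    Measurable φ ∧ MemLp (fun ω => φ (X ω)) 2 P := by
  induction hφ using Submodule.span_induction with
  | mem x hx => obtain ⟨k, rfl⟩ := hx; exact ⟨hb k, hbX k⟩
  | zero => exact ⟨measurable_const, MemLp.zero⟩
  | add x y _ _ hx hy => exact ⟨hx.1.add hy.1, hx.2.add hy.2⟩
  | smul a x _ hx => exact ⟨hx.1.const_smul a, hx.2.const_smul a⟩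

section

variable {Ω' F : Type*} [MeasurableSpace Ω'] {P' : Measure Ω'} [IsProbabilityMeasure P'] {n : ℕ}
  [NormedAddCommGroup F] {w : Ω' → Fin n → F} {C : ℝ}

theorem integrable_empirical [MeasurableSpace F] [BorelSpace F]
    [SecondCountableTopology F] (hw : ∀ m, Measurable fun ω => w ω m)
    (hC : ∀ᵐ ω ∂P', ∀ m, ‖w ω m‖ ≤ C) :
    Integrable (fun ω => (1 / n : ℝ) * ∑ m, ‖w ω m‖ ^ 2) P' := by
  refine (integrable_finsetSum _ fun m _ => ?_).const_mul _
  refine Integrable.of_bound ((hw m).norm.pow_const 2).aestronglyMeasurable (C ^ 2) ?_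
  filter_upwards [hC] with ω hω
  rw [Real.norm_eq_abs, abs_of_nonneg (sq_nonneg _)]
  exact pow_le_pow_left₀ (norm_nonneg _) (hω m) 2

omit [IsProbabilityMeasure P'] in
theorem eLpNorm_toLp_eq (hn : 1 ≤ n)
    (hint : Integrable (fun ω => (1 / n : ℝ) * ∑ m, ‖w ω m‖ ^ 2) P') :
    eLpNorm (fun ω => (WithLp.toLp 2 (w ω) : PiLp 2 fun _ : Fin n => F)) 2 P'
      = ENNReal.ofReal (√n * √(∫ ω, (1 / n : ℝ) * ∑ m, ‖w ω m‖ ^ 2 ∂P')) := by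
  have hn0 : (0 : ℝ) < n := by exact_mod_cast hn
  have h1 : eLpNorm (fun ω => (WithLp.toLp 2 (w ω) : PiLp 2 fun _ : Fin n => F)) 2 P' ^ 2
      = ENNReal.ofReal (√n * √(∫ ω, (1 / n : ℝ) * ∑ m, ‖w ω m‖ ^ 2 ∂P')) ^ 2 := by
    rw [eLpNorm_two_sq, ← ENNReal.ofReal_pow (by positivity), mul_pow,
      Real.sq_sqrt hn0.le, Real.sq_sqrt (integral_nonneg fun ω => by positivity),
      ← integral_const_mul, ofReal_integral_eq_lintegral_ofReal (hint.const_mul _)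
        (Eventually.of_forall fun ω => by positivity)]
    refine lintegral_congr fun ω => ?_
    rw [enorm_toLp_sq, ← mul_assoc, mul_one_div_cancel hn0.ne', one_mul,
      ENNReal.ofReal_sum_of_nonneg fun _ _ => sq_nonneg _]
    refine Finset.sum_congr rfl fun m _ => ?_
    rw [ENNReal.ofReal_pow (norm_nonneg _), ofReal_norm]
  exact (ENNReal.pow_right_strictMono two_ne_zero).injective h1

end

end MWLS


/-! ### The functions of the algorithm along an independent path. -/

namespace MWLS

section

variable {Ω Ω' : Type*} [mΩ : MeasurableSpace Ω] [mΩ' : MeasurableSpace Ω'] {d q : ℕ}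
  {𝓜 : Model Ω d q} {P : Measure Ω} {p : Params} {M : ℕ → ℕ} {𝓢 : Clouds Ω' d q M}
  {P' : Measure Ω'}

omit mΩ' in
theorem Clouds.sigmaFrom_anti (𝓢 : Clouds Ω' d q M) {N i j : ℕ} (hij : i ≤ j) :
    𝓢.sigmaFrom N j ≤ 𝓢.sigmaFrom N i :=
  iSup_le fun a => le_iSup (fun a : {a : Σ j : Fin N, Fin (M j) // i ≤ a.1} =>
    MeasurableSpace.comap (pathAt N a.1.1 (𝓢.H a.1.1 a.1.2) (𝓢.X a.1.1 a.1.2)) inferInstance)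
    ⟨a.1, hij.trans a.2⟩

variable [IsProbabilityMeasure P] [IsProbabilityMeasure P'] (h : 𝓜.MarkovAssumptions P p)
  (hsim : 𝓢.AreSimulations P' 𝓜 P)
include h hsim

/-- The mean square, over the clouds and an independent path, of a function of the state. -/
theorem Clouds.AreSimulations.eLpNorm_path_eq {F : Type*} [NormedAddCommGroup F]
    [MeasurableSpace F] [BorelSpace F] [SecondCountableTopology F] {i j l : ℕ} (h1 : i ≤ j)
    (h2 : j ≤ 𝓜.N) {f : 𝓢.Future 𝓜.N l × Vec d → F} (hf : Measurable f) :
    eLpNorm (fun a : 𝓢.Future 𝓜.N l × PathSpace d q => f (a.1, a.2.2 j)) 2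
        ((P'.map (𝓢.toFuture 𝓜.N l)).prod (𝓜.pathLaw P i))
      = eLpNorm (fun a : Ω' × Vec d => f (𝓢.toFuture 𝓜.N l a.1, a.2)) 2
        (P'.prod (P.map (𝓜.X j))) := by
  have hU := hsim.measurable_toFuture l
  have := Measure.isProbabilityMeasure_map (μ := P') hU.aemeasurable
  have := Measure.isProbabilityMeasure_map (μ := P) (Model.measurable_X h h2).aemeasurable
  have := Model.isProbabilityMeasure_pathLaw h i
  have e1 : ((P'.map (𝓢.toFuture 𝓜.N l)).prod (𝓜.pathLaw P i)).map
      (Prod.map id fun e : PathSpace d q => e.2 j)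
      = (P'.map (𝓢.toFuture 𝓜.N l)).prod (P.map (𝓜.X j)) := by
    rw [← Measure.map_prod_map _ _ measurable_id (measurable_path_snd j), Measure.map_id,
      Model.map_pathLaw h h1 h2]
  have e2 : (P'.prod (P.map (𝓜.X j))).map (Prod.map (𝓢.toFuture 𝓜.N l) id)
      = (P'.map (𝓢.toFuture 𝓜.N l)).prod (P.map (𝓜.X j)) := by
    rw [← Measure.map_prod_map _ _ hU measurable_id, Measure.map_id]
  have e3 := eLpNorm_map_measure (p := 2) (g := f)
    (μ := (P'.map (𝓢.toFuture 𝓜.N l)).prod (𝓜.pathLaw P i))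
    (f := Prod.map id fun e : PathSpace d q => e.2 j) hf.aestronglyMeasurable
    (measurable_id.prodMap (measurable_path_snd j)).aemeasurable
  have e4 := eLpNorm_map_measure (p := 2) (g := f) (μ := P'.prod (P.map (𝓜.X j)))
    (f := Prod.map (𝓢.toFuture 𝓜.N l) id) hf.aestronglyMeasurable
    (hU.prodMap measurable_id).aemeasurable
  rw [e1] at e3
  rw [e2] at e4
  exact e3.symm.trans e4

omit hsim mΩ' [IsProbabilityMeasure P] in
theorem Model.measurable_drv_sub {k l : ℕ} (hk : k < 𝓜.N)
    {y' : 𝓢.Future 𝓜.N l → ℕ → Vec d → ℝ} {z' : 𝓢.Future 𝓜.N l → ℕ → Vec d → Vec q}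
    (hy' : Measurable fun a : 𝓢.Future 𝓜.N l × Vec d => y' a.1 (k + 1) a.2)
    (hz' : Measurable fun a : 𝓢.Future 𝓜.N l × Vec d => z' a.1 k a.2)
    {y : ℕ → Vec d → ℝ} {z : ℕ → Vec d → Vec q} (hy : Measurable (y (k + 1)))
    (hz : Measurable (z k)) :
    Measurable fun a : 𝓢.Future 𝓜.N l × PathSpace d q =>
      (𝓜.drv (y' a.1) (z' a.1) k a.2.2 - 𝓜.drv y z k a.2.2) * (𝓜.t (k + 1) - 𝓜.t k) := by
  have hs : ∀ j, Measurable fun a : 𝓢.Future 𝓜.N l × PathSpace d q => (a.1, a.2.2 j) := fun j =>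
    measurable_fst.prodMk ((measurable_path_snd j).comp measurable_snd)
  refine Measurable.mul_const (Measurable.sub ?_ ?_) _
  · exact measurable_drv h hk (y := fun a : 𝓢.Future 𝓜.N l × PathSpace d q => y' a.1)
      (z := fun a => z' a.1) (x := fun j a => a.2.2 j) (hy'.comp (hs _)) (hz'.comp (hs _))
      ((measurable_path_snd k).comp measurable_snd)
  · exact (measurable_path_drv h hk hy hz).comp measurable_snd

/-- The driver is Lipschitz continuous in mean square over the clouds and an independent path. -/
theorem Clouds.AreSimulations.eLpNorm_drv_sub_le (hp : p.Admissible) {i k l : ℕ} (hik : i ≤ k)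
    (hk : k < 𝓜.N)
    {y' : 𝓢.Future 𝓜.N l → ℕ → Vec d → ℝ} {z' : 𝓢.Future 𝓜.N l → ℕ → Vec d → Vec q}
    (hy' : Measurable fun a : 𝓢.Future 𝓜.N l × Vec d => y' a.1 (k + 1) a.2)
    (hz' : Measurable fun a : 𝓢.Future 𝓜.N l × Vec d => z' a.1 k a.2)
    {y : ℕ → Vec d → ℝ} {z : ℕ → Vec d → Vec q} (hy : Measurable (y (k + 1)))
    (hz : Measurable (z k)) :
    eLpNorm (fun a : 𝓢.Future 𝓜.N l × PathSpace d q =>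
        (𝓜.drv (y' a.1) (z' a.1) k a.2.2 - 𝓜.drv y z k a.2.2) * (𝓜.t (k + 1) - 𝓜.t k)) 2
        ((P'.map (𝓢.toFuture 𝓜.N l)).prod (𝓜.pathLaw P i))
      ≤ ENNReal.ofReal (p.Lf * ((𝓜.t (k + 1) - 𝓜.t k) / (p.T - 𝓜.t k) ^ ((1 - p.θL) / 2))) *
        (eLpNorm (fun a : Ω' × Vec d => y (k + 1) a.2 - y' (𝓢.toFuture 𝓜.N l a.1) (k + 1) a.2) 2
            (P'.prod (P.map (𝓜.X (k + 1))))
          + eLpNorm (fun a : Ω' × Vec d => z k a.2 - z' (𝓢.toFuture 𝓜.N l a.1) k a.2) 2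
            (P'.prod (P.map (𝓜.X k)))) := by
  have hdY : Measurable fun a : 𝓢.Future 𝓜.N l × Vec d => y (k + 1) a.2 - y' a.1 (k + 1) a.2 :=
    (hy.comp measurable_snd).sub hy'
  have hdZ : Measurable fun a : 𝓢.Future 𝓜.N l × Vec d => z k a.2 - z' a.1 k a.2 :=
    (hz.comp measurable_snd).sub hz'
  rw [← hsim.eLpNorm_path_eq h (by omega : i ≤ k + 1) hk hdY,
    ← hsim.eLpNorm_path_eq h hik hk.le hdZ]
  have hs : ∀ j, Measurable fun a : 𝓢.Future 𝓜.N l × PathSpace d q => (a.1, a.2.2 j) := fun j =>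
    measurable_fst.prodMk ((measurable_path_snd j).comp measurable_snd)
  have hU := hsim.measurable_toFuture l
  have := Measure.isProbabilityMeasure_map (μ := P') hU.aemeasurable
  have := Model.isProbabilityMeasure_pathLaw h i
  have hΔ := (h.grid.step_pos hk).le
  have hT : 0 ≤ p.T - 𝓜.t k := sub_nonneg.2 (h.grid.le_last hk.le)
  have hL := hp.Lf_nonneg
  have hlip : ∀ᵐ a ∂((P'.map (𝓢.toFuture 𝓜.N l)).prod (𝓜.pathLaw P i)),
      ∀ (u u' : ℝ) (v v' : Vec q), |𝓜.f k (a.2.2 k) u v - 𝓜.f k (a.2.2 k) u' v'|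
        ≤ p.Lf / (p.T - 𝓜.t k) ^ ((1 - p.θL) / 2) * (|u - u'| + ‖v - v'‖) :=
    Measure.quasiMeasurePreserving_snd.ae
      (Model.ae_pathLaw_state h hik hk.le (h.f_lipschitz k hk))
  refine (eLpNorm_le_mul_eLpNorm_of_ae_le_mul (g := fun a : 𝓢.Future 𝓜.N l × PathSpace d q =>
      ‖y (k + 1) (a.2.2 (k + 1)) - y' a.1 (k + 1) (a.2.2 (k + 1))‖
        + ‖z k (a.2.2 k) - z' a.1 k (a.2.2 k)‖)
    (c := p.Lf * ((𝓜.t (k + 1) - 𝓜.t k) / (p.T - 𝓜.t k) ^ ((1 - p.θL) / 2))) ?_ 2).trans ?_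
  · filter_upwards [hlip] with a ha
    rw [Real.norm_eq_abs, abs_mul, abs_of_nonneg hΔ, Real.norm_eq_abs, abs_of_nonneg
      (add_nonneg (norm_nonneg _) (norm_nonneg _)), Real.norm_eq_abs]
    have h1 := mul_le_mul_of_nonneg_right (ha (y' a.1 (k + 1) (a.2.2 (k + 1)))
      (y (k + 1) (a.2.2 (k + 1))) (z' a.1 k (a.2.2 k)) (z k (a.2.2 k))) hΔ
    refine h1.trans (le_of_eq ?_)
    rw [abs_sub_comm, norm_sub_rev]
    ring
  · gcongr
    refine (eLpNorm_add_le (hdY.comp (hs (k + 1))).norm.aestronglyMeasurable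
      (hdZ.comp (hs k)).norm.aestronglyMeasurable (by norm_num)).trans (le_of_eq ?_)
    rw [eLpNorm_norm, eLpNorm_norm]
    rfl

end

namespace IsMWLS

variable {Ω Ω' : Type*} [mΩ : MeasurableSpace Ω] [mΩ' : MeasurableSpace Ω'] {d q : ℕ}
  {𝓜 : Model Ω d q} {P : Measure Ω} {p : Params} {B G : ℝ → ℝ → ℝ} {𝓡 : Regression d q}
  {𝓢 : Clouds Ω' d q 𝓡.M} {P' : Measure Ω'} {ψY yM : ℕ → Ω' → Vec d → ℝ}
  {ψZ zM : ℕ → Ω' → Vec d → Vec q} (hM : IsMWLS 𝓜 P p B G 𝓡 𝓢 P' ψY yM ψZ zM)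
include hM

/-- With `l = i + 1` this says that the functions from time `i + 1` on are determined by the clouds
independent of the one at time `i`. -/
theorem measurable_yM (h : 𝓜.MarkovAssumptions P p) {l j : ℕ} (hl : l ≤ j) (hj : j ≤ 𝓜.N) :
    Measurable fun a : 𝓢.Future 𝓜.N l × Vec d => yM j (𝓢.ofFuture a.1) a.2 := by
  rcases hj.lt_or_eq with hj | rfl
  · simp only [hM.y_eq j hj]
    exact (measurable_trunc _).comp ((hM.ψY_measurable j hj).mono
      (sup_le_sup (MeasurableSpace.comap_mono (𝓢.sigmaFrom_anti hl)) le_rfl) le_rfl)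
  · simp only [hM.terminal]
    exact h.Φ_measurable.comp measurable_snd

theorem measurable_zM {l j : ℕ} (hl : l ≤ j) (hj : j < 𝓜.N) :
    Measurable fun a : 𝓢.Future 𝓜.N l × Vec d => zM j (𝓢.ofFuture a.1) a.2 := by
  simp only [hM.z_eq j hj]
  exact (measurable_truncVec _).comp ((hM.ψZ_measurable j hj).mono
    (sup_le_sup (MeasurableSpace.comap_mono (𝓢.sigmaFrom_anti hl)) le_rfl) le_rfl)

theorem measurable_uncurry_yM (h : 𝓜.MarkovAssumptions P p) (hsim : 𝓢.AreSimulations P' 𝓜 P)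
    {j : ℕ} (hj : j ≤ 𝓜.N) : Measurable fun a : Ω' × Vec d => yM j a.1 a.2 :=
  (hM.measurable_yM h le_rfl hj).comp ((hsim.measurable_toFuture j).prodMap measurable_id)

theorem measurable_uncurry_zM (hsim : 𝓢.AreSimulations P' 𝓜 P)
    {j : ℕ} (hj : j < 𝓜.N) : Measurable fun a : Ω' × Vec d => zM j a.1 a.2 :=
  (hM.measurable_zM le_rfl hj).comp ((hsim.measurable_toFuture j).prodMap measurable_id)

variable (h : 𝓜.MarkovAssumptions P p) (hp : p.Admissible) (hB : IsSumConstant p.R B)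
  (hG : ∀ Cu γ : ℝ, 0 ≤ Cu → 0 < γ → IsGronwallConstant p.R p.T 0 (p.θL / 2) Cu γ (G Cu γ))
include h hp hB hG

theorem abs_yM_le {j : ℕ} (hj : j < 𝓜.N) (ω : Ω') (x : Vec d) :
    |yM j ω x| ≤ 𝓜.Cy P p B G j := by
  rw [hM.y_eq j hj]
  exact abs_trunc_le (𝓜.Cy_nonneg P hp h.grid hB hG hj.le) _

/-- The bound may fail on a null set at time `N` only: no truncation is made there, and `Cξ` is an
essential supremum. -/
theorem ae_abs_yM_le {j : ℕ} (hj : j ≤ 𝓜.N) (ω : Ω') :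
    ∀ᵐ x ∂(P.map (𝓜.X j)), |yM j ω x| ≤ 𝓜.Cy P p B G j := by
  rcases hj.lt_or_eq with hj | rfl
  · exact Eventually.of_forall fun x => hM.abs_yM_le h hp hB hG hj ω x
  · simp only [hM.terminal]
    exact Model.ae_map_abs_Φ_le h hp hB hG

theorem norm_zM_le {j : ℕ} (hj : j < 𝓜.N) (ω : Ω') (x : Vec d) :
    ‖zM j ω x‖ ≤ √q * 𝓜.Cz P p B G j := by
  rw [hM.z_eq j hj]
  exact norm_truncVec_le (𝓜.Cz_nonneg P hp h.grid hB hG hj.le) _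

end IsMWLS

end MWLS


namespace MWLS

/-! ### The regression errors -/

theorem norm_toLp_le {n : ℕ} {F F' : Type*} [NormedAddCommGroup F] [NormedAddCommGroup F']
    {a : Fin n → F} {b : Fin n → F'} (hab : ∀ m, ‖a m‖ ≤ ‖b m‖) :
    ‖(WithLp.toLp 2 a : PiLp 2 fun _ : Fin n => F)‖
      ≤ ‖(WithLp.toLp 2 b : PiLp 2 fun _ : Fin n => F')‖ := by
  rw [PiLp.norm_eq_of_L2, PiLp.norm_eq_of_L2]
  exact Real.sqrt_le_sqrt (Finset.sum_le_sum fun m _ =>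
    pow_le_pow_left₀ (norm_nonneg _) (hab m) 2)

/-- Division by `√n` turns Euclidean norms on the sample into empirical norms and `Γ√K` into `Γ√(K /
n)`. -/
theorem le_of_ofReal_regression {n K : ℕ} (hn : 1 ≤ n) {η A Γ s r : ℝ} (hA : 0 ≤ A) (hΓ : 0 ≤ Γ)
    (hs : 0 ≤ s) (hr : 0 ≤ r)
    (h : ENNReal.ofReal (√n * η) ≤ ENNReal.ofReal √n * ENNReal.ofReal A
      + ENNReal.ofReal (Γ * √K) + ENNReal.ofReal √n * ENNReal.ofReal s
      + ENNReal.ofReal (√n * r)) : η ≤ A + (Γ * √((K : ℝ) / n) + r + s) := by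
  have hn0 : (0 : ℝ) < √n := Real.sqrt_pos.2 (by exact_mod_cast hn)
  rw [← ENNReal.ofReal_mul hn0.le, ← ENNReal.ofReal_mul hn0.le,
    ← ENNReal.ofReal_add (by positivity) (by positivity),
    ← ENNReal.ofReal_add (by positivity) (by positivity),
    ← ENNReal.ofReal_add (by positivity) (by positivity),
    ENNReal.ofReal_le_ofReal_iff (by positivity)] at h
  refine le_of_mul_le_mul_left (h.trans (le_of_eq ?_)) hn0
  rw [Real.sqrt_div (Nat.cast_nonneg K)]
  field_simp
  ring

/-- The root mean square distance between a function and a random function of the state, over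
the randomness and an independent state. -/
noncomputable def stateError {Ω Ω' : Type*} [MeasurableSpace Ω] [MeasurableSpace Ω'] {d : ℕ}
    {F : Type*} [NormedAddCommGroup F] (P : Measure Ω) (P' : Measure Ω') (X : Ω → Vec d)
    (v : Vec d → F) (w : Ω' → Vec d → F) : ℝ :=
  (eLpNorm (fun a : Ω' × Vec d => v a.2 - w a.1 a.2) 2 (P'.prod (P.map X))).toReal

theorem stateError_nonneg {Ω Ω' : Type*} [MeasurableSpace Ω] [MeasurableSpace Ω'] {d : ℕ}
    {F : Type*} [NormedAddCommGroup F] (P : Measure Ω) (P' : Measure Ω') (X : Ω → Vec d)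
    (v : Vec d → F) (w : Ω' → Vec d → F) : 0 ≤ stateError P P' X v w := ENNReal.toReal_nonneg

theorem Clouds.sample_fst {Ω' : Type*} {d q : ℕ} {M : ℕ → ℕ} (𝓢 : Clouds Ω' d q M)
    {N i j : ℕ} (h1 : i < j) (h2 : j ≤ N) (ω : Ω') (m : Fin (M i)) :
    (𝓢.sample N i ω m).1 j = 𝓢.H i m j ω := extendPath_pathAt_fst _ _ _ h1 h2

theorem Clouds.sample_snd {Ω' : Type*} {d q : ℕ} {M : ℕ → ℕ} (𝓢 : Clouds Ω' d q M)
    {N i j : ℕ} (h1 : i ≤ j) (h2 : j ≤ N) (ω : Ω') (m : Fin (M i)) :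
    (𝓢.sample N i ω m).2 j = 𝓢.X i m j ω := extendPath_pathAt_snd _ _ _ h1 h2

namespace IsMWLS

variable {Ω Ω' : Type*} [mΩ : MeasurableSpace Ω] [mΩ' : MeasurableSpace Ω'] {d q : ℕ}
  {𝓜 : Model Ω d q} {P : Measure Ω} {p : Params} {B G : ℝ → ℝ → ℝ} {𝓡 : Regression d q}
  {𝓢 : Clouds Ω' d q 𝓡.M} {P' : Measure Ω'} {ψY yM : ℕ → Ω' → Vec d → ℝ}
  {ψZ zM : ℕ → Ω' → Vec d → Vec q} (hM : IsMWLS 𝓜 P p B G 𝓡 𝓢 P' ψY yM ψZ zM)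
  [IsProbabilityMeasure P] [IsProbabilityMeasure P']
  (h : 𝓜.MarkovAssumptions P p) (hp : p.Admissible) (hB : IsSumConstant p.R B)
  (hG : ∀ Cu γ : ℝ, 0 ≤ Cu → 0 < γ → IsGronwallConstant p.R p.T 0 (p.θL / 2) Cu γ (G Cu γ))
  {y : ℕ → Vec d → ℝ} {z : ℕ → Vec d → Vec q} (hyz : 𝓜.IsMarkovSolution P y z)
  (hsim : 𝓢.AreSimulations P' 𝓜 P)
include hM h hp hB hG hyz hsim

omit [IsProbabilityMeasure P'] hsim in
theorem ae_abs_y_sub_yM_le {j : ℕ} (hj : j ≤ 𝓜.N) :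
    ∀ᵐ x ∂(P.map (𝓜.X j)), ∀ ω, |y j x - yM j ω x| ≤ 2 * 𝓜.Cy P p B G j := by
  rcases hj.lt_or_eq with hj | rfl
  · filter_upwards [(hyz.ae_map_bounds h hp hB hG).1 j hj] with x hx ω
    have := hM.abs_yM_le h hp hB hG hj ω x
    exact (abs_sub _ _).trans (by linarith)
  · filter_upwards [hyz.terminal_ae h] with x hx ω
    rw [hM.terminal, hx, sub_self, abs_zero]
    have := 𝓜.Cy_nonneg P hp h.grid hB hG (le_refl 𝓜.N)
    positivity

omit [IsProbabilityMeasure P'] hsim in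
theorem ae_norm_z_sub_zM_le {j : ℕ} (hj : j < 𝓜.N) :
    ∀ᵐ x ∂(P.map (𝓜.X j)), ∀ ω, ‖z j x - zM j ω x‖
      ≤ 𝓜.Cz P p B G j + √q * 𝓜.Cz P p B G j := by
  filter_upwards [(hyz.ae_map_bounds h hp hB hG).2 j hj] with x hx ω
  have := hM.norm_zM_le h hp hB hG hj ω x
  exact (norm_sub_le _ _).trans (by linarith)

theorem memLp_y_sub_yM {j : ℕ} (hj : j ≤ 𝓜.N) :
    MemLp (fun a : Ω' × Vec d => y j a.2 - yM j a.1 a.2) 2 (P'.prod (P.map (𝓜.X j))) := by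
  have := Measure.isProbabilityMeasure_map (μ := P) (Model.measurable_X h hj).aemeasurable
  refine MemLp.of_bound (((hyz.1 j hj).comp measurable_snd).sub
    (hM.measurable_uncurry_yM h hsim hj)).aestronglyMeasurable (2 * 𝓜.Cy P p B G j) ?_
  filter_upwards [Measure.quasiMeasurePreserving_snd.ae
    (hM.ae_abs_y_sub_yM_le h hp hB hG hyz hj)] with a ha
  exact ha a.1

theorem memLp_z_sub_zM {j : ℕ} (hj : j < 𝓜.N) :
    MemLp (fun a : Ω' × Vec d => z j a.2 - zM j a.1 a.2) 2 (P'.prod (P.map (𝓜.X j))) := by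
  have := Measure.isProbabilityMeasure_map (μ := P) (Model.measurable_X h hj.le).aemeasurable
  refine MemLp.of_bound (((hyz.2.1 j hj).comp measurable_snd).sub
    (hM.measurable_uncurry_zM hsim hj)).aestronglyMeasurable
    (𝓜.Cz P p B G j + √q * 𝓜.Cz P p B G j) ?_
  filter_upwards [Measure.quasiMeasurePreserving_snd.ae
    (hM.ae_norm_z_sub_zM_le h hp hB hG hyz hj)] with a ha
  exact ha a.1

theorem ofReal_stateError_y {j : ℕ} (hj : j ≤ 𝓜.N) :
    ENNReal.ofReal (stateError P P' (𝓜.X j) (y j) (yM j))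
      = eLpNorm (fun a : Ω' × Vec d => y j a.2 - yM j a.1 a.2) 2 (P'.prod (P.map (𝓜.X j))) :=
  ENNReal.ofReal_toReal (hM.memLp_y_sub_yM h hp hB hG hyz hsim hj).2.ne

theorem ofReal_stateError_z {j : ℕ} (hj : j < 𝓜.N) :
    ENNReal.ofReal (stateError P P' (𝓜.X j) (z j) (zM j))
      = eLpNorm (fun a : Ω' × Vec d => z j a.2 - zM j a.1 a.2) 2 (P'.prod (P.map (𝓜.X j))) :=
  ENNReal.ofReal_toReal (hM.memLp_z_sub_zM h hp hB hG hyz hsim hj).2.ne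

omit hp hB hG [IsProbabilityMeasure P] [IsProbabilityMeasure P'] in
theorem measurable_sample_y_sub {i : ℕ} (hi : i < 𝓜.N) (m : Fin (𝓡.M i)) :
    Measurable fun ω => y i (𝓢.X i m i ω) - yM i ω (𝓢.X i m i ω) := by
  have hx : Measurable fun ω => 𝓢.X i m i ω := by
    simp only [← 𝓢.sample_snd le_rfl hi.le]
    exact (measurable_path_snd i).comp ((measurable_pi_apply m).comp (hsim.measurable_sample hi))
  exact ((hyz.1 i hi.le).comp hx).sub
    ((hM.measurable_uncurry_yM h hsim hi.le).comp (measurable_id.prodMk hx))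

omit hp hB hG h [IsProbabilityMeasure P] [IsProbabilityMeasure P'] in
theorem measurable_sample_z_sub {i : ℕ} (hi : i < 𝓜.N) (m : Fin (𝓡.M i)) :
    Measurable fun ω => z i (𝓢.X i m i ω) - zM i ω (𝓢.X i m i ω) := by
  have hx : Measurable fun ω => 𝓢.X i m i ω := by
    simp only [← 𝓢.sample_snd le_rfl hi.le]
    exact (measurable_path_snd i).comp ((measurable_pi_apply m).comp (hsim.measurable_sample hi))
  exact ((hyz.2.1 i hi).comp hx).sub
    ((hM.measurable_uncurry_zM hsim hi).comp (measurable_id.prodMk hx))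

theorem integrable_empNormSq_y {i : ℕ} (hi : i < 𝓜.N) :
    Integrable (empNormSq 𝓢 i (fun ω x => y i x - yM i ω x)) P' := by
  refine integrable_empirical (C := 2 * 𝓜.Cy P p B G i)
    (w := fun ω (m : Fin (𝓡.M i)) => y i (𝓢.X i m i ω) - yM i ω (𝓢.X i m i ω))
    (hM.measurable_sample_y_sub h hyz hsim hi) ?_
  filter_upwards [hsim.ae_sample h hi le_rfl hi.le
    (hM.ae_abs_y_sub_yM_le h hp hB hG hyz hi.le)] with ω hω m
  have := hω m ω
  rwa [𝓢.sample_snd le_rfl hi.le] at this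

theorem integrable_empNormSq_z {i : ℕ} (hi : i < 𝓜.N) :
    Integrable (empNormSq 𝓢 i (fun ω x => z i x - zM i ω x)) P' := by
  refine integrable_empirical (C := 𝓜.Cz P p B G i + √q * 𝓜.Cz P p B G i)
    (w := fun ω (m : Fin (𝓡.M i)) => z i (𝓢.X i m i ω) - zM i ω (𝓢.X i m i ω))
    (hM.measurable_sample_z_sub hyz hsim hi) ?_
  filter_upwards [hsim.ae_sample h hi le_rfl hi.le
    (hM.ae_norm_z_sub_zM_le h hp hB hG hyz hi)] with ω hω m
  have := hω m ω
  rwa [𝓢.sample_snd le_rfl hi.le] at this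

end IsMWLS

end MWLS


/-! ### Regression error for `Z`. -/

namespace MWLS

theorem Model.eLpNorm_sub_eq {Ω : Type*} [mΩ : MeasurableSpace Ω] {d q : ℕ} {𝓜 : Model Ω d q}
    {P : Measure Ω} {p : Params} (h : 𝓜.MarkovAssumptions P p) {i : ℕ} (hi : i ≤ 𝓜.N) {F : Type*}
    [NormedAddCommGroup F] [MeasurableSpace F] [BorelSpace F] [SecondCountableTopology F]
    {v φ : Vec d → F} (hv : Measurable v) (hφ : Measurable φ)
    (hv2 : MemLp (fun ω => v (𝓜.X i ω)) 2 P) (hφ2 : MemLp (fun ω => φ (𝓜.X i ω)) 2 P) :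
    eLpNorm (fun x => v x - φ x) 2 ((𝓜.pathLaw P i).map fun e => e.2 i)
      = ENNReal.ofReal √(∫ ω, ‖φ (𝓜.X i ω) - v (𝓜.X i ω)‖ ^ 2 ∂P) := by
  rw [Model.map_pathLaw h le_rfl hi]
  refine (eLpNorm_map_measure (f := 𝓜.X i) (g := fun x => v x - φ x)
    (hv.sub hφ).aestronglyMeasurable (Model.measurable_X h hi).aemeasurable).trans ?_
  refine Eq.trans ?_ (ofReal_rms (hφ2.sub hv2)).symm
  exact eLpNorm_congr_norm_ae (Eventually.of_forall fun ω => norm_sub_rev _ _)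

namespace IsMWLS

variable {Ω Ω' : Type*} [mΩ : MeasurableSpace Ω] [mΩ' : MeasurableSpace Ω'] {d q : ℕ}
  {𝓜 : Model Ω d q} {P : Measure Ω} {p : Params} {B G : ℝ → ℝ → ℝ} {𝓡 : Regression d q}
  {𝓢 : Clouds Ω' d q 𝓡.M} {P' : Measure Ω'} {ψY yM : ℕ → Ω' → Vec d → ℝ}
  {ψZ zM : ℕ → Ω' → Vec d → Vec q} (hM : IsMWLS 𝓜 P p B G 𝓡 𝓢 P' ψY yM ψZ zM)
  [IsProbabilityMeasure P] [IsProbabilityMeasure P']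
  (h : 𝓜.MarkovAssumptions P p) (hp : p.Admissible) (hB : IsSumConstant p.R B)
  (hG : ∀ Cu γ : ℝ, 0 ≤ Cu → 0 < γ → IsGronwallConstant p.R p.T 0 (p.θL / 2) Cu γ (G Cu γ))
  {y : ℕ → Vec d → ℝ} {z : ℕ → Vec d → Vec q} (hyz : 𝓜.IsMarkovSolution P y z)
  (hsim : 𝓢.AreSimulations P' 𝓜 P)
include hM h

omit [IsProbabilityMeasure P] [IsProbabilityMeasure P'] in
theorem measurable_future_obsZ {i : ℕ} (hi : i < 𝓜.N) :
    Measurable fun a : 𝓢.Future 𝓜.N (i + 1) × PathSpace d q =>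
      𝓜.obsZ (fun k => yM k (𝓢.ofFuture a.1)) (fun k => zM k (𝓢.ofFuture a.1)) i a.2.1 a.2.2 := by
  have hs : ∀ j, Measurable fun a : 𝓢.Future 𝓜.N (i + 1) × PathSpace d q => (a.1, a.2.2 j) :=
    fun j => measurable_fst.prodMk ((measurable_path_snd j).comp measurable_snd)
  exact Model.measurable_obsZ h hi
    (y := fun (a : 𝓢.Future 𝓜.N (i + 1) × PathSpace d q) k => yM k (𝓢.ofFuture a.1))
    (z := fun a k => zM k (𝓢.ofFuture a.1)) (x := fun j a => a.2.2 j) (w := fun j a => a.2.1 j)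
    (fun j h1 h2 => (hM.measurable_yM h (by omega : i + 1 ≤ j) h2).comp (hs j))
    (fun j h1 h2 => (hM.measurable_zM h1 h2).comp (hs j))
    (fun j _ _ => (measurable_path_snd j).comp measurable_snd)
    (fun j _ _ => (measurable_path_fst j).comp measurable_snd)

omit [IsProbabilityMeasure P'] in
include hp hB hG in
theorem ae_eLpNorm_future_obsZ_le {i : ℕ} (hi : i < 𝓜.N) (u : 𝓢.Future 𝓜.N (i + 1)) :
    ∀ᵐ x ∂((𝓜.pathLaw P i).map fun e => e.2 i),
      eLpNorm (fun e : PathSpace d q => 𝓜.obsZ (fun k => yM k (𝓢.ofFuture u))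
        (fun k => zM k (𝓢.ofFuture u)) i e.1 e.2) 2 (𝓜.pathKernel P i x)
        ≤ ENNReal.ofReal (𝓜.Γz P p B G i) := by
  rw [Model.map_pathLaw h le_rfl hi.le]
  exact Model.ae_eLpNorm_obsZ_le h hp hB hG hi
    (fun j h1 h2 => (hM.measurable_yM h (by omega : i + 1 ≤ j) h2).comp
      (measurable_const.prodMk measurable_id))
    (fun j h1 h2 => (hM.measurable_zM (by omega : i + 1 ≤ j) h2).comp
      (measurable_const.prodMk measurable_id))
    (fun j h1 h2 => hM.ae_abs_yM_le h hp hB hG h2 _)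
    (fun j h1 h2 => Eventually.of_forall fun x => hM.norm_zM_le h hp hB hG h2 _ x)

include hp hB hG hyz hsim

/-- The general regression estimate with `U` the later clouds, `D` the cloud at time `i`, and the
Malliavin weights as the factors with bounded conditional second moment. The terminal terms of the
two observations cancel in the bias. -/
theorem eLpNorm_z_sub_ψZ_le (hR : 𝓡.Admissible 𝓜 P) {i : ℕ} (hi : i < 𝓜.N) {φ : Vec d → Vec q}
    (hφm : Measurable φ) (hφ : φ ∈ Submodule.span ℝ (Set.range (𝓡.pZ i))) :
    eLpNorm (fun ω => (WithLp.toLp 2 fun m => z i ((𝓢.sample 𝓜.N i ω m).2 i)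
        - ψZ i ω ((𝓢.sample 𝓜.N i ω m).2 i) : PiLp 2 fun _ : Fin (𝓡.M i) => Vec q)) 2 P'
      ≤ ENNReal.ofReal √(𝓡.M i) *
          eLpNorm (fun x => z i x - φ x) 2 ((𝓜.pathLaw P i).map fun e => e.2 i)
        + ENNReal.ofReal (𝓜.Γz P p B G i * √(𝓡.KZ i))
        + ENNReal.ofReal √(𝓡.M i) * ∑ k ∈ Finset.Ioo i 𝓜.N,
          ENNReal.ofReal (p.CM / √(𝓜.t k - 𝓜.t i)) *
          eLpNorm (fun a : 𝓢.Future 𝓜.N (i + 1) × PathSpace d q =>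
            (𝓜.drv (fun k => yM k (𝓢.ofFuture a.1)) (fun k => zM k (𝓢.ofFuture a.1)) k
              a.2.2 - 𝓜.drv y z k a.2.2) * (𝓜.t (k + 1) - 𝓜.t k)) 2
            ((P'.map (𝓢.toFuture 𝓜.N (i + 1))).prod (𝓜.pathLaw P i)) := by
  have hdev : ∀ k, k < 𝓜.N → 𝓜.devξ P k ≤ 𝓜.Cξ P := fun k _ => (Model.devξ_memLp h).2
  have hΓ := 𝓜.Γz_nonneg P hp h.grid hB hG hdev hi
  have hn := hR.one_le_M i hi
  have hn0 : (0 : ℝ) < 1 / 𝓡.M i := by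
    have : (0 : ℝ) < 𝓡.M i := by exact_mod_cast hn
    positivity
  have hpr := Model.isProbabilityMeasure_pathLaw h i
  have hmap := Model.map_pathLaw h (P := P) le_rfl hi.le
  obtain ⟨-, hS₀, hvS⟩ := hyz.obs_properties h hp hB hG hi
  rw [← hmap] at hvS
  have hg : ∀ k ∈ Finset.Ioo i 𝓜.N, Measurable fun a : 𝓢.Future 𝓜.N (i + 1) × PathSpace d q =>
      (𝓜.drv (fun k => yM k (𝓢.ofFuture a.1)) (fun k => zM k (𝓢.ofFuture a.1)) k
        a.2.2 - 𝓜.drv y z k a.2.2) * (𝓜.t (k + 1) - 𝓜.t k) := fun k hk => by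
    obtain ⟨h1, h2⟩ := Finset.mem_Ioo.1 hk
    exact Model.measurable_drv_sub h h2 (y' := fun a k => yM k (𝓢.ofFuture a))
      (z' := fun a k => zM k (𝓢.ofFuture a))
      (hM.measurable_yM h (by omega : i + 1 ≤ k + 1) h2) (hM.measurable_zM h1 h2) (hyz.1 _ h2)
      (hyz.2.1 _ h2)
  have hc : ∀ k ∈ Finset.Ioo i 𝓜.N, ∀ᵐ x ∂((𝓜.pathLaw P i).map fun e => e.2 i),
      eLpNorm (fun e : PathSpace d q => e.1 k) 2 (𝓜.pathKernel P i x)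
        ≤ ENNReal.ofReal (p.CM / √(𝓜.t k - 𝓜.t i)) := fun k hk => by
    obtain ⟨h1, h2⟩ := Finset.mem_Ioo.1 hk
    rw [hmap]
    exact Model.ae_eLpNorm_weight_le h hp h1 h2.le
  -- There is no residual: the observation for `Z` involves no function fitted at time `i`, and it
  -- does not see the zero extension of the paths.
  have hs : ∀ᵐ ω ∂P', ‖(WithLp.toLp 2 fun m => 𝓜.obsZ (fun k => yM k ω) (fun k => zM k ω) i
        (fun k => 𝓢.H i m k ω) (fun k => 𝓢.X i m k ω)
      - 𝓜.obsZ (fun k => yM k ω) (fun k => zM k ω) i (𝓢.sample 𝓜.N i ω m).1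
        (𝓢.sample 𝓜.N i ω m).2 : PiLp 2 fun _ : Fin (𝓡.M i) => Vec q)‖ ≤ 0 :=
    Eventually.of_forall fun ω => by
      refine le_of_eq (norm_eq_zero.2 ?_)
      ext1 m
      refine sub_eq_zero.2 ?_
      exact Model.obsZ_congr hi (fun j h1 h2 => (𝓢.sample_fst h1 h2 ω m).symm)
        (fun j h1 h2 => (𝓢.sample_snd h1.le h2 ω m).symm) (fun _ _ _ => rfl) (fun _ _ _ => rfl)
  have hmin : ∀ᵐ ω ∂P', ∀ φ ∈ Submodule.span ℝ (Set.range (𝓡.pZ i)),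
      ∑ m, ‖ψZ i ω ((𝓢.sample 𝓜.N i ω m).2 i) - 𝓜.obsZ (fun k => yM k ω) (fun k => zM k ω) i
        (fun k => 𝓢.H i m k ω) (fun k => 𝓢.X i m k ω)‖ ^ 2
      ≤ ∑ m, ‖φ ((𝓢.sample 𝓜.N i ω m).2 i) - 𝓜.obsZ (fun k => yM k ω) (fun k => zM k ω) i
        (fun k => 𝓢.H i m k ω) (fun k => 𝓢.X i m k ω)‖ ^ 2 :=
    (hM.ψZ_solves i hi).mono fun ω hω φ hφ => by
      have := le_of_mul_le_mul_left (hω.2 φ hφ) hn0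
      simpa only [𝓢.sample_snd le_rfl hi.le] using this
  have key := eLpNorm_regression_le (P' := P') (hsim.measurable_toFuture (i + 1))
    (hsim.measurable_sample hi) (hsim.map_toFuture_sample hi) (measurable_path_snd i)
    (Model.map_pathLaw_eq_compProd h hi.le) (hM.measurable_future_obsZ h hi) hΓ
    (hM.ae_eLpNorm_future_obsZ_le h hp hB hG hi)
    hS₀ (hyz.2.1 i hi) hvS (Finset.Ioo i 𝓜.N) hg
    (h := fun k e => e.1 k) (fun k _ => measurable_path_fst k) hc
    (fun u e => by
      rw [Model.obsZ_eq, Model.obsZ_eq, add_sub_add_left_eq_sub, ← Finset.sum_sub_distrib]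
      exact Finset.sum_congr rfl fun k _ => by rw [← sub_smul, ← sub_mul])
    (hR.pZ_measurable i hi) (ρ := fun _ => 0) aestronglyMeasurable_const hs
    ((hM.ψZ_solves i hi).mono fun ω hω => hω.1) hmin hφm hφ
  simpa using key

/-- Truncation only helps, the Lipschitz estimate turns the bias into later state errors, and the
infimum over `φ` gives the approximation error. -/
theorem empNorm_z_le (hR : 𝓡.Admissible 𝓜 P) {i : ℕ} (hi : i < 𝓜.N) :
    √(∫ ω, empNormSq 𝓢 i (fun ω x => z i x - zM i ω x) ω ∂P')
      ≤ regErrorZ 𝓜 P p B G 𝓡 z i + ∑ k ∈ Finset.Ioo i 𝓜.N,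
        p.Lf * ((𝓜.t (k + 1) - 𝓜.t k) / (p.T - 𝓜.t k) ^ ((1 - p.θL) / 2))
          * (p.CM / √(𝓜.t k - 𝓜.t i))
          * (stateError P P' (𝓜.X (k + 1)) (y (k + 1)) (yM (k + 1))
            + stateError P P' (𝓜.X k) (z k) (zM k)) := by
  have hdev : ∀ k, k < 𝓜.N → 𝓜.devξ P k ≤ 𝓜.Cξ P := fun k _ => (Model.devξ_memLp h).2
  have hΓ := 𝓜.Γz_nonneg P hp h.grid hB hG hdev hi
  have hn := hR.one_le_M i hi
  unfold regErrorZ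
  rw [add_assoc]
  refine le_appError_add fun φ hφ => ?_
  obtain ⟨hφm, hφ2⟩ := memLp_of_mem_span (P := P) (X := 𝓜.X i) (hR.pZ_measurable i hi)
    (hR.pZ_memLp i hi) hφ
  have key := hM.eLpNorm_z_sub_ψZ_le h hp hB hG hyz hsim hR hi hφm hφ
  have hint := hM.integrable_empNormSq_z h hp hB hG hyz hsim hi
  have e1 := eLpNorm_toLp_eq (P' := P') hn
    (w := fun ω (m : Fin (𝓡.M i)) => z i (𝓢.X i m i ω) - zM i ω (𝓢.X i m i ω)) hint
  have e2 : eLpNorm (fun ω => (WithLp.toLp 2 fun m => z i (𝓢.X i m i ω) - zM i ω (𝓢.X i m i ω) :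
        PiLp 2 fun _ : Fin (𝓡.M i) => Vec q)) 2 P'
      ≤ eLpNorm (fun ω => (WithLp.toLp 2 fun m => z i ((𝓢.sample 𝓜.N i ω m).2 i)
        - ψZ i ω ((𝓢.sample 𝓜.N i ω m).2 i) : PiLp 2 fun _ : Fin (𝓡.M i) => Vec q)) 2 P' := by
    refine eLpNorm_mono_ae ?_
    filter_upwards [hsim.ae_sample h hi le_rfl hi.le ((hyz.ae_map_bounds h hp hB hG).2 i hi)]
      with ω hω
    refine norm_toLp_le fun m => ?_
    rw [← 𝓢.sample_snd le_rfl hi.le, hM.z_eq i hi]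
    exact norm_sub_truncVec_le (hω m) _
  have hc : ∀ k ∈ Finset.Ioo i 𝓜.N, 0 ≤ p.Lf * ((𝓜.t (k + 1) - 𝓜.t k) /
      (p.T - 𝓜.t k) ^ ((1 - p.θL) / 2)) := fun k hk => by
    have h2 := (Finset.mem_Ioo.1 hk).2
    exact mul_nonneg hp.Lf_nonneg (div_nonneg (h.grid.step_pos h2).le
      (Real.rpow_nonneg (sub_nonneg.2 (h.grid.le_last h2.le)) _))
  have he : ∀ k, 0 ≤ stateError P P' (𝓜.X (k + 1)) (y (k + 1)) (yM (k + 1))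
      + stateError P P' (𝓜.X k) (z k) (zM k) := fun k =>
    add_nonneg (stateError_nonneg ..) (stateError_nonneg ..)
  have hc' : ∀ k ∈ Finset.Ioo i 𝓜.N, 0 ≤ p.Lf * ((𝓜.t (k + 1) - 𝓜.t k) /
      (p.T - 𝓜.t k) ^ ((1 - p.θL) / 2)) * (p.CM / √(𝓜.t k - 𝓜.t i))
      * (stateError P P' (𝓜.X (k + 1)) (y (k + 1)) (yM (k + 1))
        + stateError P P' (𝓜.X k) (z k) (zM k)) := fun k hk =>
    mul_nonneg (mul_nonneg (hc k hk) (Model.CM_div_nonneg hp i k)) (he k)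
  have e4 : ∀ k ∈ Finset.Ioo i 𝓜.N, ENNReal.ofReal (p.CM / √(𝓜.t k - 𝓜.t i)) *
      eLpNorm (fun a : 𝓢.Future 𝓜.N (i + 1) × PathSpace d q =>
        (𝓜.drv (fun k => yM k (𝓢.ofFuture a.1)) (fun k => zM k (𝓢.ofFuture a.1)) k
          a.2.2 - 𝓜.drv y z k a.2.2) * (𝓜.t (k + 1) - 𝓜.t k)) 2
        ((P'.map (𝓢.toFuture 𝓜.N (i + 1))).prod (𝓜.pathLaw P i))
      ≤ ENNReal.ofReal (p.Lf * ((𝓜.t (k + 1) - 𝓜.t k) / (p.T - 𝓜.t k) ^ ((1 - p.θL) / 2))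
        * (p.CM / √(𝓜.t k - 𝓜.t i))
        * (stateError P P' (𝓜.X (k + 1)) (y (k + 1)) (yM (k + 1))
          + stateError P P' (𝓜.X k) (z k) (zM k))) := fun k hk => by
    obtain ⟨h1, h2⟩ := Finset.mem_Ioo.1 hk
    have e5 := hsim.eLpNorm_drv_sub_le h hp h1.le h2 (l := i + 1)
      (y' := fun a k => yM k (𝓢.ofFuture a)) (z' := fun a k => zM k (𝓢.ofFuture a))
      (hM.measurable_yM h (by omega : i + 1 ≤ k + 1) h2) (hM.measurable_zM h1 h2) (hyz.1 _ h2)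
      (hyz.2.1 _ h2)
    simp only [Clouds.ofFuture_toFuture] at e5
    rw [← hM.ofReal_stateError_y h hp hB hG hyz hsim h2,
      ← hM.ofReal_stateError_z h hp hB hG hyz hsim h2,
      ← ENNReal.ofReal_add (stateError_nonneg ..) (stateError_nonneg ..),
      ← ENNReal.ofReal_mul (hc k hk)] at e5
    refine (mul_le_mul_right e5 _).trans (le_of_eq ?_)
    rw [← ENNReal.ofReal_mul (Model.CM_div_nonneg hp i k)]
    congr 1
    ring
  rw [Model.eLpNorm_sub_eq h hi.le (hyz.2.1 i hi) hφm
    (((hyz.memLp_top h hp).2 i hi).mono_exponent le_top) hφ2] at key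
  have e6 := e1.symm.le.trans (e2.trans key)
  have e7 := le_of_ofReal_regression hn (Real.sqrt_nonneg _) hΓ (Finset.sum_nonneg hc') le_rfl
    (e6.trans (by
      rw [mul_zero, ENNReal.ofReal_zero, add_zero, ENNReal.ofReal_sum_of_nonneg hc']
      gcongr with k hk
      exact e4 k hk))
  rw [add_zero] at e7
  exact e7

end IsMWLS

end MWLS


/-! ### Regression error for `Y`. -/

namespace MWLS

namespace IsMWLS

variable {Ω Ω' : Type*} [mΩ : MeasurableSpace Ω] [mΩ' : MeasurableSpace Ω'] {d q : ℕ}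
  {𝓜 : Model Ω d q} {P : Measure Ω} {p : Params} {B G : ℝ → ℝ → ℝ} {𝓡 : Regression d q}
  {𝓢 : Clouds Ω' d q 𝓡.M} {P' : Measure Ω'} {ψY yM : ℕ → Ω' → Vec d → ℝ}
  {ψZ zM : ℕ → Ω' → Vec d → Vec q} (hM : IsMWLS 𝓜 P p B G 𝓡 𝓢 P' ψY yM ψZ zM)
  [IsProbabilityMeasure P] [IsProbabilityMeasure P']
  (h : 𝓜.MarkovAssumptions P p) (hp : p.Admissible) (hB : IsSumConstant p.R B)
  (hG : ∀ Cu γ : ℝ, 0 ≤ Cu → 0 < γ → IsGronwallConstant p.R p.T 0 (p.θL / 2) Cu γ (G Cu γ))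
  {y : ℕ → Vec d → ℝ} {z : ℕ → Vec d → Vec q} (hyz : 𝓜.IsMarkovSolution P y z)
  (hsim : 𝓢.AreSimulations P' 𝓜 P)
include hM

/- In the observations for `Y` at time `i`, the function at time `i` of the algorithm depends on
the cloud at time `i`; it is replaced by the exact one. -/

omit [IsProbabilityMeasure P] [IsProbabilityMeasure P'] in
theorem measurable_update_zM {i k : ℕ} (hik : i ≤ k) (hk : k < 𝓜.N) (hz : Measurable (z i)) :
    Measurable fun a : 𝓢.Future 𝓜.N (i + 1) × Vec d =>
      Function.update (fun k => zM k (𝓢.ofFuture a.1)) i (z i) k a.2 := by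
  rcases hik.eq_or_lt with rfl | hik
  · simp only [Function.update_self]
    exact hz.comp measurable_snd
  · simp only [Function.update_of_ne hik.ne']
    exact hM.measurable_zM hik hk

include h

omit [IsProbabilityMeasure P] [IsProbabilityMeasure P'] in
theorem measurable_future_obsY {i : ℕ} (hi : i < 𝓜.N) (hz : Measurable (z i)) :
    Measurable fun a : 𝓢.Future 𝓜.N (i + 1) × PathSpace d q =>
      𝓜.obsY (fun k => yM k (𝓢.ofFuture a.1))
        (Function.update (fun k => zM k (𝓢.ofFuture a.1)) i (z i)) i a.2.2 := by
  have hs : ∀ j, Measurable fun a : 𝓢.Future 𝓜.N (i + 1) × PathSpace d q => (a.1, a.2.2 j) :=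
    fun j => measurable_fst.prodMk ((measurable_path_snd j).comp measurable_snd)
  exact Model.measurable_obsY h hi.le
    (y := fun (a : 𝓢.Future 𝓜.N (i + 1) × PathSpace d q) k => yM k (𝓢.ofFuture a.1))
    (z := fun a => Function.update (fun k => zM k (𝓢.ofFuture a.1)) i (z i))
    (x := fun j a => a.2.2 j)
    (fun j h1 h2 => (hM.measurable_yM h (by omega : i + 1 ≤ j) h2).comp (hs j))
    (fun j h1 h2 => (hM.measurable_update_zM h1 h2 hz).comp (hs j))
    (fun j _ _ => (measurable_path_snd j).comp measurable_snd)

omit hM [IsProbabilityMeasure P] [IsProbabilityMeasure P'] in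
/-- The two kinds of observations for `Y` differ by the error for `Z` at time `i`. -/
theorem ae_norm_obsY_sub_le (hp : p.Admissible) (hsim : 𝓢.AreSimulations P' 𝓜 P) {i : ℕ}
    (hi : i < 𝓜.N) :
    ∀ᵐ ω ∂P', ‖(WithLp.toLp 2 fun m =>
        𝓜.obsY (fun k => yM k ω) (fun k => zM k ω) i (fun k => 𝓢.X i m k ω)
        - 𝓜.obsY (fun k => yM k ω) (Function.update (fun k => zM k ω) i (z i)) i
          (𝓢.sample 𝓜.N i ω m).2 : PiLp 2 fun _ : Fin (𝓡.M i) => ℝ)‖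
      ≤ p.Lf * ((𝓜.t (i + 1) - 𝓜.t i) / (p.T - 𝓜.t i) ^ ((1 - p.θL) / 2)) *
        ‖(WithLp.toLp 2 fun m => z i (𝓢.X i m i ω) - zM i ω (𝓢.X i m i ω) :
          PiLp 2 fun _ : Fin (𝓡.M i) => Vec q)‖ := by
  have hΔ := (h.grid.step_pos hi).le
  have hc : 0 ≤ p.Lf * ((𝓜.t (i + 1) - 𝓜.t i) / (p.T - 𝓜.t i) ^ ((1 - p.θL) / 2)) :=
    mul_nonneg hp.Lf_nonneg (div_nonneg hΔ
      (Real.rpow_nonneg (sub_nonneg.2 (h.grid.le_last hi.le)) _))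
  filter_upwards [hsim.ae_sample h hi le_rfl hi.le (h.f_lipschitz i hi)] with ω hω
  rw [← Real.norm_of_nonneg hc, ← norm_smul, ← WithLp.toLp_smul]
  refine norm_toLp_le fun m => ?_
  have h1 : 𝓜.obsY (fun k => yM k ω) (fun k => zM k ω) i (fun k => 𝓢.X i m k ω)
      = 𝓜.obsY (fun k => yM k ω) (fun k => zM k ω) i (𝓢.sample 𝓜.N i ω m).2 :=
    Model.obsY_congr hi.le (fun j h1 h2 => (𝓢.sample_snd h1 h2 ω m).symm) (fun _ _ _ => rfl)
      (fun _ _ _ => rfl)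
  rw [h1, Model.obsY_eq, Model.obsY_eq, add_sub_add_left_eq_sub, ← Finset.sum_sub_distrib,
    Finset.sum_eq_single_of_mem i (Finset.mem_Ico.2 ⟨le_rfl, hi⟩) fun k _ hk => by
      rw [Model.drv, Model.drv, Function.update_of_ne hk, sub_self]]
  rw [← sub_mul, norm_mul, Real.norm_eq_abs, Real.norm_eq_abs, abs_of_nonneg hΔ, Pi.smul_apply,
    norm_smul, Real.norm_of_nonneg hc]
  have h2 := mul_le_mul_of_nonneg_right (hω m (yM (i + 1) ω ((𝓢.sample 𝓜.N i ω m).2 (i + 1)))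
    (yM (i + 1) ω ((𝓢.sample 𝓜.N i ω m).2 (i + 1))) (zM i ω ((𝓢.sample 𝓜.N i ω m).2 i))
    (z i ((𝓢.sample 𝓜.N i ω m).2 i))) hΔ
  rw [Model.drv, Model.drv, Function.update_self, ← 𝓢.sample_snd le_rfl hi.le]
  refine h2.trans (le_of_eq ?_)
  rw [sub_self, abs_zero, zero_add, norm_sub_rev]
  ring

include hp hB hG hyz

omit [IsProbabilityMeasure P'] in
theorem ae_eLpNorm_future_obsY_le {i : ℕ} (hi : i < 𝓜.N) (u : 𝓢.Future 𝓜.N (i + 1)) :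
    ∀ᵐ x ∂((𝓜.pathLaw P i).map fun e => e.2 i),
      eLpNorm (fun e : PathSpace d q => 𝓜.obsY (fun k => yM k (𝓢.ofFuture u))
        (Function.update (fun k => zM k (𝓢.ofFuture u)) i (z i)) i e.2) 2 (𝓜.pathKernel P i x)
        ≤ ENNReal.ofReal (𝓜.Γy P p B G i) := by
  rw [Model.map_pathLaw h le_rfl hi.le]
  refine Model.ae_eLpNorm_obsY_le h hp hB hG hi
    (fun j h1 h2 => hM.ae_abs_yM_le h hp hB hG h2 _) (fun j h1 h2 => ?_)
  rcases h1.eq_or_lt with rfl | h1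
  · rw [Function.update_self]
    filter_upwards [(hyz.ae_map_bounds h hp hB hG).2 i h2] with x hx
    exact Model.le_sqrt_mul_Cz h hp hB hG h2.le hx
  · rw [Function.update_of_ne h1.ne']
    exact Eventually.of_forall fun x => hM.norm_zM_le h hp hB hG h2 _ x

include hsim

theorem eLpNorm_mul_norm_z_sub {i : ℕ} (hi : i < 𝓜.N) (hn : 1 ≤ 𝓡.M i) {c : ℝ} (hc0 : 0 ≤ c) :
    eLpNorm (fun ω => c * ‖(WithLp.toLp 2 fun m => z i (𝓢.X i m i ω) - zM i ω (𝓢.X i m i ω) :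
          PiLp 2 fun _ : Fin (𝓡.M i) => Vec q)‖) 2 P'
      = ENNReal.ofReal (√(𝓡.M i) *
          (c * √(∫ ω, empNormSq 𝓢 i (fun ω x => z i x - zM i ω x) ω ∂P'))) := by
  refine (eLpNorm_const_smul c (fun ω => ‖(WithLp.toLp 2 fun m => z i (𝓢.X i m i ω)
    - zM i ω (𝓢.X i m i ω) : PiLp 2 fun _ : Fin (𝓡.M i) => Vec q)‖) 2 P').trans ?_
  have e1 := eLpNorm_toLp_eq (P' := P') hn
    (w := fun ω (m : Fin (𝓡.M i)) => z i (𝓢.X i m i ω) - zM i ω (𝓢.X i m i ω))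
    (hM.integrable_empNormSq_z h hp hB hG hyz hsim hi)
  rw [eLpNorm_norm]
  refine (congrArg _ e1).trans ?_
  rw [Real.enorm_of_nonneg hc0, ← ENNReal.ofReal_mul hc0]
  congr 1
  simp only [empNormSq]
  ring

/-- The general regression estimate with constant weights `1`, for the observation in which `z i`
replaces `zM i`. The actual observation differs by a residual, bounded through the empirical error
of `Z` at time `i`. -/
theorem eLpNorm_y_sub_ψY_le (hR : 𝓡.Admissible 𝓜 P) {i : ℕ} (hi : i < 𝓜.N) {φ : Vec d → ℝ}
    (hφm : Measurable φ) (hφ : φ ∈ Submodule.span ℝ (Set.range (𝓡.pY i))) :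
    eLpNorm (fun ω => (WithLp.toLp 2 fun m => y i ((𝓢.sample 𝓜.N i ω m).2 i)
        - ψY i ω ((𝓢.sample 𝓜.N i ω m).2 i) : PiLp 2 fun _ : Fin (𝓡.M i) => ℝ)) 2 P'
      ≤ ENNReal.ofReal √(𝓡.M i) *
          eLpNorm (fun x => y i x - φ x) 2 ((𝓜.pathLaw P i).map fun e => e.2 i)
        + ENNReal.ofReal (𝓜.Γy P p B G i * √(𝓡.KY i))
        + ENNReal.ofReal √(𝓡.M i) * ∑ k ∈ Finset.Ico i 𝓜.N,
          eLpNorm (fun a : 𝓢.Future 𝓜.N (i + 1) × PathSpace d q =>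
            (𝓜.drv (fun k => yM k (𝓢.ofFuture a.1))
              (Function.update (fun k => zM k (𝓢.ofFuture a.1)) i (z i)) k
              a.2.2 - 𝓜.drv y z k a.2.2) * (𝓜.t (k + 1) - 𝓜.t k)) 2
            ((P'.map (𝓢.toFuture 𝓜.N (i + 1))).prod (𝓜.pathLaw P i))
        + ENNReal.ofReal (√(𝓡.M i) *
          (p.Lf * ((𝓜.t (i + 1) - 𝓜.t i) / (p.T - 𝓜.t i) ^ ((1 - p.θL) / 2)) *
            √(∫ ω, empNormSq 𝓢 i (fun ω x => z i x - zM i ω x) ω ∂P'))) := by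
  have hdev : ∀ k, k < 𝓜.N → 𝓜.devξ P k ≤ 𝓜.Cξ P := fun k _ => (Model.devξ_memLp h).2
  have hΓ := 𝓜.Γy_nonneg P hp h.grid hB hG hdev hi
  have hn := hR.one_le_M i hi
  have hn0 : (0 : ℝ) < 1 / 𝓡.M i := by
    have : (0 : ℝ) < 𝓡.M i := by exact_mod_cast hn
    positivity
  have hc0 : 0 ≤ p.Lf * ((𝓜.t (i + 1) - 𝓜.t i) / (p.T - 𝓜.t i) ^ ((1 - p.θL) / 2)) :=
    mul_nonneg hp.Lf_nonneg (div_nonneg (h.grid.step_pos hi).le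
      (Real.rpow_nonneg (sub_nonneg.2 (h.grid.le_last hi.le)) _))
  have hpr := Model.isProbabilityMeasure_pathLaw h i
  have hmap := Model.map_pathLaw h (P := P) le_rfl hi.le
  obtain ⟨⟨hS₀, hvS⟩, -⟩ := hyz.obs_properties h hp hB hG hi
  rw [← hmap] at hvS
  have hg : ∀ k ∈ Finset.Ico i 𝓜.N, Measurable fun a : 𝓢.Future 𝓜.N (i + 1) × PathSpace d q =>
      (𝓜.drv (fun k => yM k (𝓢.ofFuture a.1))
        (Function.update (fun k => zM k (𝓢.ofFuture a.1)) i (z i)) k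
        a.2.2 - 𝓜.drv y z k a.2.2) * (𝓜.t (k + 1) - 𝓜.t k) := fun k hk => by
    obtain ⟨h1, h2⟩ := Finset.mem_Ico.1 hk
    exact Model.measurable_drv_sub h h2 (y' := fun a k => yM k (𝓢.ofFuture a))
      (z' := fun a => Function.update (fun k => zM k (𝓢.ofFuture a)) i (z i))
      (hM.measurable_yM h (by omega : i + 1 ≤ k + 1) h2)
      (hM.measurable_update_zM h1 h2 (hyz.2.1 i hi)) (hyz.1 _ h2) (hyz.2.1 _ h2)
  have hc : ∀ k ∈ Finset.Ico i 𝓜.N, ∀ᵐ x ∂((𝓜.pathLaw P i).map fun e => e.2 i),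
      eLpNorm (fun _ : PathSpace d q => (1 : ℝ)) 2 (𝓜.pathKernel P i x) ≤ ENNReal.ofReal 1 :=
    fun k hk => Eventually.of_forall fun x => by
      rw [eLpNorm_const _ (by norm_num) (IsProbabilityMeasure.ne_zero _)]
      simp
  have hw : Measurable fun ω => (WithLp.toLp 2 fun m => z i (𝓢.X i m i ω)
      - zM i ω (𝓢.X i m i ω) : PiLp 2 fun _ : Fin (𝓡.M i) => Vec q) :=
    (WithLp.measurable_toLp 2 _).comp (measurable_pi_lambda _
      (hM.measurable_sample_z_sub hyz hsim hi))
  have hmin : ∀ᵐ ω ∂P', ∀ φ ∈ Submodule.span ℝ (Set.range (𝓡.pY i)),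
      ∑ m, ‖ψY i ω ((𝓢.sample 𝓜.N i ω m).2 i) - 𝓜.obsY (fun k => yM k ω) (fun k => zM k ω) i
        (fun k => 𝓢.X i m k ω)‖ ^ 2
      ≤ ∑ m, ‖φ ((𝓢.sample 𝓜.N i ω m).2 i) - 𝓜.obsY (fun k => yM k ω) (fun k => zM k ω) i
        (fun k => 𝓢.X i m k ω)‖ ^ 2 :=
    (hM.ψY_solves i hi).mono fun ω hω φ hφ => by
      have := le_of_mul_le_mul_left (hω.2 φ hφ) hn0
      simpa only [𝓢.sample_snd le_rfl hi.le] using this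
  have hs := ae_norm_obsY_sub_le (yM := yM) (zM := zM) (z := z) h hp hsim hi
  have hspan : ∀ᵐ ω ∂P', ψY i ω ∈ Submodule.span ℝ (Set.range (𝓡.pY i)) :=
    (hM.ψY_solves i hi).mono fun ω hω => hω.1
  have hdiff : ∀ (u : 𝓢.Future 𝓜.N (i + 1)) (e : PathSpace d q),
      𝓜.obsY (fun k => yM k (𝓢.ofFuture u))
        (Function.update (fun k => zM k (𝓢.ofFuture u)) i (z i)) i e.2 - 𝓜.obsY y z i e.2
      = ∑ k ∈ Finset.Ico i 𝓜.N, ((𝓜.drv (fun k => yM k (𝓢.ofFuture u))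
        (Function.update (fun k => zM k (𝓢.ofFuture u)) i (z i)) k
        e.2 - 𝓜.drv y z k e.2) * (𝓜.t (k + 1) - 𝓜.t k)) • (1 : ℝ) := fun u e => by
    rw [Model.obsY_eq, Model.obsY_eq, add_sub_add_left_eq_sub, ← Finset.sum_sub_distrib]
    exact Finset.sum_congr rfl fun k _ => by rw [smul_eq_mul, mul_one, ← sub_mul]
  have hρ := (hw.norm.const_mul (p.Lf * ((𝓜.t (i + 1) - 𝓜.t i) /
    (p.T - 𝓜.t i) ^ ((1 - p.θL) / 2)))).aestronglyMeasurable (μ := P')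
  have key := eLpNorm_regression_le (P' := P') (F := ℝ)
    (S := fun a => 𝓜.obsY (fun k => yM k (𝓢.ofFuture a.1))
        (Function.update (fun k => zM k (𝓢.ofFuture a.1)) i (z i)) i a.2.2)
    (S₀ := fun e => 𝓜.obsY y z i e.2)
    (g := fun k a => (𝓜.drv (fun k => yM k (𝓢.ofFuture a.1))
        (Function.update (fun k => zM k (𝓢.ofFuture a.1)) i (z i)) k
        a.2.2 - 𝓜.drv y z k a.2.2) * (𝓜.t (k + 1) - 𝓜.t k)) (hsim.measurable_toFuture (i + 1))
    (hsim.measurable_sample hi) (hsim.map_toFuture_sample hi) (measurable_path_snd i)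
    (Model.map_pathLaw_eq_compProd h hi.le) (hM.measurable_future_obsY h hi (hyz.2.1 i hi)) hΓ
    (hM.ae_eLpNorm_future_obsY_le h hp hB hG hyz hi)
    hS₀ (hyz.1 i hi.le) hvS (Finset.Ico i 𝓜.N) hg
    (c := fun _ => 1) (h := fun _ _ => (1 : ℝ)) (fun k _ => measurable_const) hc hdiff
    (hR.pY_measurable i hi)
    (s := fun ω m => 𝓜.obsY (fun k => yM k ω) (fun k => zM k ω) i (fun k => 𝓢.X i m k ω))
    (ρ := fun ω => p.Lf * ((𝓜.t (i + 1) - 𝓜.t i) / (p.T - 𝓜.t i) ^ ((1 - p.θL) / 2)) *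
        ‖(WithLp.toLp 2 fun m => z i (𝓢.X i m i ω) - zM i ω (𝓢.X i m i ω) :
          PiLp 2 fun _ : Fin (𝓡.M i) => Vec q)‖)
    hρ hs hspan hmin hφm hφ
  simp only [ENNReal.ofReal_one, one_mul] at key
  rw [hM.eLpNorm_mul_norm_z_sub h hp hB hG hyz hsim hi hn hc0] at key
  exact key

theorem empNorm_y_le (hR : 𝓡.Admissible 𝓜 P) {i : ℕ} (hi : i < 𝓜.N) :
    √(∫ ω, empNormSq 𝓢 i (fun ω x => y i x - yM i ω x) ω ∂P')
      ≤ regErrorY 𝓜 P p B G 𝓡 y i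
        + p.Lf * ((𝓜.t (i + 1) - 𝓜.t i) / (p.T - 𝓜.t i) ^ ((1 - p.θL) / 2)) *
            √(∫ ω, empNormSq 𝓢 i (fun ω x => z i x - zM i ω x) ω ∂P')
        + ∑ k ∈ Finset.Ico i 𝓜.N,
        p.Lf * ((𝓜.t (k + 1) - 𝓜.t k) / (p.T - 𝓜.t k) ^ ((1 - p.θL) / 2))
          * (stateError P P' (𝓜.X (k + 1)) (y (k + 1)) (yM (k + 1))
            + if k = i then 0 else stateError P P' (𝓜.X k) (z k) (zM k)) := by
  have hdev : ∀ k, k < 𝓜.N → 𝓜.devξ P k ≤ 𝓜.Cξ P := fun k _ => (Model.devξ_memLp h).2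
  have hΓ := 𝓜.Γy_nonneg P hp h.grid hB hG hdev hi
  have hn := hR.one_le_M i hi
  unfold regErrorY
  rw [add_assoc, add_assoc, ← add_assoc (_ * _)]
  refine le_appError_add fun φ hφ => ?_
  obtain ⟨hφm, hφ2⟩ := memLp_of_mem_span (P := P) (X := 𝓜.X i) (hR.pY_measurable i hi)
    (hR.pY_memLp i hi) hφ
  have key := hM.eLpNorm_y_sub_ψY_le h hp hB hG hyz hsim hR hi hφm hφ
  have e1 := eLpNorm_toLp_eq (P' := P') hn
    (w := fun ω (m : Fin (𝓡.M i)) => y i (𝓢.X i m i ω) - yM i ω (𝓢.X i m i ω))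
    (hM.integrable_empNormSq_y h hp hB hG hyz hsim hi)
  have e2 : eLpNorm (fun ω => (WithLp.toLp 2 fun m => y i (𝓢.X i m i ω) - yM i ω (𝓢.X i m i ω) :
        PiLp 2 fun _ : Fin (𝓡.M i) => ℝ)) 2 P'
      ≤ eLpNorm (fun ω => (WithLp.toLp 2 fun m => y i ((𝓢.sample 𝓜.N i ω m).2 i)
        - ψY i ω ((𝓢.sample 𝓜.N i ω m).2 i) : PiLp 2 fun _ : Fin (𝓡.M i) => ℝ)) 2 P' := by
    refine eLpNorm_mono_ae ?_
    filter_upwards [hsim.ae_sample h hi le_rfl hi.le ((hyz.ae_map_bounds h hp hB hG).1 i hi)]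
      with ω hω
    refine norm_toLp_le fun m => ?_
    rw [← 𝓢.sample_snd le_rfl hi.le, hM.y_eq i hi]
    exact abs_sub_trunc_le (hω m) _
  have hc : ∀ k ∈ Finset.Ico i 𝓜.N, 0 ≤ p.Lf * ((𝓜.t (k + 1) - 𝓜.t k) /
      (p.T - 𝓜.t k) ^ ((1 - p.θL) / 2)) := fun k hk => by
    have h2 := (Finset.mem_Ico.1 hk).2
    exact mul_nonneg hp.Lf_nonneg (div_nonneg (h.grid.step_pos h2).le
      (Real.rpow_nonneg (sub_nonneg.2 (h.grid.le_last h2.le)) _))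
  have he : ∀ k, 0 ≤ if k = i then 0 else stateError P P' (𝓜.X k) (z k) (zM k) := fun k => by
    split_ifs
    exacts [le_rfl, stateError_nonneg ..]
  have hc' : ∀ k ∈ Finset.Ico i 𝓜.N, 0 ≤ p.Lf * ((𝓜.t (k + 1) - 𝓜.t k) /
      (p.T - 𝓜.t k) ^ ((1 - p.θL) / 2))
      * (stateError P P' (𝓜.X (k + 1)) (y (k + 1)) (yM (k + 1))
        + if k = i then 0 else stateError P P' (𝓜.X k) (z k) (zM k)) := fun k hk =>
    mul_nonneg (hc k hk) (add_nonneg (stateError_nonneg ..) (he k))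
  have e4 : ∀ k ∈ Finset.Ico i 𝓜.N,
      eLpNorm (fun a : 𝓢.Future 𝓜.N (i + 1) × PathSpace d q =>
        (𝓜.drv (fun k => yM k (𝓢.ofFuture a.1))
          (Function.update (fun k => zM k (𝓢.ofFuture a.1)) i (z i)) k
          a.2.2 - 𝓜.drv y z k a.2.2) * (𝓜.t (k + 1) - 𝓜.t k)) 2
        ((P'.map (𝓢.toFuture 𝓜.N (i + 1))).prod (𝓜.pathLaw P i))
      ≤ ENNReal.ofReal (p.Lf * ((𝓜.t (k + 1) - 𝓜.t k) / (p.T - 𝓜.t k) ^ ((1 - p.θL) / 2))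
        * (stateError P P' (𝓜.X (k + 1)) (y (k + 1)) (yM (k + 1))
          + if k = i then 0 else stateError P P' (𝓜.X k) (z k) (zM k))) := fun k hk => by
    obtain ⟨h1, h2⟩ := Finset.mem_Ico.1 hk
    have e5 := hsim.eLpNorm_drv_sub_le h hp h1 h2 (l := i + 1)
      (y' := fun a k => yM k (𝓢.ofFuture a))
      (z' := fun a => Function.update (fun k => zM k (𝓢.ofFuture a)) i (z i))
      (hM.measurable_yM h (by omega : i + 1 ≤ k + 1) h2)
      (hM.measurable_update_zM h1 h2 (hyz.2.1 i hi)) (hyz.1 _ h2) (hyz.2.1 _ h2)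
    simp only [Clouds.ofFuture_toFuture] at e5
    -- At `k = i` the updated function is the exact one, so its error vanishes; the true error of
    -- `Z` at time `i` has been moved into the residual.
    have e6 : eLpNorm (fun a : Ω' × Vec d =>
        z k a.2 - Function.update (fun k => zM k a.1) i (z i) k a.2) 2 (P'.prod (P.map (𝓜.X k)))
        = ENNReal.ofReal (if k = i then 0 else stateError P P' (𝓜.X k) (z k) (zM k)) := by
      split_ifs with hki
      · subst hki
        simp
      · simp only [Function.update_of_ne hki]
        exact (hM.ofReal_stateError_z h hp hB hG hyz hsim h2).symm
    rw [← hM.ofReal_stateError_y h hp hB hG hyz hsim h2, e6,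
      ← ENNReal.ofReal_add (stateError_nonneg ..) (he k), ← ENNReal.ofReal_mul (hc k hk)] at e5
    exact e5
  rw [Model.eLpNorm_sub_eq h hi.le (hyz.1 i hi.le) hφm
    (((hyz.memLp_top h hp).1 i hi.le).mono_exponent le_top) hφ2] at key
  have e7 := le_of_ofReal_regression hn (Real.sqrt_nonneg _) hΓ (Finset.sum_nonneg hc')
    (mul_nonneg (hc i (Finset.mem_Ico.2 ⟨le_rfl, hi⟩)) (Real.sqrt_nonneg _))
    ((e1.symm.le.trans (e2.trans key)).trans (by
      rw [ENNReal.ofReal_sum_of_nonneg hc']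
      gcongr with k hk
      exact e4 k hk))
  exact e7

end IsMWLS

end MWLS


/-! ### From empirical to true norms, and the global error. -/

namespace MWLS

theorem stateError_sq {Ω Ω' : Type*} [MeasurableSpace Ω] [MeasurableSpace Ω'] {d : ℕ}
    {F : Type*} [NormedAddCommGroup F] {P : Measure Ω} {P' : Measure Ω'}
    {X : Ω → Vec d} {v : Vec d → F} {w : Ω' → Vec d → F}
    (hvw : MemLp (fun a : Ω' × Vec d => v a.2 - w a.1 a.2) 2 (P'.prod (P.map X))) :
    stateError P P' X v w ^ 2 = ∫ a, ‖v a.2 - w a.1 a.2‖ ^ 2 ∂(P'.prod (P.map X)) := by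
  rw [stateError, ← rms_eq_toReal hvw, rms_sq]

/-- A coordinate of the vector regression lies in a span of the same number of scalar functions, so
the scalar ghost sample estimate applies with the same `K`. -/
theorem apply_mem_span {d q K : ℕ} {b : Fin K → Vec d → Vec q} {φ : Vec d → Vec q}
    (hφ : φ ∈ Submodule.span ℝ (Set.range b)) (l : Fin q) :
    (fun x => φ x l) ∈ Submodule.span ℝ (Set.range fun k x => b k x l) := by
  induction hφ using Submodule.span_induction with
  | mem x hx => obtain ⟨k, rfl⟩ := hx; exact Submodule.subset_span ⟨k, rfl⟩
  | zero => exact Submodule.zero_mem _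
  | add x y _ _ hx hy => exact Submodule.add_mem _ hx hy
  | smul a x _ hx => exact Submodule.smul_mem _ a hx

theorem le_sqrt_two_mul_add {e η L X : ℝ} (hη : 0 ≤ η) (hL : 0 ≤ L) (hX : 0 ≤ X)
    (h : e ^ 2 ≤ 2 * η ^ 2 + X * L ^ 2) : e ≤ √2 * η + L * √X := by
  have h1 := mul_nonneg (mul_nonneg (Real.sqrt_nonneg 2) hη) (mul_nonneg hL (Real.sqrt_nonneg X))
  refine le_of_sq_le_sq (h.trans ?_) (by positivity)
  rw [add_sq, mul_pow, mul_pow, Real.sq_sqrt zero_le_two, Real.sq_sqrt hX]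
  linarith

namespace IsMWLS

variable {Ω Ω' : Type*} [mΩ : MeasurableSpace Ω] [mΩ' : MeasurableSpace Ω'] {d q : ℕ}
  {𝓜 : Model Ω d q} {P : Measure Ω} {p : Params} {B G : ℝ → ℝ → ℝ} {𝓡 : Regression d q}
  {𝓢 : Clouds Ω' d q 𝓡.M} {P' : Measure Ω'} {ψY yM : ℕ → Ω' → Vec d → ℝ}
  {ψZ zM : ℕ → Ω' → Vec d → Vec q} (hM : IsMWLS 𝓜 P p B G 𝓡 𝓢 P' ψY yM ψZ zM)
  [IsProbabilityMeasure P] [IsProbabilityMeasure P']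
  (h : 𝓜.MarkovAssumptions P p) (hp : p.Admissible) (hB : IsSumConstant p.R B)
  (hG : ∀ Cu γ : ℝ, 0 ≤ Cu → 0 < γ → IsGronwallConstant p.R p.T 0 (p.θL / 2) Cu γ (G Cu γ))
  {y : ℕ → Vec d → ℝ} {z : ℕ → Vec d → Vec q} (hyz : 𝓜.IsMarkovSolution P y z)
  (hsim : 𝓢.AreSimulations P' 𝓜 P)
include hM h hp hB hG hyz hsim

/-- The fitted function depends on its own cloud, so the empirical error does not estimate the true
one without bias. The ghost sample bounds the square by twice the empirical square plus a complexity
term; taking roots gives `√2` and the interdependence error. -/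
theorem stateError_y_le (hR : 𝓡.Admissible 𝓜 P) {i : ℕ} (hi : i < 𝓜.N) :
    stateError P P' (𝓜.X i) (y i) (yM i)
      ≤ √2 * √(∫ ω, empNormSq 𝓢 i (fun ω x => y i x - yM i ω x) ω ∂P')
        + depErrorY 𝓜 P p B G 𝓡 i := by
  have hn := hR.one_le_M i hi
  have hL := 𝓜.Cy_nonneg P hp h.grid hB hG hi.le
  have hlog : 0 ≤ Real.log (3 * 𝓡.M i) := Real.log_nonneg (by
    have : (1 : ℝ) ≤ 𝓡.M i := by exact_mod_cast hn
    linarith)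
  have hpr := Model.isProbabilityMeasure_pathLaw h i
  have hpr' := Measure.isProbabilityMeasure_map (μ := P) (Model.measurable_X h hi.le).aemeasurable
  have hmap := Model.map_pathLaw h (P := P) le_rfl hi.le
  have hmem := hM.memLp_y_sub_yM h hp hB hG hyz hsim hi.le
  obtain ⟨Ψ, hΨ, hψ⟩ := 𝓢.exists_factor (hM.ψY_measurable i hi)
  have hy := (hyz.ae_map_bounds h hp hB hG).1 i hi
  have key := integral_sq_le_of_law (P' := P') (hsim.measurable_toFuture (i + 1))
    (hsim.measurable_sample hi) (hsim.map_toFuture_sample hi) (measurable_path_snd i) hn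
    (hR.pY_measurable i hi) (hyz.1 i hi.le) hL (by rw [hmap]; exact hy) hΨ
    (by simpa only [← hψ] using (hM.ψY_solves i hi).mono fun ω hω => hω.1)
    (hsim.ae_sample h hi le_rfl hi.le hy)
  simp only [← hψ, ← hM.y_eq i hi, hmap, 𝓢.sample_snd le_rfl hi.le] at key
  refine le_sqrt_two_mul_add (Real.sqrt_nonneg _) hL (by positivity) ?_
  rw [stateError_sq hmem, integral_prod _ (hmem.integrable_norm_pow two_ne_zero),
    Real.sq_sqrt (integral_nonneg fun ω => by unfold empNormSq; positivity)]
  simpa only [Real.norm_eq_abs, sq_abs, empNormSq] using key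

/-- The ghost sample estimate is applied to each coordinate, truncated separately at the level `Cz`.
Summation over the coordinates produces the factor `q` in the interdependence error. -/
theorem stateError_z_le (hR : 𝓡.Admissible 𝓜 P) {i : ℕ} (hi : i < 𝓜.N) :
    stateError P P' (𝓜.X i) (z i) (zM i)
      ≤ √2 * √(∫ ω, empNormSq 𝓢 i (fun ω x => z i x - zM i ω x) ω ∂P')
        + depErrorZ 𝓜 P p B G 𝓡 i := by
  have hn := hR.one_le_M i hi
  have hL := 𝓜.Cz_nonneg P hp h.grid hB hG hi.le
  have hlog : 0 ≤ Real.log (3 * 𝓡.M i) := Real.log_nonneg (by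
    have : (1 : ℝ) ≤ 𝓡.M i := by exact_mod_cast hn
    linarith)
  have hpr := Model.isProbabilityMeasure_pathLaw h i
  have hpr' := Measure.isProbabilityMeasure_map (μ := P) (Model.measurable_X h hi.le).aemeasurable
  have hmap := Model.map_pathLaw h (P := P) le_rfl hi.le
  have hmem := hM.memLp_z_sub_zM h hp hB hG hyz hsim hi
  obtain ⟨Ψ, hΨ, hψ⟩ := 𝓢.exists_factor (hM.ψZ_measurable i hi)
  have hz := (hyz.ae_map_bounds h hp hB hG).2 i hi
  have hzl : ∀ l : Fin q, ∀ᵐ x ∂(P.map (𝓜.X i)), |z i x l| ≤ 𝓜.Cz P p B G i := fun l =>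
    hz.mono fun x hx => (abs_apply_le_norm _ l).trans hx
  have hcoord : ∀ l : Fin q, Measurable fun v : Vec q => v l := fun l =>
    (measurable_pi_apply l).comp (WithLp.measurable_ofLp 2 _)
  have key : ∀ l : Fin q, _ := fun l =>
    integral_sq_le_of_law (P' := P') (hsim.measurable_toFuture (i + 1))
    (hsim.measurable_sample hi) (hsim.map_toFuture_sample hi) (measurable_path_snd i) hn
    (b := fun k x => 𝓡.pZ i k x l) (fun k => (hcoord l).comp (hR.pZ_measurable i hi k))
    (g := fun x => z i x l) ((hcoord l).comp (hyz.2.1 i hi)) hL (by rw [hmap]; exact hzl l)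
    (ψ := fun a => Ψ a l) ((hcoord l).comp hΨ)
    (by
      simp only [← hψ]
      exact (hM.ψZ_solves i hi).mono fun ω hω => apply_mem_span hω.1 l)
    (hsim.ae_sample h hi le_rfl hi.le (hzl l))
  have hzM : ∀ ω x l, trunc (𝓜.Cz P p B G i) (ψZ i ω x l) = zM i ω x l := fun ω x l => by
    rw [hM.z_eq i hi]; rfl
  simp only [← hψ, hzM, hmap, 𝓢.sample_snd le_rfl hi.le] at key
  have hmeml : ∀ l : Fin q, MemLp (fun a : Ω' × Vec d => z i a.2 l - zM i a.1 a.2 l) 2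
      (P'.prod (P.map (𝓜.X i))) := fun l => by
    refine hmem.mono (((hcoord l).comp ((hyz.2.1 i hi).comp measurable_snd)).sub
      ((hcoord l).comp (hM.measurable_uncurry_zM hsim hi))).aestronglyMeasurable
      (Eventually.of_forall fun a => ?_)
    exact abs_apply_le_norm (z i a.2 - zM i a.1 a.2) l
  have hintl : ∀ l : Fin q, Integrable (fun ω => (1 / 𝓡.M i : ℝ) * ∑ m : Fin (𝓡.M i),
      (z i (𝓢.X i m i ω) l - zM i ω (𝓢.X i m i ω) l) ^ 2) P' := fun l => by
    have h1 := integrable_empirical (P' := P') (C := 𝓜.Cz P p B G i + √q * 𝓜.Cz P p B G i)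
      (w := fun ω (m : Fin (𝓡.M i)) => (z i (𝓢.X i m i ω) - zM i ω (𝓢.X i m i ω)) l)
      (fun m => (hcoord l).comp (hM.measurable_sample_z_sub hyz hsim hi m)) (by
        filter_upwards [hsim.ae_sample h hi le_rfl hi.le
          (hM.ae_norm_z_sub_zM_le h hp hB hG hyz hi)] with ω hω m
        have := hω m ω
        rw [𝓢.sample_snd le_rfl hi.le] at this
        exact (abs_apply_le_norm _ l).trans this)
    simpa only [Real.norm_eq_abs, sq_abs, PiLp.sub_apply] using h1
  have hsum := Finset.sum_le_sum fun l (_ : l ∈ Finset.univ) => key l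
  have hLHS : ∑ l : Fin q, ∫ ω, ∫ x, (z i x l - zM i ω x l) ^ 2 ∂(P.map (𝓜.X i)) ∂P'
      = ∫ a, ‖z i a.2 - zM i a.1 a.2‖ ^ 2 ∂(P'.prod (P.map (𝓜.X i))) := by
    have h1 : ∀ l : Fin q, ∫ ω, ∫ x, (z i x l - zM i ω x l) ^ 2 ∂(P.map (𝓜.X i)) ∂P'
        = ∫ a, (z i a.2 l - zM i a.1 a.2 l) ^ 2 ∂(P'.prod (P.map (𝓜.X i))) := fun l =>
      (integral_prod _ (hmeml l).integrable_sq).symm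
    simp only [h1]
    rw [← integral_finsetSum _ fun l _ => (hmeml l).integrable_sq]
    refine integral_congr_ae (Eventually.of_forall fun a => ?_)
    simp [EuclideanSpace.real_norm_sq_eq]
  have hRHS : ∑ l : Fin q, ∫ ω, (1 / 𝓡.M i : ℝ) * ∑ m : Fin (𝓡.M i),
      (z i (𝓢.X i m i ω) l - zM i ω (𝓢.X i m i ω) l) ^ 2 ∂P'
      = ∫ ω, empNormSq 𝓢 i (fun ω x => z i x - zM i ω x) ω ∂P' := by
    rw [← integral_finsetSum _ fun l _ => hintl l]
    refine integral_congr_ae (Eventually.of_forall fun ω => ?_)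
    simp only [empNormSq, EuclideanSpace.real_norm_sq_eq]
    rw [← Finset.mul_sum, Finset.sum_comm]
    rfl
  refine le_sqrt_two_mul_add (Real.sqrt_nonneg _) hL (by positivity) ?_
  rw [stateError_sq hmem,
    Real.sq_sqrt (integral_nonneg fun ω => by unfold empNormSq; positivity), ← hLHS, ← hRHS]
  refine hsum.trans (le_of_eq ?_)
  rw [Finset.sum_add_distrib, ← Finset.mul_sum, Finset.sum_const, Finset.card_univ,
    Fintype.card_fin, nsmul_eq_mul]
  ring

omit hp hB hG [IsProbabilityMeasure P'] hsim in
-- Exactness at time `N` starts the backward recursion and explains the cutoff in `localError`.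
theorem stateError_y_last : stateError P P' (𝓜.X 𝓜.N) (y 𝓜.N) (yM 𝓜.N) = 0 := by
  have hpr' := Measure.isProbabilityMeasure_map (μ := P) (Model.measurable_X h le_rfl).aemeasurable
  rw [stateError, eLpNorm_congr_ae (g := fun _ => 0), eLpNorm_zero', ENNReal.toReal_zero]
  filter_upwards [Measure.quasiMeasurePreserving_snd.ae (hyz.terminal_ae h)] with a ha
  rw [hM.terminal, ha, sub_self]

omit hyz hsim hM [IsProbabilityMeasure P'] in
theorem regError_nonneg (y : ℕ → Vec d → ℝ) (z : ℕ → Vec d → Vec q) {i : ℕ} (hi : i < 𝓜.N) :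
    0 ≤ regErrorY 𝓜 P p B G 𝓡 y i ∧ 0 ≤ regErrorZ 𝓜 P p B G 𝓡 z i := by
  have hdev : ∀ k, k < 𝓜.N → 𝓜.devξ P k ≤ 𝓜.Cξ P := fun k _ => (Model.devξ_memLp h).2
  exact ⟨add_nonneg (Real.sqrt_nonneg _) (mul_nonneg (𝓜.Γy_nonneg P hp h.grid hB hG hdev hi)
      (Real.sqrt_nonneg _)),
    add_nonneg (Real.sqrt_nonneg _) (mul_nonneg (𝓜.Γz_nonneg P hp h.grid hB hG hdev hi)
      (Real.sqrt_nonneg _))⟩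

/-- The global error of the algorithm. -/
theorem global_error (hR : 𝓡.Admissible 𝓜 P) {i : ℕ} (hi : i < 𝓜.N) :
    √(∫ ω, empNormSq 𝓢 i (fun ω x => y i x - yM i ω x) ω ∂P')
      ≤ regErrorY 𝓜 P p B G 𝓡 y i + p.CMy B G * ∑ j ∈ Finset.Ico i 𝓜.N,
        localError 𝓜 P p B G 𝓡 y z j * (𝓜.t (j + 1) - 𝓜.t j)
          / (p.T - 𝓜.t j) ^ ((1 - p.θL) / 2) ∧
    √(∫ ω, empNormSq 𝓢 i (fun ω x => z i x - zM i ω x) ω ∂P')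
      ≤ regErrorZ 𝓜 P p B G 𝓡 z i + p.CMz B G * ∑ j ∈ Finset.Ioo i 𝓜.N,
        localError 𝓜 P p B G 𝓡 y z j * (𝓜.t (j + 1) - 𝓜.t j)
          / ((p.T - 𝓜.t j) ^ ((1 - p.θL) / 2) * √(𝓜.t j - 𝓜.t i)) :=
  errorRecursion_bounds hp h.grid hB hG
    (ηY := fun i => √(∫ ω, empNormSq 𝓢 i (fun ω x => y i x - yM i ω x) ω ∂P'))
    (ηZ := fun i => √(∫ ω, empNormSq 𝓢 i (fun ω x => z i x - zM i ω x) ω ∂P'))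
    (barY := fun i => stateError P P' (𝓜.X i) (y i) (yM i))
    (barZ := fun i => stateError P P' (𝓜.X i) (z i) (zM i))
    (RY := regErrorY 𝓜 P p B G 𝓡 y) (RZ := regErrorZ 𝓜 P p B G 𝓡 z)
    (DY := depErrorY 𝓜 P p B G 𝓡) (DZ := depErrorZ 𝓜 P p B G 𝓡)
    (fun _ => Real.sqrt_nonneg _) (fun _ => Real.sqrt_nonneg _)
    (fun _ hk => (regError_nonneg h hp hB hG y z hk).1)
    (fun _ hk => (regError_nonneg h hp hB hG y z hk).2)
    (fun _ hk => mul_nonneg (𝓜.Cy_nonneg P hp h.grid hB hG hk.le) (Real.sqrt_nonneg _))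
    (fun _ hk => mul_nonneg (𝓜.Cz_nonneg P hp h.grid hB hG hk.le) (Real.sqrt_nonneg _))
    (fun _ hk => hM.stateError_y_le h hp hB hG hyz hsim hR hk) (hM.stateError_y_last h hyz).le
    (fun _ hk => hM.stateError_z_le h hp hB hG hyz hsim hR hk)
    (fun _ hk => hM.empNorm_y_le h hp hB hG hyz hsim hR hk)
    (fun _ hk => hM.empNorm_z_le h hp hB hG hyz hsim hR hk) (fun _ => rfl) hi

end IsMWLS

end MWLS


theorem theorem3p10 {d q : ℕ} (hd : 0 < d) (hq : 0 < q) (p : MWLS.Params) (hp : p.Admissible) :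
    -- the deterministic constants exist
    (∃ B : ℝ → ℝ → ℝ, MWLS.IsSumConstant p.R B) ∧
    (∃ G : ℝ → ℝ → ℝ, ∀ Cu γ : ℝ, 0 ≤ Cu → 0 < γ →
      MWLS.IsGronwallConstant p.R p.T 0 (p.θL / 2) Cu γ (G Cu γ)) ∧
    -- and for every choice of them
    ∀ B G : ℝ → ℝ → ℝ, MWLS.IsSumConstant p.R B →
      (∀ Cu γ : ℝ, 0 ≤ Cu → 0 < γ →
        MWLS.IsGronwallConstant p.R p.T 0 (p.θL / 2) Cu γ (G Cu γ)) →
      ∀ (Ω : Type*) [MeasurableSpace Ω] (P : Measure Ω) [IsProbabilityMeasure P]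
        (𝓜 : MWLS.Model Ω d q), 𝓜.MarkovAssumptions P p →
        -- the value functions exist
        (∃ (y : ℕ → MWLS.Vec d → ℝ) (z : ℕ → MWLS.Vec d → MWLS.Vec q),
          𝓜.IsMarkovSolution P y z) ∧
        -- and the errors of the algorithm are bounded
        ∀ (y : ℕ → MWLS.Vec d → ℝ) (z : ℕ → MWLS.Vec d → MWLS.Vec q),
          𝓜.IsMarkovSolution P y z →
        ∀ 𝓡 : MWLS.Regression d q, 𝓡.Admissible 𝓜 P →
        ∀ (Ω' : Type*) [MeasurableSpace Ω'] (P' : Measure Ω') [IsProbabilityMeasure P']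
          (𝓢 : MWLS.Clouds Ω' d q 𝓡.M), 𝓢.AreSimulations P' 𝓜 P →
        ∀ (ψY yM : ℕ → Ω' → MWLS.Vec d → ℝ) (ψZ zM : ℕ → Ω' → MWLS.Vec d → MWLS.Vec q),
          MWLS.IsMWLS 𝓜 P p B G 𝓡 𝓢 P' ψY yM ψZ zM →
        ∀ k, k < 𝓜.N →
          (Integrable (MWLS.empNormSq 𝓢 k (fun ω x => y k x - yM k ω x)) P' ∧
            √(∫ ω, MWLS.empNormSq 𝓢 k (fun ω x => y k x - yM k ω x) ω ∂P')
              ≤ MWLS.appError P (𝓜.X k) (𝓡.pY k) (y k)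
                + 𝓜.Γy P p B G k * √((𝓡.KY k : ℝ) / 𝓡.M k)
                + p.CMy B G * ∑ j ∈ Finset.Ico k 𝓜.N,
                    MWLS.localError 𝓜 P p B G 𝓡 y z j * (𝓜.t (j + 1) - 𝓜.t j)
                      / (p.T - 𝓜.t j) ^ ((1 - p.θL) / 2)) ∧
          (Integrable (MWLS.empNormSq 𝓢 k (fun ω x => z k x - zM k ω x)) P' ∧
            √(∫ ω, MWLS.empNormSq 𝓢 k (fun ω x => z k x - zM k ω x) ω ∂P')
              ≤ MWLS.appError P (𝓜.X k) (𝓡.pZ k) (z k)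
                + 𝓜.Γz P p B G k * √((𝓡.KZ k : ℝ) / 𝓡.M k)
                + p.CMz B G * ∑ j ∈ Finset.Ioo k 𝓜.N,
                    MWLS.localError 𝓜 P p B G 𝓡 y z j * (𝓜.t (j + 1) - 𝓜.t j)
                      / ((p.T - 𝓜.t j) ^ ((1 - p.θL) / 2) * √(𝓜.t j - 𝓜.t k))) := by
  refine ⟨MWLS.exists_isSumConstant hp.R_pos.le,
    MWLS.exists_isGronwallConstant hp.R_pos.le hp.T_pos hp.θL_mem, ?_⟩
  intro B G hB hG Ω _ P _ 𝓜 h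
  refine ⟨MWLS.Model.exists_isMarkovSolution h, ?_⟩
  intro y z hyz 𝓡 hR Ω' _ P' _ 𝓢 hsim ψY yM ψZ zM hM k hk
  obtain ⟨hY, hZ⟩ := hM.global_error h hp hB hG hyz hsim hR hk
  exact ⟨⟨hM.integrable_empNormSq_y h hp hB hG hyz hsim hk, hY⟩,
    hM.integrable_empNormSq_z h hp hB hG hyz hsim hk, hZ⟩
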